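/- Let $U$ and $Z$ be reflexive real Banach spaces and let $U$ be continuously and densely embedded in a real Hilbert space $H$. Let $I=[0,T]$, $T>0$. Let $\Phi:U\times Z\to\mathbb R$ and $\mathscr T:H\to\mathbb R$ be continuous quadratic functionals which are coercive, i.e. $F(x)/\|x\|\to\infty$ as $\|x\|\to\infty$. The space $H\cong H^*$ is embedded in $U^*$ by $h\mapsto\langle\mathscr T'h,\cdot\rangle$; this is how $\mathscr T'v$ and $\mathscr T'\dot v$ are understood in $U^*$. For $i=1,2$ let $p_i>1$, $p_i'=p_i/(p_i-1)$, and let $\Psi_1:U\to\mathbb R\cup\{\infty\}$, $\Psi_2:Z\to\mathbb R\cup\{\infty\}$ be proper, convex, lower semicontinuous and $p_i$-coercive, i.e. $\Psi_i(\cdot)\ge\epsilon\|\cdot\|^{p_i}$ with some $\epsilon>0$. Let $\|\xi\|_{U^*}\le C(1+\|v\|_U^{p_1-1})$ for all $v\in U$ and $\xi\in\partial\Psi_1(v)$, with some $C\in\mathbb R$. Let $u_0\in U$, $v_0\in H$, $z_0\in Z$, $f\in L^{p_1'}(I;U^*)+L^1(I;H^*)$ and $g\in L^{p_2'}(I;Z^*)$.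 For $\tau=T/N$, $N\in\{1,2,\dots\}$, consider the Crank--Nicolson scheme for $(u_\tau^k,v_\tau^k,z_\tau^k)\in U\times H\times Z$, $k=1,\dots,N$, starting from $(u_\tau^0,v_\tau^0,z_\tau^0)=(u_0,v_0,z_0)$: $$\frac{u_\tau^k-u_\tau^{k-1}}\tau=v_\tau^{k-1/2},\qquad \mathscr T'\frac{v_\tau^k-v_\tau^{k-1}}\tau+\partial\Psi_1(v_\tau^{k-1/2})+\partial_u\Phi(u_\tau^{k-1/2},z_\tau^{k-1/2})\ni f_\tau^k,$$ $$\partial\Psi_2\Big(\frac{z_\tau^k-z_\tau^{k-1}}\tau\Big)+\partial_z\Phi(u_\tau^{k-1/2},z_\tau^{k-1/2})\ni g_\tau^k,$$ where $x^{k-1/2}=\frac12(x^k+x^{k-1})$ and $f_\tau^k=\frac1\tau\int_{(k-1)\tau}^{k\tau}f\,dt$, $g_\tau^k=\frac1\tau\int_{(k-1)\tau}^{k\tau}g\,dt$. Let $u_\tau,v_\tau,z_\tau$ be the piecewise affine interpolants on the grid $\{k\tau\}$, and let $\overline{\underline v}_\tau(t)=v_\tau^{k-1/2}$ for $(k-1)\tau<t\le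 k\tau$. A triple $(u,v,z)$ with $u\in W^{1,p_1}(I;U)$, $v\in L^{p_1}(I;U)\cap C_{\rm weak}(I;H)$, $\mathscr T'v\in W^{1,1}(I;U^*)$, $z\in W^{1,p_2}(I;Z)$ is called a weak solution if $u(0)=u_0$, $v(0)=v_0$, $z(0)=z_0$, $\dot u=v$ in the sense of distributions, and for all $\tilde v\in L^\infty(I;U)$ and $\tilde z\in L^\infty(I;Z)$ $$\int_0^T\Psi_1(\tilde v)+\Psi_2(\tilde z)+\langle\mathscr T'\dot v+\partial_u\Phi(u,z)-f,\tilde v\rangle+\langle\partial_z\Phi(u,z)-g,\tilde z\rangle+\langle f,\dot u\rangle+\langle g,\dot z\rangle\,dt+\mathscr T(v_0)+\Phi(u_0,z_0)$$ $$\ge\mathscr T(v(T))+\Phi(u(T),z(T))+\int_0^T\Psi_1(\dot u)+\Psi_2(\dot z)\,dt .$$ Then the scheme has a solution for every $N\ge1$, and there is a constant $C$, independent of $\tau$, such that every solution of the scheme satisfies $$\|u_\tau\|_{L^\infty(I;U)\cap W^{1,\infty}(I;H)\cap W^{1,p_1}(I;U)}\le C,\qquad \|z_\tau\|_{W^{1,p_2}(I;Z)}\le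 C,$$ $$\|\overline{\underline v}_\tau\|_{L^\infty(I;H)\cap L^{p_1}(I;U)}\le C,\qquad \|\mathscr T'v_\tau\|_{W^{1,p_1'}(I;U^*)+W^{1,1}(I;H^*)}\le C .$$ Moreover, there is exactly one weak solution $(u,v,z)$, and as $N\to\infty$ the whole sequence $(u_\tau,\overline{\underline v}_\tau,z_\tau)$ converges to it weakly* in $L^\infty(I;U)\cap W^{1,\infty}(I;H)\cap W^{1,p_1}(I;U)$, $L^\infty(I;H)\cap L^{p_1}(I;U)$ and $W^{1,p_2}(I;Z)$, respectively. If, in addition, $p_1\le2$, then: if the space $U$ and the potential $\Psi_1$ are uniformly convex, $u_\tau\to u$ strongly in $W^{1,p_1}(I;U)$; and if the space $Z$ and the potential $\Psi_2$ are uniformly convex, $z_\tau\to z$ strongly in $W^{1,p_2}(I;Z)$. Here $\Psi$ is called uniformly convex if for all $R,\epsilon>0$ there is $\delta>0$ such that $\Psi(\frac{x+y}2)+\delta\le\frac12\Psi(x)+\frac12\Psi(y)$ whenever $\|x\|,\|y\|\le R$ and $\|x-y\|\ge\epsilon$. -/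

import Mathlib

open MeasureTheory Filter Topology Set
open scoped ENNReal NNReal

namespace CrankNicolson

noncomputable section

/-! ### Function spaces on the time interval `I = [0,T]` -/

/-- Lebesgue measure on the time interval `I = [0,T]`.
`MemLp u p (timeMeasure T)` says that `u` belongs to the Bochner space `L^p(I;X)`. -/
def timeMeasure (T : ℝ) : Measure ℝ := volume.restrict (Icc 0 T)

/-- `du` is the distributional derivative of `u` on the open interval `(0,T)`. -/
def HasWeakDeriv {X : Type*} [NormedAddCommGroup X] [NormedSpace ℝ X]
    (T : ℝ) (u du : ℝ → X) : Prop :=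
  ∀ φ : ℝ → ℝ, ContDiff ℝ (⊤ : ℕ∞) φ → HasCompactSupport φ → tsupport φ ⊆ Ioo 0 T →
    ∫ t, deriv φ t • u t ∂(timeMeasure T) = - ∫ t, φ t • du t ∂(timeMeasure T)

/-- `u` belongs to `W^{1,p}(I;X)` and its distributional derivative is `du`. -/
structure IsSobolev {X : Type*} [NormedAddCommGroup X] [NormedSpace ℝ X]
    (T : ℝ) (p : ℝ≥0∞) (u du : ℝ → X) : Prop where
  memLp : MemLp u p (timeMeasure T)
  memLp_deriv : MemLp du p (timeMeasure T)
  hasWeakDeriv : HasWeakDeriv T u du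

/-- The norm of `u` in `L^p(I;X)` is at most `C`. -/
def LpNormLE {X : Type*} [NormedAddCommGroup X]
    (T : ℝ) (p : ℝ≥0∞) (u : ℝ → X) (C : ℝ) : Prop :=
  MemLp u p (timeMeasure T) ∧ eLpNorm u p (timeMeasure T) ≤ ENNReal.ofReal C

/-- The norm of `u` in `W^{1,p}(I;X)` (sum of the norms of `u` and of its derivative)
is at most `C`. -/
def SobolevNormLE {X : Type*} [NormedAddCommGroup X] [NormedSpace ℝ X]
    (T : ℝ) (p : ℝ≥0∞) (u : ℝ → X) (C : ℝ) : Prop :=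
  ∃ du : ℝ → X, IsSobolev T p u du ∧
    eLpNorm u p (timeMeasure T) + eLpNorm du p (timeMeasure T) ≤ ENNReal.ofReal C

/-- Weak* convergence `F n → F₀` in `L^p(I;X)`, `1 < p ≤ ∞`, for a reflexive space `X`:
convergence of the pairings with all elements of `L^q(I;X*)`, `1/p + 1/q = 1`, whose dual space
is `L^p(I;X)`. For `p < ∞` this is weak convergence. -/
def TendstoWeakStarLp {X : Type*} [NormedAddCommGroup X] [NormedSpace ℝ X]
    (T : ℝ) (p : ℝ≥0∞) (F : ℕ → ℝ → X) (F₀ : ℝ → X) : Prop :=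
  ∀ q : ℝ≥0∞, p⁻¹ + q⁻¹ = 1 → ∀ φ : ℝ → StrongDual ℝ X, MemLp φ q (timeMeasure T) →
    Tendsto (fun n => ∫ t, φ t (F n t) ∂(timeMeasure T)) atTop
      (𝓝 (∫ t, φ t (F₀ t) ∂(timeMeasure T)))

/-- Weak* convergence in `W^{1,p}(I;X)`, that is, weak* convergence in `L^p(I;X)` of the
functions and of their derivatives (from the index `1` on, the functions belong to the space). -/
def TendstoWeakStarSobolev {X : Type*} [NormedAddCommGroup X] [NormedSpace ℝ X]
    (T : ℝ) (p : ℝ≥0∞) (F : ℕ → ℝ → X) (F₀ : ℝ → X) : Prop :=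
  ∃ (dF : ℕ → ℝ → X) (dF₀ : ℝ → X), (∀ n, 1 ≤ n → IsSobolev T p (F n) (dF n)) ∧
    IsSobolev T p F₀ dF₀ ∧ TendstoWeakStarLp T p F F₀ ∧ TendstoWeakStarLp T p dF dF₀

/-- Convergence in the norm of `W^{1,p}(I;X)`. -/
def TendstoSobolev {X : Type*} [NormedAddCommGroup X] [NormedSpace ℝ X]
    (T : ℝ) (p : ℝ≥0∞) (F : ℕ → ℝ → X) (F₀ : ℝ → X) : Prop :=
  ∃ (dF : ℕ → ℝ → X) (dF₀ : ℝ → X), (∀ n, 1 ≤ n → IsSobolev T p (F n) (dF n)) ∧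
    IsSobolev T p F₀ dF₀ ∧
    Tendsto (fun n => eLpNorm (fun t => F n t - F₀ t) p (timeMeasure T)) atTop (𝓝 0) ∧
    Tendsto (fun n => eLpNorm (fun t => dF n t - dF₀ t) p (timeMeasure T)) atTop (𝓝 0)

/-! ### Functionals -/

/-- The Banach space `X` is reflexive. -/
def IsReflexiveSpace (X : Type*) [NormedAddCommGroup X] [NormedSpace ℝ X] : Prop :=
  Function.Surjective (NormedSpace.inclusionInDoubleDual ℝ X)

/-- `F` is a (continuous) quadratic functional. -/
def IsQuadratic {E : Type*} [NormedAddCommGroup E] [NormedSpace ℝ E] (F : E → ℝ) : Prop :=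
  ∃ B : E →L[ℝ] E →L[ℝ] ℝ, ∀ x, F x = B x x

/-- `F` is coercive: `F x / ‖x‖ → ∞` as `‖x‖ → ∞`. -/
def IsCoerciveFunctional {E : Type*} [NormedAddCommGroup E] (F : E → ℝ) : Prop :=
  Tendsto (fun x => F x / ‖x‖) (Bornology.cobounded E) atTop

/-- A proper, convex, lower semicontinuous and `p`-coercive functional `Ψ : X → ℝ ∪ {∞}`,
`Ψ ≥ ε ‖·‖ ^ p`. Coercivity makes the values non-negative, so they are taken in `[0,∞]`. -/
structure IsDissipationPotential {X : Type*} [NormedAddCommGroup X] [NormedSpace ℝ X]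
    (p : ℝ) (Ψ : X → ℝ≥0∞) : Prop where
  proper : ∃ v, Ψ v ≠ ∞
  convex : ConvexOn ℝ≥0 univ Ψ
  lsc : LowerSemicontinuous Ψ
  coercive : ∃ ε : ℝ, 0 < ε ∧ ∀ v, ENNReal.ofReal (ε * ‖v‖ ^ p) ≤ Ψ v

/-- The convex subdifferential `∂Ψ(v) ⊆ X*`. -/
def subdiff {X : Type*} [NormedAddCommGroup X] [NormedSpace ℝ X]
    (Ψ : X → ℝ≥0∞) (v : X) : Set (StrongDual ℝ X) :=
  {ξ | Ψ v ≠ ∞ ∧ ∀ w, (Ψ v : EReal) + ((ξ (w - v) : ℝ) : EReal) ≤ (Ψ w : EReal)}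

/-- Uniform convexity of the functional `Ψ`, required on bounded sets only: this is the notion
that `‖·‖ ^ p`, `1 < p < ∞`, has on every uniformly convex space. -/
def IsUniformlyConvexFunctional {X : Type*} [NormedAddCommGroup X] [NormedSpace ℝ X]
    (Ψ : X → ℝ≥0∞) : Prop :=
  ∀ R ε : ℝ, 0 < R → 0 < ε → ∃ δ : ℝ, 0 < δ ∧ ∀ x y : X, ‖x‖ ≤ R → ‖y‖ ≤ R → ε ≤ ‖x - y‖ →
    Ψ ((2⁻¹ : ℝ) • (x + y)) + ENNReal.ofReal δ ≤ (Ψ x + Ψ y) / 2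

/-! ### The evolution problem -/

/-- The data of the evolution problem
`u̇ = v`, `𝒯'v̇ + ∂Ψ₁(v) + ∂_uΦ(u,z) ∋ f`, `∂Ψ₂(ż) + ∂_zΦ(u,z) ∋ g` on `[0,T]`
with initial values `u₀, v₀, z₀`; `ι` is the embedding of `U` into `H`. -/
structure Problem (U H Z : Type*) [NormedAddCommGroup U] [NormedSpace ℝ U]
    [NormedAddCommGroup H] [InnerProductSpace ℝ H]
    [NormedAddCommGroup Z] [NormedSpace ℝ Z] where
  T : ℝ
  ι : U →L[ℝ] H
  Φ : U × Z → ℝ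
  kin : H → ℝ
  Ψ₁ : U → ℝ≥0∞
  Ψ₂ : Z → ℝ≥0∞
  p₁ : ℝ
  p₂ : ℝ
  u₀ : U
  v₀ : H
  z₀ : Z
  f : ℝ → StrongDual ℝ U
  g : ℝ → StrongDual ℝ Z

variable {U H Z : Type*} [NormedAddCommGroup U] [NormedSpace ℝ U]
  [NormedAddCommGroup H] [InnerProductSpace ℝ H] [NormedAddCommGroup Z] [NormedSpace ℝ Z]

namespace Problem

/-- The exponent `p₁` as an extended number. -/
def q₁ (P : Problem U H Z) : ℝ≥0∞ := ENNReal.ofReal P.p₁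

/-- The exponent `p₂` as an extended number. -/
def q₂ (P : Problem U H Z) : ℝ≥0∞ := ENNReal.ofReal P.p₂

/-- The conjugate exponent of `p₁`. -/
def conj₁ (P : Problem U H Z) : ℝ≥0∞ := ENNReal.ofReal (P.p₁ / (P.p₁ - 1))

/-- The conjugate exponent of `p₂`. -/
def conj₂ (P : Problem U H Z) : ℝ≥0∞ := ENNReal.ofReal (P.p₂ / (P.p₂ - 1))

/-- The functional `𝒯'h` on `U`. In this way `H ≅ H*` is a subset of `U*`. -/
def dKin (P : Problem U H Z) (h : H) : StrongDual ℝ U := (fderiv ℝ P.kin h).comp P.ι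

/-- The partial derivative `∂_uΦ(u,z)`. -/
def dPhiU (P : Problem U H Z) (u : U) (z : Z) : StrongDual ℝ U :=
  fderiv ℝ (fun x => P.Φ (x, z)) u

/-- The partial derivative `∂_zΦ(u,z)`. -/
def dPhiZ (P : Problem U H Z) (u : U) (z : Z) : StrongDual ℝ Z :=
  fderiv ℝ (fun y => P.Φ (u, y)) z

/-- `f ∈ L^r(I;U*) + L^1(I;H*)` with `r` the conjugate exponent of `p₁`. -/
def LoadInSum (P : Problem U H Z) : Prop :=
  ∃ (f₁ : ℝ → StrongDual ℝ U) (f₂ : ℝ → StrongDual ℝ H),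
    MemLp f₁ P.conj₁ (timeMeasure P.T) ∧ MemLp f₂ 1 (timeMeasure P.T) ∧
    P.f =ᵐ[timeMeasure P.T] fun t => f₁ t + (f₂ t).comp P.ι

/-- Weak solutions: `u ∈ W^{1,p₁}(I;U)`, `v ∈ L^{p₁}(I;U) ∩ C_weak(I;H)` with
`𝒯'v ∈ W^{1,1}(I;U*)`, `z ∈ W^{1,p₂}(I;Z)`, the initial conditions, `u̇ = v`, and the
energy-type variational inequality. Functions in `W^{1,p}` are represented by their continuous
representatives; `vU` is `v` as a `U`-valued function, `dv` is the derivative of `𝒯'v`. -/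
def IsWeakSolution (P : Problem U H Z) (u : ℝ → U) (v : ℝ → H) (z : ℝ → Z) : Prop :=
  ∃ (vU : ℝ → U) (dv : ℝ → StrongDual ℝ U) (dz : ℝ → Z),
    ContinuousOn u (Icc 0 P.T) ∧
    IsSobolev P.T P.q₁ u vU ∧
    (fun t => P.ι (vU t)) =ᵐ[timeMeasure P.T] v ∧
    (∀ h : StrongDual ℝ H, ContinuousOn (fun t => h (v t)) (Icc 0 P.T)) ∧
    IsSobolev P.T 1 (fun t => P.dKin (v t)) dv ∧
    ContinuousOn z (Icc 0 P.T) ∧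
    IsSobolev P.T P.q₂ z dz ∧
    u 0 = P.u₀ ∧ v 0 = P.v₀ ∧ z 0 = P.z₀ ∧
    ∀ (v' : ℝ → U) (z' : ℝ → Z),
      MemLp v' ∞ (timeMeasure P.T) → MemLp z' ∞ (timeMeasure P.T) →
      ((P.kin (v P.T) + P.Φ (u P.T, z P.T) : ℝ) : EReal)
          + ((∫⁻ t, (P.Ψ₁ (vU t) + P.Ψ₂ (dz t)) ∂(timeMeasure P.T) : ℝ≥0∞) : EReal)
        ≤ ((∫⁻ t, (P.Ψ₁ (v' t) + P.Ψ₂ (z' t)) ∂(timeMeasure P.T) : ℝ≥0∞) : EReal)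
          + (((∫ t, ((dv t + P.dPhiU (u t) (z t) - P.f t) (v' t)
                + (P.dPhiZ (u t) (z t) - P.g t) (z' t)
                + P.f t (vU t) + P.g t (dz t)) ∂(timeMeasure P.T))
              + P.kin P.v₀ + P.Φ (P.u₀, P.z₀) : ℝ) : EReal)

/-! ### The Crank–Nicolson scheme -/

/-- The time step `τ = T / N`. -/
def step (P : Problem U H Z) (N : ℕ) : ℝ := P.T / N

/-- The mean value of `f` over the `k`-th time interval `[(k-1)τ, kτ]`. -/
def fMean (P : Problem U H Z) (N k : ℕ) : StrongDual ℝ U :=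
  (P.step N)⁻¹ • ∫ t in ((k : ℝ) - 1) * P.step N..k * P.step N, P.f t

/-- The mean value of `g` over the `k`-th time interval `[(k-1)τ, kτ]`. -/
def gMean (P : Problem U H Z) (N k : ℕ) : StrongDual ℝ Z :=
  (P.step N)⁻¹ • ∫ t in ((k : ℝ) - 1) * P.step N..k * P.step N, P.g t

/-- `(u k, v k, z k)`, `k = 0, …, N`, solves the Crank–Nicolson scheme with the step `τ = T / N`.
The element `w k` of `U` is the half-step velocity `v^{k-1/2} = (v k + v (k-1)) / 2`. -/
structure IsCNSolution (P : Problem U H Z) (N : ℕ)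
    (u : ℕ → U) (v : ℕ → H) (z : ℕ → Z) (w : ℕ → U) : Prop where
  init_u : u 0 = P.u₀
  init_v : v 0 = P.v₀
  init_z : z 0 = P.z₀
  half : ∀ k, 1 ≤ k → k ≤ N → P.ι (w k) = (2⁻¹ : ℝ) • (v k + v (k - 1))
  velocity : ∀ k, 1 ≤ k → k ≤ N → (P.step N)⁻¹ • (u k - u (k - 1)) = w k
  momentum : ∀ k, 1 ≤ k → k ≤ N →
    P.fMean N k - P.dKin ((P.step N)⁻¹ • (v k - v (k - 1)))
      - P.dPhiU ((2⁻¹ : ℝ) • (u k + u (k - 1))) ((2⁻¹ : ℝ) • (z k + z (k - 1)))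
      ∈ subdiff P.Ψ₁ (w k)
  flow : ∀ k, 1 ≤ k → k ≤ N →
    P.gMean N k
      - P.dPhiZ ((2⁻¹ : ℝ) • (u k + u (k - 1))) ((2⁻¹ : ℝ) • (z k + z (k - 1)))
      ∈ subdiff P.Ψ₂ ((P.step N)⁻¹ • (z k - z (k - 1)))

end Problem

/-- The index `k` of the time interval with `(k-1)τ < t ≤ kτ`. -/
def stepIndex (τ t : ℝ) : ℕ := ⌈t / τ⌉₊

/-- The piecewise constant function with the value `x k` for `(k-1)τ < t ≤ kτ`. -/
def pwConst {X : Type*} (τ : ℝ) (x : ℕ → X) (t : ℝ) : X := x (stepIndex τ t)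

/-- The piecewise affine interpolant, with the value
`((t - (k-1)τ)/τ) x k + ((kτ - t)/τ) x (k-1)` for `(k-1)τ < t ≤ kτ` (and `x 0` for `t = 0`). -/
def pwAffine {X : Type*} [NormedAddCommGroup X] [NormedSpace ℝ X]
    (τ : ℝ) (x : ℕ → X) (t : ℝ) : X :=
  ((t - ((stepIndex τ t : ℝ) - 1) * τ) / τ) • x (stepIndex τ t)
    + (((stepIndex τ t : ℝ) * τ - t) / τ) • x (stepIndex τ t - 1)

namespace Problem

/-- The a-priori estimates, with the constant `C`, for one solution of the scheme:
`u_τ` in `L^∞(I;U) ∩ W^{1,∞}(I;H) ∩ W^{1,p₁}(I;U)`, `z_τ` in `W^{1,p₂}(I;Z)`, the half-step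
velocity in `L^∞(I;H) ∩ L^{p₁}(I;U)`, and `𝒯'v_τ` in `W^{1,r}(I;U*) + W^{1,1}(I;H*)` with `r` the
conjugate exponent of `p₁`. -/
structure APrioriEstimates (P : Problem U H Z) (C : ℝ) (N : ℕ)
    (u : ℕ → U) (v : ℕ → H) (z : ℕ → Z) (w : ℕ → U) : Prop where
  u_LinfU : LpNormLE P.T ∞ (pwAffine (P.step N) u) C
  u_W1infH : SobolevNormLE P.T ∞ (fun t => P.ι (pwAffine (P.step N) u t)) C
  u_W1pU : SobolevNormLE P.T P.q₁ (pwAffine (P.step N) u) C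
  z_W1pZ : SobolevNormLE P.T P.q₂ (pwAffine (P.step N) z) C
  w_LinfH : LpNormLE P.T ∞ (fun t => P.ι (pwConst (P.step N) w t)) C
  w_LpU : LpNormLE P.T P.q₁ (pwConst (P.step N) w) C
  v_sum : ∃ (a : ℝ → StrongDual ℝ U) (b : ℝ → StrongDual ℝ H) (Ca Cb : ℝ),
    0 ≤ Ca ∧ 0 ≤ Cb ∧ Ca + Cb ≤ C ∧
    (∀ t ∈ Icc 0 P.T, P.dKin (pwAffine (P.step N) v t) = a t + (b t).comp P.ι) ∧
    SobolevNormLE P.T P.conj₁ a Ca ∧ SobolevNormLE P.T 1 b Cb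

/-- Weak* convergence of `(u_τ, v^{half-step}_τ, z_τ)`, `τ = T / N`, to `(u, v, z)` as `N → ∞` in
`L^∞(I;U) ∩ W^{1,∞}(I;H) ∩ W^{1,p₁}(I;U)`, `L^∞(I;H) ∩ L^{p₁}(I;U)` and `W^{1,p₂}(I;Z)`. -/
structure ConvergesWeakStar (P : Problem U H Z)
    (un : ℕ → ℕ → U) (zn : ℕ → ℕ → Z) (wn : ℕ → ℕ → U)
    (u : ℝ → U) (v : ℝ → H) (z : ℝ → Z) : Prop where
  u_LinfU : TendstoWeakStarLp P.T ∞ (fun N => pwAffine (P.step N) (un N)) u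
  u_W1infH : TendstoWeakStarSobolev P.T ∞
    (fun N t => P.ι (pwAffine (P.step N) (un N) t)) (fun t => P.ι (u t))
  u_W1pU : TendstoWeakStarSobolev P.T P.q₁ (fun N => pwAffine (P.step N) (un N)) u
  w_LinfH : TendstoWeakStarLp P.T ∞ (fun N t => P.ι (pwConst (P.step N) (wn N) t)) v
  w_LpU : ∃ vU : ℝ → U, MemLp vU P.q₁ (timeMeasure P.T) ∧
    (fun t => P.ι (vU t)) =ᵐ[timeMeasure P.T] v ∧
    TendstoWeakStarLp P.T P.q₁ (fun N => pwConst (P.step N) (wn N)) vU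
  z_W1pZ : TendstoWeakStarSobolev P.T P.q₂ (fun N => pwAffine (P.step N) (zn N)) z

end Problem

end

end CrankNicolson

open CrankNicolson

/-! After symmetrisation, the coercive quadratic functionals `Φ` and `𝒯` become forms `Q` on `U × Z`
and `K` on `H` whose diagonals are equivalent to squared norms. The spaces are therefore Hilbert
spaces up to renorming, and the parallelogram identity takes over the role of weak compactness.

Solvability: one time step is the Euler inclusion of a convex minimisation problem in the two
velocities, solved by `exists_mem_subdiff`. Estimates: for the midpoint rule the increments of
kinetic and stored energy are exact products (`CN.kin_sub`, `CN.phi_sub`), so testing with a fixed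
point of finite potential gives an energy estimate (`CN.energy_le`). The growth condition on `∂Ψ₁`
then bounds the dual velocity.

Passage to the limit: a trajectory is encoded by the velocities `w` and `y`, by `ζ`, the derivative
of the momentum `𝒯'v` minus the load, and by the terminal velocity. For fixed test functions the
variational inequality bounds a convex functional of the trajectory by an affine one. Hence the
solutions up to an error `δ` (`IsApprox`) form a convex set, and the discrete solutions belong to it
with `δ → 0` (`CN.exists_isApprox`). From shrinking bounded convex sets one can select a strongly
convergent sequence (`exists_selection`) by almost minimising a uniformly convex integral, and the
limit is an exact solution (`exists_limit`).

Uniqueness: the chain rule for the kinetic energy (`IsVelocity.energy_eq`) gives an energy balance,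
which turns the variational inequality into an integrated inclusion. Testing two solutions against
each other leaves the energy of their difference, which must vanish (`IsApprox.eqOn`). Weak
solutions are trajectories of this kind (`exists_isApprox_of_isWeakSolution`), since the growth
condition also gives `ζ` its integrability.

Convergence of the whole sequence: if the discrete solutions returned infinitely often to a closed
half-space that misses the solution, the selection could be made inside that half-space and would
converge strongly to the unique solution, a contradiction (`eventually_notMem`). Sublevel sets of
convex functionals in place of half-spaces give lower semicontinuity. Testing the inequality with
the velocities of the limit bounds the dissipation from above, so the dissipations converge, and
uniform convexity upgrades this to norm convergence (`tendsto_eLpNorm_of_uniformlyConvex`). -/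

namespace CrankNicolson

section

/-! ### Coercive quadratic functionals and their symmetric forms. -/

section Forms

variable {X : Type*} [NormedAddCommGroup X] [NormedSpace ℝ X]

/-- A symmetric, bounded, coercive bilinear form. -/
structure IsCoerciveForm (B : X →L[ℝ] X →L[ℝ] ℝ) : Prop where
  symm : ∀ x y, B x y = B y x
  coercive : ∃ c : ℝ, 0 < c ∧ ∀ x, c * ‖x‖ ^ 2 ≤ B x x

namespace IsCoerciveForm

variable {B : X →L[ℝ] X →L[ℝ] ℝ}

theorem nonneg (h : IsCoerciveForm B) (x : X) : 0 ≤ B x x := by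
  obtain ⟨c, hc, hB⟩ := h.coercive
  exact le_trans (by positivity) (hB x)

theorem eq_zero (h : IsCoerciveForm B) {x : X} (hx : B x x ≤ 0) : x = 0 := by
  obtain ⟨c, hc, hB⟩ := h.coercive
  have h1 : ‖x‖ ^ 2 ≤ 0 := by
    have := (hB x).trans hx
    by_contra hcon
    push Not at hcon
    nlinarith [mul_pos hc hcon]
  have h2 : ‖x‖ = 0 := by nlinarith [norm_nonneg x]
  exact norm_eq_zero.mp h2

theorem add_self (h : IsCoerciveForm B) (x y : X) :
    B (x + y) (x + y) = B x x + 2 * B x y + B y y := by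
  simp only [map_add, add_apply]
  rw [h.symm y x]; ring

theorem sub_self (h : IsCoerciveForm B) (x y : X) :
    B (x - y) (x - y) = B x x - 2 * B x y + B y y := by
  simp only [map_sub, sub_apply]
  rw [h.symm y x]; ring

theorem add_smul_self (h : IsCoerciveForm B) (x y : X) (s : ℝ) :
    B (x + s • y) (x + s • y) = B x x + 2 * s * B x y + s ^ 2 * B y y := by
  simp only [map_add, add_apply, map_smul, smul_apply,
    smul_eq_mul]
  rw [h.symm y x]; ring

/-- Cauchy–Schwarz: the nonnegative quadratic polynomial `s ↦ B (x + s y) (x + s y)` is evaluated at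
its minimiser. -/
theorem sq_le (h : IsCoerciveForm B) (x y : X) : B x y ^ 2 ≤ B x x * B y y := by
  by_cases hy : y = 0
  · simp [hy]
  have hyy : 0 < B y y := by
    by_contra hcon
    exact hy (h.eq_zero (not_lt.mp hcon))
  have h1 := h.nonneg (x + (-(B x y / B y y)) • y)
  rw [h.add_smul_self] at h1
  have h2 : 0 ≤ B x x - B x y ^ 2 / B y y := by
    refine h1.trans_eq ?_
    field_simp
    ring
  rw [sub_nonneg, div_le_iff₀ hyy] at h2
  exact h2

/-- The lower supporting plane of the quadratic functional. -/
theorem le_self (h : IsCoerciveForm B) (x y : X) : B x x + 2 * B x (y - x) ≤ B y y := by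
  have := h.nonneg (y - x)
  rw [h.sub_self] at this
  rw [map_sub, ← h.symm y x]
  linarith

theorem self_le (B : X →L[ℝ] X →L[ℝ] ℝ) (x : X) : B x x ≤ ‖B‖ * ‖x‖ ^ 2 := by
  have := (le_abs_self _).trans (B.le_opNorm₂ x x)
  nlinarith

theorem abs_le (B : X →L[ℝ] X →L[ℝ] ℝ) (x y : X) : |B x y| ≤ ‖B‖ * ‖x‖ * ‖y‖ :=
  B.le_opNorm₂ x y

end IsCoerciveForm

/-- Growth faster than the norm gives `F x ≥ ‖x‖` outside a ball of radius `R`. By homogeneity of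
degree two, the bound on the sphere of radius `R` scales to `F x ≥ R⁻¹ ‖x‖²`. Symmetrising a
bilinear form does not change its diagonal. -/
theorem exists_coerciveForm {F : X → ℝ} (hq : IsQuadratic F) (hc : IsCoerciveFunctional F) :
    ∃ B : X →L[ℝ] X →L[ℝ] ℝ, IsCoerciveForm B ∧ ∀ x, F x = B x x := by
  obtain ⟨B₀, hB₀⟩ := hq
  refine ⟨(2⁻¹ : ℝ) • (B₀ + B₀.flip), ⟨fun x y => ?_, ?_⟩, fun x => ?_⟩
  · simp [add_comm]
  · obtain ⟨R, hR⟩ : ∃ R : ℝ, 0 < R ∧ ∀ x : X, R ≤ ‖x‖ → ‖x‖ ≤ F x := by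
      have h1 := hc.eventually_ge_atTop 1
      rw [← comap_norm_atTop, eventually_comap] at h1
      obtain ⟨R, hR⟩ := h1.exists_forall_of_atTop
      refine ⟨max R 1, by positivity, fun x hx => ?_⟩
      have h2 := hR ‖x‖ ((le_max_left _ _).trans hx) x rfl
      have h3 : 0 < ‖x‖ := lt_of_lt_of_le one_pos ((le_max_right _ _).trans hx)
      rw [le_div_iff₀ h3] at h2
      linarith
    refine ⟨R⁻¹, inv_pos.mpr hR.1, fun x => ?_⟩
    have hx2 : ((2⁻¹ : ℝ) • (B₀ + B₀.flip)) x x = B₀ x x := by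
      simp only [smul_apply, add_apply,
        ContinuousLinearMap.flip_apply, smul_eq_mul]
      ring
    rw [hx2]
    by_cases hx : x = 0
    · simp [hx]
    have hxn : 0 < ‖x‖ := norm_pos_iff.mpr hx
    have h1 := hR.2 ((R / ‖x‖) • x) (by
      rw [norm_smul, Real.norm_of_nonneg (by have := hR.1; positivity)]
      field_simp; exact le_refl _)
    rw [hB₀, norm_smul, Real.norm_of_nonneg (by have := hR.1; positivity)] at h1
    simp only [map_smul, smul_apply, smul_eq_mul] at h1
    have hRp := hR.1
    have e1 : R / ‖x‖ * ‖x‖ = R := by field_simp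
    rw [e1] at h1
    have e2 : R / ‖x‖ * (R / ‖x‖ * B₀ x x) = R ^ 2 / ‖x‖ ^ 2 * B₀ x x := by ring
    rw [e2, div_mul_eq_mul_div, le_div_iff₀ (by positivity)] at h1
    rw [inv_mul_le_iff₀ hRp]
    nlinarith
  · rw [hB₀]
    simp only [smul_apply, add_apply,
        ContinuousLinearMap.flip_apply, smul_eq_mul]
    ring

theorem hasFDerivAt_form {B : X →L[ℝ] X →L[ℝ] ℝ} (h : IsCoerciveForm B) (x : X) :
    HasFDerivAt (fun y => B y y) ((2 : ℝ) • B x) x := by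
  have h1 : HasFDerivAt (fun y => B y y) _ x := (B.hasFDerivAt).clm_apply (hasFDerivAt_id x)
  have h2 : (2 : ℝ) • B x = (B x).comp (ContinuousLinearMap.id ℝ X) + B.flip x := by
    ext y
    change 2 * B x y = B x y + B y x
    rw [h.symm y x]; ring
  rw [h2]
  exact h1

end Forms

/-! ### Convex potentials, subdifferentials and minimisation. -/

section ConvexPotential

variable {X : Type*} [NormedAddCommGroup X] [NormedSpace ℝ X] {Ψ : X → ℝ≥0∞}

theorem convexOn_real_combo (hc : ConvexOn ℝ≥0 univ Ψ) (x y : X) {a b : ℝ} (ha : 0 ≤ a)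
    (hb : 0 ≤ b) (hab : a + b = 1) :
    Ψ (a • x + b • y) ≤ ENNReal.ofReal a * Ψ x + ENNReal.ofReal b * Ψ y := by
  have h := hc.2 (mem_univ x) (mem_univ y) (zero_le (a := a.toNNReal)) (zero_le (a := b.toNNReal))
    (by rw [← Real.toNNReal_add ha hb, hab, Real.toNNReal_one])
  simp only [NNReal.smul_def, Real.coe_toNNReal _ ha, Real.coe_toNNReal _ hb] at h
  exact h

theorem mem_subdiff_iff {v : X} {ξ : StrongDual ℝ X} :
    ξ ∈ subdiff Ψ v ↔ Ψ v ≠ ∞ ∧ ∀ w, Ψ w ≠ ∞ → (Ψ v).toReal + ξ (w - v) ≤ (Ψ w).toReal := by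
  refine and_congr_right fun hv => forall_congr' fun w => ?_
  by_cases hw : Ψ w = ∞
  · simp [hw]
  · simp only [hw, ne_eq, not_false_eq_true, forall_const]
    rw [← EReal.coe_ennreal_toReal hv, ← EReal.coe_ennreal_toReal hw, ← EReal.coe_add,
      EReal.coe_le_coe_iff]

/-- Minimization of a convex lower semicontinuous functional perturbed by a coercive quadratic
one, in the form of the Euler inclusion. -/
theorem exists_mem_subdiff [CompleteSpace X] {B : X →L[ℝ] X →L[ℝ] ℝ} (hB : IsCoerciveForm B)
    (hp : ∃ v, Ψ v ≠ ∞) (hc : ConvexOn ℝ≥0 univ Ψ) (hl : LowerSemicontinuous Ψ)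
    (ℓ : StrongDual ℝ X) : ∃ x, ℓ - (2 : ℝ) • B x ∈ subdiff Ψ x := by
  obtain ⟨c, hc0, hcB⟩ := hB.coercive
  set D : Set X := {x | Ψ x ≠ ∞} with hD
  set J : X → ℝ := fun x => (Ψ x).toReal + B x x - ℓ x with hJ
  have hbdd : BddBelow (J '' D) := by
    -- The minimum over `r` of `c r² - ‖ℓ‖ r`.
    refine ⟨-(‖ℓ‖ ^ 2 / (4 * c)), ?_⟩
    rintro _ ⟨x, -, rfl⟩
    have h1 := (le_abs_self _).trans (ℓ.le_opNorm x)
    have h2 := hcB x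
    have h3 : 0 ≤ (Ψ x).toReal := ENNReal.toReal_nonneg
    have h4 : ‖ℓ‖ * ‖x‖ ≤ c * ‖x‖ ^ 2 + ‖ℓ‖ ^ 2 / (4 * c) := by
      have : 0 ≤ (2 * c * ‖x‖ - ‖ℓ‖) ^ 2 / (4 * c) := by positivity
      have e : (2 * c * ‖x‖ - ‖ℓ‖) ^ 2 / (4 * c)
        = c * ‖x‖ ^ 2 - ‖ℓ‖ * ‖x‖ + ‖ℓ‖ ^ 2 / (4 * c) := by field_simp; ring
      linarith
    simp only [hJ]; linarith
  obtain ⟨v₀, hv₀⟩ := hp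
  have hne : (J '' D).Nonempty := ⟨_, v₀, hv₀, rfl⟩
  set m := sInf (J '' D) with hm
  have hmid : ∀ x ∈ D, ∀ y ∈ D, ∀ s : ℝ, 0 ≤ s → s ≤ 1 → x + s • (y - x) ∈ D ∧
      (Ψ (x + s • (y - x))).toReal ≤ (1 - s) * (Ψ x).toReal + s * (Ψ y).toReal := by
    intro x hx y hy s hs hs1
    have h1 := convexOn_real_combo hc x y (sub_nonneg.mpr hs1) hs (by ring)
    have e : (1 - s) • x + s • y = x + s • (y - x) := by
      rw [sub_smul, one_smul, smul_sub]; abel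
    rw [e] at h1
    have hfin : ENNReal.ofReal (1 - s) * Ψ x + ENNReal.ofReal s * Ψ y ≠ ∞ :=
      ENNReal.add_ne_top.mpr ⟨ENNReal.mul_ne_top ENNReal.ofReal_ne_top hx,
        ENNReal.mul_ne_top ENNReal.ofReal_ne_top hy⟩
    refine ⟨ne_top_of_le_ne_top hfin h1, ?_⟩
    have h2 := ENNReal.toReal_mono hfin h1
    rw [ENNReal.toReal_add (ENNReal.mul_ne_top ENNReal.ofReal_ne_top hx)
        (ENNReal.mul_ne_top ENNReal.ofReal_ne_top hy), ENNReal.toReal_mul, ENNReal.toReal_mul,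
        ENNReal.toReal_ofReal (sub_nonneg.mpr hs1), ENNReal.toReal_ofReal hs] at h2
    exact h2
  have hJm : ∀ x ∈ D, m ≤ J x := fun x hx => csInf_le hbdd ⟨x, hx, rfl⟩
  -- The midpoint of two near-minimisers still has value at least `m`; the parallelogram identity
  -- then bounds their distance, so minimising sequences are Cauchy.
  have hcau : ∀ x ∈ D, ∀ y ∈ D, c * ‖x - y‖ ^ 2 ≤ 2 * (J x - m) + 2 * (J y - m) := by
    intro x hx y hy
    obtain ⟨h1, h2⟩ := hmid x hx y hy 2⁻¹ (by norm_num) (by norm_num)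
    have h3 := hJm _ h1
    have h4 := hcB (y - x)
    rw [norm_sub_rev] at h4
    simp only [hJ] at h3 ⊢
    rw [hB.add_smul_self, map_add ℓ, map_smul ℓ, map_sub ℓ, map_sub (B x), smul_eq_mul] at h3
    have h5 := hB.sub_self y x
    rw [hB.symm y x] at h5
    linarith
  have hseq : ∀ n : ℕ, ∃ x ∈ D, J x < m + 1 / (n + 1) := by
    intro n
    obtain ⟨_, ⟨x, hx, rfl⟩, h⟩ := exists_lt_of_csInf_lt hne
      (lt_add_of_pos_right m (Nat.one_div_pos_of_nat (n := n)))
    exact ⟨x, hx, h⟩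
  choose x hxD hxJ using hseq
  have hCS : CauchySeq x := by
    rw [Metric.cauchySeq_iff']
    intro ε hε
    obtain ⟨N, hN⟩ := exists_nat_one_div_lt (show 0 < c * ε ^ 2 / 4 by positivity)
    refine ⟨N, fun n hn => ?_⟩
    have h1 := hcau _ (hxD n) _ (hxD N)
    have h2 := hxJ n
    have h3 := hxJ N
    have h4 : (1 : ℝ) / (n + 1) ≤ 1 / (N + 1) := Nat.one_div_le_one_div hn
    rw [dist_eq_norm]
    have h5 : c * ‖x n - x N‖ ^ 2 < c * ε ^ 2 := by linarith
    exact lt_of_pow_lt_pow_left₀ 2 hε.le (lt_of_mul_lt_mul_left h5 hc0.le)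
  obtain ⟨a, ha⟩ := cauchySeq_tendsto_of_complete hCS
  have hqc : Continuous fun x => B x x - ℓ x := by fun_prop
  have hle : Ψ a ≤ ENNReal.ofReal (m - (B a a - ℓ a)) := by
    have h1 : Tendsto (fun n : ℕ => ENNReal.ofReal (m + 1 / ((n : ℝ) + 1) - (B (x n) (x n) - ℓ (x n))))
        atTop (𝓝 (ENNReal.ofReal (m + 0 - (B a a - ℓ a)))) := by
      refine ENNReal.tendsto_ofReal ?_
      exact (tendsto_const_nhds.add tendsto_one_div_add_atTop_nhds_zero_nat).sub
        ((hqc.tendsto a).comp ha)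
    rw [add_zero] at h1
    rw [← h1.liminf_eq]
    have h2 := lowerSemicontinuousAt_iff_le_liminf.mp (hl a)
    refine h2.trans ((liminf_le_liminf_of_le (ha : map x atTop ≤ 𝓝 a)).trans ?_)
    change liminf (fun n => Ψ (x n)) atTop ≤ _
    refine liminf_le_liminf (Eventually.of_forall fun n => ?_)
    rw [← ENNReal.ofReal_toReal (hxD n)]
    refine ENNReal.ofReal_le_ofReal ?_
    have := (hxJ n).le
    simp only [hJ] at this
    linarith
  have haD : a ∈ D := ne_top_of_le_ne_top ENNReal.ofReal_ne_top hle
  -- Shows that `ENNReal.ofReal` has not truncated a negative number in `hle`.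
  have hge : 0 ≤ m - (B a a - ℓ a) := by
    refine ge_of_tendsto' (x := atTop) (f := fun n : ℕ => m + 1 / ((n : ℝ) + 1) - (B (x n) (x n) - ℓ (x n))) ?_ ?_
    · have := (tendsto_const_nhds (x := m)).add
        (tendsto_one_div_add_atTop_nhds_zero_nat (𝕜 := ℝ)) |>.sub ((hqc.tendsto a).comp ha)
      simpa using this
    · intro n
      have := (hxJ n).le
      have h0 : 0 ≤ (Ψ (x n)).toReal := ENNReal.toReal_nonneg
      simp only [hJ] at this
      linarith
  have hJa : J a ≤ m := by
    have := ENNReal.toReal_mono ENNReal.ofReal_ne_top hle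
    rw [ENNReal.toReal_ofReal hge] at this
    simp only [hJ]; linarith
  refine ⟨a, mem_subdiff_iff.mpr ⟨haD, fun y hy => ?_⟩⟩
  -- The minimiser is compared with `a + s (y - a)`; convexity of `Ψ` allows division by `s`, and
  -- the remaining quadratic term disappears as `s → 0`.
  have key : ∀ s : ℝ, 0 < s → s ≤ 1 →
      (Ψ a).toReal + (ℓ - (2 : ℝ) • B a) (y - a) ≤ (Ψ y).toReal + s * B (y - a) (y - a) := by
    intro s hs hs1
    obtain ⟨h1, h2⟩ := hmid a haD y hy s hs.le hs1
    have h3 := hJa.trans (hJm _ h1)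
    simp only [hJ] at h3
    rw [hB.add_smul_self, map_add, map_smul, smul_eq_mul] at h3
    simp only [sub_apply, smul_apply, smul_eq_mul]
    have h4 : s * ((Ψ a).toReal + (ℓ (y - a) - 2 * B a (y - a)))
        ≤ s * ((Ψ y).toReal + s * B (y - a) (y - a)) := by nlinarith
    exact le_of_mul_le_mul_left h4 hs
  refine ge_of_tendsto (b := (Ψ a).toReal + (ℓ - (2 : ℝ) • B a) (y - a))
    (f := fun s : ℝ => (Ψ y).toReal + s * B (y - a) (y - a)) (x := 𝓝[>] (0 : ℝ)) ?_ ?_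
  · have : Tendsto (fun s : ℝ => (Ψ y).toReal + s * B (y - a) (y - a)) (𝓝 0)
        (𝓝 ((Ψ y).toReal + 0 * B (y - a) (y - a))) := by
      apply Continuous.tendsto; fun_prop
    simp only [zero_mul, add_zero] at this
    exact this.mono_left nhdsWithin_le_nhds
  · filter_upwards [Ioc_mem_nhdsGT (zero_lt_one' ℝ)] with s hs using key s hs.1 hs.2

end ConvexPotential

/-! ### Riesz representation by a coercive form. -/

section Duality

variable {X : Type*} [NormedAddCommGroup X] [NormedSpace ℝ X] [CompleteSpace X]

/-- Riesz representation by a coercive form. -/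
theorem IsCoerciveForm.surjective {B : X →L[ℝ] X →L[ℝ] ℝ} (hB : IsCoerciveForm B) :
    Function.Surjective B := by
  intro ℓ
  -- For the zero potential the Euler inclusion says `ℓ = 2 B x`.
  obtain ⟨x, hx⟩ := exists_mem_subdiff hB (Ψ := fun _ => 0) ⟨0, by simp⟩
    ⟨convex_univ, by simp⟩ lowerSemicontinuous_const ℓ
  rw [mem_subdiff_iff] at hx
  have h1 : ∀ y, (ℓ - (2 : ℝ) • B x) y ≤ 0 := fun y => by
    simpa using hx.2 (x + y) (by simp)
  refine ⟨(2 : ℝ) • x, ?_⟩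
  ext y
  have h2 := h1 y
  have h3 := h1 (-y)
  simp only [map_neg, sub_apply, smul_apply,
    smul_eq_mul] at h2 h3
  simp only [map_smul, smul_apply, smul_eq_mul]
  linarith

theorem IsCoerciveForm.injective {B : X →L[ℝ] X →L[ℝ] ℝ} (hB : IsCoerciveForm B) :
    Function.Injective B := by
  rw [injective_iff_map_eq_zero]
  intro x hx
  exact hB.eq_zero (by simp [hx])

/-- The Riesz isomorphism of a coercive form. -/
noncomputable def IsCoerciveForm.equiv {B : X →L[ℝ] X →L[ℝ] ℝ} (hB : IsCoerciveForm B) :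
    X ≃L[ℝ] StrongDual ℝ X :=
  ContinuousLinearEquiv.ofBijective B (LinearMap.ker_eq_bot.mpr hB.injective)
    (LinearMap.range_eq_top.mpr hB.surjective)

theorem IsCoerciveForm.equiv_symm_apply {B : X →L[ℝ] X →L[ℝ] ℝ} (hB : IsCoerciveForm B)
    (ζ : StrongDual ℝ X) : B (hB.equiv.symm ζ) = ζ :=
  hB.equiv.apply_symm_apply ζ

/-- The pairing of a functional with its Riesz representative is `B` of the representative with
itself. This provides a coercive form on the space of dual velocities, which the selection argument
needs alongside the forms on `U` and `Z`. -/
theorem IsCoerciveForm.exists_dual {B : X →L[ℝ] X →L[ℝ] ℝ} (hB : IsCoerciveForm B) :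
    ∃ B' : StrongDual ℝ X →L[ℝ] StrongDual ℝ X →L[ℝ] ℝ, IsCoerciveForm B' := by
  set e := hB.equiv
  set J : StrongDual ℝ X →L[ℝ] X := e.symm.toContinuousLinearMap
  refine ⟨(ContinuousLinearMap.apply ℝ ℝ).comp J, ⟨fun x y => ?_, ?_⟩⟩
  · change y (e.symm x) = x (e.symm y)
    have h1 : ∀ x y : StrongDual ℝ X, y (e.symm x) = B (e.symm y) (e.symm x) := fun x y => by
      rw [show B (e.symm y) = y from hB.equiv_symm_apply y]
    rw [h1 x y, h1 y x, hB.symm]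
  · obtain ⟨c, hc, hcB⟩ := hB.coercive
    refine ⟨c / (‖B‖ + 1) ^ 2, by positivity, fun ζ => ?_⟩
    change _ ≤ ζ (e.symm ζ)
    have h1 : ζ (e.symm ζ) = B (e.symm ζ) (e.symm ζ) := by
      rw [show B (e.symm ζ) = ζ from hB.equiv_symm_apply ζ]
    rw [h1]
    refine le_trans ?_ (hcB _)
    have h2 : ‖ζ‖ ≤ (‖B‖ + 1) * ‖e.symm ζ‖ := by
      conv_lhs => rw [← hB.equiv_symm_apply ζ]
      refine (B.le_opNorm _).trans ?_
      have := norm_nonneg (e.symm ζ)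
      change ‖B‖ * ‖e.symm ζ‖ ≤ _
      nlinarith
    rw [div_mul_eq_mul_div, div_le_iff₀ (by positivity), mul_assoc]
    refine mul_le_mul_of_nonneg_left ?_ hc.le
    calc ‖ζ‖ ^ 2 ≤ ((‖B‖ + 1) * ‖e.symm ζ‖) ^ 2 := by gcongr
      _ = _ := by ring

end Duality

/-! ### Forms on product spaces. -/

section Product

variable {X Y : Type*} [NormedAddCommGroup X] [NormedSpace ℝ X] [NormedAddCommGroup Y]
  [NormedSpace ℝ Y]

/-- The orthogonal sum of two bilinear forms. -/
noncomputable def prodForm (B : X →L[ℝ] X →L[ℝ] ℝ) (C : Y →L[ℝ] Y →L[ℝ] ℝ) :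
    (X × Y) →L[ℝ] (X × Y) →L[ℝ] ℝ :=
  B.bilinearComp (ContinuousLinearMap.fst ℝ X Y) (ContinuousLinearMap.fst ℝ X Y)
    + C.bilinearComp (ContinuousLinearMap.snd ℝ X Y) (ContinuousLinearMap.snd ℝ X Y)

theorem IsCoerciveForm.prod {B : X →L[ℝ] X →L[ℝ] ℝ} {C : Y →L[ℝ] Y →L[ℝ] ℝ}
    (hB : IsCoerciveForm B) (hC : IsCoerciveForm C) : IsCoerciveForm (prodForm B C) := by
  refine ⟨fun x y => ?_, ?_⟩
  · simp [prodForm, hB.symm x.1, hC.symm x.2]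
  · obtain ⟨b, hb, hbB⟩ := hB.coercive
    obtain ⟨c, hc, hcC⟩ := hC.coercive
    refine ⟨min b c, lt_min hb hc, fun x => ?_⟩
    have h1 := hbB x.1
    have h2 := hcC x.2
    simp only [prodForm, add_apply, ContinuousLinearMap.bilinearComp_apply,
      ContinuousLinearMap.coe_fst', ContinuousLinearMap.coe_snd']
    have h3 : ‖x‖ ^ 2 ≤ ‖x.1‖ ^ 2 + ‖x.2‖ ^ 2 := by
      rcases max_choice ‖x.1‖ ‖x.2‖ with h | h <;> rw [Prod.norm_def, h] <;> nlinarith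
    have h4 : min b c * ‖x.1‖ ^ 2 ≤ b * ‖x.1‖ ^ 2 := by gcongr; exact min_le_left _ _
    have h5 : min b c * ‖x.2‖ ^ 2 ≤ c * ‖x.2‖ ^ 2 := by gcongr; exact min_le_right _ _
    have h6 := mul_le_mul_of_nonneg_left h3 (lt_min hb hc).le
    linarith

/-- The restriction of a coercive form to the first factor. -/
theorem IsCoerciveForm.fst {Q : (X × Y) →L[ℝ] (X × Y) →L[ℝ] ℝ} (hQ : IsCoerciveForm Q) :
    IsCoerciveForm (Q.bilinearComp (ContinuousLinearMap.inl ℝ X Y)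
      (ContinuousLinearMap.inl ℝ X Y)) := by
  obtain ⟨c, hc, h⟩ := hQ.coercive
  refine ⟨fun x y => by simp [hQ.symm (x, 0)], c, hc, fun x => ?_⟩
  simpa [Prod.norm_def] using h (x, 0)

/-- The restriction of a coercive form to the second factor. -/
theorem IsCoerciveForm.snd {Q : (X × Y) →L[ℝ] (X × Y) →L[ℝ] ℝ} (hQ : IsCoerciveForm Q) :
    IsCoerciveForm (Q.bilinearComp (ContinuousLinearMap.inr ℝ X Y)
      (ContinuousLinearMap.inr ℝ X Y)) := by
  obtain ⟨c, hc, h⟩ := hQ.coercive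
  refine ⟨fun x y => by simp [hQ.symm (0, x)], c, hc, fun x => ?_⟩
  simpa [Prod.norm_def] using h (0, x)

end Product

end

section

/-! ### Integrals of `p`-th powers and `L^p` norms. -/

section LpTools

theorem real_add_rpow_le {a b p : ℝ} (ha : 0 ≤ a) (hb : 0 ≤ b) (hp : 1 ≤ p) :
    (a + b) ^ p ≤ 2 ^ (p - 1) * (a ^ p + b ^ p) := by
  lift a to ℝ≥0 using ha
  lift b to ℝ≥0 using hb
  exact_mod_cast NNReal.rpow_add_le_mul_rpow_add_rpow a b hp

variable {Ω : Type*} [MeasurableSpace Ω] {μ : Measure Ω} {X : Type*} [NormedAddCommGroup X]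

theorem integral_rpow_le {p K : ℝ} (hp : 0 < p) (hK : 0 ≤ K) {f : Ω → X}
    (hf : MemLp f (ENNReal.ofReal p) μ) (h : eLpNorm f (ENNReal.ofReal p) μ ≤ ENNReal.ofReal K) :
    ∫ t, ‖f t‖ ^ p ∂μ ≤ K ^ p := by
  have h0 : ENNReal.ofReal p ≠ 0 := by simpa using hp
  rw [hf.eLpNorm_eq_integral_rpow_norm h0 ENNReal.ofReal_ne_top, ENNReal.toReal_ofReal hp.le,
    ENNReal.ofReal_le_ofReal_iff hK] at h
  have hI : 0 ≤ ∫ t, ‖f t‖ ^ p ∂μ := integral_nonneg fun _ => by positivity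
  have h2 := Real.rpow_le_rpow (by positivity) h hp.le
  rwa [← Real.rpow_mul hI, inv_mul_cancel₀ hp.ne', Real.rpow_one] at h2

theorem eLpNorm_le_of_integral_rpow_le {p K : ℝ} (hp : 0 < p) {f : Ω → X}
    (hf : MemLp f (ENNReal.ofReal p) μ) (h : ∫ t, ‖f t‖ ^ p ∂μ ≤ K) :
    eLpNorm f (ENNReal.ofReal p) μ ≤ ENNReal.ofReal (K ^ p⁻¹) := by
  have h0 : ENNReal.ofReal p ≠ 0 := by simpa using hp
  have hI : 0 ≤ ∫ t, ‖f t‖ ^ p ∂μ := integral_nonneg fun _ => by positivity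
  rw [hf.eLpNorm_eq_integral_rpow_norm h0 ENNReal.ofReal_ne_top, ENNReal.toReal_ofReal hp.le]
  exact ENNReal.ofReal_le_ofReal (Real.rpow_le_rpow hI h (by positivity))

theorem MemLp.integrable_rpow {p : ℝ} (hp : 0 < p) {f : Ω → X}
    (hf : MemLp f (ENNReal.ofReal p) μ) : Integrable (fun t => ‖f t‖ ^ p) μ := by
  have := hf.integrable_norm_rpow (by simpa using hp) ENNReal.ofReal_ne_top
  rwa [ENNReal.toReal_ofReal hp.le] at this

end LpTools

/-! ### Strongly convergent selections from decreasing convex sets. -/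

section Selection

variable {X : Type*} [NormedAddCommGroup X] [NormedSpace ℝ X]

/-- A uniformly convex function of linear growth. -/
noncomputable def formGauge (B : X →L[ℝ] X →L[ℝ] ℝ) (x : X) : ℝ := √(1 + B x x)

variable {B : X →L[ℝ] X →L[ℝ] ℝ}

theorem one_le_formGauge (hB : IsCoerciveForm B) (x : X) : 1 ≤ formGauge B x := by
  rw [formGauge, Real.one_le_sqrt]
  linarith [hB.nonneg x]

theorem sq_formGauge (hB : IsCoerciveForm B) (x : X) : formGauge B x ^ 2 = 1 + B x x :=
  Real.sq_sqrt (by linarith [hB.nonneg x])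

theorem formGauge_le (hB : IsCoerciveForm B) (x : X) :
    formGauge B x ≤ 1 + (1 + ‖B‖) * ‖x‖ := by
  have h1 := IsCoerciveForm.self_le B x
  rw [formGauge, Real.sqrt_le_left (by positivity)]
  nlinarith [norm_nonneg B, norm_nonneg x, mul_nonneg (norm_nonneg B) (norm_nonneg x),
    sq_nonneg (‖B‖ * ‖x‖), mul_nonneg (norm_nonneg B) (sq_nonneg ‖x‖), sq_nonneg ‖x‖]

theorem continuous_formGauge : Continuous (formGauge B) := by
  unfold formGauge; fun_prop

/-- With `α`, `β`, `γ` the gauges of `a`, `b` and the midpoint, and `s = 1 + B a b`, one has `(α + β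
- 2γ)(α + β + 2γ) = 2(αβ - s)`. Cauchy–Schwarz gives `B (a - b) (a - b) ≤ (αβ - s)(αβ + s)`. The
cubic factor reflects that a function of linear growth loses its convexity at infinity. -/
theorem formGauge_deficit (hB : IsCoerciveForm B) (a b : X) :
    0 ≤ formGauge B a + formGauge B b - 2 * formGauge B ((2⁻¹ : ℝ) • (a + b)) ∧
    B (a - b) (a - b) ≤ (formGauge B a + formGauge B b) ^ 3 *
      (formGauge B a + formGauge B b - 2 * formGauge B ((2⁻¹ : ℝ) • (a + b))) := by
  set α := formGauge B a
  set β := formGauge B b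
  set γ := formGauge B ((2⁻¹ : ℝ) • (a + b))
  have hα : 1 ≤ α := one_le_formGauge hB a
  have hβ : 1 ≤ β := one_le_formGauge hB b
  have hγ : 1 ≤ γ := one_le_formGauge hB _
  have h1 : α ^ 2 = 1 + B a a := sq_formGauge hB a
  have h2 : β ^ 2 = 1 + B b b := sq_formGauge hB b
  have h3 : γ ^ 2 = 1 + 4⁻¹ * (B a a + 2 * B a b + B b b) := by
    rw [show γ ^ 2 = _ from sq_formGauge hB _, map_smul, map_smul, smul_apply, smul_eq_mul,
      smul_eq_mul, hB.add_self]
    ring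
  have h4 := hB.sq_le a b
  have h5 := hB.sub_self a b
  have h6 := hB.nonneg (a - b)
  set s := 1 + B a b with hs
  have h7 : B (a - b) (a - b) ≤ (α * β - s) * (α * β + s) := by
    have : (α * β - s) * (α * β + s) = α ^ 2 * β ^ 2 - s ^ 2 := by ring
    rw [this, h1, h2]
    nlinarith
  have hsle : |s| ≤ α * β := by
    apply abs_le_of_sq_le_sq _ (by positivity)
    nlinarith
  obtain ⟨hs1, hs2⟩ := abs_le.mp hsle
  have h8 : (α + β - 2 * γ) * (α + β + 2 * γ) = 2 * (α * β - s) := by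
    have : (α + β - 2 * γ) * (α + β + 2 * γ) = α ^ 2 + β ^ 2 + 2 * (α * β) - 4 * γ ^ 2 := by ring
    rw [this, h1, h2, h3, hs]; ring
  have h9 : 0 ≤ α + β - 2 * γ := by
    by_contra hcon
    push Not at hcon
    nlinarith
  refine ⟨h9, ?_⟩
  have h10 : α * β - s ≤ (α + β - 2 * γ) * (α + β) := by nlinarith
  calc B (a - b) (a - b) ≤ (α * β - s) * (α * β + s) := h7
    _ ≤ (α * β - s) * (2 * (α * β)) := by
        apply mul_le_mul_of_nonneg_left <;> linarith
    _ ≤ ((α + β - 2 * γ) * (α + β)) * (2 * (α * β)) := by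
        apply mul_le_mul_of_nonneg_right h10; positivity
    _ ≤ ((α + β - 2 * γ) * (α + β)) * ((α + β) ^ 2) := by
        apply mul_le_mul_of_nonneg_left _ (by positivity)
        nlinarith [sq_nonneg (α - β), sq_nonneg α, sq_nonneg β]
    _ = _ := by ring

/-- The gauge deficit controls the distance up to small errors. -/
theorem norm_sub_le_formGauge (hB : IsCoerciveForm B) {p : ℝ} (hp : 1 < p) :
    ∀ l : ℝ, 0 < l → ∀ ρ : ℝ, 0 < ρ → ∃ M : ℝ, 0 ≤ M ∧ ∀ a b : X,
      ‖a - b‖ ≤ l + M * (formGauge B a + formGauge B b - 2 * formGauge B ((2⁻¹ : ℝ) • (a + b)))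
        + 2 ^ (p - 1) * ρ ^ (1 - p) * (‖a‖ ^ p + ‖b‖ ^ p) := by
  intro l hl ρ hρ
  obtain ⟨c, hc, hcB⟩ := hB.coercive
  -- When `‖a‖ + ‖b‖ ≤ ρ` the sum of the gauges is at most `2 + (1 + ‖B‖) ρ`, and `r ≤ l + r² / l`
  -- converts the quadratic deficit bound into a linear one. Larger arguments are paid for by the
  -- `p`-th powers.
  refine ⟨(2 + (1 + ‖B‖) * ρ) ^ 3 / (c * l), by positivity, fun a b => ?_⟩
  obtain ⟨hD0, hD⟩ := formGauge_deficit hB a b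
  set D := formGauge B a + formGauge B b - 2 * formGauge B ((2⁻¹ : ℝ) • (a + b))
  set S := formGauge B a + formGauge B b
  have hS0 : 0 ≤ S := add_nonneg (by linarith [one_le_formGauge hB a])
    (by linarith [one_le_formGauge hB b])
  have hd : ‖a - b‖ ≤ ‖a‖ + ‖b‖ := norm_sub_le a b
  have hT : 0 ≤ 2 ^ (p - 1) * ρ ^ (1 - p) * (‖a‖ ^ p + ‖b‖ ^ p) := by positivity
  rcases le_or_gt (‖a‖ + ‖b‖) ρ with h | h
  · have h1 : S ≤ 2 + (1 + ‖B‖) * ρ := by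
      have h2 := formGauge_le hB a
      have h3 := formGauge_le hB b
      have h4 : (1 + ‖B‖) * (‖a‖ + ‖b‖) ≤ (1 + ‖B‖) * ρ := by gcongr
      simp only [S]; linarith
    have h2 : c * ‖a - b‖ ^ 2 ≤ (2 + (1 + ‖B‖) * ρ) ^ 3 * D := by
      refine (hcB _).trans (hD.trans ?_)
      gcongr
    have h3 : ‖a - b‖ ≤ l + ‖a - b‖ ^ 2 / l := by
      have : 0 ≤ (‖a - b‖ - l) ^ 2 / l + ‖a - b‖ := by positivity
      have e : (‖a - b‖ - l) ^ 2 / l + ‖a - b‖ = ‖a - b‖ ^ 2 / l - ‖a - b‖ + l := by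
        field_simp; ring
      linarith
    have h4 : ‖a - b‖ ^ 2 / l ≤ (2 + (1 + ‖B‖) * ρ) ^ 3 / (c * l) * D := by
      rw [div_le_iff₀ hl]
      have e : (2 + (1 + ‖B‖) * ρ) ^ 3 / (c * l) * D * l = ((2 + (1 + ‖B‖) * ρ) ^ 3 * D) / c := by
        field_simp
      rw [e, le_div_iff₀ hc]
      linarith
    linarith
  · have hn : 0 < ‖a‖ + ‖b‖ := hρ.trans h
    have h1 : ‖a‖ + ‖b‖ ≤ ρ ^ (1 - p) * (‖a‖ + ‖b‖) ^ p := by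
      have e : (‖a‖ + ‖b‖) = (‖a‖ + ‖b‖) ^ (1 - p) * (‖a‖ + ‖b‖) ^ p := by
        rw [← Real.rpow_add hn]; simp
      conv_lhs => rw [e]
      gcongr ?_ * _
      exact Real.rpow_le_rpow_of_nonpos hρ h.le (by linarith)
    have h2 : (‖a‖ + ‖b‖) ^ p ≤ 2 ^ (p - 1) * (‖a‖ ^ p + ‖b‖ ^ p) :=
      real_add_rpow_le (norm_nonneg a) (norm_nonneg b) hp.le
    have h3 : ρ ^ (1 - p) * (‖a‖ + ‖b‖) ^ p
        ≤ ρ ^ (1 - p) * (2 ^ (p - 1) * (‖a‖ ^ p + ‖b‖ ^ p)) := by gcongr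
    have h4 : 0 ≤ (2 + (1 + ‖B‖) * ρ) ^ 3 / (c * l) * D := by positivity
    linarith

variable {Ω : Type*} [MeasurableSpace Ω] {μ : Measure Ω} [IsFiniteMeasure μ]

theorem integrable_formGauge (hB : IsCoerciveForm B) {x : Ω → X} (hx : Integrable x μ) :
    Integrable (fun t => formGauge B (x t)) μ := by
  refine Integrable.mono' (g := fun t => 1 + (1 + ‖B‖) * ‖x t‖)
    ((integrable_const _).add (hx.norm.const_mul _))
    (continuous_formGauge.comp_aestronglyMeasurable hx.1) (Eventually.of_forall fun t => ?_)
  rw [Real.norm_of_nonneg (by linarith [one_le_formGauge hB (x t)])]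
  exact formGauge_le hB _

/-- From a decreasing sequence of convex sets of functions, bounded in `L^p` with `p > 1`, one can
select a strongly convergent sequence. -/
theorem exists_selection [CompleteSpace X] (hB : IsCoerciveForm B) {p K : ℝ} (hp : 1 < p)
    (hK : 0 ≤ K) {C : ℕ → Set (Ω → X)} (hanti : Antitone C) (hconv : ∀ n, Convex ℝ (C n))
    (hne : ∀ n, (C n).Nonempty)
    (hmem : ∀ x ∈ C 0, MemLp x (ENNReal.ofReal p) μ ∧
      eLpNorm x (ENNReal.ofReal p) μ ≤ ENNReal.ofReal K) :
    ∃ (x : ℕ → Ω → X) (y : Ω → X), (∀ n, x n ∈ C n) ∧ MemLp y 1 μ ∧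
      Tendsto (fun n => eLpNorm (x n - y) 1 μ) atTop (𝓝 0) ∧
      ∀ᵐ t ∂μ, Tendsto (fun n => x n t) atTop (𝓝 (y t)) := by
  have hp0 : 0 < p := by linarith
  have hmem' : ∀ n, ∀ x ∈ C n, MemLp x (ENNReal.ofReal p) μ ∧
      eLpNorm x (ENNReal.ofReal p) μ ≤ ENNReal.ofReal K :=
    fun n x hx => hmem x (hanti (Nat.zero_le n) hx)
  have hint : ∀ n, ∀ x ∈ C n, Integrable x μ := fun n x hx =>
    (hmem' n x hx).1.integrable (by simpa using hp.le)
  -- Linear growth makes `J` finite on integrable functions; almost minimising it over `C n` is the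
  -- analogue of projecting the origin onto a convex set.
  set J : (Ω → X) → ℝ := fun x => ∫ t, formGauge B (x t) ∂μ with hJ
  have hJ0 : ∀ x, 0 ≤ J x := fun x => integral_nonneg fun t => by
    have := one_le_formGauge hB (x t); simp only [Pi.zero_apply]; linarith
  set m : ℕ → ℝ := fun n => sInf (J '' C n) with hm
  have hbdd : ∀ n, BddBelow (J '' C n) := fun n => ⟨0, by rintro _ ⟨x, -, rfl⟩; exact hJ0 x⟩
  have hmono : Monotone m := fun i j hij =>
    csInf_le_csInf (hbdd i) ((hne j).image J) (image_mono (hanti hij))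
  have hJle : ∀ n, ∀ x ∈ C n, J x ≤ ∫ t, (1 + (1 + ‖B‖) * (1 + ‖x t‖ ^ p)) ∂μ := by
    intro n x hx
    refine integral_mono (integrable_formGauge hB (hint n x hx))
      ((integrable_const _).add (((integrable_const _).add
        (MemLp.integrable_rpow hp0 (hmem' n x hx).1)).const_mul _)) fun t => ?_
    refine (formGauge_le hB _).trans ?_
    gcongr
    rcases le_or_gt ‖x t‖ 1 with h | h
    · have : 0 ≤ ‖x t‖ ^ p := by positivity
      linarith
    · have := Real.rpow_le_rpow_of_exponent_le h.le hp.le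
      rw [Real.rpow_one] at this
      linarith
  have hint2 : ∀ n, ∀ x ∈ C n, ∫ t, ‖x t‖ ^ p ∂μ ≤ K ^ p := fun n x hx =>
    integral_rpow_le hp0 hK (hmem' n x hx).1 (hmem' n x hx).2
  set M₀ := μ.real univ * (1 + (1 + ‖B‖)) + (1 + ‖B‖) * K ^ p
  have hmbdd : BddAbove (range m) := by
    refine ⟨M₀, ?_⟩
    rintro _ ⟨n, rfl⟩
    obtain ⟨x, hx⟩ := hne n
    refine (csInf_le (hbdd n) ⟨x, hx, rfl⟩).trans ((hJle n x hx).trans ?_)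
    have hi := MemLp.integrable_rpow hp0 (hmem' n x hx).1
    have e : ∀ t, 1 + (1 + ‖B‖) * (1 + ‖x t‖ ^ p)
        = (1 + (1 + ‖B‖)) + (1 + ‖B‖) * ‖x t‖ ^ p := fun t => by ring
    simp_rw [e]
    rw [integral_add (integrable_const _) (hi.const_mul _), integral_const, integral_const_mul,
      smul_eq_mul]
    have := hint2 n x hx
    simp only [M₀]
    gcongr
  have hmlim := tendsto_atTop_ciSup hmono hmbdd
  set m₀ := ⨆ n, m n
  have hseq : ∀ n : ℕ, ∃ x ∈ C n, J x < m n + 1 / (n + 1) := by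
    intro n
    obtain ⟨_, ⟨x, hx, rfl⟩, h⟩ := exists_lt_of_csInf_lt ((hne n).image J)
      (lt_add_of_pos_right (m n) (Nat.one_div_pos_of_nat (n := n)))
    exact ⟨x, hx, h⟩
  choose x hxC hxJ using hseq
  have hmle : ∀ n, m n ≤ m₀ := fun n => le_ciSup hmbdd n
  -- The midpoint of `x i` and `x j` lies in `C N`, so its `J` is at least `m N`, whereas `J (x i)`
  -- and `J (x j)` exceed `m₀` by at most `1 / (N + 1)`.
  have hdef : ∀ N i j, N ≤ i → N ≤ j →
      ∫ t, (formGauge B (x i t) + formGauge B (x j t)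
        - 2 * formGauge B ((2⁻¹ : ℝ) • (x i t + x j t))) ∂μ
        ≤ 2 * (m₀ - m N) + 2 * (1 / (N + 1)) := by
    intro N i j hi hj
    have hmidC : (2⁻¹ : ℝ) • (x i + x j) ∈ C N := by
      have := hconv N (hanti hi (hxC i)) (hanti hj (hxC j)) (a := 2⁻¹) (b := 2⁻¹)
        (by norm_num) (by norm_num) (by norm_num)
      rwa [← smul_add] at this
    have h1 : m N ≤ J ((2⁻¹ : ℝ) • (x i + x j)) := csInf_le (hbdd N) ⟨_, hmidC, rfl⟩
    have hii := integrable_formGauge hB (hint i _ (hxC i))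
    have hij := integrable_formGauge hB (hint j _ (hxC j))
    have him := integrable_formGauge hB (hint N _ hmidC)
    have e := integral_sub (hii.add hij) (him.const_mul 2)
    simp only [Pi.add_apply, Pi.smul_apply] at e
    rw [e, integral_add hii hij, integral_const_mul]
    have h2 := hxJ i
    have h3 := hxJ j
    have h4 : (1 : ℝ) / (i + 1) ≤ 1 / (N + 1) := Nat.one_div_le_one_div hi
    have h5 : (1 : ℝ) / (j + 1) ≤ 1 / (N + 1) := Nat.one_div_le_one_div hj
    have h6 := hmle i
    have h7 := hmle j
    simp only [hJ, Pi.smul_apply, Pi.add_apply] at h1 h2 h3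
    linarith
  -- First `ρ` is taken large, where `p > 1` makes the tail small; then `l` is taken small; finally
  -- `N` is chosen so large that the deficit absorbs the constant `M`.
  have hcau : ∀ ε : ℝ, 0 < ε → ∃ N, ∀ i j, N ≤ i → N ≤ j → ∫ t, ‖x i t - x j t‖ ∂μ < ε := by
    intro ε hε
    obtain ⟨ρ, hρ0, hρ⟩ : ∃ ρ : ℝ, 0 < ρ ∧ 2 ^ (p - 1) * ρ ^ (1 - p) * (2 * K ^ p) < ε / 4 := by
      have h1 : Tendsto (fun ρ : ℝ => 2 ^ (p - 1) * ρ ^ (1 - p) * (2 * K ^ p)) atTop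
          (𝓝 (2 ^ (p - 1) * 0 * (2 * K ^ p))) := by
        refine Tendsto.mul_const _ (Tendsto.const_mul _ ?_)
        rw [show (1 - p) = -(p - 1) by ring]
        exact tendsto_rpow_neg_atTop (by linarith)
      simp only [mul_zero, zero_mul] at h1
      obtain ⟨ρ, h2, h3⟩ := ((h1.eventually_lt_const (show (0 : ℝ) < ε / 4 by linarith)).and
        (eventually_gt_atTop 0)).exists
      exact ⟨ρ, h3, h2⟩
    set l := ε / (4 * (μ.real univ + 1))
    have hμ0 : 0 ≤ μ.real univ := measureReal_nonneg
    have hl0 : 0 < l := by positivity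
    have hl1 : μ.real univ * l ≤ ε / 4 := by
      have : l * (μ.real univ + 1) = ε / 4 := by simp only [l]; field_simp
      nlinarith
    obtain ⟨M, hM0, hM⟩ := norm_sub_le_formGauge hB hp l hl0 ρ hρ0
    have hlim : Tendsto (fun N : ℕ => M * (2 * (m₀ - m N) + 2 * (1 / ((N : ℝ) + 1)))) atTop
        (𝓝 (M * (2 * (m₀ - m₀) + 2 * 0))) :=
      (((tendsto_const_nhds.sub hmlim).const_mul 2).add
        (tendsto_one_div_add_atTop_nhds_zero_nat.const_mul 2)).const_mul M
    simp only [sub_self, mul_zero, add_zero] at hlim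
    obtain ⟨N, hN⟩ := (hlim.eventually_lt_const (show (0 : ℝ) < ε / 4 by linarith)).exists
    refine ⟨N, fun i j hi hj => ?_⟩
    have hmidC : (2⁻¹ : ℝ) • (x i + x j) ∈ C N := by
      have := hconv N (hanti hi (hxC i)) (hanti hj (hxC j)) (a := 2⁻¹) (b := 2⁻¹)
        (by norm_num) (by norm_num) (by norm_num)
      rwa [← smul_add] at this
    have hii := integrable_formGauge hB (hint i _ (hxC i))
    have hij := integrable_formGauge hB (hint j _ (hxC j))
    have him := integrable_formGauge hB (hint N _ hmidC)
    have hDi : Integrable (fun t => formGauge B (x i t) + formGauge B (x j t)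
        - 2 * formGauge B ((2⁻¹ : ℝ) • (x i t + x j t))) μ := (hii.add hij).sub (him.const_mul 2)
    have hpi := MemLp.integrable_rpow hp0 (hmem' i _ (hxC i)).1
    have hpj := MemLp.integrable_rpow hp0 (hmem' j _ (hxC j)).1
    have h1 : ∫ t, ‖x i t - x j t‖ ∂μ ≤ ∫ t, (l + M * (formGauge B (x i t) + formGauge B (x j t)
        - 2 * formGauge B ((2⁻¹ : ℝ) • (x i t + x j t)))
        + 2 ^ (p - 1) * ρ ^ (1 - p) * (‖x i t‖ ^ p + ‖x j t‖ ^ p)) ∂μ :=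
      integral_mono ((hint i _ (hxC i)).sub (hint j _ (hxC j))).norm
        (((integrable_const _).add (hDi.const_mul _)).add ((hpi.add hpj).const_mul _))
        fun t => hM _ _
    have h2 := integral_add ((integrable_const (μ := μ) l).add (hDi.const_mul M))
      ((hpi.add hpj).const_mul (2 ^ (p - 1) * ρ ^ (1 - p)))
    simp only [Pi.add_apply] at h2
    rw [h2, integral_add (integrable_const _) (hDi.const_mul _), integral_const, integral_const_mul,
      integral_const_mul, integral_add hpi hpj, smul_eq_mul] at h1
    have h3 := mul_le_mul_of_nonneg_left (hdef N i j hi hj) hM0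
    have h4 : 2 ^ (p - 1) * ρ ^ (1 - p) * (∫ t, ‖x i t‖ ^ p ∂μ + ∫ t, ‖x j t‖ ^ p ∂μ)
        ≤ 2 ^ (p - 1) * ρ ^ (1 - p) * (2 * K ^ p) := by
      have := hint2 i _ (hxC i)
      have := hint2 j _ (hxC j)
      gcongr
      linarith
    linarith
  have hpow : ∀ n : ℕ, ∃ N, ∀ i j, N ≤ i → N ≤ j → ∫ t, ‖x i t - x j t‖ ∂μ < (1 / 2) ^ n :=
    fun n => hcau _ (by positivity)
  choose N hN using hpow
  -- A fast subsequence for completeness of `L¹`; a further one below gives almost everywhere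
  -- convergence. Indices only grow, so the `n`-th element still lies in `C n`.
  obtain ⟨φ, hφ, hφN⟩ : ∃ φ : ℕ → ℕ, StrictMono φ ∧ ∀ n, N n ≤ φ n := by
    have := extraction_forall_of_eventually' (P := fun n k => N n ≤ k)
      (fun n => ⟨N n, fun k hk => hk⟩)
    exact this
  have hL : ∀ n, MemLp (x (φ n)) 1 μ := fun n => memLp_one_iff_integrable.mpr (hint _ _ (hxC _))
  have hnorm : ∀ i j, eLpNorm (x i - x j) 1 μ = ENNReal.ofReal (∫ t, ‖x i t - x j t‖ ∂μ) := by
    intro i j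
    rw [eLpNorm_one_eq_lintegral_enorm]
    exact (ofReal_integral_norm_eq_lintegral_enorm ((hint i _ (hxC i)).sub (hint j _ (hxC j)))).symm
  have hcauL : ∀ k n m : ℕ, k ≤ n → k ≤ m →
      eLpNorm (x (φ n) - x (φ m)) 1 μ < ENNReal.ofReal ((1 / 2) ^ k) := by
    intro k n m hn hm
    rw [hnorm]
    exact (ENNReal.ofReal_lt_ofReal_iff (by positivity)).mpr
      (hN k _ _ ((hφN k).trans (hφ.monotone hn)) ((hφN k).trans (hφ.monotone hm)))
  have hsum : ∑' k : ℕ, ENNReal.ofReal ((1 / 2) ^ k) ≠ ∞ := by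
    rw [← ENNReal.ofReal_tsum_of_nonneg (fun _ => by positivity)
      (summable_geometric_of_lt_one (by norm_num) (by norm_num))]
    exact ENNReal.ofReal_ne_top
  obtain ⟨y, hy, hylim⟩ := Lp.cauchy_complete_eLpNorm le_rfl hL hsum hcauL
  obtain ⟨ψ, hψ, hae⟩ := (tendstoInMeasure_of_tendsto_eLpNorm one_ne_zero
    (fun n => (hL n).1) hy.1 hylim).exists_seq_tendsto_ae
  refine ⟨fun n => x (φ (ψ n)), y, fun n => hanti ?_ (hxC _), hy, hylim.comp hψ.tendsto_atTop, hae⟩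
  exact (hψ.id_le n).trans (hφ.id_le _)

end Selection

end

section

/-! ### Integration over the time interval. -/

section TimeMeasure

instance (T : ℝ) : IsFiniteMeasure (timeMeasure T) := by
  unfold timeMeasure; infer_instance

variable {X : Type*} [NormedAddCommGroup X] [NormedSpace ℝ X] {T : ℝ}

theorem intervalIntegrable_of_timeMeasure {F : ℝ → X} (hF : Integrable F (timeMeasure T))
    {a b : ℝ} (ha : a ∈ Icc 0 T) (hb : b ∈ Icc 0 T) : IntervalIntegrable F volume a b := by
  rw [intervalIntegrable_iff]
  have h : IntegrableOn F (Icc 0 T) volume := hF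
  refine h.mono_set fun t ht => ?_
  rcases le_total a b with hab | hab
  · rw [uIoc_of_le hab] at ht
    exact ⟨ha.1.trans ht.1.le, ht.2.trans hb.2⟩
  · rw [uIoc_of_ge hab] at ht
    exact ⟨hb.1.trans ht.1.le, ht.2.trans ha.2⟩

theorem integral_timeMeasure (hT : 0 ≤ T) (F : ℝ → X) :
    ∫ t, F t ∂(timeMeasure T) = ∫ t in (0 : ℝ)..T, F t := by
  rw [intervalIntegral.integral_of_le hT, timeMeasure, integral_Icc_eq_integral_Ioc]

theorem integrable_timeMeasure_iff (hT : 0 ≤ T) {F : ℝ → X} :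
    Integrable F (timeMeasure T) ↔ IntervalIntegrable F volume 0 T := by
  rw [intervalIntegrable_iff_integrableOn_Icc_of_le hT]; rfl

theorem ae_timeMeasure_mem : ∀ᵐ t ∂(timeMeasure T), t ∈ Icc 0 T :=
  ae_restrict_mem measurableSet_Icc

theorem ae_timeMeasure_mem_Ioc : ∀ᵐ t ∂(timeMeasure T), t ∈ Ioc 0 T := by
  rw [timeMeasure, ← restrict_Ioc_eq_restrict_Icc]
  exact ae_restrict_mem measurableSet_Ioc

theorem ae_timeMeasure_mem_Ioo : ∀ᵐ t ∂(timeMeasure T), t ∈ Ioo 0 T := by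
  rw [timeMeasure, ← restrict_Ioo_eq_restrict_Icc]
  exact ae_restrict_mem measurableSet_Ioo

theorem continuousOn_primitive {F : ℝ → X} (hF : Integrable F (timeMeasure T)) :
    ContinuousOn (fun t => ∫ s in (0 : ℝ)..t, F s) (Icc 0 T) := by
  rcases le_or_gt 0 T with hT | hT
  · rw [← uIcc_of_le hT]
    apply intervalIntegral.continuousOn_primitive_interval
    rw [uIcc_of_le hT]
    exact hF
  · simp [Icc_eq_empty_of_lt hT]

theorem norm_intervalIntegral_le {F : ℝ → X} (hF : Integrable F (timeMeasure T)) {a b : ℝ}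
    (ha : a ∈ Icc 0 T) (hb : b ∈ Icc 0 T) :
    ‖∫ s in a..b, F s‖ ≤ ∫ t, ‖F t‖ ∂(timeMeasure T) := by
  refine intervalIntegral.norm_integral_le_integral_norm_uIoc.trans ?_
  refine setIntegral_mono_set hF.norm (Eventually.of_forall fun t => norm_nonneg _) ?_
  refine HasSubset.Subset.eventuallyLE fun t ht => ?_
  rcases le_total a b with hab | hab
  · rw [uIoc_of_le hab] at ht
    exact ⟨ha.1.trans ht.1.le, ht.2.trans hb.2⟩
  · rw [uIoc_of_ge hab] at ht
    exact ⟨hb.1.trans ht.1.le, ht.2.trans ha.2⟩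

theorem primitive_sub {F : ℝ → X} (hF : Integrable F (timeMeasure T)) {a b : ℝ}
    (ha : a ∈ Icc 0 T) (hb : b ∈ Icc 0 T) :
    (∫ s in (0 : ℝ)..b, F s) - ∫ s in (0 : ℝ)..a, F s = ∫ s in a..b, F s := by
  have h0 : (0 : ℝ) ∈ Icc 0 T := ⟨le_rfl, ha.1.trans ha.2⟩
  exact intervalIntegral.integral_interval_sub_left (intervalIntegrable_of_timeMeasure hF h0 hb)
    (intervalIntegrable_of_timeMeasure hF h0 ha)

theorem aestronglyMeasurable_of_continuousOn {F : ℝ → X} (hF : ContinuousOn F (Icc 0 T)) :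
    AEStronglyMeasurable F (timeMeasure T) :=
  hF.aestronglyMeasurable measurableSet_Icc

theorem integrable_of_continuousOn {F : ℝ → X} (hF : ContinuousOn F (Icc 0 T)) :
    Integrable F (timeMeasure T) :=
  hF.integrableOn_compact isCompact_Icc

theorem memLp_of_continuousOn {F : ℝ → X} (hF : ContinuousOn F (Icc 0 T)) (p : ℝ≥0∞) :
    MemLp F p (timeMeasure T) := by
  obtain ⟨C, hC⟩ := isCompact_Icc.exists_bound_of_continuousOn hF
  refine MemLp.of_bound (aestronglyMeasurable_of_continuousOn hF) C ?_
  filter_upwards [ae_timeMeasure_mem] with t ht using hC t ht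

end TimeMeasure

/-! ### Duality pairings of Bochner functions. -/

section Pairing

variable {Ω : Type*} [MeasurableSpace Ω] {μ : Measure Ω}
  {X : Type*} [NormedAddCommGroup X] [NormedSpace ℝ X] {p q : ℝ≥0∞}

theorem dual_apply_le (ξ : StrongDual ℝ X) (x : X) : ‖ξ x‖ ≤ ‖ξ‖ * ‖x‖ := ξ.le_opNorm x

theorem aestronglyMeasurable_pairing {φ : Ω → StrongDual ℝ X} {F : Ω → X}
    (hφ : AEStronglyMeasurable φ μ) (hF : AEStronglyMeasurable F μ) :
    AEStronglyMeasurable (fun t => φ t (F t)) μ := by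
  have h : Continuous fun x : StrongDual ℝ X × X => x.1 x.2 := by fun_prop
  exact h.comp_aestronglyMeasurable (hφ.prodMk hF)

theorem eLpNorm_pairing_le (hpq : p⁻¹ + q⁻¹ = 1) {φ : Ω → StrongDual ℝ X} {F : Ω → X}
    (hφ : AEStronglyMeasurable φ μ) (hF : AEStronglyMeasurable F μ) :
    eLpNorm (fun t => φ t (F t)) 1 μ ≤ eLpNorm φ q μ * eLpNorm F p μ := by
  have : ENNReal.HolderTriple q p 1 := ENNReal.holderConjugate_iff.mpr (by rw [add_comm]; exact hpq)
  have h := eLpNorm_le_eLpNorm_mul_eLpNorm'_of_norm (p := q) (q := p) (r := 1) hφ hF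
    (fun f x => f x) 1 (Eventually.of_forall fun t => by
      simpa using dual_apply_le (φ t) (F t))
  simpa using h

theorem integrable_pairing (hpq : p⁻¹ + q⁻¹ = 1) {φ : Ω → StrongDual ℝ X} {F : Ω → X}
    (hφ : MemLp φ q μ) (hF : MemLp F p μ) : Integrable (fun t => φ t (F t)) μ := by
  rw [← memLp_one_iff_integrable]
  exact ⟨aestronglyMeasurable_pairing hφ.1 hF.1,
    (eLpNorm_pairing_le hpq hφ.1 hF.1).trans_lt (ENNReal.mul_lt_top hφ.2 hF.2)⟩

theorem abs_integral_pairing_le (hpq : p⁻¹ + q⁻¹ = 1) {φ : Ω → StrongDual ℝ X} {F : Ω → X}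
    (hφ : MemLp φ q μ) (hF : MemLp F p μ) :
    |∫ t, φ t (F t) ∂μ| ≤ (eLpNorm φ q μ).toReal * (eLpNorm F p μ).toReal := by
  have h1 : |∫ t, φ t (F t) ∂μ| ≤ (eLpNorm (fun t => φ t (F t)) 1 μ).toReal := by
    rw [← Real.norm_eq_abs, eLpNorm_one_eq_lintegral_enorm, ← integral_norm_eq_lintegral_enorm
      (aestronglyMeasurable_pairing hφ.1 hF.1)]
    exact norm_integral_le_integral_norm _
  refine h1.trans ?_
  rw [← ENNReal.toReal_mul]
  exact ENNReal.toReal_mono (ENNReal.mul_ne_top hφ.2.ne hF.2.ne)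
    (eLpNorm_pairing_le hpq hφ.1 hF.1)

theorem tendsto_eLpNorm_zero_of_bounded [IsFiniteMeasure μ] {q C : ℝ} (hq : 0 < q) {F : ℕ → Ω → X}
    (hF : ∀ n, AEStronglyMeasurable (F n) μ) (hC : ∀ n, ∀ᵐ t ∂μ, ‖F n t‖ ≤ C)
    (hlim : ∀ᵐ t ∂μ, Tendsto (fun n => F n t) atTop (𝓝 0)) :
    Tendsto (fun n => eLpNorm (F n) (ENNReal.ofReal q) μ) atTop (𝓝 0) := by
  have h0 : ENNReal.ofReal q ≠ 0 := by simpa using hq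
  simp_rw [eLpNorm_eq_lintegral_rpow_enorm_toReal h0 ENNReal.ofReal_ne_top,
    ENNReal.toReal_ofReal hq.le]
  have h1 : Tendsto (fun n => ∫⁻ t, ‖F n t‖ₑ ^ q ∂μ) atTop (𝓝 (∫⁻ _, 0 ∂μ)) := by
    refine tendsto_lintegral_of_dominated_convergence' (fun _ => ENNReal.ofReal C ^ q)
      (fun n => (hF n).enorm.pow_const _) (fun n => ?_) ?_ ?_
    · filter_upwards [hC n] with t ht
      gcongr
      rw [← ofReal_norm_eq_enorm]
      exact ENNReal.ofReal_le_ofReal ht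
    · rw [lintegral_const]
      finiteness
    · filter_upwards [hlim] with t ht
      have h2 : Tendsto (fun n => ‖F n t‖ₑ) atTop (𝓝 0) := by
        simpa using ht.enorm
      have := (ENNReal.continuous_rpow_const (y := q)).tendsto 0 |>.comp h2
      simpa [hq, Function.comp_def] using this
  simp only [lintegral_const, zero_mul] at h1
  have h2 := (ENNReal.continuous_rpow_const (y := 1 / q)).tendsto 0 |>.comp h1
  simpa [hq, Function.comp_def] using h2

variable {T : ℝ}

/-- Bounded sequences in `L^p` that converge in `L^1` converge weakly (weakly* for `p = ∞`). -/
theorem tendsto_integral_pairing (hpq : p⁻¹ + q⁻¹ = 1) (hq : q ≠ ∞) {K : ℝ} {F : ℕ → ℝ → X}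
    {F₀ : ℝ → X} (hF : ∀ n, MemLp (F n) p (timeMeasure T))
    (hFK : ∀ n, eLpNorm (F n) p (timeMeasure T) ≤ ENNReal.ofReal K)
    (hF₀ : MemLp F₀ p (timeMeasure T))
    (hlim : Tendsto (fun n => eLpNorm (F n - F₀) 1 (timeMeasure T)) atTop (𝓝 0))
    {φ : ℝ → StrongDual ℝ X} (hφ : MemLp φ q (timeMeasure T)) :
    Tendsto (fun n => ∫ t, φ t (F n t) ∂(timeMeasure T)) atTop
      (𝓝 (∫ t, φ t (F₀ t) ∂(timeMeasure T))) := by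
  have hp1 : 1 ≤ p := by
    by_contra hcon
    have h1 : 1 < p⁻¹ := by rw [ENNReal.one_lt_inv]; exact not_le.mp hcon
    have h2 : p⁻¹ ≤ 1 := hpq ▸ le_self_add
    exact absurd h1 (not_lt.mpr h2)
  have hq1 : 1 ≤ q := by
    by_contra hcon
    have h1 : 1 < q⁻¹ := by rw [ENNReal.one_lt_inv]; exact not_le.mp hcon
    have h2 : q⁻¹ ≤ 1 := hpq ▸ le_add_self
    exact absurd h1 (not_lt.mpr h2)
  set μ := timeMeasure T
  set M : ℝ := K + (eLpNorm F₀ p μ).toReal with hM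
  have hd : ∀ n, MemLp (F n - F₀) p μ := fun n => (hF n).sub hF₀
  have hdM : ∀ n, (eLpNorm (F n - F₀) p μ).toReal ≤ |M| := by
    intro n
    have h1 : eLpNorm (F n - F₀) p μ ≤ ENNReal.ofReal K + eLpNorm F₀ p μ :=
      (eLpNorm_sub_le (hF n).1 hF₀.1 hp1).trans (by gcongr; exact hFK n)
    refine (ENNReal.toReal_mono (ENNReal.add_ne_top.mpr ⟨ENNReal.ofReal_ne_top, hF₀.2.ne⟩) h1).trans ?_
    rw [ENNReal.toReal_add ENNReal.ofReal_ne_top hF₀.2.ne]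
    -- For `K ≤ 0` the bound `ENNReal.ofReal K` is zero, so all `F n`, and hence `F₀`, vanish almost
    -- everywhere.
    rcases le_total 0 K with hK | hK
    · rw [ENNReal.toReal_ofReal hK]; exact le_abs_self _
    · have h3 : eLpNorm (F n) p μ ≤ 0 := by
        simpa [ENNReal.ofReal_of_nonpos hK] using hFK n
      have h4 : eLpNorm F₀ p μ = 0 := by
        have h5 : ∀ n, F n =ᵐ[μ] 0 := fun n => by
          have := hFK n
          rw [ENNReal.ofReal_of_nonpos hK, nonpos_iff_eq_zero] at this
          exact (eLpNorm_eq_zero_iff (hF n).1 (by positivity)).mp this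
        have h6 : ∀ n, eLpNorm (F n - F₀) 1 μ = eLpNorm F₀ 1 μ := fun n => by
          rw [← eLpNorm_neg F₀]
          refine eLpNorm_congr_ae ?_
          filter_upwards [h5 n] with t ht
          simp [ht]
        simp_rw [h6] at hlim
        have h7 := tendsto_nhds_unique hlim tendsto_const_nhds
        have h8 := (eLpNorm_eq_zero_iff hF₀.1 one_ne_zero).mp h7.symm
        rw [eLpNorm_congr_ae h8]; simp
      rw [ENNReal.ofReal_of_nonpos hK, h4]; simp
  have hint : ∀ n, Integrable (fun t => φ t (F n t)) μ := fun n => integrable_pairing hpq hφ (hF n)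
  have hint0 : Integrable (fun t => φ t (F₀ t)) μ := integrable_pairing hpq hφ hF₀
  have hdiff : ∀ n, (∫ t, φ t (F n t) ∂μ) - ∫ t, φ t (F₀ t) ∂μ = ∫ t, φ t ((F n - F₀) t) ∂μ := by
    intro n
    rw [← integral_sub (hint n) hint0]
    simp
  rw [Metric.tendsto_atTop]
  intro ε hε
  -- As `q` is finite, `φ` is close in `L^q` to a bounded continuous `ψ`. The error is controlled by
  -- the `L^p` bound, and the pairing with `ψ` by convergence in `L¹`.
  obtain ⟨ψ, hψs, hψ, hψc, hψm⟩ := hφ.exists_hasCompactSupport_eLpNorm_sub_le hq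
    (ε := ENNReal.ofReal (ε / (4 * (|M| + 1)))) (by simp; positivity)
  obtain ⟨C, hC⟩ := hψs.exists_bound_of_continuous hψc
  have hC0 : 0 ≤ C := (norm_nonneg _).trans (hC 0)
  have hlim' : Tendsto (fun n => C * (eLpNorm (F n - F₀) 1 μ).toReal) atTop (𝓝 0) := by
    have h1 := (ENNReal.tendsto_toReal ENNReal.zero_ne_top).comp hlim
    have := h1.const_mul C
    simpa using this
  obtain ⟨N, hN⟩ := (hlim'.eventually_lt_const (show 0 < ε / 2 by linarith)).exists_forall_of_atTop
  refine ⟨N, fun n hn => ?_⟩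
  rw [Real.dist_eq, hdiff]
  have hi1 : Integrable (fun t => (φ - ψ) t ((F n - F₀) t)) μ :=
    integrable_pairing hpq (hφ.sub hψm) (hd n)
  have hi2 : Integrable (fun t => ψ t ((F n - F₀) t)) μ := integrable_pairing hpq hψm (hd n)
  have e : ∫ t, φ t ((F n - F₀) t) ∂μ
      = (∫ t, (φ - ψ) t ((F n - F₀) t) ∂μ) + ∫ t, ψ t ((F n - F₀) t) ∂μ := by
    rw [← integral_add hi1 hi2]
    congr 1; ext t
    simp
  rw [e]
  have h1 : |∫ t, (φ - ψ) t ((F n - F₀) t) ∂μ| ≤ ε / (4 * (|M| + 1)) * |M| := by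
    refine (abs_integral_pairing_le hpq (hφ.sub hψm) (hd n)).trans ?_
    gcongr
    · rw [← ENNReal.toReal_ofReal (show 0 ≤ ε / (4 * (|M| + 1)) by positivity)]
      exact ENNReal.toReal_mono ENNReal.ofReal_ne_top hψ
    · exact hdM n
  have h2 : |∫ t, ψ t ((F n - F₀) t) ∂μ| ≤ C * (eLpNorm (F n - F₀) 1 μ).toReal := by
    have hi : Integrable (F n - F₀) μ := (hd n).integrable hp1
    rw [← Real.norm_eq_abs, eLpNorm_one_eq_lintegral_enorm,
      ← integral_norm_eq_lintegral_enorm hi.1, ← integral_const_mul]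
    refine norm_integral_le_of_norm_le (hi.norm.const_mul _) (Eventually.of_forall fun t => ?_)
    exact (dual_apply_le (ψ t) _).trans (by gcongr; exact hC t)
  have h3 : ε / (4 * (|M| + 1)) * |M| ≤ ε / 4 := by
    rw [div_mul_eq_mul_div, div_le_div_iff₀ (by positivity) (by norm_num)]
    nlinarith [abs_nonneg M]
  have h4 := hN n hn
  have h5 := abs_add_le (∫ t, (φ - ψ) t ((F n - F₀) t) ∂μ) (∫ t, ψ t ((F n - F₀) t) ∂μ)
  linarith

end Pairing

/-! ### Weak derivatives and primitives. -/

section WeakDeriv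

variable {X : Type*} [NormedAddCommGroup X] [NormedSpace ℝ X] [CompleteSpace X] {T : ℝ}

theorem eq_zero_of_notMem_tsupport {φ : ℝ → ℝ} {t : ℝ} {S : Set ℝ} (hφ : tsupport φ ⊆ S)
    (ht : t ∉ S) : φ t = 0 := by
  by_contra hcon
  exact ht (hφ (subset_tsupport _ hcon))

/-- Tested with continuous linear functionals, this is integration by parts for scalar absolutely
continuous functions. -/
theorem hasWeakDeriv_of_primitive (hT : 0 ≤ T) {u w : ℝ → X} {c : X}
    (hw : Integrable w (timeMeasure T))
    (hu : u =ᵐ[timeMeasure T] fun t => c + ∫ s in (0 : ℝ)..t, w s) : HasWeakDeriv T u w := by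
  intro φ hφ hφc hφs
  have hUc : ContinuousOn (fun t => c + ∫ s in (0 : ℝ)..t, w s) (Icc 0 T) :=
    continuousOn_const.add (continuousOn_primitive hw)
  have hφ' : Continuous (deriv φ) := hφ.continuous_deriv (by simp)
  obtain ⟨Cφ, hCφ⟩ := hφc.exists_bound_of_continuous hφ.continuous
  have h1 : ∫ t, deriv φ t • u t ∂(timeMeasure T)
      = ∫ t, deriv φ t • (c + ∫ s in (0 : ℝ)..t, w s) ∂(timeMeasure T) := by
    refine integral_congr_ae ?_
    filter_upwards [hu] with t ht using by rw [ht]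
  rw [h1]
  have hi1 : Integrable (fun t => deriv φ t • (c + ∫ s in (0 : ℝ)..t, w s)) (timeMeasure T) :=
    integrable_of_continuousOn (hφ'.continuousOn.smul hUc)
  have hi2 : Integrable (fun t => φ t • w t) (timeMeasure T) :=
    hw.bdd_smul Cφ hφ.continuous.aestronglyMeasurable (Eventually.of_forall hCφ)
  rw [SeparatingDual.eq_iff_forall_dual_eq (R := ℝ)]
  intro ℓ
  rw [map_neg, ← ContinuousLinearMap.integral_comp_comm ℓ hi1,
    ← ContinuousLinearMap.integral_comp_comm ℓ hi2]
  have h0 : (0 : ℝ) ∈ Icc 0 T := ⟨le_rfl, hT⟩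
  have hTm : T ∈ Icc 0 T := ⟨hT, le_rfl⟩
  have hℓw : Integrable (fun t => ℓ (w t)) (timeMeasure T) := ℓ.integrable_comp hw
  have hii := intervalIntegrable_of_timeMeasure hℓw h0 hTm
  set g : ℝ → ℝ := fun t => ℓ c + ∫ s in (0 : ℝ)..t, ℓ (w s)
  have hac : AbsolutelyContinuousOnInterval g 0 T := by
    have hc : AbsolutelyContinuousOnInterval (fun _ : ℝ => ℓ c) 0 T :=
      (LipschitzWith.const (α := ℝ) (ℓ c)).lipschitzOnWith.absolutelyContinuousOnInterval
    exact hc.add (hii.absolutelyContinuousOnInterval_intervalIntegral (by simp))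
  have hφac : AbsolutelyContinuousOnInterval φ 0 T :=
    (hφ.of_le (by simp)).contDiffOn.absolutelyContinuousOnInterval
  have hparts := hφac.integral_mul_deriv_eq_deriv_mul hac
  have hφ0 : φ 0 = 0 := eq_zero_of_notMem_tsupport hφs (by simp)
  have hφT : φ T = 0 := eq_zero_of_notMem_tsupport hφs (by simp)
  rw [hφ0, hφT] at hparts
  rw [integral_timeMeasure hT, integral_timeMeasure hT]
  have e1 : ∫ t in (0 : ℝ)..T, ℓ (deriv φ t • (c + ∫ s in (0 : ℝ)..t, w s))
      = ∫ t in (0 : ℝ)..T, deriv φ t * g t := by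
    refine intervalIntegral.integral_congr fun t ht => ?_
    rw [uIcc_of_le hT] at ht
    simp only [map_smul, map_add, smul_eq_mul, g]
    rw [ℓ.intervalIntegral_comp_comm (intervalIntegrable_of_timeMeasure hw h0 ht)]
  have e2 : ∫ t in (0 : ℝ)..T, ℓ (φ t • w t) = ∫ t in (0 : ℝ)..T, φ t * deriv g t := by
    refine intervalIntegral.integral_congr_ae ?_
    filter_upwards [hii.ae_hasDerivAt_integral] with t ht htm
    have h2 := (ht (uIoc_subset_uIcc htm) 0 (by simp)).const_add (ℓ c)
    rw [map_smul, smul_eq_mul, show deriv g t = ℓ (w t) from h2.deriv]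
  rw [e1, e2, hparts]
  ring

theorem ae_eq_zero_of_forall_integral_smul (hT : 0 ≤ T) {F : ℝ → X}
    (hF : Integrable F (timeMeasure T))
    (h : ∀ φ : ℝ → ℝ, ContDiff ℝ (⊤ : ℕ∞) φ → HasCompactSupport φ → tsupport φ ⊆ Ioo 0 T →
      ∫ t, φ t • F t ∂(timeMeasure T) = 0) : F =ᵐ[timeMeasure T] 0 := by
  have hloc : LocallyIntegrableOn F (Ioo 0 T) volume :=
    (show IntegrableOn F (Icc 0 T) volume from hF).mono_set Ioo_subset_Icc_self
      |>.locallyIntegrableOn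
  have h1 := isOpen_Ioo.ae_eq_zero_of_integral_contDiff_smul_eq_zero (U := Ioo 0 T) hloc
    (fun φ hφ hφc hφs => by
      rw [← h φ hφ hφc hφs, timeMeasure, setIntegral_eq_integral_of_forall_compl_eq_zero]
      intro t ht
      rw [eq_zero_of_notMem_tsupport hφs fun h => ht (Ioo_subset_Icc_self h), zero_smul])
  have h2 : ∀ᵐ t ∂(timeMeasure T), t ∈ Ioo 0 T → F t = 0 := ae_restrict_of_ae h1
  filter_upwards [h2, ae_timeMeasure_mem_Ioo] with t h3 h4 using h3 h4

/-- The difference of the integrands is a weak derivative of the zero function, so the fundamental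
lemma of the calculus of variations applies. -/
theorem ae_eq_of_primitive_eq (hT : 0 ≤ T) {F G : ℝ → X} (hF : Integrable F (timeMeasure T))
    (hG : Integrable G (timeMeasure T))
    (h : ∀ t ∈ Icc 0 T, ∫ s in (0 : ℝ)..t, F s = ∫ s in (0 : ℝ)..t, G s) :
    F =ᵐ[timeMeasure T] G := by
  have hFG := hF.sub hG
  have h0 : (0 : ℝ) ∈ Icc 0 T := ⟨le_rfl, hT⟩
  have h1 : HasWeakDeriv T (fun _ => (0 : X)) (F - G) := by
    refine hasWeakDeriv_of_primitive hT (c := 0) hFG ?_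
    filter_upwards [ae_timeMeasure_mem] with t ht
    simp only [Pi.sub_apply, zero_add]
    rw [intervalIntegral.integral_sub (intervalIntegrable_of_timeMeasure hF h0 ht)
      (intervalIntegrable_of_timeMeasure hG h0 ht), h t ht, sub_self]
  have h2 := ae_eq_zero_of_forall_integral_smul hT hFG (fun φ h3 h4 h5 => by
    have := h1 φ h3 h4 h5
    simp only [smul_zero, integral_zero] at this
    exact neg_eq_zero.mp this.symm)
  filter_upwards [h2] with t ht
  simpa [sub_eq_zero] using ht

/-- A function with an integrable weak derivative is a primitive of it. -/
theorem exists_eq_primitive (hT : 0 < T) {u w : ℝ → X} (hu : Integrable u (timeMeasure T))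
    (hw : Integrable w (timeMeasure T)) (h : HasWeakDeriv T u w) :
    ∃ c : X, u =ᵐ[timeMeasure T] fun t => c + ∫ s in (0 : ℝ)..t, w s := by
  set U : ℝ → X := fun t => 0 + ∫ s in (0 : ℝ)..t, w s with hU
  have hUw : HasWeakDeriv T U w := hasWeakDeriv_of_primitive hT.le hw (EventuallyEq.refl _ _)
  have hUc : ContinuousOn U (Icc 0 T) := continuousOn_const.add (continuousOn_primitive hw)
  have hUi : Integrable U (timeMeasure T) := integrable_of_continuousOn hUc
  have hgi : Integrable (u - U) (timeMeasure T) := hu.sub hUi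
  have hg : ∀ φ : ℝ → ℝ, ContDiff ℝ (⊤ : ℕ∞) φ → HasCompactSupport φ → tsupport φ ⊆ Ioo 0 T →
      ∫ t, deriv φ t • (u - U) t ∂(timeMeasure T) = 0 := by
    intro φ h1 h2 h3
    have hφ' : Continuous (deriv φ) := h1.continuous_deriv (by simp)
    obtain ⟨C, hC⟩ := h2.deriv.exists_bound_of_continuous hφ'
    have hb : ∀ {F : ℝ → X}, Integrable F (timeMeasure T) →
        Integrable (fun t => deriv φ t • F t) (timeMeasure T) := fun hF =>
      hF.bdd_smul C hφ'.aestronglyMeasurable (Eventually.of_forall hC)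
    simp only [Pi.sub_apply, smul_sub]
    rw [integral_sub (hb hu) (hb hUi), h φ h1 h2 h3, hUw φ h1 h2 h3, sub_self]
  -- The argument of du Bois-Reymond: after subtracting the multiple of `θ` with the same integral,
  -- every test function becomes the derivative of a test function.
  obtain ⟨θ, hθs, hθc, hθd, hθr, hθ1⟩ := exists_contDiff_tsupport_subset (n := ⊤)
    (Ioo_mem_nhds (show 0 < T / 2 by linarith) (show T / 2 < T by linarith))
  have hθpos : 0 < ∫ t in (0 : ℝ)..T, θ t := by
    refine intervalIntegral.integral_pos hT hθd.continuous.continuousOn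
      (fun t _ => (hθr (mem_range_self t)).1) ⟨T / 2, ⟨by linarith, by linarith⟩, ?_⟩
    rw [hθ1]; norm_num
  set I := ∫ t in (0 : ℝ)..T, θ t
  obtain ⟨Cθ, hCθ⟩ := hθc.exists_bound_of_continuous hθd.continuous
  set c : X := I⁻¹ • ∫ t, θ t • (u - U) t ∂(timeMeasure T) with hc
  refine ⟨c, ?_⟩
  have hgc : (fun t => (u - U) t - c) =ᵐ[timeMeasure T] 0 := by
    refine ae_eq_zero_of_forall_integral_smul hT.le (hgi.sub (integrable_const c)) ?_
    intro ψ hψ hψc hψs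
    set a := (∫ t in (0 : ℝ)..T, ψ t) / I with ha
    set χ : ℝ → ℝ := fun t => ψ t - a * θ t with hχ
    have hχc : ContDiff ℝ (⊤ : ℕ∞) χ := hψ.sub (contDiff_const.mul hθd)
    set φ : ℝ → ℝ := fun t => ∫ s in (0 : ℝ)..t, χ s with hφ
    have hφd : ∀ t, HasDerivAt φ (χ t) t := fun t =>
      intervalIntegral.integral_hasDerivAt_right (hχc.continuous.intervalIntegrable _ _)
        (hχc.continuous.stronglyMeasurableAtFilter _ _) hχc.continuous.continuousAt
    have hderiv : deriv φ = χ := funext fun t => (hφd t).deriv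
    have hφc : ContDiff ℝ (⊤ : ℕ∞) φ := by
      rw [contDiff_infty_iff_deriv]
      exact ⟨fun t => (hφd t).differentiableAt, hderiv ▸ hχc⟩
    set K := tsupport ψ ∪ tsupport θ with hK
    have hKc : IsCompact K := hψc.isCompact.union hθc.isCompact
    have hKs : K ⊆ Ioo 0 T := union_subset hψs hθs
    have hKne : K.Nonempty := ⟨T / 2, Or.inr (subset_tsupport _ (by simp [hθ1]))⟩
    have hχ0 : ∀ t, t ∉ K → χ t = 0 := by
      intro t ht
      have h1 : ψ t = 0 := by
        by_contra hcon; exact ht (Or.inl (subset_tsupport _ hcon))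
      have h2 : θ t = 0 := by
        by_contra hcon; exact ht (Or.inr (subset_tsupport _ hcon))
      simp [hχ, h1, h2]
    have hinf := hKs (hKc.sInf_mem hKne)
    have hsup := hKs (hKc.sSup_mem hKne)
    have hle : ∀ t ∈ K, sInf K ≤ t := fun t ht => csInf_le hKc.bddBelow ht
    have hge : ∀ t ∈ K, t ≤ sSup K := fun t ht => le_csSup hKc.bddAbove ht
    have hφT : φ T = 0 := by
      simp only [hφ, hχ]
      rw [intervalIntegral.integral_sub (hψ.continuous.intervalIntegrable _ _)
        ((hθd.continuous.const_mul a).intervalIntegrable _ _) (f := ψ) (g := fun t => a * θ t),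
        intervalIntegral.integral_const_mul, ha]
      field_simp
      simp [I]
    -- To the left of `K` the primitive integrates zero; to the right of `K` it equals its value at
    -- `T`, which vanishes because `χ` has zero mean.
    have hφ0 : ∀ t, t ∉ Icc (sInf K) (sSup K) → φ t = 0 := by
      intro t ht
      rw [mem_Icc, not_and_or, not_le, not_le] at ht
      rcases ht with ht | ht
      · simp only [hφ]
        rw [intervalIntegral.integral_congr (g := fun _ => (0 : ℝ)), intervalIntegral.integral_zero]
        intro s hs
        refine hχ0 s fun hsK => ?_
        have h1 := hle s hsK
        rcases le_total 0 t with h0t | h0t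
        · rw [uIcc_of_le h0t] at hs; linarith [hs.2]
        · rw [uIcc_of_ge h0t] at hs; linarith [hs.2, hinf.1]
      · have h1 : φ T - φ t = ∫ s in t..T, χ s :=
          intervalIntegral.integral_interval_sub_left (hχc.continuous.intervalIntegrable _ _)
            (hχc.continuous.intervalIntegrable _ _)
        rw [intervalIntegral.integral_congr (g := fun _ => (0 : ℝ)), intervalIntegral.integral_zero,
          hφT] at h1
        · linarith
        intro s hs
        refine hχ0 s fun hsK => ?_
        have h1 := hge s hsK
        rcases le_total t T with h0t | h0t
        · rw [uIcc_of_le h0t] at hs; linarith [hs.1]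
        · rw [uIcc_of_ge h0t] at hs; linarith [hs.1, hsup.2]
    have hφsup : tsupport φ ⊆ Icc (sInf K) (sSup K) := by
      refine closure_minimal (fun t ht => ?_) isClosed_Icc
      by_contra hcon
      exact ht (hφ0 t hcon)
    have hφcs : HasCompactSupport φ :=
      IsCompact.of_isClosed_subset isCompact_Icc (isClosed_tsupport _) hφsup
    have key := hg φ hφc hφcs (hφsup.trans fun t ht =>
      ⟨hinf.1.trans_le ht.1, ht.2.trans_lt hsup.2⟩)
    rw [hderiv] at key
    obtain ⟨Cψ, hCψ⟩ := hψc.exists_bound_of_continuous hψ.continuous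
    have hbψ : ∀ {F : ℝ → X}, Integrable F (timeMeasure T) →
        Integrable (fun t => ψ t • F t) (timeMeasure T) := fun hF =>
      hF.bdd_smul Cψ hψ.continuous.aestronglyMeasurable (Eventually.of_forall hCψ)
    have hbθ : Integrable (fun t => θ t • (u - U) t) (timeMeasure T) :=
      hgi.bdd_smul Cθ hθd.continuous.aestronglyMeasurable (Eventually.of_forall hCθ)
    have e1 : ∫ t, χ t • (u - U) t ∂(timeMeasure T)
        = (∫ t, ψ t • (u - U) t ∂(timeMeasure T)) - (∫ t in (0 : ℝ)..T, ψ t) • c := by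
      simp only [hχ, sub_smul, mul_smul]
      rw [integral_sub (hbψ hgi) (show Integrable (fun t => a • θ t • (u - U) t) _ from hbθ.smul a),
        integral_smul, hc, smul_smul, ha]
      rfl
    rw [e1] at key
    have e2 : ∫ t, ψ t • ((u - U) t - c) ∂(timeMeasure T)
        = (∫ t, ψ t • (u - U) t ∂(timeMeasure T)) - (∫ t in (0 : ℝ)..T, ψ t) • c := by
      simp only [smul_sub]
      rw [integral_sub (hbψ hgi) (hbψ (integrable_const c)), integral_smul_const,
        integral_timeMeasure hT.le ψ]
    rw [e2, key]
  filter_upwards [hgc] with t ht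
  have h1 : u t - U t - c = 0 := by simpa using ht
  have h2 : u t = c + U t := by
    rw [← sub_eq_zero, ← h1]; abel
  rw [h2]; simp [hU]

end WeakDeriv

end

section

/-! ### Steklov averages. -/

section Averages

variable {X : Type*} [NormedAddCommGroup X] [NormedSpace ℝ X] {T : ℝ}

/-- Strong convergence of contractive approximations of the identity on `L^q`. -/
theorem tendsto_eLpNorm_of_dense {q : ℝ} (hq : 1 ≤ q) {S : ℕ → (ℝ → X) → ℝ → X}
    (hsub : ∀ n α β, MemLp α (ENNReal.ofReal q) (timeMeasure T) →
      MemLp β (ENNReal.ofReal q) (timeMeasure T) → S n (α - β) =ᵐ[timeMeasure T] S n α - S n β)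
    (hmem : ∀ n α, MemLp α (ENNReal.ofReal q) (timeMeasure T) →
      MemLp (S n α) (ENNReal.ofReal q) (timeMeasure T) ∧
      eLpNorm (S n α) (ENNReal.ofReal q) (timeMeasure T) ≤
        eLpNorm α (ENNReal.ofReal q) (timeMeasure T))
    (hcont : ∀ β : ℝ → X, Continuous β → (∃ C, ∀ t, ‖β t‖ ≤ C) →
      Tendsto (fun n => eLpNorm (S n β - β) (ENNReal.ofReal q) (timeMeasure T)) atTop (𝓝 0))
    {α : ℝ → X} (hα : MemLp α (ENNReal.ofReal q) (timeMeasure T)) :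
    Tendsto (fun n => eLpNorm (S n α - α) (ENNReal.ofReal q) (timeMeasure T)) atTop (𝓝 0) := by
  have hq1 : (1 : ℝ≥0∞) ≤ ENNReal.ofReal q := by simpa using hq
  rw [ENNReal.tendsto_nhds_zero]
  intro ε hε
  have hε3 : ε / 3 ≠ 0 := (ENNReal.div_pos hε.ne' (by simp)).ne'
  obtain ⟨β, hβs, hβ, hβc, hβm⟩ := hα.exists_hasCompactSupport_eLpNorm_sub_le
    ENNReal.ofReal_ne_top hε3
  have h1 := hcont β hβc (hβs.exists_bound_of_continuous hβc)
  rw [ENNReal.tendsto_nhds_zero] at h1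
  filter_upwards [h1 _ (pos_iff_ne_zero.mpr hε3)] with n hn
  have h2 := hmem n _ (hα.sub hβm)
  have e : S n α - α =ᵐ[timeMeasure T] S n (α - β) + (S n β - β) - (α - β) := by
    filter_upwards [hsub n α β hα hβm] with t ht
    simp only [Pi.sub_apply, Pi.add_apply] at ht ⊢
    rw [ht]; abel
  rw [eLpNorm_congr_ae e]
  have hm2 : MemLp (S n β - β) (ENNReal.ofReal q) (timeMeasure T) := (hmem n β hβm).1.sub hβm
  calc eLpNorm (S n (α - β) + (S n β - β) - (α - β)) (ENNReal.ofReal q) (timeMeasure T)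
      ≤ eLpNorm (S n (α - β) + (S n β - β)) (ENNReal.ofReal q) (timeMeasure T)
        + eLpNorm (α - β) (ENNReal.ofReal q) (timeMeasure T) :=
        eLpNorm_sub_le (h2.1.add hm2).1 (hα.sub hβm).1 hq1
    _ ≤ eLpNorm (S n (α - β)) (ENNReal.ofReal q) (timeMeasure T)
        + eLpNorm (S n β - β) (ENNReal.ofReal q) (timeMeasure T)
        + eLpNorm (α - β) (ENNReal.ofReal q) (timeMeasure T) := by
        gcongr; exact eLpNorm_add_le h2.1.1 hm2.1 hq1
    _ ≤ ε / 3 + ε / 3 + ε / 3 := by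
        gcongr
        exact h2.2.trans hβ
    _ = ε := ENNReal.add_thirds ε

/-- Jensen's inequality for means over intervals. -/
theorem mean_rpow_le {q : ℝ} (hq : 1 ≤ q) {F : ℝ → X}
    (hF : MemLp F (ENNReal.ofReal q) (timeMeasure T)) {a b h : ℝ} (ha : a ∈ Icc 0 T)
    (hb : b ∈ Icc 0 T) (hab : a ≤ b) (hh : 0 < h) (hle : b - a ≤ h) :
    ‖h⁻¹ • ∫ t in a..b, F t‖ ^ q ≤ h⁻¹ * ∫ t in a..b, ‖F t‖ ^ q := by
  have hq0 : 0 < q := by linarith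
  rcases hab.eq_or_lt with rfl | hlt
  · simp [hq0.ne']
  have hFi : Integrable F (timeMeasure T) := hF.integrable (by simpa using hq)
  have hsub : Ioc a b ⊆ Icc 0 T := fun t ht => ⟨ha.1.trans ht.1.le, ht.2.trans hb.2⟩
  have hi1 : IntegrableOn (fun t => ‖F t‖) (Ioc a b) volume :=
    IntegrableOn.mono_set (show IntegrableOn _ (Icc 0 T) volume from hFi.norm) hsub
  have hi2 : IntegrableOn (fun t => ‖F t‖ ^ q) (Ioc a b) volume :=
    IntegrableOn.mono_set (show IntegrableOn _ (Icc 0 T) volume from MemLp.integrable_rpow hq0 hF)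
      hsub
  have hJ := (convexOn_rpow hq).map_set_average_le (μ := volume) (t := Ioc a b)
    (f := fun t => ‖F t‖) (Real.continuous_rpow_const hq0.le).continuousOn isClosed_Ici
    (by simp [hlt]) (by simp) (Eventually.of_forall fun t => norm_nonneg _) hi1 hi2
  rw [setAverage_eq, setAverage_eq] at hJ
  have hvol : volume.real (Ioc a b) = b - a := by
    rw [Real.volume_real_Ioc_of_le hab]
  rw [hvol, smul_eq_mul, smul_eq_mul, ← intervalIntegral.integral_of_le hab,
    ← intervalIntegral.integral_of_le hab] at hJ
  set I := ∫ t in a..b, ‖F t‖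
  set J := ∫ t in a..b, ‖F t‖ ^ q
  have hba : 0 < b - a := by linarith
  have hI0 : 0 ≤ I := intervalIntegral.integral_nonneg hab fun t _ => norm_nonneg _
  have hJ0 : 0 ≤ J := intervalIntegral.integral_nonneg hab fun t _ => by positivity
  have h1 : ‖h⁻¹ • ∫ t in a..b, F t‖ ≤ h⁻¹ * I := by
    rw [norm_smul, norm_inv, Real.norm_of_nonneg hh.le]
    gcongr
    exact intervalIntegral.norm_integral_le_integral_norm hab
  have h2 : h⁻¹ * I = (h⁻¹ * (b - a)) * ((b - a)⁻¹ * I) := by field_simp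
  have h3 : h⁻¹ * (b - a) ≤ 1 := by
    rw [inv_mul_le_iff₀ hh]; linarith
  -- Averages cut off at time zero divide by `h` although the interval is shorter; the ratio is at
  -- most one, so its `q`-th power is no larger than the ratio itself.
  have h4 : (h⁻¹ * (b - a)) ^ q ≤ h⁻¹ * (b - a) := by
    conv_rhs => rw [← Real.rpow_one (h⁻¹ * (b - a))]
    exact Real.rpow_le_rpow_of_exponent_ge (by positivity) h3 hq
  calc ‖h⁻¹ • ∫ t in a..b, F t‖ ^ q ≤ (h⁻¹ * I) ^ q := by gcongr
    _ = (h⁻¹ * (b - a)) ^ q * ((b - a)⁻¹ * I) ^ q := by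
        rw [h2, Real.mul_rpow (by positivity) (by positivity)]
    _ ≤ (h⁻¹ * (b - a)) * ((b - a)⁻¹ * J) := by gcongr
    _ = h⁻¹ * J := by field_simp

/-- The backward Steklov average. -/
noncomputable def steklov (h : ℝ) (F : ℝ → X) (r : ℝ) : X := h⁻¹ • ∫ s in max (r - h) 0..r, F s

theorem max_mem_Icc {r h : ℝ} (hh : 0 ≤ h) (hr : r ∈ Icc 0 T) :
    max (r - h) 0 ∈ Icc 0 T ∧ max (r - h) 0 ≤ r :=
  ⟨⟨le_max_right _ _, max_le (by linarith [hr.2]) (hr.1.trans hr.2)⟩,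
    max_le (by linarith) hr.1⟩

/-- Times before zero are replaced by zero, which produces the term `h • k 0`. In the chain rule it
becomes the initial energy. -/
theorem integral_comp_shift [CompleteSpace X] {k : ℝ → X} {h : ℝ} (hh : 0 < h) (hhT : h ≤ T)
    (hk : Integrable k (timeMeasure T)) :
    IntervalIntegrable (fun r => k (max (r - h) 0)) volume 0 T ∧
    ∫ r in (0 : ℝ)..T, k (max (r - h) 0) = h • k 0 + ∫ r in (0 : ℝ)..T - h, k r := by
  have hT : 0 ≤ T := hh.le.trans hhT
  have e1 : EqOn (fun r => k (max (r - h) 0)) (fun _ => k 0) (uIcc 0 h) := by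
    intro r hr
    rw [uIcc_of_le hh.le] at hr
    simp only
    rw [max_eq_right (by linarith [hr.2])]
  have e2 : EqOn (fun r => k (max (r - h) 0)) (fun r => k (r - h)) (uIcc h T) := by
    intro r hr
    rw [uIcc_of_le hhT] at hr
    simp only
    rw [max_eq_left (by linarith [hr.1])]
  have i1 : IntervalIntegrable (fun r => k (max (r - h) 0)) volume 0 h :=
    (intervalIntegrable_const (c := k 0)).congr fun r hr => (e1 (uIoc_subset_uIcc hr)).symm
  have i2 : IntervalIntegrable (fun r => k (max (r - h) 0)) volume h T := by
    have h1 : IntervalIntegrable k volume 0 (T - h) := intervalIntegrable_of_timeMeasure hk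
      ⟨le_rfl, hT⟩ ⟨by linarith, by linarith⟩
    have h2 := h1.comp_sub_right h
    rw [zero_add, sub_add_cancel] at h2
    exact h2.congr fun r hr => (e2 (uIoc_subset_uIcc hr)).symm
  refine ⟨i1.trans i2, ?_⟩
  rw [← intervalIntegral.integral_add_adjacent_intervals i1 i2, intervalIntegral.integral_congr e1,
    intervalIntegral.integral_congr e2, intervalIntegral.integral_const,
    intervalIntegral.integral_comp_sub_right, sub_zero, sub_self]

theorem continuousOn_steklov {F : ℝ → X} {h : ℝ} (hh : 0 ≤ h)
    (hF : Integrable F (timeMeasure T)) : ContinuousOn (steklov h F) (Icc 0 T) := by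
  have h1 := continuousOn_primitive hF
  have h2 : ContinuousOn (fun r => ∫ s in (0 : ℝ)..max (r - h) 0, F s) (Icc 0 T) :=
    h1.comp (f := fun r => max (r - h) 0) (by fun_prop) fun r hr => (max_mem_Icc hh hr).1
  refine ((h1.sub h2).const_smul h⁻¹).congr fun r hr => ?_
  simp only [steklov]
  rw [← primitive_sub hF (max_mem_Icc hh hr).1 hr]
  rfl

theorem steklov_tendsto {F : ℝ → X} [CompleteSpace X] (hF : ContinuousOn F (Icc 0 T)) {h : ℕ → ℝ}
    (hpos : ∀ n, 0 < h n) (hlim : Tendsto h atTop (𝓝 0)) {r : ℝ} (hr : r ∈ Ioc 0 T) :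
    Tendsto (fun n => steklov (h n) F r) atTop (𝓝 (F r)) := by
  have hr' : r ∈ Icc 0 T := Ioc_subset_Icc_self hr
  rw [Metric.tendsto_atTop]
  intro ε hε
  obtain ⟨δ, hδ, hδF⟩ := Metric.continuousWithinAt_iff.mp (hF r hr') (ε / 2) (by linarith)
  obtain ⟨N, hN⟩ := ((hlim.eventually_lt_const hδ).and
    (hlim.eventually_lt_const hr.1)).exists_forall_of_atTop
  refine ⟨N, fun n hn => ?_⟩
  obtain ⟨h1, h2⟩ := hN n hn
  have h3 := hpos n
  have hFi := integrable_of_continuousOn hF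
  have hmem : r - h n ∈ Icc 0 T := ⟨by linarith, by linarith [hr.2]⟩
  have e : steklov (h n) F r - F r = (h n)⁻¹ • ∫ s in (r - h n)..r, (F s - F r) := by
    rw [intervalIntegral.integral_sub (intervalIntegrable_of_timeMeasure hFi hmem hr')
      intervalIntegrable_const, intervalIntegral.integral_const, smul_sub, steklov,
      max_eq_left (by linarith), smul_smul, show r - (r - h n) = h n by ring,
      inv_mul_cancel₀ h3.ne', one_smul]
  rw [dist_eq_norm, e, norm_smul, norm_inv, Real.norm_of_nonneg h3.le]
  have h4 : ‖∫ s in (r - h n)..r, (F s - F r)‖ ≤ ε / 2 * |r - (r - h n)| := by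
    refine intervalIntegral.norm_integral_le_of_norm_le_const fun s hs => ?_
    rw [uIoc_of_le (by linarith)] at hs
    rw [← dist_eq_norm]
    refine (hδF ⟨by linarith [hs.1, hmem.1], hs.2.trans hr.2⟩ ?_).le
    rw [Real.dist_eq, abs_lt]
    exact ⟨by linarith [hs.1], by linarith [hs.2]⟩
  rw [show r - (r - h n) = h n by ring, abs_of_pos h3] at h4
  rw [inv_mul_lt_iff₀ h3]
  nlinarith

theorem tendsto_eLpNorm_steklov [CompleteSpace X] {q : ℝ} (hq : 1 ≤ q) {h : ℕ → ℝ}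
    (hpos : ∀ n, 0 < h n) (hle : ∀ n, h n ≤ T) (hlim : Tendsto h atTop (𝓝 0)) {α : ℝ → X}
    (hα : MemLp α (ENNReal.ofReal q) (timeMeasure T)) :
    Tendsto (fun n => eLpNorm (steklov (h n) α - α) (ENNReal.ofReal q) (timeMeasure T))
      atTop (𝓝 0) := by
  have hT : 0 < T := (hpos 0).trans_le (hle 0)
  have hq0 : 0 < q := by linarith
  have hint : ∀ {F : ℝ → X}, MemLp F (ENNReal.ofReal q) (timeMeasure T) →
      Integrable F (timeMeasure T) := fun hF => hF.integrable (by simpa using hq)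
  refine tendsto_eLpNorm_of_dense (S := fun n => steklov (h n)) hq ?_ ?_ ?_ hα
  · intro n α β hα hβ
    filter_upwards [ae_timeMeasure_mem] with r hr
    have hm := max_mem_Icc (hpos n).le hr
    simp only [steklov, Pi.sub_apply]
    rw [intervalIntegral.integral_sub (intervalIntegrable_of_timeMeasure (hint hα) hm.1 hr)
      (intervalIntegrable_of_timeMeasure (hint hβ) hm.1 hr), smul_sub]
  · intro n α hα
    have hcon := continuousOn_steklov (hpos n).le (hint hα)
    have hmem := memLp_of_continuousOn hcon (ENNReal.ofReal q)
    refine ⟨hmem, ?_⟩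
    have hb : Integrable (fun t => ‖α t‖ ^ q) (timeMeasure T) := MemLp.integrable_rpow hq0 hα
    -- Jensen bounds the `q`-th power of the average by a difference quotient of this primitive, and
    -- the integral of the quotient telescopes through the time shift.
    set A : ℝ → ℝ := fun r => ∫ s in (0 : ℝ)..r, ‖α s‖ ^ q with hA
    have hAc : ContinuousOn A (Icc 0 T) := continuousOn_primitive hb
    have hAi : Integrable A (timeMeasure T) := integrable_of_continuousOn hAc
    obtain ⟨hsi, hse⟩ := integral_comp_shift (hpos n) (hle n) hAi
    have h0m : (0 : ℝ) ∈ Icc 0 T := ⟨le_rfl, hT.le⟩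
    have hTm : T ∈ Icc 0 T := ⟨hT.le, le_rfl⟩
    have hThm : T - h n ∈ Icc 0 T := ⟨by linarith [hle n], by linarith [hpos n]⟩
    have h1 : ∫ t, ‖steklov (h n) α t‖ ^ q ∂(timeMeasure T) ≤ ∫ t, ‖α t‖ ^ q ∂(timeMeasure T) := by
      have h2 : ∫ t, ‖steklov (h n) α t‖ ^ q ∂(timeMeasure T)
          ≤ ∫ t, (h n)⁻¹ * (A t - A (max (t - h n) 0)) ∂(timeMeasure T) := by
        refine integral_mono_ae (MemLp.integrable_rpow hq0 hmem)
          ((hAi.sub ((integrable_timeMeasure_iff hT.le).mpr hsi)).const_mul _) ?_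
        filter_upwards [ae_timeMeasure_mem] with r hr
        have hm := max_mem_Icc (hpos n).le hr
        have := mean_rpow_le hq hα hm.1 hr hm.2 (hpos n)
          (by linarith [le_max_left (r - h n) 0])
        rw [← primitive_sub hb hm.1 hr] at this
        exact this
      refine h2.trans ?_
      rw [integral_const_mul, integral_sub hAi ((integrable_timeMeasure_iff hT.le).mpr hsi),
        integral_timeMeasure hT.le A, integral_timeMeasure hT.le, hse]
      have hA0 : A 0 = 0 := by simp [hA]
      rw [hA0, smul_zero, zero_add, primitive_sub hAi hThm hTm, inv_mul_le_iff₀ (hpos n)]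
      have h3 : ∫ r in (T - h n)..T, A r ≤ ∫ r in (T - h n)..T, A T := by
        refine intervalIntegral.integral_mono_on (by linarith [hpos n])
          (intervalIntegrable_of_timeMeasure hAi hThm hTm) intervalIntegrable_const fun r hr => ?_
        have hr' : r ∈ Icc 0 T := ⟨hThm.1.trans hr.1, hr.2⟩
        have := primitive_sub hb hr' hTm
        have h4 : 0 ≤ ∫ s in r..T, ‖α s‖ ^ q :=
          intervalIntegral.integral_nonneg hr.2 fun t _ => by positivity
        simp only [hA]; linarith
      rw [intervalIntegral.integral_const, smul_eq_mul] at h3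
      rw [integral_timeMeasure hT.le]
      simp only [hA] at h3 ⊢
      linarith
    have h0 : ENNReal.ofReal q ≠ 0 := by simpa using hq0
    rw [hα.eLpNorm_eq_integral_rpow_norm h0 ENNReal.ofReal_ne_top, ENNReal.toReal_ofReal hq0.le]
    exact eLpNorm_le_of_integral_rpow_le hq0 hmem h1
  · rintro β hβ ⟨C, hC⟩
    have hC0 : 0 ≤ C := (norm_nonneg _).trans (hC 0)
    have hβi : Integrable β (timeMeasure T) := integrable_of_continuousOn hβ.continuousOn
    refine tendsto_eLpNorm_zero_of_bounded (C := C + C) hq0 (fun n =>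
      ((continuousOn_steklov (hpos n).le hβi).sub hβ.continuousOn).aestronglyMeasurable
        measurableSet_Icc) (fun n => ?_) ?_
    · filter_upwards [ae_timeMeasure_mem] with r hr
      refine (norm_sub_le _ _).trans (add_le_add ?_ (hC r))
      have hm := max_mem_Icc (hpos n).le hr
      rw [steklov, norm_smul, norm_inv, Real.norm_of_nonneg (hpos n).le, inv_mul_le_iff₀ (hpos n)]
      have h1 := intervalIntegral.norm_integral_le_of_norm_le_const (a := max (r - h n) 0) (b := r)
        (f := β) (C := C) fun s _ => hC s
      rw [abs_of_nonneg (by linarith [hm.2])] at h1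
      have : r - max (r - h n) 0 ≤ h n := by linarith [le_max_left (r - h n) 0]
      nlinarith
    · filter_upwards [ae_timeMeasure_mem_Ioc] with r hr
      have := (steklov_tendsto hβ.continuousOn hpos hlim hr).sub_const (β r)
      simpa using this

/-- Steklov averages of the dual factor may be used in pairings. -/
theorem tendsto_integral_steklov_pairing {Y : Type*} [NormedAddCommGroup Y] [NormedSpace ℝ Y]
    {p : ℝ≥0∞} {q : ℝ} (hq : 1 ≤ q) (hpq : p⁻¹ + (ENNReal.ofReal q)⁻¹ = 1) {d : ℕ → ℝ}
    (hdpos : ∀ n, 0 < d n) (hdle : ∀ n, d n ≤ T) (hdlim : Tendsto d atTop (𝓝 0))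
    {γ : ℝ → StrongDual ℝ Y} {y : ℝ → Y} (hγ : MemLp γ (ENNReal.ofReal q) (timeMeasure T))
    (hy : MemLp y p (timeMeasure T)) :
    Tendsto (fun n => ∫ t, steklov (d n) γ t (y t) ∂(timeMeasure T)) atTop
      (𝓝 (∫ t, γ t (y t) ∂(timeMeasure T))) := by
  have hm : ∀ n, MemLp (steklov (d n) γ) (ENNReal.ofReal q) (timeMeasure T) := fun n =>
    memLp_of_continuousOn (continuousOn_steklov (hdpos n).le (hγ.integrable (by simpa using hq))) _
  rw [tendsto_iff_norm_sub_tendsto_zero]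
  have h1 := (ENNReal.tendsto_toReal ENNReal.zero_ne_top).comp
    (tendsto_eLpNorm_steklov hq hdpos hdle hdlim hγ)
  have h2 := h1.mul_const (eLpNorm y p (timeMeasure T)).toReal
  simp only [ENNReal.toReal_zero, zero_mul] at h2
  refine squeeze_zero (fun _ => norm_nonneg _) (fun n => ?_) h2
  have h3 := abs_integral_pairing_le hpq ((hm n).sub hγ) hy
  rw [Real.norm_eq_abs, ← integral_sub (integrable_pairing hpq (hm n) hy)
    (integrable_pairing hpq hγ hy)]
  exact h3

end Averages

/-! ### Chain rule for the kinetic energy of a weakly continuous velocity. -/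

section ChainRule

variable {U H : Type*} [NormedAddCommGroup U] [NormedSpace ℝ U] [NormedAddCommGroup H]
  [NormedSpace ℝ H] {T : ℝ}

theorem timeMeasure_mono {t : ℝ} (ht : t ≤ T) : timeMeasure t ≤ timeMeasure T :=
  Measure.restrict_mono (Icc_subset_Icc_right ht) le_rfl

/-- The derivative `α + β ∘ ι` of `2 K(v(·), ι ·)` in the dual of `U`. -/
structure IsVelocity (T : ℝ) (K : H →L[ℝ] H →L[ℝ] ℝ) (ι : U →L[ℝ] H) (p : ℝ≥0∞) (q : ℝ)
    (w : ℝ → U) (v : ℝ → H) (α : ℝ → StrongDual ℝ U) (β : ℝ → StrongDual ℝ H) : Prop where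
  memLp : MemLp w p (timeMeasure T)
  memLp_α : MemLp α (ENNReal.ofReal q) (timeMeasure T)
  memLp_β : MemLp β 1 (timeMeasure T)
  ae_eq : (fun t => ι (w t)) =ᵐ[timeMeasure T] v
  bdd : ∃ M : ℝ, ∀ t ∈ Icc 0 T, ‖v t‖ ≤ M
  weak_cont : ∀ h : H, ContinuousOn (fun t => K (v t) h) (Icc 0 T)
  deriv : ∀ t ∈ Icc 0 T, ((2 : ℝ) • K (v t)).comp ι
    = ((2 : ℝ) • K (v 0)).comp ι + ∫ s in (0 : ℝ)..t, (α s + (β s).comp ι)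

variable {K : H →L[ℝ] H →L[ℝ] ℝ} {ι : U →L[ℝ] H} {p : ℝ≥0∞} {q : ℝ} {w : ℝ → U} {v : ℝ → H}
  {α : ℝ → StrongDual ℝ U} {β : ℝ → StrongDual ℝ H}

namespace IsVelocity

theorem mono (h : IsVelocity T K ι p q w v α β) {t : ℝ} (htT : t ≤ T) :
    IsVelocity t K ι p q w v α β := by
  have hs : Icc 0 t ⊆ Icc 0 T := Icc_subset_Icc_right htT
  obtain ⟨M, hM⟩ := h.bdd
  exact ⟨h.memLp.mono_measure (timeMeasure_mono htT), h.memLp_α.mono_measure (timeMeasure_mono htT),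
    h.memLp_β.mono_measure (timeMeasure_mono htT),
    h.ae_eq.filter_mono (ae_mono (timeMeasure_mono htT)), ⟨M, fun s hs' => hM s (hs hs')⟩,
    fun x => (h.weak_cont x).mono hs, fun s hs' => h.deriv s (hs hs')⟩

theorem integrable_α (h : IsVelocity T K ι p q w v α β) (hq : 1 ≤ q) :
    Integrable α (timeMeasure T) := h.memLp_α.integrable (by simpa using hq)

theorem integrable_β (h : IsVelocity T K ι p q w v α β) : Integrable β (timeMeasure T) :=
  memLp_one_iff_integrable.mp h.memLp_β

theorem memLp_top (h : IsVelocity T K ι p q w v α β) :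
    MemLp (fun t => ι (w t)) ∞ (timeMeasure T) := by
  obtain ⟨M, hM⟩ := h.bdd
  refine memLp_top_of_bound (ι.continuous.comp_aestronglyMeasurable h.memLp.1) M ?_
  filter_upwards [h.ae_eq, ae_timeMeasure_mem] with t ht htm
  rw [ht]; exact hM t htm

theorem integrable_energy (h : IsVelocity T K ι p q w v α β) :
    Integrable (fun t => K (v t) (v t)) (timeMeasure T) := by
  obtain ⟨M, hM⟩ := h.bdd
  have hc : Continuous fun x => K x x := by fun_prop
  have hv : AEStronglyMeasurable v (timeMeasure T) :=
    (ι.continuous.comp_aestronglyMeasurable h.memLp.1).congr h.ae_eq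
  refine Integrable.of_bound (hc.comp_aestronglyMeasurable hv) (‖K‖ * M * M) ?_
  filter_upwards [ae_timeMeasure_mem] with t ht
  have h1 := hM t ht
  have h0 : 0 ≤ M := (norm_nonneg _).trans h1
  refine (K.le_opNorm₂ _ _).trans ?_
  gcongr

theorem integrable_comp (h : IsVelocity T K ι p q w v α β) :
    Integrable (fun s => ((β s).comp ι : StrongDual ℝ U)) (timeMeasure T) :=
  ((ContinuousLinearMap.compL ℝ U H ℝ).flip ι).integrable_comp h.integrable_β

theorem integrable_sum (h : IsVelocity T K ι p q w v α β) (hq : 1 ≤ q) :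
    Integrable (fun s => α s + ((β s).comp ι : StrongDual ℝ U)) (timeMeasure T) :=
  (h.integrable_α hq).add (g := fun s => ((β s).comp ι : StrongDual ℝ U)) h.integrable_comp

theorem deriv_sub (h : IsVelocity T K ι p q w v α β) (hq : 1 ≤ q) {a b : ℝ} (ha : a ∈ Icc 0 T)
    (hb : b ∈ Icc 0 T) (x : U) :
    2 * K (v b - v a) (ι x) = (∫ s in a..b, α s) x + (∫ s in a..b, β s) (ι x) := by
  have hi : Integrable (fun s => α s + (β s).comp ι) (timeMeasure T) := h.integrable_sum hq
  have h1 := primitive_sub hi ha hb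
  have h2 := h.deriv b hb
  have h3 := h.deriv a ha
  have h4 : ((2 : ℝ) • K (v b)).comp ι - ((2 : ℝ) • K (v a)).comp ι
      = ∫ s in a..b, (α s + (β s).comp ι) := by
    rw [h2, h3, ← h1]; abel
  rw [intervalIntegral.integral_add (intervalIntegrable_of_timeMeasure (h.integrable_α hq) ha hb)
    (intervalIntegrable_of_timeMeasure h.integrable_comp ha hb)] at h4
  have h5 : ∫ s in a..b, (β s).comp ι = (∫ s in a..b, β s).comp ι :=
    ((ContinuousLinearMap.compL ℝ U H ℝ).flip ι).intervalIntegral_comp_comm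
      (intervalIntegrable_of_timeMeasure h.integrable_β ha hb)
  rw [h5] at h4
  have h6 := DFunLike.congr_fun h4 x
  simp only [sub_apply, add_apply, ContinuousLinearMap.comp_apply, smul_apply, smul_eq_mul] at h6
  rw [map_sub, sub_apply]
  linarith

/-- Convexity gives `K(v r, v r) - K(v(r-d), v(r-d)) ≤ 2 K(v r - v(r-d), v r)`. The right side is an
increment of the momentum paired with `w r`, that is `d` times the Steklov averages of `α` and `β`.
Integrating over `r` leaves the mean energy near `T`, which is bounded below by the tangent plane of
the energy at `v T`. -/
theorem energy_steklov_le (hK : IsCoerciveForm K) (h : IsVelocity T K ι p q w v α β)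
    (hT : 0 < T) (hq : 1 ≤ q) (hpq : p⁻¹ + (ENNReal.ofReal q)⁻¹ = 1) {d : ℝ} (hdpos : 0 < d)
    (hdle : d ≤ T) :
    K (v T) (v T) - K (v 0) (v 0)
        + steklov d (fun t => 2 * (K (v t) (v T) - K (v T) (v T))) T
      ≤ (∫ t, steklov d α t (w t) ∂(timeMeasure T))
        + ∫ t, steklov d β t (ι (w t)) ∂(timeMeasure T) := by
  have hTm : T ∈ Icc 0 T := ⟨hT.le, le_rfl⟩
  set k : ℝ → ℝ := fun t => K (v t) (v t) with hk
  have hki : Integrable k (timeMeasure T) := h.integrable_energy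
  set c : ℝ → ℝ := fun t => 2 * (K (v t) (v T) - K (v T) (v T)) with hc
  have hcc : ContinuousOn c (Icc 0 T) :=
    continuousOn_const.mul ((h.weak_cont (v T)).sub continuousOn_const)
  have hpq1 : (∞ : ℝ≥0∞)⁻¹ + (1 : ℝ≥0∞)⁻¹ = 1 := by simp
  have hiα : Integrable (fun t => steklov d α t (w t)) (timeMeasure T) :=
    integrable_pairing hpq
      (memLp_of_continuousOn (continuousOn_steklov hdpos.le (h.integrable_α hq)) _) h.memLp
  have hiβ : Integrable (fun t => steklov d β t (ι (w t))) (timeMeasure T) :=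
    integrable_pairing hpq1
      (memLp_of_continuousOn (continuousOn_steklov hdpos.le h.integrable_β) _) h.memLp_top
  change k T - k 0 + steklov d c T ≤ _
  obtain ⟨hsi, hse⟩ := integral_comp_shift hdpos hdle hki
  have hsi' := (integrable_timeMeasure_iff hT.le).mpr hsi
  have h1 : ∫ t, (k t - k (max (t - d) 0)) ∂(timeMeasure T) ≤
      ∫ t, d * (steklov (d) α t (w t) + steklov (d) β t (ι (w t))) ∂(timeMeasure T) := by
    refine integral_mono_ae (hki.sub hsi') ((hiα.add hiβ).const_mul _) ?_
    filter_upwards [ae_timeMeasure_mem, h.ae_eq] with r hr hrw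
    have hm := max_mem_Icc hdpos.le hr
    have h2 := h.deriv_sub hq hm.1 hr (w r)
    have h3 := hK.le_self (v r) (v (max (r - d) 0))
    have h4 : K (v r) (v (max (r - d) 0) - v r) = - K (v r - v (max (r - d) 0)) (v r) := by
      rw [hK.symm, ← neg_sub, map_neg]
      rfl
    rw [h4] at h3
    simp only [steklov, smul_apply, smul_eq_mul, hk]
    rw [hrw] at h2 ⊢
    have hd0 := hdpos.ne'
    have e : d * ((d)⁻¹ * (∫ s in max (r - d) 0..r, α s) (w r)
        + (d)⁻¹ * (∫ s in max (r - d) 0..r, β s) (v r))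
        = (∫ s in max (r - d) 0..r, α s) (w r) + (∫ s in max (r - d) 0..r, β s) (v r) := by
      field_simp
    rw [e]
    linarith
  rw [integral_sub hki hsi', integral_const_mul, integral_add hiα hiβ,
    integral_timeMeasure hT.le k, integral_timeMeasure hT.le (fun t => k (max (t - d) 0)),
    hse] at h1
  have hThm : T - d ∈ Icc 0 T := ⟨by linarith [hdle], by linarith [hdpos]⟩
  have h5 := primitive_sub hki hThm hTm
  have h6 : ∫ r in (T - d)..T, (k T + c r) ≤ ∫ r in (T - d)..T, k r := by
    refine intervalIntegral.integral_mono_on (by linarith [hdpos])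
      (intervalIntegrable_const.add (intervalIntegrable_of_timeMeasure
        (integrable_of_continuousOn hcc) hThm hTm))
      (intervalIntegrable_of_timeMeasure hki hThm hTm) fun r _ => ?_
    have h7 := hK.le_self (v T) (v r)
    rw [map_sub, hK.symm (v T) (v r)] at h7
    exact h7
  rw [intervalIntegral.integral_add intervalIntegrable_const (intervalIntegrable_of_timeMeasure
        (integrable_of_continuousOn hcc) hThm hTm), intervalIntegral.integral_const,
        smul_eq_mul] at h6
  have h8 : steklov (d) c T = (d)⁻¹ * ∫ r in (T - d)..T, c r := by
    rw [steklov, max_eq_left hThm.1, smul_eq_mul]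
  have h9 : d * (k T - k 0 + steklov (d) c T) ≤ d * ((∫ t, steklov (d) α t (w t) ∂(timeMeasure T))
      + ∫ t, steklov (d) β t (ι (w t)) ∂(timeMeasure T)) := by
    refine le_trans ?_ h1
    have e : d * (k T - k 0 + steklov (d) c T)
        = d * k T - d * k 0 + ∫ r in (T - d)..T, c r := by
      rw [h8]; have := hdpos.ne'; field_simp
    rw [e, smul_eq_mul]
    have : T - (T - d) = d := by ring
    rw [this] at h6
    linarith
  exact le_of_mul_le_mul_left h9 hdpos

/-- As `d → 0` the averages converge strongly. The correction at time `T` is affine in `v`, so weak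
continuity is enough for it to vanish. -/
theorem energy_le (hK : IsCoerciveForm K) (h : IsVelocity T K ι p q w v α β) (hT : 0 < T)
    (hq : 1 ≤ q) (hpq : p⁻¹ + (ENNReal.ofReal q)⁻¹ = 1) :
    K (v T) (v T) - K (v 0) (v 0)
      ≤ (∫ t, α t (w t) ∂(timeMeasure T)) + ∫ t, β t (ι (w t)) ∂(timeMeasure T) := by
  set d : ℕ → ℝ := fun n => T / ((n : ℝ) + 1) with hd
  have hdpos : ∀ n, 0 < d n := fun n => by positivity
  have hdle : ∀ n, d n ≤ T := fun n => by
    rw [hd, div_le_iff₀ (by positivity)]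
    nlinarith [(Nat.cast_nonneg n : (0 : ℝ) ≤ n)]
  have hdlim : Tendsto d atTop (𝓝 0) := by
    have := (tendsto_one_div_add_atTop_nhds_zero_nat (𝕜 := ℝ)).const_mul T
    simpa [hd, div_eq_mul_inv] using this
  set c : ℝ → ℝ := fun t => 2 * (K (v t) (v T) - K (v T) (v T)) with hc
  have hcc : ContinuousOn c (Icc 0 T) :=
    continuousOn_const.mul ((h.weak_cont (v T)).sub continuousOn_const)
  have hlimL : Tendsto (fun n => K (v T) (v T) - K (v 0) (v 0) + steklov (d n) c T) atTop
      (𝓝 (K (v T) (v T) - K (v 0) (v 0) + 0)) := by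
    have h1 := steklov_tendsto hcc hdpos hdlim (⟨hT, le_rfl⟩ : T ∈ Ioc 0 T)
    have h2 : c T = 0 := by simp [hc]
    rw [h2] at h1
    exact h1.const_add _
  rw [add_zero] at hlimL
  have hβ : MemLp β (ENNReal.ofReal 1) (timeMeasure T) := by simpa using h.memLp_β
  have h1 := tendsto_integral_steklov_pairing hq hpq hdpos hdle hdlim h.memLp_α h.memLp
  have h2 := tendsto_integral_steklov_pairing (p := ∞) le_rfl (by simp) hdpos hdle hdlim hβ
    h.memLp_top
  exact le_of_tendsto_of_tendsto' hlimL (h1.add h2) fun n =>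
    h.energy_steklov_le hK hT hq hpq (hdpos n) (hdle n)

theorem map_reflect (hT : 0 ≤ T) :
    MeasurePreserving (fun t => T - t) (timeMeasure T) (timeMeasure T) := by
  have h1 : MeasurePreserving (fun t : ℝ => T - t) volume volume :=
    Measure.measurePreserving_sub_left volume T
  have h2 := h1.restrict_preimage (s := Icc 0 T) measurableSet_Icc
  have h3 : (fun t : ℝ => T - t) ⁻¹' Icc 0 T = Icc 0 T := by
    ext t; simp only [mem_preimage, mem_Icc]
    constructor <;> rintro ⟨h1, h2⟩ <;> constructor <;> linarith
  rw [h3] at h2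
  exact h2

/-- Time reversal turns the one-sided estimate `energy_le` into the opposite one, which gives
equality. -/
theorem reflect (h : IsVelocity T K ι p q w v α β) (hT : 0 ≤ T) (hq : 1 ≤ q) :
    IsVelocity T K ι p q (fun t => w (T - t)) (fun t => v (T - t)) (fun t => -α (T - t))
      (fun t => -β (T - t)) := by
  have hmp := map_reflect hT
  have hmem : ∀ t ∈ Icc 0 T, T - t ∈ Icc 0 T := fun t ht =>
    ⟨by linarith [ht.2], by linarith [ht.1]⟩
  obtain ⟨M, hM⟩ := h.bdd
  refine ⟨h.memLp.comp_measurePreserving hmp, (h.memLp_α.comp_measurePreserving hmp).neg,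
    (h.memLp_β.comp_measurePreserving hmp).neg,
    hmp.quasiMeasurePreserving.ae_eq_comp h.ae_eq, ⟨M, fun t ht => hM _ (hmem t ht)⟩,
    fun x => (h.weak_cont x).comp (by fun_prop) hmem, fun t ht => ?_⟩
  have hi : Integrable (fun s => α s + (β s).comp ι) (timeMeasure T) := h.integrable_sum hq
  have h1 := primitive_sub hi (hmem t ht) (⟨hT, le_rfl⟩ : T ∈ Icc 0 T)
  have h2 := h.deriv _ (hmem t ht)
  have h3 := h.deriv T ⟨hT, le_rfl⟩
  have h4 := intervalIntegral.integral_comp_sub_left (a := 0) (b := t)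
    (fun s => α s + (β s).comp ι) T
  rw [sub_zero] at h4
  have h5 : ∀ s, -α (T - s) + (-β (T - s)).comp ι = -(α (T - s) + (β (T - s)).comp ι) := by
    intro s; ext x; simp; ring
  simp_rw [h5]
  rw [intervalIntegral.integral_neg]
  simp only [sub_zero]
  rw [h4, ← h1, h2, h3]
  abel

/-- The chain rule for the kinetic energy. -/
theorem energy_eq (hK : IsCoerciveForm K) (h : IsVelocity T K ι p q w v α β) (hT : 0 ≤ T)
    (hq : 1 ≤ q) (hpq : p⁻¹ + (ENNReal.ofReal q)⁻¹ = 1) :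
    K (v T) (v T) - K (v 0) (v 0)
      = (∫ t, α t (w t) ∂(timeMeasure T)) + ∫ t, β t (ι (w t)) ∂(timeMeasure T) := by
  rcases hT.eq_or_lt with rfl | hT'
  · simp [integral_timeMeasure]
  refine le_antisymm (h.energy_le hK hT' hq hpq) ?_
  have h1 := (h.reflect hT hq).energy_le hK hT' hq hpq
  have hmp := map_reflect hT
  have e1 : ∫ t, (-α (T - t)) (w (T - t)) ∂(timeMeasure T) = - ∫ t, α t (w t) ∂(timeMeasure T) := by
    rw [← integral_neg]
    exact hmp.integral_comp (Homeomorph.subLeft T).measurableEmbedding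
      (fun t => (-(α t (w t)) : ℝ))
  have e2 : ∫ t, (-β (T - t)) (ι (w (T - t))) ∂(timeMeasure T)
      = - ∫ t, β t (ι (w t)) ∂(timeMeasure T) := by
    rw [← integral_neg]
    exact hmp.integral_comp (Homeomorph.subLeft T).measurableEmbedding
      (fun t => (-(β t (ι (w t))) : ℝ))
  rw [e1, e2] at h1
  simp only [sub_self, sub_zero] at h1
  linarith

end IsVelocity

end ChainRule

end

section

/-! ### Grid functions, interpolants and cell means. -/

section Grid

variable {X : Type*} [NormedAddCommGroup X] {T τ : ℝ} {N : ℕ}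

theorem stepIndex_eq (hτ : 0 < τ) {k : ℕ} {t : ℝ} (ht : t ∈ Ioc (k * τ) ((k + 1) * τ)) :
    stepIndex τ t = k + 1 := by
  rw [stepIndex, Nat.ceil_eq_iff (by omega)]
  rw [Nat.add_sub_cancel, lt_div_iff₀ hτ, div_le_iff₀ hτ]
  push_cast
  exact ht

theorem exists_mem_Ioc (hτ : 0 < τ) (hN : N * τ = T) {t : ℝ} (ht : t ∈ Ioc 0 T) :
    ∃ k < N, t ∈ Ioc ((k : ℝ) * τ) ((k + 1) * τ) := by
  have h1 : 0 < t / τ := div_pos ht.1 hτ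
  obtain ⟨k, hk⟩ : ∃ k, ⌈t / τ⌉₊ = k + 1 := Nat.exists_eq_add_one.mpr (Nat.ceil_pos.mpr h1)
  have h2 := (Nat.ceil_eq_iff (by omega)).mp hk
  rw [Nat.add_sub_cancel, lt_div_iff₀ hτ, div_le_iff₀ hτ] at h2
  push_cast at h2
  refine ⟨k, ?_, h2⟩
  have h3 : (k : ℝ) * τ < N * τ := h2.1.trans_le (ht.2.trans hN.ge)
  exact_mod_cast lt_of_mul_lt_mul_right h3 hτ.le

theorem grid_mem_Icc (hτ : 0 < τ) (hN : N * τ = T) {k : ℕ} (hk : k ≤ N) :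
    (k : ℝ) * τ ∈ Icc 0 T := by
  refine ⟨by positivity, ?_⟩
  rw [← hN]
  have : (k : ℝ) ≤ N := by exact_mod_cast hk
  gcongr

theorem stepIndex_le (hτ : 0 < τ) (hN : N * τ = T) {t : ℝ} (ht : t ∈ Icc 0 T) :
    stepIndex τ t ≤ N := by
  rw [stepIndex, Nat.ceil_le, div_le_iff₀ hτ, hN]
  exact ht.2

theorem stronglyMeasurable_pwConst (τ : ℝ) (x : ℕ → X) : StronglyMeasurable (pwConst τ x) := by
  have h1 : StronglyMeasurable x := StronglyMeasurable.of_discrete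
  exact h1.comp_measurable (Nat.measurable_ceil.comp (measurable_id.div_const τ))

theorem norm_pwConst_le (hτ : 0 < τ) (hN : N * τ = T) (x : ℕ → X) {t : ℝ} (ht : t ∈ Icc 0 T) :
    ‖pwConst τ x t‖ ≤ ∑ k ∈ Finset.range (N + 1), ‖x k‖ :=
  Finset.single_le_sum (f := fun k => ‖x k‖) (fun _ _ => norm_nonneg _)
    (Finset.mem_range.mpr (Nat.lt_succ_of_le (stepIndex_le hτ hN ht)))

theorem memLp_pwConst (hτ : 0 < τ) (hN : N * τ = T) (x : ℕ → X) (p : ℝ≥0∞) :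
    MemLp (pwConst τ x) p (timeMeasure T) := by
  refine MemLp.of_bound (stronglyMeasurable_pwConst τ x).aestronglyMeasurable
    (∑ k ∈ Finset.range (N + 1), ‖x k‖) ?_
  filter_upwards [ae_timeMeasure_mem] with t ht using norm_pwConst_le hτ hN x ht

theorem integrable_pwConst (hτ : 0 < τ) (hN : N * τ = T) (x : ℕ → X) :
    Integrable (pwConst τ x) (timeMeasure T) :=
  memLp_one_iff_integrable.mp (memLp_pwConst hτ hN x 1)

variable [NormedSpace ℝ X]

/-- Integration over the grid intervals. -/
theorem integral_grid (hτ : 0 < τ) (hN : N * τ = T) {F : ℝ → X} (hF : Integrable F (timeMeasure T))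
    {n : ℕ} (hn : n ≤ N) :
    ∫ t in (0 : ℝ)..n * τ, F t
      = ∑ k ∈ Finset.range n, ∫ t in (k : ℝ) * τ..((k : ℝ) + 1) * τ, F t := by
  have h := intervalIntegral.sum_integral_adjacent_intervals (f := F) (μ := volume)
    (a := fun k : ℕ => (k : ℝ) * τ) (n := n) fun k hk => intervalIntegrable_of_timeMeasure hF
      (grid_mem_Icc hτ hN (by omega)) (grid_mem_Icc hτ hN (by omega))
  simp only [Nat.cast_zero, zero_mul] at h
  rw [← h]
  simp

theorem integral_timeMeasure_grid (hτ : 0 < τ) (hN : N * τ = T) {F : ℝ → X}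
    (hF : Integrable F (timeMeasure T)) :
    ∫ t, F t ∂(timeMeasure T)
      = ∑ k ∈ Finset.range N, ∫ t in (k : ℝ) * τ..((k : ℝ) + 1) * τ, F t := by
  rw [integral_timeMeasure (by rw [← hN]; positivity), ← integral_grid hτ hN hF le_rfl, hN]

/-- On a grid interval the index is constant. -/
theorem integral_stepIndex (hτ : 0 < τ) (G : ℕ → ℝ → X) (k : ℕ) {t : ℝ}
    (ht : t ∈ Icc ((k : ℝ) * τ) ((k + 1) * τ)) :
    ∫ s in (k : ℝ) * τ..t, G (stepIndex τ s) s = ∫ s in (k : ℝ) * τ..t, G (k + 1) s := by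
  refine intervalIntegral.integral_congr_uIoo fun s hs => ?_
  rw [uIoo_of_le ht.1] at hs
  rw [stepIndex_eq hτ ⟨hs.1, hs.2.le.trans ht.2⟩]

theorem left_mem_grid (hτ : 0 < τ) (k : ℕ) :
    ((k : ℝ) + 1) * τ ∈ Icc ((k : ℝ) * τ) ((k + 1) * τ) := ⟨by nlinarith, le_rfl⟩

variable [CompleteSpace X]

theorem integral_pwConst_part (hτ : 0 < τ) (x : ℕ → X) (k : ℕ) {t : ℝ}
    (ht : t ∈ Icc ((k : ℝ) * τ) ((k + 1) * τ)) :
    ∫ s in (k : ℝ) * τ..t, pwConst τ x s = (t - k * τ) • x (k + 1) := by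
  rw [show (∫ s in (k : ℝ) * τ..t, pwConst τ x s) = ∫ s in (k : ℝ) * τ..t, x (stepIndex τ s) from
    rfl, integral_stepIndex hτ (fun n _ => x n) k ht, intervalIntegral.integral_const]

theorem integral_pwConst (hτ : 0 < τ) (hN : N * τ = T) (x : ℕ → X) {n : ℕ} (hn : n ≤ N) :
    ∫ t in (0 : ℝ)..n * τ, pwConst τ x t = ∑ k ∈ Finset.range n, τ • x (k + 1) := by
  rw [integral_grid hτ hN (integrable_pwConst hτ hN x) hn]
  refine Finset.sum_congr rfl fun k _ => ?_
  rw [integral_pwConst_part hτ x k (left_mem_grid hτ k)]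
  congr 1; ring

theorem integral_timeMeasure_pwConst (hτ : 0 < τ) (hN : N * τ = T) (x : ℕ → X) :
    ∫ t, pwConst τ x t ∂(timeMeasure T) = ∑ k ∈ Finset.range N, τ • x (k + 1) := by
  rw [integral_timeMeasure (by rw [← hN]; positivity), ← integral_pwConst hτ hN x le_rfl, hN]

theorem pwAffine_apply (hτ : 0 < τ) (x : ℕ → X) {k : ℕ} {t : ℝ}
    (ht : t ∈ Ioc ((k : ℝ) * τ) ((k + 1) * τ)) :
    pwAffine τ x t = x k + (t - k * τ) • (τ⁻¹ • (x (k + 1) - x k)) := by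
  rw [pwAffine, stepIndex_eq hτ ht, Nat.add_sub_cancel]
  push_cast
  have h1 : (((k : ℝ) + 1) * τ - t) / τ = 1 - (t - k * τ) * τ⁻¹ := by field_simp; ring
  have h2 : (t - ((k : ℝ) + 1 - 1) * τ) / τ = (t - k * τ) * τ⁻¹ := by field_simp; ring
  rw [h1, h2, smul_smul]
  module

theorem pwAffine_zero (τ : ℝ) (hτ : 0 < τ) (x : ℕ → X) : pwAffine τ x 0 = x 0 := by
  have : stepIndex τ 0 = 0 := by simp [stepIndex]
  rw [pwAffine, this]
  simp [hτ.ne']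

/-- The piecewise affine interpolant is the primitive of the difference quotients. -/
theorem pwAffine_eq_primitive (hτ : 0 < τ) (hN : N * τ = T) (x : ℕ → X) {t : ℝ}
    (ht : t ∈ Icc 0 T) :
    pwAffine τ x t
      = x 0 + ∫ s in (0 : ℝ)..t, pwConst τ (fun k => τ⁻¹ • (x k - x (k - 1))) s := by
  rcases ht.1.eq_or_lt with rfl | h0
  · simp [pwAffine_zero τ hτ]
  obtain ⟨k, hk, hkt⟩ := exists_mem_Ioc hτ hN ⟨h0, ht.2⟩
  set y : ℕ → X := fun k => τ⁻¹ • (x k - x (k - 1)) with hy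
  have hi := integrable_pwConst hτ hN y
  have h1 := primitive_sub hi (grid_mem_Icc hτ hN hk.le) ht
  rw [integral_pwConst_part hτ y k (Ioc_subset_Icc_self hkt), integral_pwConst hτ hN y hk.le] at h1
  have h2 : ∑ j ∈ Finset.range k, τ • y (j + 1) = x k - x 0 := by
    rw [← Finset.sum_range_sub]
    refine Finset.sum_congr rfl fun j _ => ?_
    simp only [hy, Nat.add_sub_cancel]
    rw [smul_smul, mul_inv_cancel₀ hτ.ne', one_smul]
  rw [h2] at h1
  rw [pwAffine_apply hτ x hkt, eq_add_of_sub_eq h1]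
  simp only [hy, Nat.add_sub_cancel]
  abel

/-- The mean values over the grid intervals. -/
noncomputable def gridMean (τ : ℝ) (F : ℝ → X) (k : ℕ) : X :=
  τ⁻¹ • ∫ t in ((k : ℝ) - 1) * τ..k * τ, F t

theorem gridMean_succ (τ : ℝ) (F : ℝ → X) (k : ℕ) :
    gridMean τ F (k + 1) = τ⁻¹ • ∫ t in (k : ℝ) * τ..((k : ℝ) + 1) * τ, F t := by
  simp [gridMean]

theorem integral_rpow_gridMean_le (hτ : 0 < τ) (hN : N * τ = T) {q : ℝ} (hq : 1 ≤ q) {F : ℝ → X}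
    (hF : MemLp F (ENNReal.ofReal q) (timeMeasure T)) :
    ∫ t, ‖pwConst τ (gridMean τ F) t‖ ^ q ∂(timeMeasure T)
      ≤ ∫ t, ‖F t‖ ^ q ∂(timeMeasure T) := by
  have h1 := integral_timeMeasure_pwConst hτ hN (fun k => ‖gridMean τ F k‖ ^ q)
  have h2 : ∀ t, pwConst τ (fun k => ‖gridMean τ F k‖ ^ q) t = ‖pwConst τ (gridMean τ F) t‖ ^ q :=
    fun t => rfl
  simp only [h2] at h1
  rw [h1, integral_timeMeasure_grid hτ hN (MemLp.integrable_rpow (by linarith) hF)]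
  refine Finset.sum_le_sum fun k hk => ?_
  have hk' := Finset.mem_range.mp hk
  have ha := grid_mem_Icc hτ hN hk'.le
  have hb := grid_mem_Icc hτ hN (Nat.succ_le_of_lt hk')
  push_cast at hb
  have := mean_rpow_le hq hF ha hb (left_mem_grid hτ k).1 hτ (by linarith)
  rw [gridMean_succ, smul_eq_mul]
  rwa [le_inv_mul_iff₀ hτ] at this

theorem eLpNorm_gridMean_le (hτ : 0 < τ) (hN : N * τ = T) {q : ℝ} (hq : 1 ≤ q) {F : ℝ → X}
    (hF : MemLp F (ENNReal.ofReal q) (timeMeasure T)) :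
    eLpNorm (pwConst τ (gridMean τ F)) (ENNReal.ofReal q) (timeMeasure T)
      ≤ eLpNorm F (ENNReal.ofReal q) (timeMeasure T) := by
  have hq0 : 0 < q := by linarith
  have h0 : ENNReal.ofReal q ≠ 0 := by simpa using hq0
  rw [hF.eLpNorm_eq_integral_rpow_norm h0 ENNReal.ofReal_ne_top, ENNReal.toReal_ofReal hq0.le]
  exact eLpNorm_le_of_integral_rpow_le hq0 (memLp_pwConst hτ hN _ _)
    (integral_rpow_gridMean_le hτ hN hq hF)

theorem gridMean_add (hτ : 0 < τ) (hN : N * τ = T) {F G : ℝ → X}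
    (hF : Integrable F (timeMeasure T)) (hG : Integrable G (timeMeasure T)) {k : ℕ} (hk : k < N) :
    gridMean τ (fun t => F t + G t) (k + 1) = gridMean τ F (k + 1) + gridMean τ G (k + 1) := by
  have ha := grid_mem_Icc hτ hN hk.le
  have hb := grid_mem_Icc hτ hN (Nat.succ_le_of_lt hk)
  push_cast at hb
  rw [gridMean_succ, gridMean_succ, gridMean_succ, intervalIntegral.integral_add
    (intervalIntegrable_of_timeMeasure hF ha hb) (intervalIntegrable_of_timeMeasure hG ha hb),
    smul_add]

theorem gridMean_neg (τ : ℝ) (F : ℝ → X) (k : ℕ) :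
    gridMean τ (fun t => - F t) k = - gridMean τ F k := by
  simp [gridMean]

theorem gridMean_congr (hτ : 0 < τ) (hN : N * τ = T) {F G : ℝ → X}
    (h : F =ᵐ[timeMeasure T] G) {k : ℕ} (hk : k < N) :
    gridMean τ F (k + 1) = gridMean τ G (k + 1) := by
  have ha := grid_mem_Icc hτ hN hk.le
  have hb := grid_mem_Icc hτ hN (Nat.succ_le_of_lt hk)
  push_cast at hb
  rw [gridMean_succ, gridMean_succ]
  congr 1
  refine intervalIntegral.integral_congr_ae_restrict ?_
  have h' : F =ᵐ[volume.restrict (Icc 0 T)] G := h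
  refine ae_mono (Measure.restrict_mono ?_ le_rfl) h'
  rw [uIoc_of_le (left_mem_grid hτ k).1]
  exact fun t ht => ⟨ha.1.trans ht.1.le, ht.2.trans hb.2⟩

theorem integral_pairing_pwConst {Y : Type*} [NormedAddCommGroup Y] [NormedSpace ℝ Y]
    (hτ : 0 < τ) (hN : N * τ = T) {F : ℝ → StrongDual ℝ Y} (hF : Integrable F (timeMeasure T))
    (x : ℕ → Y) :
    ∫ t, F t (pwConst τ x t) ∂(timeMeasure T)
      = ∑ k ∈ Finset.range N, τ * gridMean τ F (k + 1) (x (k + 1)) := by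
  have hi : Integrable (fun t => F t (pwConst τ x t)) (timeMeasure T) :=
    integrable_pairing (p := ∞) (q := 1) (by simp) (memLp_one_iff_integrable.mpr hF)
      (memLp_pwConst hτ hN x ∞)
  rw [integral_timeMeasure_grid hτ hN hi]
  refine Finset.sum_congr rfl fun k hk => ?_
  have hk' := Finset.mem_range.mp hk
  have ha := grid_mem_Icc hτ hN hk'.le
  have hb := grid_mem_Icc hτ hN (Nat.succ_le_of_lt hk')
  push_cast at hb
  rw [show (∫ s in (k : ℝ) * τ..(k + 1) * τ, F s (pwConst τ x s))
    = ∫ s in (k : ℝ) * τ..(k + 1) * τ, F s (x (stepIndex τ s)) from rfl,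
    integral_stepIndex hτ (fun n s => F s (x n)) k (left_mem_grid hτ k), gridMean_succ, smul_apply,
    smul_eq_mul, mul_inv_cancel_left₀ hτ.ne']
  exact (ContinuousLinearMap.intervalIntegral_apply
    (intervalIntegrable_of_timeMeasure hF ha hb) _).symm

/-- Averaging over grid cells is a contraction of `L^q` by Jensen and converges pointwise on
continuous functions; density does the rest. The index `n` stands for `N = n + 1` steps. -/
theorem tendsto_gridMean (hT : 0 < T) {q : ℝ} (hq : 1 ≤ q) {F : ℝ → X}
    (hF : MemLp F (ENNReal.ofReal q) (timeMeasure T)) :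
    Tendsto (fun n : ℕ => eLpNorm
      (pwConst (T / ((n + 1 : ℕ) : ℝ)) (gridMean (T / ((n + 1 : ℕ) : ℝ)) F) - F)
      (ENNReal.ofReal q) (timeMeasure T)) atTop (𝓝 0) := by
  have hq0 : 0 < q := by linarith
  have hpos : ∀ n : ℕ, 0 < T / ((n + 1 : ℕ) : ℝ) := fun n => by positivity
  have hN : ∀ n : ℕ, ((n + 1 : ℕ) : ℝ) * (T / ((n + 1 : ℕ) : ℝ)) = T := fun n => by field_simp
  have hint : ∀ {F : ℝ → X}, MemLp F (ENNReal.ofReal q) (timeMeasure T) →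
      Integrable F (timeMeasure T) := fun hF => hF.integrable (by simpa using hq)
  have hlim : Tendsto (fun n : ℕ => T / ((n + 1 : ℕ) : ℝ)) atTop (𝓝 0) := by
    have := (tendsto_one_div_add_atTop_nhds_zero_nat (𝕜 := ℝ)).const_mul T
    simpa [div_eq_mul_inv] using this
  refine tendsto_eLpNorm_of_dense
    (S := fun (n : ℕ) F => pwConst (T / ((n + 1 : ℕ) : ℝ)) (gridMean (T / ((n + 1 : ℕ) : ℝ)) F))
    hq ?_ ?_ ?_ hF
  · intro n α β hα hβ
    filter_upwards [ae_timeMeasure_mem_Ioc] with t ht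
    obtain ⟨k, hk, hkt⟩ := exists_mem_Ioc (hpos n) (hN n) ht
    simp only [Pi.sub_apply, pwConst, stepIndex_eq (hpos n) hkt]
    have h1 : gridMean (T / ((n + 1 : ℕ) : ℝ)) (α - β) (k + 1)
        = gridMean (T / ((n + 1 : ℕ) : ℝ)) α (k + 1)
          + gridMean (T / ((n + 1 : ℕ) : ℝ)) (-β) (k + 1) := by
      rw [sub_eq_add_neg]
      exact gridMean_add (hpos n) (hN n) (hint hα) (hint hβ).neg hk
    rw [h1, show gridMean (T / ((n + 1 : ℕ) : ℝ)) (-β) (k + 1)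
      = - gridMean (T / ((n + 1 : ℕ) : ℝ)) β (k + 1) from gridMean_neg _ _ _,
      sub_eq_add_neg]
  · exact fun n α hα => ⟨memLp_pwConst (hpos n) (hN n) _ _,
      eLpNorm_gridMean_le (hpos n) (hN n) hq hα⟩
  · rintro β hβ ⟨C, hC⟩
    refine tendsto_eLpNorm_zero_of_bounded (C := C + C) hq0 (fun n =>
      (stronglyMeasurable_pwConst _ _).aestronglyMeasurable.sub hβ.aestronglyMeasurable)
      (fun n => ?_) ?_
    · filter_upwards [ae_timeMeasure_mem_Ioc] with t ht
      refine (norm_sub_le _ _).trans (add_le_add ?_ (hC t))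
      obtain ⟨k, hk, hkt⟩ := exists_mem_Ioc (hpos n) (hN n) ht
      simp only [pwConst, stepIndex_eq (hpos n) hkt]
      rw [gridMean_succ, norm_smul, norm_inv, Real.norm_of_nonneg (hpos n).le,
        inv_mul_le_iff₀ (hpos n)]
      have h1 := intervalIntegral.norm_integral_le_of_norm_le_const
        (a := (k : ℝ) * (T / ((n + 1 : ℕ) : ℝ))) (b := (k + 1) * (T / ((n + 1 : ℕ) : ℝ)))
        (f := β) (C := C) fun s _ => hC s
      rw [show ((k : ℝ) + 1) * (T / ((n + 1 : ℕ) : ℝ)) - k * (T / ((n + 1 : ℕ) : ℝ))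
        = T / ((n + 1 : ℕ) : ℝ) by ring, abs_of_pos (hpos n)] at h1
      linarith
    · filter_upwards [ae_timeMeasure_mem_Ioc] with t ht
      rw [Metric.tendsto_atTop]
      intro ε hε
      obtain ⟨δ, hδ, hδβ⟩ := Metric.continuous_iff.mp hβ t (ε / 2) (by linarith)
      obtain ⟨M, hM⟩ := (hlim.eventually_lt_const hδ).exists_forall_of_atTop
      refine ⟨M, fun n hn => ?_⟩
      have h0 := hM n hn
      obtain ⟨k, hk, hkt⟩ := exists_mem_Ioc (hpos n) (hN n) ht
      set τ := T / ((n + 1 : ℕ) : ℝ) with hτdef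
      have hτ : 0 < τ := hpos n
      have hkτ := (left_mem_grid hτ k).1
      have e : gridMean τ β (k + 1) - β t
          = τ⁻¹ • ∫ s in (k : ℝ) * τ..(k + 1) * τ, (β s - β t) := by
        rw [intervalIntegral.integral_sub (hβ.intervalIntegrable _ _) intervalIntegrable_const,
          intervalIntegral.integral_const, smul_sub, gridMean_succ, smul_smul,
          show ((k : ℝ) + 1) * τ - k * τ = τ by ring, inv_mul_cancel₀ hτ.ne', one_smul]
      rw [dist_zero_right]
      simp only [Pi.sub_apply, pwConst, stepIndex_eq hτ hkt]
      rw [e, norm_smul, norm_inv, Real.norm_of_nonneg hτ.le, inv_mul_lt_iff₀ hτ]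
      have h4 : ‖∫ s in (k : ℝ) * τ..(k + 1) * τ, (β s - β t)‖
          ≤ ε / 2 * |(k + 1) * τ - k * τ| := by
        refine intervalIntegral.norm_integral_le_of_norm_le_const fun s hs => ?_
        rw [uIoc_of_le hkτ] at hs
        rw [← dist_eq_norm]
        refine (hδβ s ?_).le
        rw [Real.dist_eq, abs_lt]
        constructor <;> nlinarith [hs.1, hs.2, hkt.1, hkt.2]
      rw [show ((k : ℝ) + 1) * τ - k * τ = τ by ring, abs_of_pos hτ] at h4
      nlinarith

end Grid

end

/-! ### Trajectories and the convex set of approximate solutions. -/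

section

theorem holder_ofReal {p : ℝ} (hp : 1 < p) :
    (ENNReal.ofReal p)⁻¹ + (ENNReal.ofReal (p / (p - 1)))⁻¹ = 1 := by
  have h1 : 0 < p / (p - 1) := div_pos (by linarith) (by linarith)
  rw [← ENNReal.ofReal_inv_of_pos (by linarith), ← ENNReal.ofReal_inv_of_pos h1,
    ← ENNReal.ofReal_add (by positivity) (by positivity)]
  have h2 : p - 1 ≠ 0 := by linarith
  have h3 : p ≠ 0 := by linarith
  have : p⁻¹ + (p / (p - 1))⁻¹ = 1 := by field_simp; ring
  rw [this, ENNReal.ofReal_one]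

theorem one_lt_conj {p : ℝ} (hp : 1 < p) : 1 < p / (p - 1) := by
  rw [one_lt_div (by linarith)]; linarith

/-- The primitive of `w` with the initial value `c`. -/
noncomputable def primitive {X : Type*} [NormedAddCommGroup X] [NormedSpace ℝ X] (c : X)
    (w : ℝ → X) (t : ℝ) : X := c + ∫ s in (0 : ℝ)..t, w s

section Primitive

variable {X : Type*} [NormedAddCommGroup X] [NormedSpace ℝ X] {T : ℝ}

theorem primitive_zero (c : X) (w : ℝ → X) : primitive c w 0 = c := by simp [primitive]

theorem continuousOn_primitive' {w : ℝ → X} (c : X) (hw : Integrable w (timeMeasure T)) :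
    ContinuousOn (primitive c w) (Icc 0 T) := continuousOn_const.add (continuousOn_primitive hw)

theorem primitive_combo {w y : ℝ → X} {c : X} {a b : ℝ} (hab : a + b = 1)
    (hw : Integrable w (timeMeasure T)) (hy : Integrable y (timeMeasure T)) {t : ℝ}
    (ht : t ∈ Icc 0 T) :
    primitive c (fun s => a • w s + b • y s) t = a • primitive c w t + b • primitive c y t := by
  have h0 : (0 : ℝ) ∈ Icc 0 T := ⟨le_rfl, ht.1.trans ht.2⟩
  have h1 := intervalIntegrable_of_timeMeasure hw h0 ht
  have h2 := intervalIntegrable_of_timeMeasure hy h0 ht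
  simp only [primitive]
  have h3 : ∫ s in (0 : ℝ)..t, (a • w s + b • y s)
      = (∫ s in (0 : ℝ)..t, a • w s) + ∫ s in (0 : ℝ)..t, b • y s :=
    intervalIntegral.integral_add (h1.smul a) (h2.smul b)
  rw [h3, intervalIntegral.integral_smul, intervalIntegral.integral_smul]
  conv_lhs => rw [← one_smul ℝ c, ← hab]
  module

theorem norm_primitive_sub_le {w y : ℝ → X} (c : X) (hw : Integrable w (timeMeasure T))
    (hy : Integrable y (timeMeasure T)) {t : ℝ} (ht : t ∈ Icc 0 T) :
    ‖primitive c w t - primitive c y t‖ ≤ (eLpNorm (w - y) 1 (timeMeasure T)).toReal := by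
  have h0 : (0 : ℝ) ∈ Icc 0 T := ⟨le_rfl, ht.1.trans ht.2⟩
  have h1 := intervalIntegrable_of_timeMeasure hw h0 ht
  have h2 := intervalIntegrable_of_timeMeasure hy h0 ht
  simp only [primitive, add_sub_add_left_eq_sub]
  rw [← intervalIntegral.integral_sub h1 h2]
  refine (norm_intervalIntegral_le (hw.sub hy) h0 ht).trans_eq ?_
  rw [eLpNorm_one_eq_lintegral_enorm, ← integral_norm_eq_lintegral_enorm (hw.sub hy).1]

end Primitive

/-- The data and the assumptions of the evolution problem, with the bilinear forms of the
quadratic functionals and with a decomposition of the load. -/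
structure Frame (U H Z : Type*) [NormedAddCommGroup U] [NormedSpace ℝ U]
    [NormedAddCommGroup H] [InnerProductSpace ℝ H]
    [NormedAddCommGroup Z] [NormedSpace ℝ Z] where
  P : Problem U H Z
  K : H →L[ℝ] H →L[ℝ] ℝ
  Q : (U × Z) →L[ℝ] (U × Z) →L[ℝ] ℝ
  f₁ : ℝ → StrongDual ℝ U
  f₂ : ℝ → StrongDual ℝ H
  T_pos : 0 < P.T
  inj : Function.Injective P.ι
  dense : DenseRange P.ι
  hK : IsCoerciveForm K
  kin_eq : ∀ h, P.kin h = K h h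
  hQ : IsCoerciveForm Q
  phi_eq : ∀ x, P.Φ x = Q x x
  hp₁ : 1 < P.p₁
  hp₂ : 1 < P.p₂
  hΨ₁ : IsDissipationPotential P.p₁ P.Ψ₁
  hΨ₂ : IsDissipationPotential P.p₂ P.Ψ₂
  growth : ∃ C : ℝ, ∀ v : U, ∀ ξ ∈ subdiff P.Ψ₁ v, ‖ξ‖ ≤ C * (1 + ‖v‖ ^ (P.p₁ - 1))
  memLp_f₁ : MemLp f₁ P.conj₁ (timeMeasure P.T)
  memLp_f₂ : MemLp f₂ 1 (timeMeasure P.T)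
  f_eq : P.f =ᵐ[timeMeasure P.T] fun t => f₁ t + (f₂ t).comp P.ι
  memLp_g : MemLp P.g P.conj₂ (timeMeasure P.T)

/-- Velocities of `u` and `z`, the dual velocity, and the terminal velocity in `H`. -/
abbrev Traj (U H Z : Type*) [NormedAddCommGroup U] [NormedSpace ℝ U] : Type _ :=
  (ℝ → U) × (ℝ → Z) × (ℝ → StrongDual ℝ U) × H

variable {U H Z : Type*} [NormedAddCommGroup U] [NormedSpace ℝ U]
  [NormedAddCommGroup H] [InnerProductSpace ℝ H]
  [NormedAddCommGroup Z] [NormedSpace ℝ Z]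

namespace Traj

/-- The velocity of `u`. -/
abbrev w (A : Traj U H Z) : ℝ → U := A.1

/-- The velocity of `z`. -/
abbrev y (A : Traj U H Z) : ℝ → Z := A.2.1

/-- The derivative of the momentum, without the load. -/
abbrev ζ (A : Traj U H Z) : ℝ → StrongDual ℝ U := A.2.2.1

/-- The terminal velocity. -/
abbrev vT (A : Traj U H Z) : H := A.2.2.2

end Traj

namespace Frame

variable (F : Frame U H Z)

/-- The measure of the time interval. -/
noncomputable abbrev μ : Measure ℝ := timeMeasure F.P.T

/-- `h ↦ 𝒯' h` as a map from `H` to the dual of `U`. -/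
noncomputable def dK : H →L[ℝ] U →L[ℝ] ℝ :=
  (2 : ℝ) • F.K.bilinearComp (ContinuousLinearMap.id ℝ H) F.P.ι

@[simp] theorem dK_apply (h : H) (x : U) : F.dK h x = 2 * F.K h (F.P.ι x) := by
  simp [dK]

theorem dKin_eq (h : H) : F.P.dKin h = F.dK h := by
  have h1 : F.P.kin = fun h => F.K h h := funext F.kin_eq
  ext x
  rw [Problem.dKin, h1, (hasFDerivAt_form F.hK h).fderiv]
  simp

theorem dPhiU_apply (u : U) (z : Z) (x : U) : F.P.dPhiU u z x = 2 * F.Q (u, z) (x, 0) := by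
  have h1 : (fun x => F.P.Φ (x, z)) = fun x => F.Q (x, z) (x, z) := funext fun x => F.phi_eq _
  have h2 : HasFDerivAt (fun x : U => (x, z)) (ContinuousLinearMap.inl ℝ U Z) u :=
    hasFDerivAt_prodMk_left u z
  have h3 : HasFDerivAt (fun x : U => F.Q (x, z) (x, z)) _ u :=
    HasFDerivAt.comp (g := fun y : U × Z => F.Q y y) u (hasFDerivAt_form F.hQ (u, z)) h2
  rw [Problem.dPhiU, h1, h3.fderiv]
  simp

theorem dPhiZ_apply (u : U) (z : Z) (x : Z) : F.P.dPhiZ u z x = 2 * F.Q (u, z) (0, x) := by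
  have h1 : (fun y => F.P.Φ (u, y)) = fun y => F.Q (u, y) (u, y) := funext fun x => F.phi_eq _
  have h2 : HasFDerivAt (fun y : Z => (u, y)) (ContinuousLinearMap.inr ℝ U Z) z :=
    hasFDerivAt_prodMk_right u z
  have h3 : HasFDerivAt (fun y : Z => F.Q (u, y) (u, y)) _ z :=
    HasFDerivAt.comp (g := fun y : U × Z => F.Q y y) z (hasFDerivAt_form F.hQ (u, z)) h2
  rw [Problem.dPhiZ, h1, h3.fderiv]
  simp

theorem holder₁ : F.P.q₁⁻¹ + F.P.conj₁⁻¹ = 1 := holder_ofReal F.hp₁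

theorem holder₂ : F.P.q₂⁻¹ + F.P.conj₂⁻¹ = 1 := holder_ofReal F.hp₂

theorem one_le_q₁ : 1 ≤ F.P.q₁ := by simpa [Problem.q₁] using F.hp₁.le

theorem one_le_q₂ : 1 ≤ F.P.q₂ := by simpa [Problem.q₂] using F.hp₂.le

theorem one_le_conj₁ : 1 ≤ F.P.conj₁ := by
  simpa [Problem.conj₁] using (one_lt_conj F.hp₁).le

theorem one_le_conj₂ : 1 ≤ F.P.conj₂ := by
  simpa [Problem.conj₂] using (one_lt_conj F.hp₂).le

theorem zero_mem : (0 : ℝ) ∈ Icc 0 F.P.T := ⟨le_rfl, F.T_pos.le⟩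

theorem T_mem : F.P.T ∈ Icc 0 F.P.T := ⟨F.T_pos.le, le_rfl⟩

/-- The total load. -/
def load (t : ℝ) : StrongDual ℝ U := F.f₁ t + (F.f₂ t).comp F.P.ι

theorem integrable_f₁ : Integrable F.f₁ F.μ := F.memLp_f₁.integrable F.one_le_conj₁

theorem integrable_f₂ : Integrable F.f₂ F.μ := memLp_one_iff_integrable.mp F.memLp_f₂

theorem integrable_f₂_comp : Integrable (fun t => ((F.f₂ t).comp F.P.ι : StrongDual ℝ U)) F.μ :=
  ((ContinuousLinearMap.compL ℝ U H ℝ).flip F.P.ι).integrable_comp F.integrable_f₂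

theorem integrable_load : Integrable F.load F.μ :=
  F.integrable_f₁.add (g := fun t => ((F.f₂ t).comp F.P.ι : StrongDual ℝ U)) F.integrable_f₂_comp

/-- The state `(u, z)`. -/
noncomputable def state (A : Traj U H Z) (t : ℝ) : U × Z :=
  (primitive F.P.u₀ A.w t, primitive F.P.z₀ A.y t)

/-- The momentum `𝒯' v`. -/
noncomputable def mom (A : Traj U H Z) (t : ℝ) : StrongDual ℝ U :=
  primitive (F.dK F.P.v₀) (fun s => A.ζ s + F.load s) t

/-- The total dissipation. -/
noncomputable def pot (a : ℝ → U) (b : ℝ → Z) : ℝ≥0∞ :=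
  ∫⁻ t, (F.P.Ψ₁ (a t) + F.P.Ψ₂ (b t)) ∂F.μ

/-- The affine part of the variational inequality. -/
noncomputable def lin (A : Traj U H Z) (a : ℝ → U) (b : ℝ → Z) : ℝ :=
  (∫ t, A.ζ t (a t) ∂F.μ) + (∫ t, 2 * F.Q (F.state A t) (a t, b t) ∂F.μ)
    + (∫ t, F.f₁ t (A.w t) ∂F.μ) + (∫ t, F.f₂ t (F.P.ι (A.w t)) ∂F.μ) + (∫ t, F.P.g t (A.y t) ∂F.μ)
    - (∫ t, F.P.g t (b t) ∂F.μ) + F.K F.P.v₀ F.P.v₀ + F.Q (F.P.u₀, F.P.z₀) (F.P.u₀, F.P.z₀)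

/-- A-priori bounds. -/
structure IsBdd (R : ℝ) (A : Traj U H Z) : Prop where
  memLp_w : MemLp A.w F.P.q₁ F.μ
  le_w : eLpNorm A.w F.P.q₁ F.μ ≤ ENNReal.ofReal R
  memLp_y : MemLp A.y F.P.q₂ F.μ
  le_y : eLpNorm A.y F.P.q₂ F.μ ≤ ENNReal.ofReal R
  memLp_ζ : MemLp A.ζ F.P.conj₁ F.μ
  le_ζ : eLpNorm A.ζ F.P.conj₁ F.μ ≤ ENNReal.ofReal R
  bdd : ∀ᵐ t ∂F.μ, ‖F.P.ι (A.w t)‖ ≤ R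
  bdd_vT : ‖A.vT‖ ≤ R

/-- Approximate solutions of the variational inequality; for `δ = 0` these are the solutions. -/
structure IsApprox (R δ : ℝ) (A : Traj U H Z) : Prop extends F.IsBdd R A where
  pot_ne : F.pot A.w A.y ≠ ∞
  mom_T : F.dK A.vT = F.mom A F.P.T
  mom_ae : ∫ t, ‖F.dK (F.P.ι (A.w t)) - F.mom A t‖ ∂F.μ ≤ δ
  vi : ∀ a b, MemLp a F.P.q₁ F.μ → MemLp b F.P.q₂ F.μ → F.pot a b ≠ ∞ →
    F.K A.vT A.vT + F.Q (F.state A F.P.T) (F.state A F.P.T) + (F.pot A.w A.y).toReal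
      ≤ (F.pot a b).toReal + F.lin A a b
        + δ * ((eLpNorm a F.P.q₁ F.μ).toReal + (eLpNorm b F.P.q₂ F.μ).toReal)

variable {F} {R δ : ℝ} {A B : Traj U H Z}

theorem IsApprox.mono (h : F.IsApprox R δ A) {δ' : ℝ} (hδ : δ ≤ δ') : F.IsApprox R δ' A :=
  { h with
    mom_ae := h.mom_ae.trans hδ
    vi := fun a b ha hb hab => (h.vi a b ha hb hab).trans (by gcongr) }

namespace IsBdd

theorem integrable_w (h : F.IsBdd R A) : Integrable A.w F.μ := h.memLp_w.integrable F.one_le_q₁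

theorem integrable_y (h : F.IsBdd R A) : Integrable A.y F.μ := h.memLp_y.integrable F.one_le_q₂

theorem integrable_ζ (h : F.IsBdd R A) : Integrable A.ζ F.μ := h.memLp_ζ.integrable F.one_le_conj₁

theorem integrable_ζ_load (h : F.IsBdd R A) : Integrable (fun t => A.ζ t + F.load t) F.μ :=
  h.integrable_ζ.add (g := F.load) F.integrable_load

theorem memLp_ιw (h : F.IsBdd R A) : MemLp (fun t => F.P.ι (A.w t)) ∞ F.μ :=
  memLp_top_of_bound (F.P.ι.continuous.comp_aestronglyMeasurable h.memLp_w.1) R h.bdd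

theorem continuousOn_state (h : F.IsBdd R A) : ContinuousOn (F.state A) (Icc 0 F.P.T) :=
  (continuousOn_primitive' _ h.integrable_w).prodMk (continuousOn_primitive' _ h.integrable_y)

theorem continuousOn_mom (h : F.IsBdd R A) : ContinuousOn (F.mom A) (Icc 0 F.P.T) :=
  continuousOn_primitive' _ h.integrable_ζ_load

theorem integrable_state (h : F.IsBdd R A) {a : ℝ → U} {b : ℝ → Z} (ha : Integrable a F.μ)
    (hb : Integrable b F.μ) : Integrable (fun t => 2 * F.Q (F.state A t) (a t, b t)) F.μ := by
  have h1 : MemLp (fun t => F.Q (F.state A t)) ∞ F.μ :=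
    memLp_of_continuousOn (F.Q.continuous.comp_continuousOn h.continuousOn_state) _
  exact (integrable_pairing (p := 1) (q := ∞) (by simp) h1
    (memLp_one_iff_integrable.mpr (ha.prodMk hb))).const_mul 2

theorem integrable_mom_sub (h : F.IsBdd R A) :
    Integrable (fun t => F.dK (F.P.ι (A.w t)) - F.mom A t) F.μ :=
  ((F.dK.comp F.P.ι).integrable_comp h.integrable_w).sub
    (integrable_of_continuousOn h.continuousOn_mom)

end IsBdd

/-- The state is affine, not linear, in the velocities: the initial value enters with weight `a + b
= 1`. -/
theorem state_combo (hA : F.IsBdd R A) {R' : ℝ} (hB : F.IsBdd R' B) {a b : ℝ} (hab : a + b = 1) {t : ℝ}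
    (ht : t ∈ Icc 0 F.P.T) :
    F.state (a • A + b • B) t = a • F.state A t + b • F.state B t :=
  Prod.ext (primitive_combo hab hA.integrable_w hB.integrable_w ht)
    (primitive_combo hab hA.integrable_y hB.integrable_y ht)

theorem mom_combo (hA : F.IsBdd R A) {R' : ℝ} (hB : F.IsBdd R' B) {a b : ℝ} (hab : a + b = 1) {t : ℝ}
    (ht : t ∈ Icc 0 F.P.T) :
    F.mom (a • A + b • B) t = a • F.mom A t + b • F.mom B t := by
  have h := primitive_combo (c := F.dK F.P.v₀) hab hA.integrable_ζ_load hB.integrable_ζ_load ht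
  rw [mom, mom, mom, ← h]
  congr 1
  funext s
  have : F.load s = a • F.load s + b • F.load s := by rw [← add_smul, hab, one_smul]
  change a • A.ζ s + b • B.ζ s + F.load s = _
  rw [smul_add, smul_add, add_add_add_comm, ← this]

theorem integral_combo {Φ₁ Φ₂ : ℝ → ℝ} (h₁ : Integrable Φ₁ F.μ) (h₂ : Integrable Φ₂ F.μ)
    (a b : ℝ) : ∫ t, (a * Φ₁ t + b * Φ₂ t) ∂F.μ = a * ∫ t, Φ₁ t ∂F.μ + b * ∫ t, Φ₂ t ∂F.μ := by
  rw [integral_add (h₁.const_mul a) (h₂.const_mul b), integral_const_mul, integral_const_mul]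

/-- For fixed tests every integral that contains the trajectory is affine in it; the remaining terms
are constants and use `c + d = 1`. Only affine combinations are needed for convexity of the set of
approximate solutions. -/
theorem lin_combo (hA : F.IsBdd R A) {R' : ℝ} (hB : F.IsBdd R' B) {c d : ℝ} (hcd : c + d = 1) {a : ℝ → U}
    {b : ℝ → Z} (ha : MemLp a F.P.q₁ F.μ) (hb : MemLp b F.P.q₂ F.μ) :
    F.lin (c • A + d • B) a b = c * F.lin A a b + d * F.lin B a b := by
  have hq : (∞ : ℝ≥0∞)⁻¹ + (1 : ℝ≥0∞)⁻¹ = 1 := by simp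
  have e1 := integral_combo (integrable_pairing F.holder₁ hA.memLp_ζ ha)
    (integrable_pairing F.holder₁ hB.memLp_ζ ha) c d
  have e2 := integral_combo (hA.integrable_state (ha.integrable F.one_le_q₁)
    (hb.integrable F.one_le_q₂)) (hB.integrable_state (ha.integrable F.one_le_q₁)
    (hb.integrable F.one_le_q₂)) c d
  have e3 := integral_combo (integrable_pairing F.holder₁ F.memLp_f₁ hA.memLp_w)
    (integrable_pairing F.holder₁ F.memLp_f₁ hB.memLp_w) c d
  have e4 := integral_combo (integrable_pairing hq F.memLp_f₂ hA.memLp_ιw)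
    (integrable_pairing hq F.memLp_f₂ hB.memLp_ιw) c d
  have e5 := integral_combo (integrable_pairing F.holder₂ F.memLp_g hA.memLp_y)
    (integrable_pairing F.holder₂ F.memLp_g hB.memLp_y) c d
  have i1 : ∫ t, (c • A + d • B).ζ t (a t) ∂F.μ
      = ∫ t, (c * A.ζ t (a t) + d * B.ζ t (a t)) ∂F.μ := rfl
  have i2 : ∫ t, 2 * F.Q (F.state (c • A + d • B) t) (a t, b t) ∂F.μ
      = ∫ t, (c * (2 * F.Q (F.state A t) (a t, b t))
        + d * (2 * F.Q (F.state B t) (a t, b t))) ∂F.μ := by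
    refine integral_congr_ae ?_
    filter_upwards [ae_timeMeasure_mem] with t ht
    rw [state_combo hA hB hcd ht]
    simp only [map_add, map_smul, add_apply, smul_apply, smul_eq_mul]
    ring
  have i3 : ∫ t, F.f₁ t ((c • A + d • B).w t) ∂F.μ
      = ∫ t, (c * F.f₁ t (A.w t) + d * F.f₁ t (B.w t)) ∂F.μ :=
    integral_congr_ae (Eventually.of_forall fun t => by
      change F.f₁ t (c • A.w t + d • B.w t) = _; simp)
  have i4 : ∫ t, F.f₂ t (F.P.ι ((c • A + d • B).w t)) ∂F.μ
      = ∫ t, (c * F.f₂ t (F.P.ι (A.w t)) + d * F.f₂ t (F.P.ι (B.w t))) ∂F.μ :=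
    integral_congr_ae (Eventually.of_forall fun t => by
      change F.f₂ t (F.P.ι (c • A.w t + d • B.w t)) = _; simp)
  have i5 : ∫ t, F.P.g t ((c • A + d • B).y t) ∂F.μ
      = ∫ t, (c * F.P.g t (A.y t) + d * F.P.g t (B.y t)) ∂F.μ :=
    integral_congr_ae (Eventually.of_forall fun t => by
      change F.P.g t (c • A.y t + d • B.y t) = _; simp)
  rw [lin, i1, i2, i3, i4, i5, e1, e2, e3, e4, e5, lin, lin]
  obtain rfl : d = 1 - c := by linarith
  ring

theorem eLpNorm_combo_le {X : Type*} [NormedAddCommGroup X] [NormedSpace ℝ X] {p : ℝ≥0∞}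
    (hp : 1 ≤ p) {x y : ℝ → X} (hx : MemLp x p F.μ) (hy : MemLp y p F.μ)
    (hxR : eLpNorm x p F.μ ≤ ENNReal.ofReal R) (hyR : eLpNorm y p F.μ ≤ ENNReal.ofReal R)
    {a b : ℝ} (ha : 0 ≤ a) (hb : 0 ≤ b) (hab : a + b = 1) :
    eLpNorm (a • x + b • y) p F.μ ≤ ENNReal.ofReal R := by
  refine (eLpNorm_add_le (hx.const_smul a).1 (hy.const_smul b).1 hp).trans ?_
  rw [eLpNorm_const_smul, eLpNorm_const_smul, Real.enorm_of_nonneg ha, Real.enorm_of_nonneg hb]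
  calc ENNReal.ofReal a * eLpNorm x p F.μ + ENNReal.ofReal b * eLpNorm y p F.μ
      ≤ ENNReal.ofReal a * ENNReal.ofReal R + ENNReal.ofReal b * ENNReal.ofReal R := by gcongr
    _ = ENNReal.ofReal R := by
      rw [← add_mul, ← ENNReal.ofReal_add ha hb, hab, ENNReal.ofReal_one, one_mul]

/-- A lower semicontinuous function is Borel, and strongly measurable functions are measurable for
the Borel σ-algebra, which is put on the space locally. -/
theorem aemeasurable_comp_lsc {X : Type*} [NormedAddCommGroup X] {Ψ : X → ℝ≥0∞}
    (hΨ : LowerSemicontinuous Ψ) {w : ℝ → X} {μ : Measure ℝ} (hw : AEStronglyMeasurable w μ) :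
    AEMeasurable (fun t => Ψ (w t)) μ := by
  letI : MeasurableSpace X := borel X
  haveI : BorelSpace X := ⟨rfl⟩
  exact hΨ.measurable.comp_aemeasurable hw.aemeasurable

theorem aemeasurable_pot {a : ℝ → U} {b : ℝ → Z} (ha : AEStronglyMeasurable a F.μ)
    (hb : AEStronglyMeasurable b F.μ) :
    AEMeasurable (fun t => F.P.Ψ₁ (a t) + F.P.Ψ₂ (b t)) F.μ :=
  (aemeasurable_comp_lsc F.hΨ₁.lsc ha).add (aemeasurable_comp_lsc F.hΨ₂.lsc hb)

theorem pot_combo_le {w w' : ℝ → U} {y y' : ℝ → Z} (hw : AEStronglyMeasurable w F.μ)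
    (hy : AEStronglyMeasurable y F.μ) (hw' : AEStronglyMeasurable w' F.μ)
    (hy' : AEStronglyMeasurable y' F.μ)
    {a b : ℝ} (ha : 0 ≤ a) (hb : 0 ≤ b) (hab : a + b = 1) :
    F.pot (a • w + b • w') (a • y + b • y')
      ≤ ENNReal.ofReal a * F.pot w y + ENNReal.ofReal b * F.pot w' y' := by
  rw [pot, pot, pot, ← lintegral_const_mul'' _ (aemeasurable_pot hw hy),
    ← lintegral_const_mul'' _ (aemeasurable_pot hw' hy'),
    ← lintegral_add_left' ((aemeasurable_pot hw hy).const_mul _)]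
  refine lintegral_mono fun t => ?_
  have h1 := convexOn_real_combo F.hΨ₁.convex (w t) (w' t) ha hb hab
  have h2 := convexOn_real_combo F.hΨ₂.convex (y t) (y' t) ha hb hab
  refine (add_le_add h1 h2).trans_eq ?_
  ring

theorem IsCoerciveForm_combo {X : Type*} [NormedAddCommGroup X] [NormedSpace ℝ X]
    {B : X →L[ℝ] X →L[ℝ] ℝ} (hB : IsCoerciveForm B) (x y : X) {a b : ℝ} (ha : 0 ≤ a)
    (hb : 0 ≤ b) (hab : a + b = 1) :
    B (a • x + b • y) (a • x + b • y) ≤ a * B x x + b * B y y := by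
  have h1 := hB.nonneg (x - y)
  rw [hB.sub_self] at h1
  have h2 : 0 ≤ a * b := mul_nonneg ha hb
  simp only [map_add, add_apply, map_smul, smul_apply, smul_eq_mul]
  rw [hB.symm y x]
  obtain rfl : b = 1 - a := by linarith
  nlinarith

theorem IsBdd.combo (hA : F.IsBdd R A) (hB : F.IsBdd R B) {a b : ℝ}
    (ha : 0 ≤ a) (hb : 0 ≤ b) (hab : a + b = 1) : F.IsBdd R (a • A + b • B) where
  memLp_w := (hA.memLp_w.const_smul a).add (hB.memLp_w.const_smul b)
  le_w := eLpNorm_combo_le F.one_le_q₁ hA.memLp_w hB.memLp_w hA.le_w hB.le_w ha hb hab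
  memLp_y := (hA.memLp_y.const_smul a).add (hB.memLp_y.const_smul b)
  le_y := eLpNorm_combo_le F.one_le_q₂ hA.memLp_y hB.memLp_y hA.le_y hB.le_y ha hb hab
  memLp_ζ := (hA.memLp_ζ.const_smul a).add (hB.memLp_ζ.const_smul b)
  le_ζ := eLpNorm_combo_le F.one_le_conj₁ hA.memLp_ζ hB.memLp_ζ hA.le_ζ hB.le_ζ ha hb hab
  bdd := by
    filter_upwards [hA.bdd, hB.bdd] with t h1 h2
    change ‖F.P.ι (a • A.w t + b • B.w t)‖ ≤ R
    rw [map_add, map_smul, map_smul]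
    have := convex_closedBall (0 : H) R (mem_closedBall_zero_iff.mpr h1)
      (mem_closedBall_zero_iff.mpr h2) ha hb hab
    exact mem_closedBall_zero_iff.mp this
  bdd_vT := mem_closedBall_zero_iff.mp <| convex_closedBall (0 : H) R
    (mem_closedBall_zero_iff.mpr hA.bdd_vT) (mem_closedBall_zero_iff.mpr hB.bdd_vT) ha hb hab

/-- The set of approximate solutions is convex. -/
theorem convex_isApprox (F : Frame U H Z) (R δ : ℝ) : Convex ℝ {A | F.IsApprox R δ A} := by
  intro A hA B hB a b ha hb hab
  rw [mem_setOf_eq] at hA hB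
  have hbd := hA.toIsBdd.combo hB.toIsBdd ha hb hab
  have hpot : F.pot (a • A + b • B).w (a • A + b • B).y
      ≤ ENNReal.ofReal a * F.pot A.w A.y + ENNReal.ofReal b * F.pot B.w B.y :=
    pot_combo_le hA.memLp_w.1 hA.memLp_y.1 hB.memLp_w.1 hB.memLp_y.1 ha hb hab
  have hne : ENNReal.ofReal a * F.pot A.w A.y + ENNReal.ofReal b * F.pot B.w B.y ≠ ∞ :=
    ENNReal.add_ne_top.mpr ⟨ENNReal.mul_ne_top ENNReal.ofReal_ne_top hA.pot_ne,
      ENNReal.mul_ne_top ENNReal.ofReal_ne_top hB.pot_ne⟩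
  have hpotR := ENNReal.toReal_mono hne hpot
  rw [ENNReal.toReal_add (ENNReal.mul_ne_top ENNReal.ofReal_ne_top hA.pot_ne)
    (ENNReal.mul_ne_top ENNReal.ofReal_ne_top hB.pot_ne), ENNReal.toReal_mul, ENNReal.toReal_mul,
    ENNReal.toReal_ofReal ha, ENNReal.toReal_ofReal hb] at hpotR
  refine ⟨hbd, ne_top_of_le_ne_top hne hpot, ?_, ?_, ?_⟩
  · rw [mom_combo hA.toIsBdd hB.toIsBdd hab F.T_mem, ← hA.mom_T, ← hB.mom_T]
    change F.dK (a • A.vT + b • B.vT) = _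
    rw [map_add, map_smul, map_smul]
  · have h1 : ∫ t, ‖F.dK (F.P.ι ((a • A + b • B).w t)) - F.mom (a • A + b • B) t‖ ∂F.μ
        ≤ ∫ t, (a * ‖F.dK (F.P.ι (A.w t)) - F.mom A t‖
          + b * ‖F.dK (F.P.ι (B.w t)) - F.mom B t‖) ∂F.μ := by
      refine integral_mono_ae hbd.integrable_mom_sub.norm
        ((hA.integrable_mom_sub.norm.const_mul a).add (hB.integrable_mom_sub.norm.const_mul b)) ?_
      filter_upwards [ae_timeMeasure_mem] with t ht
      rw [mom_combo hA.toIsBdd hB.toIsBdd hab ht]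
      have e : F.dK (F.P.ι ((a • A + b • B).w t)) - (a • F.mom A t + b • F.mom B t)
          = a • (F.dK (F.P.ι (A.w t)) - F.mom A t) + b • (F.dK (F.P.ι (B.w t)) - F.mom B t) := by
        change F.dK (F.P.ι (a • A.w t + b • B.w t)) - _ = _
        simp only [map_add, map_smul, smul_sub]
        abel
      rw [e]
      refine (norm_add_le _ _).trans ?_
      rw [norm_smul, norm_smul, Real.norm_of_nonneg ha, Real.norm_of_nonneg hb]
    rw [integral_combo hA.integrable_mom_sub.norm hB.integrable_mom_sub.norm] at h1
    have h2 := hA.mom_ae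
    have h3 := hB.mom_ae
    have h4 : a * δ + b * δ = δ := by rw [← add_mul, hab, one_mul]
    linarith [mul_le_mul_of_nonneg_left h2 ha, mul_le_mul_of_nonneg_left h3 hb]
  -- For fixed tests the left side is convex in the trajectory and the right side affine, so the two
  -- inequalities can be averaged.
  · intro x z hx hz hxz
    have h1 := hA.vi x z hx hz hxz
    have h2 := hB.vi x z hx hz hxz
    rw [lin_combo hA.toIsBdd hB.toIsBdd hab hx hz, state_combo hA.toIsBdd hB.toIsBdd hab F.T_mem]
    have h3 := IsCoerciveForm_combo F.hK A.vT B.vT ha hb hab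
    have h4 := IsCoerciveForm_combo F.hQ (F.state A F.P.T) (F.state B F.P.T) ha hb hab
    change F.K (a • A.vT + b • B.vT) (a • A.vT + b • B.vT) + _ + _ ≤ _
    have h5 := mul_le_mul_of_nonneg_left h1 ha
    have h6 := mul_le_mul_of_nonneg_left h2 hb
    set N := δ * ((eLpNorm x F.P.q₁ F.μ).toReal + (eLpNorm z F.P.q₂ F.μ).toReal)
    set I := (F.pot x z).toReal
    have h7 : a * (I + F.lin A x z + N) + b * (I + F.lin B x z + N)
        = I + (a * F.lin A x z + b * F.lin B x z) + N := by
      obtain rfl : b = 1 - a := by linarith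
      ring
    linarith

end Frame

end

/-! ### Convergence of trajectories. -/

section

theorem memLp_clm {X Y : Type*} [NormedAddCommGroup X] [NormedSpace ℝ X] [NormedAddCommGroup Y]
    [NormedSpace ℝ Y] (L : X →L[ℝ] Y) {p : ℝ≥0∞} {μ : Measure ℝ} {a : ℝ → X} (ha : MemLp a p μ) :
    MemLp (fun t => L (a t)) p μ := L.comp_memLp' ha

theorem lintegral_lsc_le_liminf {X : Type*} [NormedAddCommGroup X] {Ψ : X → ℝ≥0∞}
    (hΨ : LowerSemicontinuous Ψ) {μ : Measure ℝ} {x : ℕ → ℝ → X} {x₀ : ℝ → X}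
    (hx : ∀ n, AEStronglyMeasurable (x n) μ)
    (hlim : ∀ᵐ t ∂μ, Tendsto (fun n => x n t) atTop (𝓝 (x₀ t))) :
    ∫⁻ t, Ψ (x₀ t) ∂μ ≤ liminf (fun n => ∫⁻ t, Ψ (x n t) ∂μ) atTop := by
  refine le_trans ?_ (lintegral_liminf_le' fun n => Frame.aemeasurable_comp_lsc hΨ (hx n))
  refine lintegral_mono_ae ?_
  filter_upwards [hlim] with t ht
  exact ((lowerSemicontinuous_iff_le_liminf.mp hΨ) (x₀ t)).trans
    (liminf_le_liminf_of_le (u := Ψ) ht)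

namespace Frame

variable {U H Z : Type*} [NormedAddCommGroup U] [NormedSpace ℝ U]
  [NormedAddCommGroup H] [InnerProductSpace ℝ H]
  [NormedAddCommGroup Z] [NormedSpace ℝ Z] {F : Frame U H Z} {R δ : ℝ} {A B : Traj U H Z}

theorem pot_le_liminf {w : ℕ → ℝ → U} {y : ℕ → ℝ → Z} {w₀ : ℝ → U} {y₀ : ℝ → Z}
    (hw : ∀ n, AEStronglyMeasurable (w n) F.μ) (hy : ∀ n, AEStronglyMeasurable (y n) F.μ)
    (hwl : ∀ᵐ t ∂F.μ, Tendsto (fun n => w n t) atTop (𝓝 (w₀ t)))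
    (hyl : ∀ᵐ t ∂F.μ, Tendsto (fun n => y n t) atTop (𝓝 (y₀ t))) :
    F.pot w₀ y₀ ≤ liminf (fun n => F.pot (w n) (y n)) atTop := by
  have h1 : LowerSemicontinuous fun x : U × Z => F.P.Ψ₁ x.1 + F.P.Ψ₂ x.2 :=
    (F.hΨ₁.lsc.comp continuous_fst).add (F.hΨ₂.lsc.comp continuous_snd)
  exact lintegral_lsc_le_liminf h1 (x := fun n t => (w n t, y n t)) (x₀ := fun t => (w₀ t, y₀ t))
    (fun n => (hw n).prodMk (hy n)) (by
      filter_upwards [hwl, hyl] with t h1 h2 using h1.prodMk_nhds h2)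

theorem abs_dK_le (F : Frame U H Z) (h : H) (x : U) :
    |F.dK h x| ≤ 2 * ‖F.K‖ * ‖h‖ * ‖F.P.ι x‖ := by
  rw [dK_apply, abs_mul, abs_two]
  have := IsCoerciveForm.abs_le F.K h (F.P.ι x)
  linarith

/-- `U` is dense in `H`: a functional `K h` that vanishes on the image of `ι` vanishes on `H`, and
coercivity gives `h = 0`. -/
theorem dK_injective (F : Frame U H Z) : Function.Injective F.dK := by
  rw [injective_iff_map_eq_zero]
  intro h hh
  have h1 : ∀ k, F.K h k = 0 := by
    have h2 : (fun k => F.K h k) = fun _ => 0 :=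
      F.dense.equalizer (F.K h).continuous continuous_const (funext fun x => by
        have := DFunLike.congr_fun hh x
        rw [dK_apply] at this
        simpa using this)
    exact fun k => congrFun h2 k
  exact F.hK.eq_zero (h1 h).le

variable [CompleteSpace H]

/-- Functionals on `U` that are bounded in the norm of `H` are given by elements of `H`. -/
theorem exists_dK_eq (F : Frame U H Z) : ∃ C : ℝ, 0 ≤ C ∧ ∀ (M : ℝ) (ξ : StrongDual ℝ U), 0 ≤ M →
    (∀ x, |ξ x| ≤ M * ‖F.P.ι x‖) → ∃ h, F.dK h = ξ ∧ ‖h‖ ≤ C * M := by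
  obtain ⟨c, hc, hcK⟩ := F.hK.coercive
  refine ⟨(2 * c)⁻¹, by positivity, fun M ξ hM hξ => ?_⟩
  -- As `ι` is injective, `ξ` descends to its range, where it is bounded in the norm of `H`.
  -- Hahn–Banach extends it and the Riesz map of `K` represents it; the factor `2⁻¹` below
  -- compensates the `2` in `dK`.
  set e := LinearEquiv.ofInjective (F.P.ι : U →ₗ[ℝ] H) F.inj with he
  have hes : ∀ x : LinearMap.range (F.P.ι : U →ₗ[ℝ] H), F.P.ι (e.symm x) = x := fun x =>
    congrArg Subtype.val (e.apply_symm_apply x)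
  obtain ⟨g, hg, hgn⟩ := _root_.exists_extension_norm_eq (LinearMap.range (F.P.ι : U →ₗ[ℝ] H))
    (LinearMap.mkContinuous ((ξ : U →ₗ[ℝ] ℝ).comp e.symm.toLinearMap) M fun x => by
      have := hξ (e.symm x)
      rw [hes] at this
      exact this)
  have hgM : ‖g‖ ≤ M := hgn.trans_le (LinearMap.mkContinuous_norm_le _ hM _)
  set k := F.hK.equiv.symm g with hk
  have hKk : F.K k = g := F.hK.equiv_symm_apply g
  have hgι : ∀ x, g (F.P.ι x) = ξ x := fun x => by
    have h1 := hg ⟨F.P.ι x, x, rfl⟩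
    have h2 : e.symm ⟨F.P.ι x, x, rfl⟩ = x := F.inj (hes _)
    rw [h1]
    change ξ (e.symm _) = ξ x
    rw [h2]
  refine ⟨(2⁻¹ : ℝ) • k, ?_, ?_⟩
  · ext x
    rw [dK_apply, map_smul, smul_apply, hKk, hgι, smul_eq_mul]
    ring
  · have h1 := hcK k
    rw [hKk] at h1
    have h2 : c * ‖k‖ ^ 2 ≤ M * ‖k‖ := h1.trans ((le_abs_self _).trans
      ((dual_apply_le g k).trans (by gcongr)))
    have h3 : c * ‖k‖ ≤ M := by
      rcases (norm_nonneg k).eq_or_lt with h0 | h0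
      · rw [← h0]; simpa using hM
      · exact le_of_mul_le_mul_right (by nlinarith) h0
    rw [norm_smul, norm_inv, Real.norm_two, mul_inv, mul_assoc]
    gcongr
    rwa [le_inv_mul_iff₀ hc]

/-- Bounded sequences converge weakly in `H` if they converge when tested with elements of `U`. -/
theorem tendsto_of_dK {α : Type*} {l : Filter α} {v : α → H} {h : H} {M : ℝ}
    (hb : ∀ᶠ a in l, ‖v a‖ ≤ M)
    (hx : ∀ x, Tendsto (fun a => F.dK (v a) x) l (𝓝 (F.dK h x))) (ℓ : StrongDual ℝ H) :
    Tendsto (fun a => ℓ (v a)) l (𝓝 (ℓ h)) := by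
  obtain ⟨k, rfl⟩ := F.hK.surjective ℓ
  rw [Metric.tendsto_nhds]
  intro ε hε
  set L := ‖F.K‖ * (|M| + ‖h‖) + 1 with hL
  have hL0 : 0 < L := by positivity
  obtain ⟨x, hxk⟩ := F.dense.exists_dist_lt k (show 0 < ε / (2 * L) by positivity)
  filter_upwards [hb, Metric.tendsto_nhds.mp (hx x) ε hε] with a ha hax
  rw [Real.dist_eq] at hax ⊢
  have e : F.K k (v a) - F.K k h = F.K (v a - h) (k - F.P.ι x)
      + 2⁻¹ * (F.dK (v a) x - F.dK h x) := by
    rw [F.hK.symm k, F.hK.symm k]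
    simp only [map_sub, sub_apply, dK_apply]
    ring
  rw [e]
  have h1 := IsCoerciveForm.abs_le F.K (v a - h) (k - F.P.ι x)
  rw [dist_eq_norm] at hxk
  have h2 : ‖v a - h‖ ≤ |M| + ‖h‖ := (norm_sub_le _ _).trans (by gcongr; exact ha.trans (le_abs_self _))
  have h3 : ‖F.K‖ * ‖v a - h‖ * ‖k - F.P.ι x‖ ≤ L * (ε / (2 * L)) := by
    refine mul_le_mul ?_ hxk.le (norm_nonneg _) hL0.le
    rw [hL]
    have := mul_le_mul_of_nonneg_left h2 (norm_nonneg F.K)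
    linarith
  have h4 : L * (ε / (2 * L)) = ε / 2 := by field_simp
  calc |F.K (v a - h) (k - F.P.ι x) + 2⁻¹ * (F.dK (v a) x - F.dK h x)|
      ≤ |F.K (v a - h) (k - F.P.ι x)| + |2⁻¹ * (F.dK (v a) x - F.dK h x)| := abs_add_le _ _
    _ < ε := by
      rw [abs_mul, abs_of_pos (show (0 : ℝ) < 2⁻¹ by norm_num)]
      linarith

/-- Convergence of bounded approximate trajectories. -/
structure Tends (F : Frame U H Z) (R : ℝ) (A' : ℕ → Traj U H Z) (A : Traj U H Z) : Prop where
  bdd_n : ∀ n, F.IsBdd R (A' n)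
  bdd : F.IsBdd R A
  w_L1 : Tendsto (fun n => eLpNorm ((A' n).w - A.w) 1 F.μ) atTop (𝓝 0)
  w_ae : ∀ᵐ t ∂F.μ, Tendsto (fun n => (A' n).w t) atTop (𝓝 (A.w t))
  y_L1 : Tendsto (fun n => eLpNorm ((A' n).y - A.y) 1 F.μ) atTop (𝓝 0)
  y_ae : ∀ᵐ t ∂F.μ, Tendsto (fun n => (A' n).y t) atTop (𝓝 (A.y t))
  ζ_L1 : Tendsto (fun n => eLpNorm ((A' n).ζ - A.ζ) 1 F.μ) atTop (𝓝 0)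
  vT : ∀ ℓ : StrongDual ℝ H, Tendsto (fun n => ℓ (A' n).vT) atTop (𝓝 (ℓ A.vT))

namespace Tends

variable {A' : ℕ → Traj U H Z}

theorem pairing_w (h : F.Tends R A' A) {φ : ℝ → StrongDual ℝ U} (hφ : MemLp φ F.P.conj₁ F.μ) :
    Tendsto (fun n => ∫ t, φ t ((A' n).w t) ∂F.μ) atTop (𝓝 (∫ t, φ t (A.w t) ∂F.μ)) :=
  tendsto_integral_pairing F.holder₁ ENNReal.ofReal_ne_top (fun n => (h.bdd_n n).memLp_w)
    (fun n => (h.bdd_n n).le_w) h.bdd.memLp_w h.w_L1 hφ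

theorem pairing_y (h : F.Tends R A' A) {φ : ℝ → StrongDual ℝ Z} (hφ : MemLp φ F.P.conj₂ F.μ) :
    Tendsto (fun n => ∫ t, φ t ((A' n).y t) ∂F.μ) atTop (𝓝 (∫ t, φ t (A.y t) ∂F.μ)) :=
  tendsto_integral_pairing F.holder₂ ENNReal.ofReal_ne_top (fun n => (h.bdd_n n).memLp_y)
    (fun n => (h.bdd_n n).le_y) h.bdd.memLp_y h.y_L1 hφ

/-- Elements of `U` act on the dual as elements of the bidual, so the pairing lemma applies with the
exponents exchanged. -/
theorem pairing_ζ (h : F.Tends R A' A) {a : ℝ → U} (ha : MemLp a F.P.q₁ F.μ) :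
    Tendsto (fun n => ∫ t, (A' n).ζ t (a t) ∂F.μ) atTop (𝓝 (∫ t, A.ζ t (a t) ∂F.μ)) := by
  obtain ⟨L, hL⟩ : ∃ L : U →L[ℝ] StrongDual ℝ (StrongDual ℝ U), ∀ x f, L x f = f x :=
    ⟨NormedSpace.inclusionInDoubleDual ℝ U, fun x f => NormedSpace.dual_def ℝ U x f⟩
  have h1 : MemLp (fun t => L (a t)) F.P.q₁ F.μ :=
    memLp_clm (Y := StrongDual ℝ (StrongDual ℝ U)) L ha
  have h2 := tendsto_integral_pairing (X := StrongDual ℝ U) (p := F.P.conj₁) (q := F.P.q₁)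
    (by rw [add_comm]; exact F.holder₁) ENNReal.ofReal_ne_top (fun n => (h.bdd_n n).memLp_ζ)
    (fun n => (h.bdd_n n).le_ζ) h.bdd.memLp_ζ h.ζ_L1 h1
  simpa only [hL] using h2

/-- The load `f₂` is only integrable in time, so the bound of the velocities in `H`, uniform in
time, is what makes this pairing converge. -/
theorem pairing_ιw (h : F.Tends R A' A) {φ : ℝ → StrongDual ℝ H} (hφ : MemLp φ 1 F.μ) :
    Tendsto (fun n => ∫ t, φ t (F.P.ι ((A' n).w t)) ∂F.μ) atTop
      (𝓝 (∫ t, φ t (F.P.ι (A.w t)) ∂F.μ)) := by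
  refine tendsto_integral_pairing (p := ∞) (q := 1) (K := R) (by simp) ENNReal.one_ne_top
    (fun n => (h.bdd_n n).memLp_ιw) (fun n => ?_) h.bdd.memLp_ιw ?_ hφ
  · rw [eLpNorm_exponent_top]
    refine eLpNormEssSup_le_of_ae_bound ?_
    exact (h.bdd_n n).bdd
  · have h1 := ENNReal.Tendsto.const_mul (a := ENNReal.ofReal ‖F.P.ι‖) h.w_L1
      (Or.inr ENNReal.ofReal_ne_top)
    rw [mul_zero] at h1
    refine tendsto_of_tendsto_of_tendsto_of_le_of_le tendsto_const_nhds h1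
      (fun _ => zero_le) fun n => ?_
    refine eLpNorm_le_mul_eLpNorm_of_ae_le_mul (Eventually.of_forall fun t => ?_) 1
    simp only [Pi.sub_apply, ← map_sub]
    exact F.P.ι.le_opNorm _

/-- The states converge uniformly. -/
theorem exists_state_bound (h : F.Tends R A' A) : ∃ e : ℕ → ℝ, Tendsto e atTop (𝓝 0) ∧
    ∀ n, 0 ≤ e n ∧ ∀ t ∈ Icc 0 F.P.T, ‖F.state (A' n) t - F.state A t‖ ≤ e n := by
  have h1 := ((ENNReal.tendsto_toReal ENNReal.zero_ne_top).comp h.w_L1).add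
    ((ENNReal.tendsto_toReal ENNReal.zero_ne_top).comp h.y_L1)
  simp only [ENNReal.toReal_zero, add_zero] at h1
  refine ⟨_, h1, fun n => ⟨by simp only [Function.comp]; positivity, fun t ht => ?_⟩⟩
  simp only [Function.comp]
  have h2 := norm_primitive_sub_le F.P.u₀ (h.bdd_n n).integrable_w h.bdd.integrable_w ht
  have h3 := norm_primitive_sub_le F.P.z₀ (h.bdd_n n).integrable_y h.bdd.integrable_y ht
  rw [Prod.norm_def]
  refine max_le (h2.trans (le_add_of_nonneg_right ENNReal.toReal_nonneg))
    (h3.trans (le_add_of_nonneg_left ENNReal.toReal_nonneg))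

theorem tendsto_state (h : F.Tends R A' A) {t : ℝ} (ht : t ∈ Icc 0 F.P.T) :
    Tendsto (fun n => F.state (A' n) t) atTop (𝓝 (F.state A t)) := by
  obtain ⟨e, he, hb⟩ := h.exists_state_bound
  rw [tendsto_iff_norm_sub_tendsto_zero]
  exact squeeze_zero (fun _ => norm_nonneg _) (fun n => (hb n).2 t ht) he

/-- Pairings of the states with integrable functionals converge. -/
theorem pairing_state (h : F.Tends R A' A) {φ : ℝ → StrongDual ℝ (U × Z)}
    (hφ : Integrable φ F.μ) : Tendsto (fun n => ∫ t, φ t (F.state (A' n) t) ∂F.μ) atTop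
      (𝓝 (∫ t, φ t (F.state A t) ∂F.μ)) := by
  obtain ⟨e, he, hb⟩ := h.exists_state_bound
  have hi : ∀ {B}, F.IsBdd R B → Integrable (fun t => φ t (F.state B t)) F.μ := fun hB =>
    integrable_pairing (p := ∞) (q := 1) (by simp) (memLp_one_iff_integrable.mpr hφ)
      (memLp_of_continuousOn hB.continuousOn_state _)
  rw [tendsto_iff_norm_sub_tendsto_zero]
  have h1 := he.mul_const (∫ t, ‖φ t‖ ∂F.μ)
  rw [zero_mul] at h1
  refine squeeze_zero (fun _ => norm_nonneg _) (fun n => ?_) h1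
  rw [← integral_sub (hi (h.bdd_n n)) (hi h.bdd), ← integral_const_mul]
  refine norm_integral_le_of_norm_le (hφ.norm.const_mul _) ?_
  filter_upwards [ae_timeMeasure_mem] with t ht
  rw [← map_sub]
  refine (dual_apply_le _ _).trans ?_
  rw [mul_comm]
  gcongr
  exact (hb n).2 t ht

theorem state_form (h : F.Tends R A' A) {a : ℝ → U} {b : ℝ → Z} (ha : MemLp a F.P.q₁ F.μ)
    (hb : MemLp b F.P.q₂ F.μ) :
    Tendsto (fun n => ∫ t, 2 * F.Q (F.state (A' n) t) (a t, b t) ∂F.μ) atTop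
      (𝓝 (∫ t, 2 * F.Q (F.state A t) (a t, b t) ∂F.μ)) := by
  have h1 : Integrable (fun t => (2 : ℝ) • F.Q (a t, b t)) F.μ :=
    (F.Q.integrable_comp ((ha.integrable F.one_le_q₁).prodMk (hb.integrable F.one_le_q₂))).smul
      (2 : ℝ)
  have h2 := h.pairing_state h1
  simp only [smul_apply, smul_eq_mul] at h2
  simpa only [F.hQ.symm (F.state _ _)] using h2

theorem lin (h : F.Tends R A' A) {a : ℝ → U} {b : ℝ → Z} (ha : MemLp a F.P.q₁ F.μ)
    (hb : MemLp b F.P.q₂ F.μ) :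
    Tendsto (fun n => F.lin (A' n) a b) atTop (𝓝 (F.lin A a b)) :=
  ((((((h.pairing_ζ ha).add (h.state_form ha hb)).add (h.pairing_w F.memLp_f₁)).add
    (h.pairing_ιw F.memLp_f₂)).add (h.pairing_y F.memLp_g)).sub_const _ |>.add_const _).add_const _

end Tends

end Frame

end

/-! ### Velocities of solutions, and limits of approximate solutions. -/

section

namespace Frame

variable {U H Z : Type*} [NormedAddCommGroup U] [NormedSpace ℝ U]
  [NormedAddCommGroup H] [InnerProductSpace ℝ H]
  [NormedAddCommGroup Z] [NormedSpace ℝ Z] {F : Frame U H Z} {R δ : ℝ} {A B : Traj U H Z}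

theorem exists_pot_ne_top (F : Frame U H Z) : ∃ (x : U) (y : Z),
    F.P.Ψ₁ x ≠ ∞ ∧ F.P.Ψ₂ y ≠ ∞ ∧ F.pot (fun _ => x) (fun _ => y) ≠ ∞ := by
  obtain ⟨x, hx⟩ := F.hΨ₁.proper
  obtain ⟨y, hy⟩ := F.hΨ₂.proper
  refine ⟨x, y, hx, hy, ?_⟩
  rw [pot, lintegral_const]
  exact ENNReal.mul_ne_top (ENNReal.add_ne_top.mpr ⟨hx, hy⟩) (measure_ne_top _ _)

theorem mom_zero (F : Frame U H Z) (A : Traj U H Z) : F.mom A 0 = F.dK F.P.v₀ := primitive_zero _ _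

theorem state_zero (F : Frame U H Z) (A : Traj U H Z) : F.state A 0 = (F.P.u₀, F.P.z₀) :=
  Prod.ext (primitive_zero _ _) (primitive_zero _ _)

variable [CompleteSpace H]

/-- The velocity of a solution as a weakly continuous function with values in `H`. -/
theorem IsApprox.exists_velocity (h : F.IsApprox R 0 A) :
    ∃ v : ℝ → H, IsVelocity F.P.T F.K F.P.ι F.P.q₁ (F.P.p₁ / (F.P.p₁ - 1)) A.w v
      (fun t => A.ζ t + F.f₁ t) F.f₂ ∧ v 0 = F.P.v₀ ∧ v F.P.T = A.vT ∧
      (∀ t ∈ Icc 0 F.P.T, F.dK (v t) = F.mom A t) ∧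
      ∀ ℓ : StrongDual ℝ H, ContinuousOn (fun t => ℓ (v t)) (Icc 0 F.P.T) := by
  have hR : 0 ≤ R := (norm_nonneg _).trans h.bdd_vT
  have hae : ∀ᵐ t ∂F.μ, F.dK (F.P.ι (A.w t)) = F.mom A t := by
    have h1 : ∫ t, ‖F.dK (F.P.ι (A.w t)) - F.mom A t‖ ∂F.μ = 0 :=
      le_antisymm h.mom_ae (integral_nonneg fun _ => norm_nonneg _)
    rw [integral_eq_zero_iff_of_nonneg (fun _ => norm_nonneg _) h.integrable_mom_sub.norm] at h1
    filter_upwards [h1] with t ht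
    simpa [sub_eq_zero] using ht
  -- Almost everywhere the momentum is `dK (ι w)`, where `ι w` is bounded in `H`. The positive part
  -- of the difference of both sides is continuous and vanishes almost everywhere, hence at every
  -- time; so at each time the momentum is represented by an element of `H`.
  have hbd : ∀ t ∈ Icc 0 F.P.T, ∀ x, |F.mom A t x| ≤ 2 * ‖F.K‖ * R * ‖F.P.ι x‖ := by
    intro t ht x
    have hc : ContinuousOn (fun t => max (|F.mom A t x| - 2 * ‖F.K‖ * R * ‖F.P.ι x‖) 0)
        (Icc 0 F.P.T) := by
      have h1 : ContinuousOn (fun t => F.mom A t x) (Icc 0 F.P.T) :=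
        h.continuousOn_mom.clm_apply continuousOn_const
      exact (h1.abs.sub continuousOn_const).sup continuousOn_const
    have he := Measure.eqOn_Icc_of_ae_eq volume F.T_pos.ne (g := fun _ => (0 : ℝ)) (by
      have h2 : ∀ᵐ t ∂F.μ, max (|F.mom A t x| - 2 * ‖F.K‖ * R * ‖F.P.ι x‖) 0 = 0 := by
        filter_upwards [hae, h.bdd] with t h1 h2
        rw [max_eq_right_iff, sub_nonpos, ← h1]
        refine (F.abs_dK_le _ _).trans ?_
        gcongr
      exact h2) hc continuousOn_const ht
    have h3 := le_max_left (|F.mom A t x| - 2 * ‖F.K‖ * R * ‖F.P.ι x‖) 0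
    simp only at he
    linarith
  obtain ⟨C, hC, hex⟩ := F.exists_dK_eq
  choose! v hv hvn using fun (t : ℝ) (ht : t ∈ Icc 0 F.P.T) =>
    hex (2 * ‖F.K‖ * R) (F.mom A t) (by positivity) (hbd t ht)
  have hcont : ∀ ℓ : StrongDual ℝ H, ContinuousOn (fun t => ℓ (v t)) (Icc 0 F.P.T) := by
    intro ℓ t ht
    refine tendsto_of_dK (F := F) (M := C * (2 * ‖F.K‖ * R)) ?_ (fun x => ?_) ℓ
    · exact eventually_of_mem self_mem_nhdsWithin hvn
    · have h1 : Tendsto (fun s => F.mom A s x) (𝓝[Icc 0 F.P.T] t) (𝓝 (F.mom A t x)) :=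
        (h.continuousOn_mom.clm_apply continuousOn_const) t ht
      rw [hv t ht]
      exact h1.congr' (eventually_of_mem self_mem_nhdsWithin fun s hs => by
        simp only [hv s hs])
  have hα : MemLp (fun t => A.ζ t + F.f₁ t) F.P.conj₁ F.μ :=
    MemLp.add (f := A.ζ) (g := F.f₁) h.memLp_ζ F.memLp_f₁
  rw [Problem.conj₁] at hα
  refine ⟨v, ⟨h.memLp_w, hα, F.memLp_f₂, ?_, ⟨_, hvn⟩, fun k => ?_, ?_⟩,
    F.dK_injective ?_, F.dK_injective ?_, hv, hcont⟩
  · filter_upwards [hae, ae_timeMeasure_mem] with t h1 h2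
    exact F.dK_injective (h1.trans (hv t h2).symm)
  · simp only [F.hK.symm (v _) k]
    exact hcont (F.K k)
  · intro t ht
    have h1 : ∀ t, ((2 : ℝ) • F.K (v t)).comp F.P.ι = F.dK (v t) := fun t => by
      ext x; simp
    rw [h1, h1, hv t ht, hv 0 F.zero_mem, F.mom_zero, mom, primitive]
    simp only [load, add_assoc]
  · rw [hv 0 F.zero_mem, F.mom_zero]
  · rw [hv _ F.T_mem, h.mom_T]

theorem memLp_of_tendsto_ae {X : Type*} [NormedAddCommGroup X] {μ : Measure ℝ} {p : ℝ≥0∞}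
    {x : ℕ → ℝ → X} {x₀ : ℝ → X} (hm : ∀ n, MemLp (x n) p μ)
    (hle : ∀ n, eLpNorm (x n) p μ ≤ ENNReal.ofReal R)
    (hl : ∀ᵐ t ∂μ, Tendsto (fun n => x n t) atTop (𝓝 (x₀ t))) :
    MemLp x₀ p μ ∧ eLpNorm x₀ p μ ≤ ENNReal.ofReal R := by
  have h1 : eLpNorm x₀ p μ ≤ ENNReal.ofReal R :=
    (Lp.eLpNorm_lim_le_liminf_eLpNorm (fun n => (hm n).1) x₀ hl).trans
      (liminf_le_of_frequently_le' (Frequently.of_forall hle))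
  exact ⟨⟨aestronglyMeasurable_of_tendsto_ae atTop (fun n => (hm n).1) hl,
    h1.trans_lt ENNReal.ofReal_lt_top⟩, h1⟩

/-- Limits of approximate solutions. -/
theorem exists_limit {A' : ℕ → Traj U H Z} {δ : ℕ → ℝ} (h : ∀ n, F.IsApprox R (δ n) (A' n))
    (hδ : Tendsto δ atTop (𝓝 0)) {w : ℝ → U} {y : ℝ → Z} {ζ : ℝ → StrongDual ℝ U}
    (hw : Tendsto (fun n => eLpNorm ((A' n).w - w) 1 F.μ) atTop (𝓝 0))
    (hwa : ∀ᵐ t ∂F.μ, Tendsto (fun n => (A' n).w t) atTop (𝓝 (w t)))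
    (hy : Tendsto (fun n => eLpNorm ((A' n).y - y) 1 F.μ) atTop (𝓝 0))
    (hya : ∀ᵐ t ∂F.μ, Tendsto (fun n => (A' n).y t) atTop (𝓝 (y t)))
    (hζ : Tendsto (fun n => eLpNorm ((A' n).ζ - ζ) 1 F.μ) atTop (𝓝 0))
    (hζa : ∀ᵐ t ∂F.μ, Tendsto (fun n => (A' n).ζ t) atTop (𝓝 (ζ t))) :
    ∃ vT, F.Tends R A' (w, y, ζ, vT) ∧ F.IsApprox R 0 (w, y, ζ, vT) := by
  have hR : 0 ≤ R := (norm_nonneg _).trans (h 0).bdd_vT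
  obtain ⟨hw1, hw2⟩ := memLp_of_tendsto_ae (fun n => (h n).memLp_w) (fun n => (h n).le_w) hwa
  obtain ⟨hy1, hy2⟩ := memLp_of_tendsto_ae (fun n => (h n).memLp_y) (fun n => (h n).le_y) hya
  obtain ⟨hζ1, hζ2⟩ := memLp_of_tendsto_ae (fun n => (h n).memLp_ζ) (fun n => (h n).le_ζ) hζa
  have hbd : ∀ᵐ t ∂F.μ, ‖F.P.ι (w t)‖ ≤ R := by
    filter_upwards [hwa, ae_all_iff.mpr fun n => (h n).bdd] with t h1 h2
    exact le_of_tendsto ((F.P.ι.continuous.tendsto _).comp h1).norm (Eventually.of_forall h2)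
  have hbdd : ∀ {vT : H}, ‖vT‖ ≤ R → F.IsBdd R (w, y, ζ, vT) := fun hv =>
    ⟨hw1, hw2, hy1, hy2, hζ1, hζ2, hbd, hv⟩
  have htends : ∀ {vT : H}, ‖vT‖ ≤ R →
      (∀ ℓ : StrongDual ℝ H, Tendsto (fun n => ℓ (A' n).vT) atTop (𝓝 (ℓ vT))) →
      F.Tends R A' (w, y, ζ, vT) := fun hv hl =>
    ⟨fun n => (h n).toIsBdd, hbdd hv, hw, hwa, hy, hya, hζ, hl⟩
  have hmom : ∀ t ∈ Icc 0 F.P.T, Tendsto (fun n => F.mom (A' n) t) atTop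
      (𝓝 (F.mom (w, y, ζ, (0 : H)) t)) := by
    intro t ht
    rw [tendsto_iff_norm_sub_tendsto_zero]
    have h1 := (ENNReal.tendsto_toReal ENNReal.zero_ne_top).comp hζ
    rw [ENNReal.toReal_zero] at h1
    have hb0 := hbdd (vT := 0) (by simpa using hR)
    refine squeeze_zero (fun _ => norm_nonneg _) (fun n => ?_) h1
    refine (norm_primitive_sub_le _ (h n).integrable_ζ_load hb0.integrable_ζ_load ht).trans_eq ?_
    simp only [Function.comp]
    congr 2
    funext s
    simp only [Pi.sub_apply]
    abel
  -- the terminal velocity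
  obtain ⟨C, hC, hex⟩ := F.exists_dK_eq
  obtain ⟨vT, hvT, -⟩ := hex (2 * ‖F.K‖ * R) (F.mom (w, y, ζ, (0 : H)) F.P.T) (by positivity)
    fun x => by
      have h1 : Tendsto (fun n => |F.mom (A' n) F.P.T x|) atTop
          (𝓝 |F.mom (w, y, ζ, (0 : H)) F.P.T x|) :=
        ((ContinuousLinearMap.apply ℝ ℝ x).continuous.tendsto _ |>.comp (hmom _ F.T_mem)).abs
      refine le_of_tendsto' h1 fun n => ?_
      rw [← (h n).mom_T]
      refine (F.abs_dK_le _ _).trans ?_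
      gcongr
      exact (h n).bdd_vT
  have hvl : ∀ ℓ : StrongDual ℝ H, Tendsto (fun n => ℓ (A' n).vT) atTop (𝓝 (ℓ vT)) := fun ℓ =>
    tendsto_of_dK (F := F) (Eventually.of_forall fun n => (h n).bdd_vT) (fun x => by
      rw [hvT]
      simp only [(h _).mom_T]
      exact (ContinuousLinearMap.apply ℝ ℝ x).continuous.tendsto _ |>.comp (hmom _ F.T_mem)) ℓ
  -- Weak lower semicontinuity of the norm, tested with `vT` itself, keeps the bound `R` exactly;
  -- the representation lemma alone would give a larger constant.
  have hvR : ‖vT‖ ≤ R := by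
    have h1 := hvl (innerSL ℝ vT)
    have h2 : ‖vT‖ ^ 2 ≤ ‖vT‖ * R := by
      refine le_of_tendsto' (by simpa using h1) fun n => ?_
      exact (real_inner_le_norm _ _).trans (by gcongr; exact (h n).bdd_vT)
    by_contra hcon
    push Not at hcon
    nlinarith [norm_nonneg vT]
  have hT := htends hvR hvl
  have hB := hbdd hvR
  have key : ∀ a b, MemLp a F.P.q₁ F.μ → MemLp b F.P.q₂ F.μ → F.pot a b ≠ ∞ →
      ∃ c : ℝ, 0 ≤ c ∧ F.pot w y ≤ ENNReal.ofReal c ∧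
        F.K vT vT + F.Q (F.state (w, y, ζ, vT) F.P.T) (F.state (w, y, ζ, vT) F.P.T) + c
          = (F.pot a b).toReal + F.lin (w, y, ζ, vT) a b := by
    intro a b ha hb hab
    set N := (eLpNorm a F.P.q₁ F.μ).toReal + (eLpNorm b F.P.q₂ F.μ).toReal
    -- The kinetic energy is replaced by its tangent plane at `vT`, which is weakly continuous. All
    -- terms of `c n` then converge, and Fatou's lemma handles the dissipation on the other side.
    set c : ℕ → ℝ := fun n => (F.pot a b).toReal + F.lin (A' n) a b + δ n * N
      - (F.K vT vT + 2 * (F.K vT (A' n).vT - F.K vT vT))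
      - F.Q (F.state (A' n) F.P.T) (F.state (A' n) F.P.T) with hc
    have hcn : ∀ n, (F.pot (A' n).w (A' n).y).toReal ≤ c n := fun n => by
      have h1 := (h n).vi a b ha hb hab
      have h2 := F.hK.le_self vT (A' n).vT
      rw [map_sub] at h2
      simp only [hc]
      linarith
    have hlim : Tendsto c atTop (𝓝 ((F.pot a b).toReal + F.lin (w, y, ζ, vT) a b + 0 * N
        - (F.K vT vT + 2 * (F.K vT vT - F.K vT vT))
        - F.Q (F.state (w, y, ζ, vT) F.P.T) (F.state (w, y, ζ, vT) F.P.T))) := by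
      have h1 := hT.tendsto_state F.T_mem
      have h2 : Continuous fun x => F.Q x x := by fun_prop
      exact ((((hT.lin ha hb).const_add _).add (hδ.mul_const N)).sub
        ((((hvl (F.K vT)).sub_const _).const_mul 2).const_add _)).sub
        ((h2.tendsto _).comp h1)
    refine ⟨_, ge_of_tendsto' hlim fun n => ENNReal.toReal_nonneg.trans (hcn n), ?_, by ring⟩
    refine (pot_le_liminf (fun n => (h n).memLp_w.1) (fun n => (h n).memLp_y.1) hwa hya).trans ?_
    rw [← (ENNReal.tendsto_ofReal hlim).liminf_eq]
    refine liminf_le_liminf (Eventually.of_forall fun n => ?_)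
    rw [← ENNReal.ofReal_toReal (h n).pot_ne]
    exact ENNReal.ofReal_le_ofReal (hcn n)
  refine ⟨vT, hT, hB, ?_, hvT, ?_, ?_⟩
  · obtain ⟨x, z, -, -, hxz⟩ := F.exists_pot_ne_top
    obtain ⟨c, -, hc, -⟩ := key _ _ (memLp_const x) (memLp_const z) hxz
    exact ne_top_of_le_ne_top ENNReal.ofReal_ne_top hc
  · obtain ⟨M, hM⟩ : ∃ M, M = ‖F.dK.comp F.P.ι‖ := ⟨_, rfl⟩
    -- Three errors: the change of `w`, the defect `δ n` of the approximate solution, and the change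
    -- of the momentum, which is uniform in time and integrates to a factor `T`.
    have h1 : Tendsto (fun n => M * (eLpNorm ((A' n).w - w) 1 F.μ).toReal + δ n
        + F.P.T * (eLpNorm ((A' n).ζ - ζ) 1 F.μ).toReal) atTop
        (𝓝 (M * 0 + 0 + F.P.T * 0)) :=
      ((((ENNReal.tendsto_toReal ENNReal.zero_ne_top).comp hw).const_mul M).add hδ).add
        (((ENNReal.tendsto_toReal ENNReal.zero_ne_top).comp hζ).const_mul F.P.T)
    simp only [mul_zero, add_zero] at h1
    refine ge_of_tendsto' h1 fun n => ?_
    have hwi := (h n).integrable_w.sub hB.integrable_w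
    have e1 : M * (eLpNorm ((A' n).w - w) 1 F.μ).toReal = ∫ t, M * ‖(A' n).w t - w t‖ ∂F.μ := by
      rw [integral_const_mul, eLpNorm_one_eq_lintegral_enorm,
        ← integral_norm_eq_lintegral_enorm hwi.1]
      rfl
    have e2 : F.P.T * (eLpNorm ((A' n).ζ - ζ) 1 F.μ).toReal
        = ∫ t, (eLpNorm ((A' n).ζ - ζ) 1 F.μ).toReal ∂F.μ := by
      rw [integral_timeMeasure F.T_pos.le, intervalIntegral.integral_const, sub_zero, smul_eq_mul]
    rw [e1, e2]
    refine le_trans ?_ (add_le_add_left (add_le_add_right (h n).mom_ae _) _)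
    have hi1 : Integrable (fun t => M * ‖(A' n).w t - w t‖) F.μ := hwi.norm.const_mul M
    have hi2 : Integrable (fun t => M * ‖(A' n).w t - w t‖
        + ‖F.dK (F.P.ι ((A' n).w t)) - F.mom (A' n) t‖) F.μ :=
      hi1.add (h n).integrable_mom_sub.norm
    rw [← integral_add hi1 (h n).integrable_mom_sub.norm, ← integral_add hi2 (integrable_const _)]
    refine integral_mono_ae hB.integrable_mom_sub.norm (hi2.add (integrable_const _)) ?_
    filter_upwards [ae_timeMeasure_mem] with t ht
    have h2 : ‖F.mom (A' n) t - F.mom (w, y, ζ, vT) t‖ ≤ (eLpNorm ((A' n).ζ - ζ) 1 F.μ).toReal := by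
      refine (norm_primitive_sub_le _ (h n).integrable_ζ_load hB.integrable_ζ_load ht).trans_eq ?_
      congr 2
      funext s
      simp only [Pi.sub_apply]
      abel
    have h3 : ‖F.dK (F.P.ι ((A' n).w t - w t))‖ ≤ M * ‖(A' n).w t - w t‖ := by
      rw [hM]
      exact (F.dK.comp F.P.ι).le_opNorm _
    have e3 : F.dK (F.P.ι (w t)) - F.mom (w, y, ζ, vT) t
        = - F.dK (F.P.ι ((A' n).w t - w t)) + (F.dK (F.P.ι ((A' n).w t)) - F.mom (A' n) t)
          + (F.mom (A' n) t - F.mom (w, y, ζ, vT) t) := by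
      rw [map_sub, map_sub]; abel
    rw [e3]
    refine (norm_add₃_le).trans ?_
    rw [norm_neg]
    gcongr
  · intro a b ha hb hab
    obtain ⟨c, hc0, hc, he⟩ := key a b ha hb hab
    have h1 : (F.pot w y).toReal ≤ c := ENNReal.toReal_le_of_le_ofReal hc0 hc
    change F.K vT vT + _ + (F.pot w y).toReal ≤ _
    linarith

end Frame

end

/-! ### Energy balance and uniqueness. -/

section

theorem IsVelocity.sub {U H : Type*} [NormedAddCommGroup U] [NormedSpace ℝ U]
    [NormedAddCommGroup H] [NormedSpace ℝ H] {T : ℝ} {K : H →L[ℝ] H →L[ℝ] ℝ} {ι : U →L[ℝ] H}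
    {p : ℝ≥0∞} {q : ℝ} {w w' : ℝ → U} {v v' : ℝ → H} {α α' : ℝ → StrongDual ℝ U}
    {β β' : ℝ → StrongDual ℝ H} (h : IsVelocity T K ι p q w v α β)
    (h' : IsVelocity T K ι p q w' v' α' β') (hq : 1 ≤ q) :
    IsVelocity T K ι p q (fun t => w t - w' t) (fun t => v t - v' t) (fun t => α t - α' t)
      (fun t => β t - β' t) := by
  obtain ⟨M, hM⟩ := h.bdd
  obtain ⟨M', hM'⟩ := h'.bdd
  refine ⟨h.memLp.sub h'.memLp, MemLp.sub (f := α) (g := α') h.memLp_α h'.memLp_α,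
    MemLp.sub (f := β) (g := β') h.memLp_β h'.memLp_β, ?_,
    ⟨M + M', fun t ht => (norm_sub_le _ _).trans (add_le_add (hM t ht) (hM' t ht))⟩,
    fun x => ?_, fun t ht => ?_⟩
  · filter_upwards [h.ae_eq, h'.ae_eq] with t h1 h2
    rw [map_sub, h1, h2]
  · simp only [map_sub, sub_apply]
    exact (h.weak_cont x).sub (h'.weak_cont x)
  · have h0 : (0 : ℝ) ∈ Icc 0 T := ⟨le_rfl, ht.1.trans ht.2⟩
    have e1 : ∀ t, ((2 : ℝ) • K (v t - v' t)).comp ι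
        = ((2 : ℝ) • K (v t)).comp ι - ((2 : ℝ) • K (v' t)).comp ι := fun t => by
      ext x; simp; ring
    have e2 : ∫ s in (0 : ℝ)..t, (α s - α' s + (β s - β' s).comp ι)
        = (∫ s in (0 : ℝ)..t, (α s + (β s).comp ι))
          - ∫ s in (0 : ℝ)..t, (α' s + (β' s).comp ι) := by
      rw [← intervalIntegral.integral_sub
        (intervalIntegrable_of_timeMeasure (h.integrable_sum hq) h0 ht)
        (intervalIntegrable_of_timeMeasure (h'.integrable_sum hq) h0 ht)]
      congr 1
      funext s
      ext x
      simp
      ring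
    rw [e1, e1, e2, h.deriv t ht, h'.deriv t ht]
    abel

/-- The chain rule for a form along an absolutely continuous function. -/
theorem form_primitive {X : Type*} [NormedAddCommGroup X] [NormedSpace ℝ X] [CompleteSpace X]
    {T : ℝ} {B : X →L[ℝ] X →L[ℝ] ℝ} (hB : IsCoerciveForm B) (hT : 0 ≤ T) {w : ℝ → X}
    (hw : Integrable w (timeMeasure T)) {x : ℝ → X} (hxc : ContinuousOn x (Icc 0 T))
    (hx : ∀ t ∈ Icc 0 T, x t = x 0 + ∫ s in (0 : ℝ)..t, w s) :
    B (x T) (x T) - B (x 0) (x 0) = ∫ t, 2 * B (x t) (w t) ∂(timeMeasure T) := by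
  obtain ⟨M, hM⟩ := isCompact_Icc.exists_bound_of_continuousOn hxc
  have h2 : Integrable (fun t => (2 : ℝ) • B (w t)) (timeMeasure T) :=
    (B.integrable_comp hw).smul (2 : ℝ)
  -- The kinetic chain rule with `ι` the identity, `α = 0`, and the continuous function `x` in the
  -- role of the velocity.
  have h1 : IsVelocity T B (ContinuousLinearMap.id ℝ X) ∞ 1 x x (fun _ => 0)
      (fun t => (2 : ℝ) • B (w t)) := by
    refine ⟨memLp_of_continuousOn hxc _, memLp_const (0 : StrongDual ℝ X),
      memLp_one_iff_integrable.mpr h2,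
      Eventually.of_forall fun t => rfl, ⟨M, hM⟩, fun k => ?_, fun t ht => ?_⟩
    · exact (B.continuous.comp_continuousOn hxc).clm_apply continuousOn_const
    · have h0 : (0 : ℝ) ∈ Icc 0 T := ⟨le_rfl, hT⟩
      simp only [ContinuousLinearMap.comp_id, zero_add]
      rw [intervalIntegral.integral_smul, B.intervalIntegral_comp_comm
        (intervalIntegrable_of_timeMeasure hw h0 ht), hx t ht, map_add, smul_add]
  have h3 := h1.energy_eq hB hT le_rfl (by simp)
  simp only [zero_apply, integral_zero, zero_add, ContinuousLinearMap.id_apply, smul_apply,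
    smul_eq_mul] at h3
  rw [h3]
  simp only [hB.symm (w _)]

theorem timeMeasure_restrict_Iic {T s : ℝ} (hs : s ≤ T) :
    (timeMeasure T).restrict (Iic s) = timeMeasure s := by
  rw [timeMeasure, timeMeasure, Measure.restrict_restrict measurableSet_Iic]
  congr 1
  ext t
  simp only [mem_inter_iff, mem_Iic, mem_Icc]
  constructor
  · rintro ⟨h1, h2, -⟩; exact ⟨h2, h1⟩
  · rintro ⟨h1, h2⟩; exact ⟨h2, h1, h2.trans hs⟩

namespace Frame

variable {U H Z : Type*} [NormedAddCommGroup U] [NormedSpace ℝ U]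
  [NormedAddCommGroup H] [InnerProductSpace ℝ H]
  [NormedAddCommGroup Z] [NormedSpace ℝ Z] {F : Frame U H Z} {R R' δ : ℝ} {A B : Traj U H Z}

/-- The difference of two lines of the variational inequality. -/
noncomputable def loc (F : Frame U H Z) (A : Traj U H Z) (a : ℝ → U) (b : ℝ → Z) (t : ℝ) : ℝ :=
  A.ζ t (A.w t - a t) + 2 * F.Q (F.state A t) (A.w t - a t, A.y t - b t)
    - F.P.g t (A.y t - b t)

theorem IsBdd.integrable_loc (h : F.IsBdd R A) {a : ℝ → U} {b : ℝ → Z} (ha : MemLp a F.P.q₁ F.μ)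
    (hb : MemLp b F.P.q₂ F.μ) : Integrable (F.loc A a b) F.μ :=
  ((integrable_pairing F.holder₁ h.memLp_ζ (h.memLp_w.sub ha)).add
    (h.integrable_state (h.integrable_w.sub (ha.integrable F.one_le_q₁))
      (h.integrable_y.sub (hb.integrable F.one_le_q₂)))).sub
    (integrable_pairing F.holder₂ F.memLp_g (h.memLp_y.sub hb))

theorem IsBdd.state_eq (h : F.IsBdd R A) {t : ℝ} (ht : t ∈ Icc 0 F.P.T) [CompleteSpace U]
    [CompleteSpace Z] :
    F.state A t = F.state A 0 + ∫ s in (0 : ℝ)..t, (A.w s, A.y s) := by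
  have hi : IntervalIntegrable (fun s => (A.w s, A.y s)) volume 0 t :=
    intervalIntegrable_of_timeMeasure (h.integrable_w.prodMk h.integrable_y) F.zero_mem ht
  have e1 := (ContinuousLinearMap.fst ℝ U Z).intervalIntegral_comp_comm hi
  have e2 := (ContinuousLinearMap.snd ℝ U Z).intervalIntegral_comp_comm hi
  rw [F.state_zero]
  refine Prod.ext ?_ ?_
  · exact congrArg (F.P.u₀ + ·) e1
  · exact congrArg (F.P.z₀ + ·) e2

theorem hq (F : Frame U H Z) : 1 ≤ F.P.p₁ / (F.P.p₁ - 1) := (one_lt_conj F.hp₁).le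

variable [CompleteSpace U] [CompleteSpace H] [CompleteSpace Z]

/-- The energy balance of a solution. -/
theorem IsApprox.energy_eq (h : F.IsApprox R 0 A) :
    F.K A.vT A.vT + F.Q (F.state A F.P.T) (F.state A F.P.T)
      = F.lin A A.w A.y := by
  obtain ⟨v, hv, hv0, hvT, -⟩ := h.exists_velocity
  have h1 := hv.energy_eq F.hK F.T_pos.le F.hq F.holder₁
  have h2 := form_primitive F.hQ F.T_pos.le (h.integrable_w.prodMk h.integrable_y)
    h.continuousOn_state (fun t ht => h.state_eq ht)
  rw [hv0, hvT] at h1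
  rw [F.state_zero] at h2
  simp only [add_apply] at h1
  rw [integral_add (integrable_pairing F.holder₁ h.memLp_ζ h.memLp_w)
    (integrable_pairing F.holder₁ F.memLp_f₁ h.memLp_w)] at h1
  rw [lin]
  linarith

/-- Solutions satisfy an integrated differential inclusion. -/
theorem IsApprox.inclusion (h : F.IsApprox R 0 A) {a : ℝ → U} {b : ℝ → Z}
    (ha : MemLp a F.P.q₁ F.μ) (hb : MemLp b F.P.q₂ F.μ) (hab : F.pot a b ≠ ∞) :
    (F.pot A.w A.y).toReal + ∫ t, F.loc A a b t ∂F.μ ≤ (F.pot a b).toReal := by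
  have h1 := h.vi a b ha hb hab
  -- The terminal energy equals the affine part evaluated at the own velocities, so only the
  -- difference of two affine parts remains.
  rw [h.energy_eq, zero_mul, add_zero] at h1
  have e : ∫ t, F.loc A a b t ∂F.μ = F.lin A A.w A.y - F.lin A a b := by
    have i1 := integral_sub (integrable_pairing F.holder₁ h.memLp_ζ h.memLp_w)
      (integrable_pairing F.holder₁ h.memLp_ζ ha)
    have i2 := integral_sub (h.integrable_state h.integrable_w h.integrable_y)
      (h.integrable_state (ha.integrable F.one_le_q₁) (hb.integrable F.one_le_q₂))
    have i3 := integral_sub (integrable_pairing F.holder₂ F.memLp_g h.memLp_y)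
      (integrable_pairing F.holder₂ F.memLp_g hb)
    have j1 : Integrable (fun t => A.ζ t (A.w t) - A.ζ t (a t)) F.μ :=
      (integrable_pairing F.holder₁ h.memLp_ζ h.memLp_w).sub
      (integrable_pairing F.holder₁ h.memLp_ζ ha)
    have j2 : Integrable (fun t => 2 * F.Q (F.state A t) (A.w t, A.y t)
        - 2 * F.Q (F.state A t) (a t, b t)) F.μ :=
      (h.integrable_state h.integrable_w h.integrable_y).sub
      (h.integrable_state (ha.integrable F.one_le_q₁) (hb.integrable F.one_le_q₂))
    have j3 : Integrable (fun t => F.P.g t (A.y t) - F.P.g t (b t)) F.μ :=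
      (integrable_pairing F.holder₂ F.memLp_g h.memLp_y).sub
      (integrable_pairing F.holder₂ F.memLp_g hb)
    have e1 : F.loc A a b = fun t => (A.ζ t (A.w t) - A.ζ t (a t))
        + (2 * F.Q (F.state A t) (A.w t, A.y t) - 2 * F.Q (F.state A t) (a t, b t))
        - (F.P.g t (A.y t) - F.P.g t (b t)) := by
      funext t
      rw [loc, ← Prod.mk_sub_mk, map_sub, map_sub, map_sub]
      ring
    have j12 : Integrable (fun t => (A.ζ t (A.w t) - A.ζ t (a t))
        + (2 * F.Q (F.state A t) (A.w t, A.y t) - 2 * F.Q (F.state A t) (a t, b t))) F.μ :=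
      j1.add j2
    rw [e1, integral_sub j12 j3, integral_add j1 j2, i1, i2, i3, lin, lin]
    ring
  rw [e]
  linarith

open Classical in
/-- The inclusion, localised to `[0,s]`. -/
theorem IsApprox.inclusion_Iic (h : F.IsApprox R 0 A) {a : ℝ → U} {b : ℝ → Z}
    (ha : MemLp a F.P.q₁ F.μ) (hb : MemLp b F.P.q₂ F.μ) (hab : F.pot a b ≠ ∞) (s : ℝ) :
    (∫⁻ t in Iic s, (F.P.Ψ₁ (A.w t) + F.P.Ψ₂ (A.y t)) ∂F.μ).toReal
      + ∫ t in Iic s, F.loc A a b t ∂F.μ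
      ≤ (∫⁻ t in Iic s, (F.P.Ψ₁ (a t) + F.P.Ψ₂ (b t)) ∂F.μ).toReal := by
  -- The test follows `a` and `b` up to time `s` and the velocities of the solution afterwards, so
  -- everything after `s` cancels.
  set a' := (Iic s).piecewise a A.w with ha'
  set b' := (Iic s).piecewise b A.y with hb'
  have hma : MemLp a' F.P.q₁ F.μ := MemLp.piecewise measurableSet_Iic (ha.restrict _)
    (h.memLp_w.restrict _)
  have hmb : MemLp b' F.P.q₂ F.μ := MemLp.piecewise measurableSet_Iic (hb.restrict _)
    (h.memLp_y.restrict _)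
  have e1 := lintegral_add_compl (μ := F.μ) (fun t => F.P.Ψ₁ (A.w t) + F.P.Ψ₂ (A.y t))
    (measurableSet_Iic (a := s))
  have e2 := lintegral_add_compl (μ := F.μ) (fun t => F.P.Ψ₁ (a' t) + F.P.Ψ₂ (b' t))
    (measurableSet_Iic (a := s))
  have e3 : ∫⁻ t in Iic s, (F.P.Ψ₁ (a' t) + F.P.Ψ₂ (b' t)) ∂F.μ
      = ∫⁻ t in Iic s, (F.P.Ψ₁ (a t) + F.P.Ψ₂ (b t)) ∂F.μ :=
    setLIntegral_congr_fun measurableSet_Iic fun t ht => by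
      simp only [ha', hb', piecewise_eq_of_mem _ _ _ ht]
  have e4 : ∫⁻ t in (Iic s)ᶜ, (F.P.Ψ₁ (a' t) + F.P.Ψ₂ (b' t)) ∂F.μ
      = ∫⁻ t in (Iic s)ᶜ, (F.P.Ψ₁ (A.w t) + F.P.Ψ₂ (A.y t)) ∂F.μ :=
    setLIntegral_congr_fun measurableSet_Iic.compl fun t ht => by
      simp only [ha', hb', piecewise_eq_of_notMem _ _ _ ht]
  rw [e3, e4] at e2
  have hA := h.pot_ne
  rw [pot, ← e1, ENNReal.add_ne_top] at hA
  have hB : ∫⁻ t in Iic s, (F.P.Ψ₁ (a t) + F.P.Ψ₂ (b t)) ∂F.μ ≠ ∞ :=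
    ne_top_of_le_ne_top hab (setLIntegral_le_lintegral _ _)
  have h1 := h.inclusion hma hmb (by rw [pot, ← e2]; exact ENNReal.add_ne_top.mpr ⟨hB, hA.2⟩)
  rw [pot, pot, ← e1, ← e2, ENNReal.toReal_add hA.1 hA.2, ENNReal.toReal_add hB hA.2] at h1
  have e5 : ∫ t, F.loc A a' b' t ∂F.μ = ∫ t in Iic s, F.loc A a b t ∂F.μ := by
    rw [← integral_indicator measurableSet_Iic]
    congr 1
    funext t
    by_cases ht : t ∈ Iic s
    · simp only [indicator_of_mem ht, loc, ha', hb', piecewise_eq_of_mem _ _ _ ht]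
    · simp only [indicator_of_notMem ht, loc, ha', hb', piecewise_eq_of_notMem _ _ _ ht, sub_self,
        map_zero]
      rw [show ((0 : U), (0 : Z)) = 0 from rfl, map_zero]
      simp
  rw [e5] at h1
  linarith

/-- Uniqueness of the solution. -/
theorem IsApprox.eqOn (hA : F.IsApprox R 0 A) (hB : F.IsApprox R' 0 B) {s : ℝ}
    (hs : s ∈ Icc 0 F.P.T) : F.state A s = F.state B s ∧ F.mom A s = F.mom B s := by
  obtain ⟨v, hv, hv0, -, hvm, -⟩ := hA.exists_velocity
  obtain ⟨v', hv', hv0', -, hvm', -⟩ := hB.exists_velocity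
  have h1 := hA.inclusion_Iic hB.memLp_w hB.memLp_y hB.pot_ne s
  have h2 := hB.inclusion_Iic hA.memLp_w hA.memLp_y hA.pot_ne s
  rw [timeMeasure_restrict_Iic hs.2] at h1 h2
  have hm := timeMeasure_mono hs.2
  have i1 := (hA.integrable_loc hB.memLp_w hB.memLp_y).mono_measure hm
  have i2 := (hB.integrable_loc hA.memLp_w hA.memLp_y).mono_measure hm
  -- Each solution is tested with the velocities of the other; the dissipations cancel in the sum.
  have h3 : ∫ t, (F.loc A B.w B.y t + F.loc B A.w A.y t) ∂(timeMeasure s) ≤ 0 := by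
    rw [integral_add i1 i2]; linarith
  -- The chain rule for the difference of the velocities, where the loads and the initial values
  -- drop out. With `h5`, the sum of the two localised integrals becomes the energy of the
  -- difference at time `s`, which is therefore not positive.
  have h4 := ((hv.sub hv' F.hq).mono hs.2).energy_eq F.hK hs.1 F.hq F.holder₁
  have hsub : Icc 0 s ⊆ Icc 0 F.P.T := Icc_subset_Icc_right hs.2
  have iw : Integrable (fun t => (A.w t - B.w t, A.y t - B.y t)) (timeMeasure s) :=
    ((hA.integrable_w.sub hB.integrable_w).prodMk
      (hA.integrable_y.sub hB.integrable_y)).mono_measure hm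
  have h5 := form_primitive F.hQ hs.1 iw (x := fun t => F.state A t - F.state B t)
    ((hA.continuousOn_state.sub hB.continuousOn_state).mono hsub) (fun t ht => by
      have h0 : (0 : ℝ) ∈ Icc 0 s := ⟨le_rfl, hs.1⟩
      simp only [← Prod.mk_sub_mk]
      rw [intervalIntegral.integral_sub
        (intervalIntegrable_of_timeMeasure (hA.integrable_w.prodMk hA.integrable_y) F.zero_mem
          (hsub ht))
        (intervalIntegrable_of_timeMeasure (hB.integrable_w.prodMk hB.integrable_y) F.zero_mem
          (hsub ht)), hA.state_eq (hsub ht), hB.state_eq (hsub ht)]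
      abel)
  simp only [hv0, hv0', sub_self, map_zero, sub_zero, zero_apply, integral_zero, add_zero,
    add_sub_add_right_eq_sub, F.state_zero] at h4 h5
  have e : ∀ t, F.loc A B.w B.y t + F.loc B A.w A.y t = (A.ζ t - B.ζ t) (A.w t - B.w t)
      + 2 * F.Q (F.state A t - F.state B t)
        (A.w t - B.w t, A.y t - B.y t) := by
    intro t
    rw [loc, loc, ← Prod.mk_sub_mk, ← Prod.mk_sub_mk]
    simp only [map_sub, sub_apply]
    ring
  have i3 : Integrable (fun t => (A.ζ t - B.ζ t) (A.w t - B.w t)) (timeMeasure s) :=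
    (integrable_pairing F.holder₁ (hA.memLp_ζ.sub hB.memLp_ζ)
      (hA.memLp_w.sub hB.memLp_w)).mono_measure hm
  simp only [e] at h3
  rw [integral_add i3 (by
    refine ((i1.add i2).sub i3).congr (Eventually.of_forall fun t => ?_)
    simp only [Pi.add_apply, Pi.sub_apply, e]
    ring), ← h4, ← h5] at h3
  have h6 := F.hK.nonneg (v s - v' s)
  have h7 := F.hQ.nonneg (F.state A s - F.state B s)
  refine ⟨sub_eq_zero.mp (F.hQ.eq_zero (by linarith)), ?_⟩
  rw [← hvm s hs, ← hvm' s hs, sub_eq_zero.mp (F.hK.eq_zero (x := v s - v' s) (by linarith))]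

/-- Equality of the primitives at all times determines the densities almost everywhere; in the
momentum the load cancels. -/
theorem IsApprox.unique (hA : F.IsApprox R 0 A) (hB : F.IsApprox R' 0 B) :
    A.w =ᵐ[F.μ] B.w ∧ A.y =ᵐ[F.μ] B.y ∧ A.ζ =ᵐ[F.μ] B.ζ ∧ A.vT = B.vT := by
  refine ⟨?_, ?_, ?_, F.dK_injective ?_⟩
  · refine ae_eq_of_primitive_eq F.T_pos.le hA.integrable_w hB.integrable_w fun t ht => ?_
    have := congrArg Prod.fst (hA.eqOn hB ht).1
    simpa [state, primitive] using this
  · refine ae_eq_of_primitive_eq F.T_pos.le hA.integrable_y hB.integrable_y fun t ht => ?_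
    have := congrArg Prod.snd (hA.eqOn hB ht).1
    simpa [state, primitive] using this
  · have h1 := ae_eq_of_primitive_eq F.T_pos.le hA.integrable_ζ_load hB.integrable_ζ_load
      fun t ht => by
        have := (hA.eqOn hB ht).2
        simpa [mom, primitive] using this
    filter_upwards [h1] with t ht
    exact add_right_cancel ht
  · rw [hA.mom_T, hB.mom_T, (hA.eqOn hB F.T_mem).2]

end Frame

end

/-! ### Selecting convergent approximate solutions in a convex set. -/

section

theorem eLpNorm_prodMk_le {Ω X Y : Type*} [MeasurableSpace Ω] {μ : Measure Ω}
    [NormedAddCommGroup X] [NormedAddCommGroup Y] {p : ℝ≥0∞} (hp : 1 ≤ p) {x : Ω → X} {y : Ω → Y}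
    (hx : AEStronglyMeasurable x μ) (hy : AEStronglyMeasurable y μ) :
    eLpNorm (fun t => (x t, y t)) p μ ≤ eLpNorm x p μ + eLpNorm y p μ := by
  rw [← eLpNorm_norm x, ← eLpNorm_norm y]
  refine le_trans (eLpNorm_mono (g := (fun t => ‖x t‖) + fun t => ‖y t‖) fun t => ?_)
    (eLpNorm_add_le hx.norm hy.norm hp)
  simp only [Pi.add_apply]
  rw [Real.norm_of_nonneg (by positivity), Prod.norm_def]
  exact max_le_add_of_nonneg (norm_nonneg _) (norm_nonneg _)

theorem tendsto_eLpNorm_of_le {Ω X Y : Type*} [MeasurableSpace Ω] {μ : Measure Ω}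
    [NormedAddCommGroup X] [NormedAddCommGroup Y] {p : ℝ≥0∞} {x : ℕ → Ω → X} {y : ℕ → Ω → Y}
    (hx : Tendsto (fun n => eLpNorm (x n) p μ) atTop (𝓝 0)) (h : ∀ n t, ‖y n t‖ ≤ ‖x n t‖) :
    Tendsto (fun n => eLpNorm (y n) p μ) atTop (𝓝 0) :=
  tendsto_of_tendsto_of_tendsto_of_le_of_le tendsto_const_nhds hx (fun _ => zero_le)
    fun n => eLpNorm_mono (h n)

namespace Frame

variable {U H Z : Type*} [NormedAddCommGroup U] [NormedSpace ℝ U]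
  [NormedAddCommGroup H] [InnerProductSpace ℝ H]
  [NormedAddCommGroup Z] [NormedSpace ℝ Z] {F : Frame U H Z} {R R' δ : ℝ} {A B : Traj U H Z}

variable [CompleteSpace U] [CompleteSpace H] [CompleteSpace Z]

theorem measure_univ_ne_zero (F : Frame U H Z) : F.μ univ ≠ 0 := by
  simpa [timeMeasure] using F.T_pos

/-- Approximate solutions in a convex set can be chosen to converge to a solution. -/
theorem exists_tends {S : Set (Traj U H Z)} (hS : Convex ℝ ({A | F.IsBdd R A} ∩ S))
    (hne : ∀ ε > 0, ∃ A ∈ S, F.IsApprox R ε A) :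
    ∃ (A' : ℕ → Traj U H Z) (A : Traj U H Z), (∀ n, A' n ∈ S) ∧ F.Tends R A' A ∧
      F.IsApprox R 0 A := by
  -- Shrinking tolerances give a decreasing sequence of convex sets, to which the selection is
  -- applied.
  set C : ℕ → Set (Traj U H Z) := fun n => {A | F.IsApprox R (1 / ((n : ℝ) + 1)) A} ∩
    ({A | F.IsBdd R A} ∩ S) with hC
  have hCc : ∀ n, Convex ℝ (C n) := fun n => (convex_isApprox F R _).inter hS
  have hCne : ∀ n, (C n).Nonempty := fun n => by
    obtain ⟨A, hAS, hA⟩ := hne (1 / ((n : ℝ) + 1)) (by positivity)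
    exact ⟨A, hA, hA.toIsBdd, hAS⟩
  have hCanti : Antitone C := by
    intro m n hmn A hA
    refine ⟨IsApprox.mono hA.1 ?_, hA.2⟩
    exact one_div_le_one_div_of_le (by positivity) (by gcongr)
  -- The terminal velocity is left out; in the limit it is recovered from the momentum at `T`.
  set e : Traj U H Z → ℝ → U × (Z × StrongDual ℝ U) := fun A t => (A.w t, (A.y t, A.ζ t)) with he
  obtain ⟨B', hB'⟩ := F.hQ.fst.exists_dual
  have hB := F.hQ.fst.prod (F.hQ.snd.prod hB')
  -- A common exponent, still larger than one, for the three components.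
  set r := min F.P.p₁ (min F.P.p₂ (F.P.p₁ / (F.P.p₁ - 1))) with hr
  have hr1 : 1 < r := lt_min F.hp₁ (lt_min F.hp₂ (one_lt_conj F.hp₁))
  have hr1' : 1 ≤ ENNReal.ofReal r := by simpa using hr1.le
  have hrp₁ : ENNReal.ofReal r ≤ F.P.q₁ := ENNReal.ofReal_le_ofReal (min_le_left _ _)
  have hrp₂ : ENNReal.ofReal r ≤ F.P.q₂ :=
    ENNReal.ofReal_le_ofReal ((min_le_right _ _).trans (min_le_left _ _))
  have hrc : ENNReal.ofReal r ≤ F.P.conj₁ :=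
    ENNReal.ofReal_le_ofReal ((min_le_right _ _).trans (min_le_right _ _))
  obtain ⟨M, hM⟩ : ∃ M : ℝ≥0∞, M ≠ ∞ ∧ ∀ A, F.IsBdd R A →
      eLpNorm (e A) (ENNReal.ofReal r) F.μ ≤ M := by
    have hfin : ∀ a : ℝ, (F.μ univ) ^ a ≠ ∞ := fun a =>
      ENNReal.rpow_ne_top_of_ne_zero F.measure_univ_ne_zero (measure_ne_top _ _)
    refine ⟨ENNReal.ofReal R
        * (F.μ univ) ^ (1 / (ENNReal.ofReal r).toReal - 1 / F.P.q₁.toReal)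
      + (ENNReal.ofReal R
        * (F.μ univ) ^ (1 / (ENNReal.ofReal r).toReal - 1 / F.P.q₂.toReal)
      + ENNReal.ofReal R
        * (F.μ univ) ^ (1 / (ENNReal.ofReal r).toReal - 1 / F.P.conj₁.toReal)), ?_, ?_⟩
    · exact ENNReal.add_ne_top.mpr ⟨ENNReal.mul_ne_top ENNReal.ofReal_ne_top (hfin _),
        ENNReal.add_ne_top.mpr ⟨ENNReal.mul_ne_top ENNReal.ofReal_ne_top (hfin _),
        ENNReal.mul_ne_top ENNReal.ofReal_ne_top (hfin _)⟩⟩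
    · intro A hA
      refine (eLpNorm_prodMk_le hr1' hA.memLp_w.1 (hA.memLp_y.1.prodMk hA.memLp_ζ.1)).trans ?_
      refine add_le_add ?_ ((eLpNorm_prodMk_le hr1' hA.memLp_y.1 hA.memLp_ζ.1).trans
        (add_le_add ?_ ?_))
      · refine (eLpNorm_le_eLpNorm_mul_rpow_measure_univ hrp₁ hA.memLp_w.1).trans ?_
        gcongr; exact hA.le_w
      · refine (eLpNorm_le_eLpNorm_mul_rpow_measure_univ hrp₂ hA.memLp_y.1).trans ?_
        gcongr; exact hA.le_y
      · refine (eLpNorm_le_eLpNorm_mul_rpow_measure_univ hrc hA.memLp_ζ.1).trans ?_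
        gcongr; exact hA.le_ζ
  obtain ⟨x, y, hx, hy, hlim, hae⟩ := exists_selection (μ := F.μ) (C := fun n => e '' C n) hB hr1
    (K := M.toReal) ENNReal.toReal_nonneg (fun m n hmn => image_mono (hCanti hmn))
    (fun n => by
      rintro _ ⟨A, hA, rfl⟩ _ ⟨B, hB, rfl⟩ a b ha hb hab
      exact ⟨a • A + b • B, hCc n hA hB ha hb hab, rfl⟩) (fun n => (hCne n).image e) (by
      rintro _ ⟨A, hA, rfl⟩
      have hb := hA.2.1
      refine ⟨⟨hb.memLp_w.1.prodMk (hb.memLp_y.1.prodMk hb.memLp_ζ.1),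
        (hM.2 A hb).trans_lt hM.1.lt_top⟩, ?_⟩
      rw [ENNReal.ofReal_toReal hM.1]
      exact hM.2 A hb)
  choose A' hA' hxA using hx
  have hx' : x = fun n => e (A' n) := funext fun n => (hxA n).symm
  subst hx'
  have hδ : Tendsto (fun n : ℕ => 1 / ((n : ℝ) + 1)) atTop (𝓝 0) :=
    tendsto_one_div_add_atTop_nhds_zero_nat
  obtain ⟨vT, hT, hA⟩ := exists_limit (F := F) (fun n => (hA' n).1) hδ (w := fun t => (y t).1)
    (y := fun t => (y t).2.1) (ζ := fun t => (y t).2.2)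
    (tendsto_eLpNorm_of_le hlim fun n t => norm_fst_le ((e (A' n) - y) t))
    (by filter_upwards [hae] with t ht using (continuous_fst.tendsto _).comp ht)
    (tendsto_eLpNorm_of_le hlim fun n t => (norm_fst_le ((e (A' n) - y) t).2).trans (norm_snd_le _))
    (by filter_upwards [hae] with t ht using
      ((continuous_fst.comp continuous_snd).tendsto _).comp ht)
    (tendsto_eLpNorm_of_le hlim fun n t => (norm_snd_le ((e (A' n) - y) t).2).trans (norm_snd_le _))
    (by filter_upwards [hae] with t ht using
      ((continuous_snd.comp continuous_snd).tendsto _).comp ht)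
  exact ⟨A', _, fun n => (hA' n).2.2, hT, hA⟩

/-- Approximate solutions in a convex set can be chosen to converge to the solution. -/
theorem IsApprox.exists_tends (hA : F.IsApprox R 0 A) {S : Set (Traj U H Z)}
    (hS : Convex ℝ ({A | F.IsBdd R A} ∩ S)) (hne : ∀ ε > 0, ∃ A ∈ S, F.IsApprox R ε A) :
    ∃ A' : ℕ → Traj U H Z, (∀ n, A' n ∈ S) ∧ F.Tends R A' A := by
  obtain ⟨A', B, hA', hT, hB⟩ := Frame.exists_tends hS hne
  -- The limit `B` is an exact solution, hence coincides with `A` almost everywhere and may be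
  -- replaced by it.
  obtain ⟨hw, hy, hζ, hv⟩ := hB.unique hA
  refine ⟨A', hA', hT.bdd_n, hA.toIsBdd, ?_, ?_, ?_, ?_, ?_, ?_⟩
  · exact hT.w_L1.congr fun n => eLpNorm_congr_ae (by
      filter_upwards [hw] with t ht; simp only [Pi.sub_apply, ht])
  · filter_upwards [hT.w_ae, hw] with t h1 h2
    rwa [← h2]
  · exact hT.y_L1.congr fun n => eLpNorm_congr_ae (by
      filter_upwards [hy] with t ht; simp only [Pi.sub_apply, ht])
  · filter_upwards [hT.y_ae, hy] with t h1 h2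
    rwa [← h2]
  · exact hT.ζ_L1.congr fun n => eLpNorm_congr_ae (by
      filter_upwards [hζ] with t ht; simp only [Pi.sub_apply, ht])
  · rw [← hv]
    exact hT.vT

end Frame

end

/-! ### Growth of the potential, dominated convergence and truncation. -/

section

section Growth

variable {X : Type*} [NormedAddCommGroup X] [NormedSpace ℝ X] [CompleteSpace X]

/-- A growth condition on the subdifferential bounds the potential. -/
theorem potential_le_of_subdiff_le {B : X →L[ℝ] X →L[ℝ] ℝ} (hB : IsCoerciveForm B)
    {Ψ : X → ℝ≥0∞} (hp : ∃ v, Ψ v ≠ ∞) (hc : ConvexOn ℝ≥0 univ Ψ) (hl : LowerSemicontinuous Ψ)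
    {C p : ℝ} (hp1 : 1 < p) (hC : ∀ v : X, ∀ ξ ∈ subdiff Ψ v, ‖ξ‖ ≤ C * (1 + ‖v‖ ^ (p - 1))) :
    ∃ M : ℝ, 0 ≤ M ∧ ∀ x, Ψ x ≤ ENNReal.ofReal (M * (1 + ‖x‖ ^ p)) := by
  obtain ⟨x₀, hx₀⟩ := hp
  obtain ⟨c, hc0, hcB⟩ := hB.coercive
  set I := (Ψ x₀).toReal with hI
  have hI0 : 0 ≤ I := ENNReal.toReal_nonneg
  refine ⟨I + 2 * |C| * (1 + ‖x₀‖), by positivity, fun x => ?_⟩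
  have hnB : ∀ n : ℕ, IsCoerciveForm (((n : ℝ) + 1) • B) := fun n =>
    ⟨fun a b => by simp [hB.symm a b], ((n : ℝ) + 1) * c, by positivity, fun a => by
      have := hcB a
      simp only [smul_apply, smul_eq_mul, mul_assoc]
      gcongr⟩
  -- Proximal points: `y n` minimises `Ψ` plus `(n + 1) B` of the distance to `x`, so it carries the
  -- subgradient `2 (n + 1) B (x - y n)`.
  choose y hy using fun n : ℕ =>
    exists_mem_subdiff (hnB n) ⟨x₀, hx₀⟩ hc hl ((2 : ℝ) • (((n : ℝ) + 1) • B) x)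
  have hξ : ∀ n, (2 * ((n : ℝ) + 1)) • B (x - y n) ∈ subdiff Ψ (y n) := fun n => by
    convert hy n using 1
    ext z
    simp only [map_sub, smul_apply, sub_apply, smul_eq_mul]
    ring
  have hineq : ∀ n, (Ψ (y n)).toReal + 2 * ((n : ℝ) + 1) * B (x - y n) (x₀ - y n) ≤ I := fun n => by
    have := (mem_subdiff_iff.mp (hξ n)).2 x₀ hx₀
    rwa [smul_apply, smul_eq_mul] at this
  -- the resolvents are bounded
  obtain ⟨D, hD0, hD⟩ : ∃ D : ℝ, 0 ≤ D ∧ ∀ n, ‖x - y n‖ ≤ D := by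
    refine ⟨1 + (I + ‖B‖ * ‖x₀ - x‖) / c, by positivity, fun n => ?_⟩
    have h1 := hineq n
    have e : x₀ - y n = (x₀ - x) + (x - y n) := by abel
    rw [e, map_add] at h1
    have h2 := IsCoerciveForm.abs_le B (x - y n) (x₀ - x)
    have h3 := hcB (x - y n)
    have h4 : 0 ≤ (Ψ (y n)).toReal := ENNReal.toReal_nonneg
    have h5 := neg_abs_le (B (x - y n) (x₀ - x))
    set r := ‖x - y n‖
    have hr : 0 ≤ r := norm_nonneg _
    by_contra hcon
    push Not at hcon
    have hr1 : 1 ≤ r := by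
      refine le_trans ?_ hcon.le
      have : 0 ≤ (I + ‖B‖ * ‖x₀ - x‖) / c := by positivity
      linarith
    have h6 : (I + ‖B‖ * ‖x₀ - x‖) < c * r := by
      have : (I + ‖B‖ * ‖x₀ - x‖) / c < r := by linarith
      rw [div_lt_iff₀ hc0] at this
      linarith
    have h7 : I * r + ‖B‖ * ‖x₀ - x‖ * r < c * r ^ 2 := by nlinarith
    have h8 : I ≤ I * r := by nlinarith
    have h9 : I < B (x - y n) (x₀ - x) + B (x - y n) (x - y n) := by
      nlinarith
    have hn : (0 : ℝ) ≤ n := Nat.cast_nonneg n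
    nlinarith
  have hyb : ∀ n, ‖y n‖ ≤ ‖x‖ + D := fun n => by
    have : y n = x - (x - y n) := by abel
    rw [this]
    exact (norm_sub_le _ _).trans (by gcongr; exact hD n)
  have hsub : ∀ n : ℕ, ‖(2 * ((n : ℝ) + 1)) • B (x - y n)‖ ≤ |C| * (1 + ‖y n‖ ^ (p - 1)) := fun n =>
    (hC _ _ (hξ n)).trans (by gcongr; exact le_abs_self C)
  -- The `y n` are bounded, so the growth condition bounds the subgradients `2 (n + 1) B (x - y n)`;
  -- the distance is therefore of order `1 / (n + 1)`.
  have hlim : Tendsto y atTop (𝓝 x) := by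
    rw [tendsto_iff_norm_sub_tendsto_zero]
    have h1 : Tendsto (fun n : ℕ => |C| * (1 + (‖x‖ + D) ^ (p - 1)) / (2 * c)
        * (1 / ((n : ℝ) + 1))) atTop (𝓝 0) := by
      simpa using (tendsto_one_div_add_atTop_nhds_zero_nat (𝕜 := ℝ)).const_mul
        (|C| * (1 + (‖x‖ + D) ^ (p - 1)) / (2 * c))
    refine squeeze_zero (fun _ => norm_nonneg _) (fun n => ?_) h1
    rw [norm_sub_rev]
    have h2 : ‖(2 * ((n : ℝ) + 1)) • B (x - y n)‖ ≤ |C| * (1 + (‖x‖ + D) ^ (p - 1)) :=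
      (hsub n).trans (by
        gcongr
        exact hyb n)
    have h3 := (le_abs_self _).trans (dual_apply_le ((2 * ((n : ℝ) + 1)) • B (x - y n)) (x - y n))
    rw [smul_apply, smul_eq_mul] at h3
    have h4 := hcB (x - y n)
    set r := ‖x - y n‖
    have hr : 0 ≤ r := norm_nonneg _
    have h5 : 2 * ((n : ℝ) + 1) * (c * r ^ 2) ≤ |C| * (1 + (‖x‖ + D) ^ (p - 1)) * r := by
      refine le_trans ?_ (h3.trans (mul_le_mul_of_nonneg_right h2 hr))
      gcongr
    rcases hr.eq_or_lt with h0 | h0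
    · rw [← h0]; positivity
    · have h6 : 2 * ((n : ℝ) + 1) * (c * r) ≤ |C| * (1 + (‖x‖ + D) ^ (p - 1)) :=
        le_of_mul_le_mul_right (by nlinarith) h0
      rw [div_mul_div_comm, mul_one, le_div_iff₀ (by positivity)]
      linarith
  -- The subgradient inequality at `y n` against the fixed point `x₀`; lower semicontinuity then
  -- carries the bound to `x`.
  have hbound : ∀ n, Ψ (y n)
      ≤ ENNReal.ofReal (I + |C| * (1 + ‖y n‖ ^ (p - 1)) * (‖y n‖ + ‖x₀‖)) := fun n => by
    rw [← ENNReal.ofReal_toReal (mem_subdiff_iff.mp (hξ n)).1]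
    refine ENNReal.ofReal_le_ofReal ?_
    have h1 := hineq n
    have h2 := (neg_abs_le _).trans' (neg_le_neg
      (dual_apply_le ((2 * ((n : ℝ) + 1)) • B (x - y n)) (x₀ - y n)))
    rw [smul_apply, smul_eq_mul] at h2
    have h3 : ‖(2 * ((n : ℝ) + 1)) • B (x - y n)‖ * ‖x₀ - y n‖
        ≤ |C| * (1 + ‖y n‖ ^ (p - 1)) * (‖y n‖ + ‖x₀‖) := by
      refine mul_le_mul (hsub n) ?_ (norm_nonneg _) (by positivity)
      rw [add_comm]
      exact norm_sub_le _ _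
    linarith
  have hcont : Tendsto (fun n => ENNReal.ofReal
      (I + |C| * (1 + ‖y n‖ ^ (p - 1)) * (‖y n‖ + ‖x₀‖))) atTop
      (𝓝 (ENNReal.ofReal (I + |C| * (1 + ‖x‖ ^ (p - 1)) * (‖x‖ + ‖x₀‖)))) := by
    refine ENNReal.tendsto_ofReal ?_
    have h1 : Continuous fun z : X => I + |C| * (1 + ‖z‖ ^ (p - 1)) * (‖z‖ + ‖x₀‖) := by
      have : Continuous fun z : X => ‖z‖ ^ (p - 1) :=
        (Real.continuous_rpow_const (by linarith)).comp continuous_norm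
      fun_prop
    exact (h1.tendsto x).comp hlim
  have h1 : Ψ x ≤ ENNReal.ofReal (I + |C| * (1 + ‖x‖ ^ (p - 1)) * (‖x‖ + ‖x₀‖)) := by
    refine ((lowerSemicontinuous_iff_le_liminf.mp hl) x).trans
      ((liminf_le_liminf_of_le (u := Ψ) hlim).trans ?_)
    rw [← hcont.liminf_eq]
    exact liminf_le_liminf (Eventually.of_forall hbound)
  refine h1.trans (ENNReal.ofReal_le_ofReal ?_)
  set r := ‖x‖
  have hr : 0 ≤ r := norm_nonneg _
  set s := ‖x₀‖
  have hs : 0 ≤ s := norm_nonneg _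
  have hrp : 0 ≤ r ^ p := by positivity
  have h2 : (1 + r ^ (p - 1)) * (r + s) ≤ 2 * (1 + s) * (1 + r ^ p) := by
    rcases le_total r 1 with h | h
    · have h3 : r ^ (p - 1) ≤ 1 := Real.rpow_le_one hr h (by linarith)
      have h4 : 0 ≤ r ^ (p - 1) := by positivity
      calc (1 + r ^ (p - 1)) * (r + s) ≤ 2 * (1 + s) := by gcongr; linarith
        _ ≤ 2 * (1 + s) * (1 + r ^ p) := le_mul_of_one_le_right (by positivity) (by linarith)
    · have h3 : r ^ p = r ^ (p - 1) * r := by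
        rw [← Real.rpow_add_one (by positivity)]; congr 1; ring
      have h4 : 1 ≤ r ^ (p - 1) := Real.one_le_rpow h (by linarith)
      calc (1 + r ^ (p - 1)) * (r + s) ≤ (2 * r ^ (p - 1)) * (r * (1 + s)) := by
            gcongr
            · linarith
            · nlinarith
        _ = 2 * (1 + s) * r ^ p := by rw [h3]; ring
        _ ≤ 2 * (1 + s) * (1 + r ^ p) := by gcongr; linarith
  have h3 := mul_le_mul_of_nonneg_left h2 (abs_nonneg C)
  nlinarith [mul_nonneg hI0 hrp]

end Growth

section Dominated

variable {X : Type*} [NormedAddCommGroup X] [NormedSpace ℝ X] {μ : Measure ℝ} [IsFiniteMeasure μ]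

/-- Dominated convergence for pairings. -/
theorem tendsto_pairing_of_dominated {p q : ℝ≥0∞} (hpq : p⁻¹ + q⁻¹ = 1) {φ : ℝ → StrongDual ℝ X}
    (hφ : MemLp φ q μ) {a : ℝ → X} (ha : MemLp a p μ) {c : ℝ} {a' : ℕ → ℝ → X}
    (ham : ∀ n, AEStronglyMeasurable (a' n) μ) (hle : ∀ n t, ‖a' n t‖ ≤ ‖a t‖ + c)
    (hlim : ∀ t, Tendsto (fun n => a' n t) atTop (𝓝 (a t))) :
    Tendsto (fun n => ∫ t, φ t (a' n t) ∂μ) atTop (𝓝 (∫ t, φ t (a t) ∂μ)) := by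
  have hb : Integrable (fun t => ‖φ t‖ * (‖a t‖ + c)) μ := by
    have : ENNReal.HolderTriple q p 1 :=
      ENNReal.holderConjugate_iff.mpr (by rw [add_comm]; exact hpq)
    have h1 : MemLp (fun t => ‖a t‖ + c) p μ := ha.norm.add (memLp_const c)
    exact memLp_one_iff_integrable.mp (h1.mul hφ.norm (r := 1))
  refine tendsto_integral_of_dominated_convergence _
    (fun n => aestronglyMeasurable_pairing hφ.1 (ham n)) hb
    (fun n => Eventually.of_forall fun t => (dual_apply_le _ _).trans ?_)
    (Eventually.of_forall fun t => ((φ t).continuous.tendsto _).comp (hlim t))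
  gcongr
  exact hle n t

/-- Truncation of a pair of functions. -/
theorem exists_truncation {Y : Type*} [NormedAddCommGroup Y] [NormedSpace ℝ Y] {a : ℝ → X}
    {b : ℝ → Y} (ha : AEStronglyMeasurable a μ) (hb : AEStronglyMeasurable b μ) (x₀ : X) (y₀ : Y) :
    ∃ (a' : ℕ → ℝ → X) (b' : ℕ → ℝ → Y), (∀ n, MemLp (a' n) ∞ μ) ∧ (∀ n, MemLp (b' n) ∞ μ) ∧
      (∀ n t, (a' n t = a t ∧ b' n t = b t) ∨ (a' n t = x₀ ∧ b' n t = y₀)) ∧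
      ∀ t, ∀ᶠ n in atTop, a' n t = a t ∧ b' n t = b t := by
  classical
  set φ : ℕ → ℝ → ℝ := fun n s => if s ≤ n then 1 else 0 with hφ
  have hφm : ∀ n, Measurable (φ n) := fun n =>
    Measurable.ite measurableSet_Iic measurable_const measurable_const
  -- One cut-off, by the joint size, for both functions: at each time the pair is either kept or
  -- replaced by `(x₀, y₀)`.
  set χ : ℕ → ℝ → ℝ := fun n t => φ n (‖a t‖ + ‖b t‖) with hχ
  have hχm : ∀ n, AEStronglyMeasurable (χ n) μ := fun n =>
    ((hφm n).comp_aemeasurable (ha.norm.add hb.norm).aemeasurable).aestronglyMeasurable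
  have hcase : ∀ (n : ℕ) t, (‖a t‖ + ‖b t‖ ≤ n ∧ χ n t = 1) ∨ χ n t = 0 := fun n t => by
    simp only [hχ, hφ]
    split_ifs with h
    · exact Or.inl ⟨h, rfl⟩
    · exact Or.inr rfl
  refine ⟨fun n t => x₀ + χ n t • (a t - x₀), fun n t => y₀ + χ n t • (b t - y₀), fun n => ?_,
    fun n => ?_, fun n t => ?_, fun t => ?_⟩
  · refine memLp_top_of_bound (aestronglyMeasurable_const.add
      ((hχm n).smul (ha.sub aestronglyMeasurable_const))) (max n ‖x₀‖)
      (Eventually.of_forall fun t => ?_)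
    rcases hcase n t with h | h
    · refine le_max_of_le_left ?_
      change ‖x₀ + χ n t • (a t - x₀)‖ ≤ _
      rw [h.2, one_smul, add_sub_cancel]
      linarith [norm_nonneg (b t), h.1]
    · change ‖x₀ + χ n t • (a t - x₀)‖ ≤ _
      rw [h, zero_smul, add_zero]
      exact le_max_right _ _
  · refine memLp_top_of_bound (aestronglyMeasurable_const.add
      ((hχm n).smul (hb.sub aestronglyMeasurable_const))) (max n ‖y₀‖)
      (Eventually.of_forall fun t => ?_)
    rcases hcase n t with h | h
    · refine le_max_of_le_left ?_
      change ‖y₀ + χ n t • (b t - y₀)‖ ≤ _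
      rw [h.2, one_smul, add_sub_cancel]
      linarith [norm_nonneg (a t), h.1]
    · change ‖y₀ + χ n t • (b t - y₀)‖ ≤ _
      rw [h, zero_smul, add_zero]
      exact le_max_right _ _
  · rcases hcase n t with h | h
    · left; simp [h.2]
    · right; simp [h]
  · filter_upwards [eventually_ge_atTop ⌈‖a t‖ + ‖b t‖⌉₊] with n hn
    have h1 : ‖a t‖ + ‖b t‖ ≤ n := (Nat.le_ceil _).trans (by exact_mod_cast hn)
    simp [hχ, hφ, h1]

end Dominated

end

/-! ### From solutions of the variational inequality to weak solutions. -/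

section

/-- A continuous function with an integrable weak derivative is the primitive of it. -/
theorem eqOn_primitive {X : Type*} [NormedAddCommGroup X] [NormedSpace ℝ X] [CompleteSpace X]
    {T : ℝ} (hT : 0 < T) {u w : ℝ → X} (hu : ContinuousOn u (Icc 0 T))
    (hw : Integrable w (timeMeasure T)) (h : HasWeakDeriv T u w) :
    EqOn u (primitive (u 0) w) (Icc 0 T) := by
  obtain ⟨c, hc⟩ := exists_eq_primitive hT (integrable_of_continuousOn hu) hw h
  have h1 : EqOn u (primitive c w) (Icc 0 T) :=
    Measure.eqOn_Icc_of_ae_eq volume hT.ne hc hu (continuousOn_primitive' c hw)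
  have h2 := h1 ⟨le_rfl, hT.le⟩
  rw [primitive_zero] at h2
  rwa [h2]

namespace Frame

variable {U H Z : Type*} [NormedAddCommGroup U] [NormedSpace ℝ U]
  [NormedAddCommGroup H] [InnerProductSpace ℝ H]
  [NormedAddCommGroup Z] [NormedSpace ℝ Z] {F : Frame U H Z} {R : ℝ} {A : Traj U H Z}

/-- Since `dv - f = ζ`, the load disappears from the terms with the test function and acts only on
the velocity itself, where it is split into `f₁` paired in `U` and `f₂` paired in `H`. The tests are
bounded and `ζ` is merely integrable, as for a weak solution before any further regularity is known.
-/
theorem lin_add_integral (hw : MemLp A.w F.P.q₁ F.μ) (hy : MemLp A.y F.P.q₂ F.μ)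
    (hι : MemLp (fun t => F.P.ι (A.w t)) ∞ F.μ) (hζ : Integrable A.ζ F.μ)
    {u : ℝ → U} {z : ℝ → Z} (huz : EqOn (fun t => (u t, z t)) (F.state A) (Icc 0 F.P.T))
    {dv : ℝ → StrongDual ℝ U} (hdv : ∀ t, dv t = A.ζ t + F.load t)
    {a : ℝ → U} {b : ℝ → Z} (ha : MemLp a ∞ F.μ) (hb : MemLp b ∞ F.μ) :
    ((∫ t, ((dv t + F.P.dPhiU (u t) (z t) - F.P.f t) (a t)
        + (F.P.dPhiZ (u t) (z t) - F.P.g t) (b t) + F.P.f t (A.w t) + F.P.g t (A.y t)) ∂F.μ)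
      + F.P.kin F.P.v₀ + F.P.Φ (F.P.u₀, F.P.z₀)) = F.lin A a b := by
  have hq : (∞ : ℝ≥0∞)⁻¹ + (1 : ℝ≥0∞)⁻¹ = 1 := by simp
  have hst : ContinuousOn (F.state A) (Icc 0 F.P.T) :=
    (continuousOn_primitive' _ (hw.integrable F.one_le_q₁)).prodMk
      (continuousOn_primitive' _ (hy.integrable F.one_le_q₂))
  have hQ : MemLp (fun t => F.Q (F.state A t)) 1 F.μ :=
    memLp_of_continuousOn (F.Q.continuous.comp_continuousOn hst) _
  have hab : MemLp (fun t => (a t, b t)) ∞ F.μ :=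
    ⟨ha.1.prodMk hb.1, (eLpNorm_prodMk_le le_top ha.1 hb.1).trans_lt
      (ENNReal.add_lt_top.mpr ⟨ha.2, hb.2⟩)⟩
  have hg : MemLp F.P.g 1 F.μ := F.memLp_g.mono_exponent F.one_le_conj₂
  have i1 : Integrable (fun t => A.ζ t (a t)) F.μ :=
    integrable_pairing hq (memLp_one_iff_integrable.mpr hζ) ha
  have i2 : Integrable (fun t => 2 * F.Q (F.state A t) (a t, b t)) F.μ :=
    (integrable_pairing hq hQ hab).const_mul 2
  have i3 := integrable_pairing F.holder₁ F.memLp_f₁ hw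
  have i4 := integrable_pairing hq F.memLp_f₂ hι
  have i5 := integrable_pairing F.holder₂ F.memLp_g hy
  have i6 := integrable_pairing hq hg hb
  rw [lin, F.kin_eq, F.phi_eq]
  congr 2
  have e1 := integral_add i1 i2
  have e2 := integral_add (i1.add i2) i3
  have e3 := integral_add ((i1.add i2).add i3) i4
  have e4 := integral_add (((i1.add i2).add i3).add i4) i5
  have e5 := integral_sub ((((i1.add i2).add i3).add i4).add i5) i6
  simp only [Pi.add_apply] at e1 e2 e3 e4 e5
  rw [← e1, ← e2, ← e3, ← e4, ← e5]
  refine integral_congr_ae ?_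
  filter_upwards [ae_timeMeasure_mem, F.f_eq] with t ht hf
  have h1 := huz ht
  simp only at h1
  rw [hdv, hf]
  simp only [load, add_apply, sub_apply, F.dPhiU_apply, F.dPhiZ_apply, h1,
    ContinuousLinearMap.comp_apply]
  have h2 : F.Q (F.state A t) (a t, b t) = F.Q (F.state A t) (a t, 0) + F.Q (F.state A t) (0, b t) := by
    rw [← map_add]; simp
  rw [h2]
  ring

variable [CompleteSpace U] [CompleteSpace H] [CompleteSpace Z]

/-- Solutions of the variational inequality are weak solutions. -/
theorem IsApprox.isWeakSolution (h : F.IsApprox R 0 A) {v : ℝ → H}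
    (hv : (fun t => F.P.ι (A.w t)) =ᵐ[F.μ] v)
    (hv0 : v 0 = F.P.v₀) (hvT : v F.P.T = A.vT) (hdK : ∀ t ∈ Icc 0 F.P.T, F.dK (v t) = F.mom A t)
    (hvc : ∀ ℓ : StrongDual ℝ H, ContinuousOn (fun t => ℓ (v t)) (Icc 0 F.P.T)) :
    F.P.IsWeakSolution (fun t => (F.state A t).1) v (fun t => (F.state A t).2) := by
  have hT := F.T_pos.le
  have hae : (fun t => F.P.dKin (v t)) =ᵐ[F.μ] F.mom A := by
    filter_upwards [ae_timeMeasure_mem] with t ht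
    rw [F.dKin_eq, hdK t ht]
  refine ⟨A.w, fun t => A.ζ t + F.load t, A.y, h.continuousOn_state.fst,
    ⟨memLp_of_continuousOn h.continuousOn_state.fst _, h.memLp_w,
      hasWeakDeriv_of_primitive (c := F.P.u₀) hT h.integrable_w (ae_eq_refl _)⟩, hv, hvc,
    ⟨(memLp_of_continuousOn h.continuousOn_mom _).ae_eq hae.symm,
      memLp_one_iff_integrable.mpr h.integrable_ζ_load,
      hasWeakDeriv_of_primitive (c := F.dK F.P.v₀) hT h.integrable_ζ_load hae⟩,
    h.continuousOn_state.snd,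
    ⟨memLp_of_continuousOn h.continuousOn_state.snd _, h.memLp_y,
      hasWeakDeriv_of_primitive (c := F.P.z₀) hT h.integrable_y (ae_eq_refl _)⟩,
    by simp [F.state_zero], hv0, by simp [F.state_zero], fun a b ha hb => ?_⟩
  have e := lin_add_integral (F := F) h.memLp_w h.memLp_y h.memLp_ιw h.integrable_ζ
    (u := fun t => (F.state A t).1) (z := fun t => (F.state A t).2) (fun t _ => rfl)
    (fun t => rfl) ha hb
  rw [e]
  change _ + ((F.pot A.w A.y : ℝ≥0∞) : EReal) ≤ ((F.pot a b : ℝ≥0∞) : EReal) + _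
  by_cases hab : F.pot a b = ∞
  · rw [hab]
    simp
  have h1 := h.vi a b (ha.mono_exponent le_top) (hb.mono_exponent le_top) hab
  rw [← ENNReal.ofReal_toReal hab, ← ENNReal.ofReal_toReal h.pot_ne,
    EReal.coe_ennreal_ofReal, EReal.coe_ennreal_ofReal, max_eq_left ENNReal.toReal_nonneg,
    max_eq_left ENNReal.toReal_nonneg, F.kin_eq, F.phi_eq, hvT]
  norm_cast
  change _ + F.Q (F.state A F.P.T) (F.state A F.P.T) + _ ≤ _
  linarith

end Frame

end

/-! ### Conjugate integrability from a one-sided bound. -/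

section

/-- A functional bounded below on bounded tests, up to a potential of `p`-growth, has the
conjugate integrability. -/
theorem memLp_conj_of_le {X : Type*} [NormedAddCommGroup X] [NormedSpace ℝ X] [CompleteSpace X]
    {B : X →L[ℝ] X →L[ℝ] ℝ} (hB : IsCoerciveForm B) {μ : Measure ℝ} [IsFiniteMeasure μ] {p : ℝ}
    (hp : 1 < p) {Ψ : X → ℝ≥0∞} {M : ℝ} (hM : 0 ≤ M)
    (hΨ : ∀ x, Ψ x ≤ ENNReal.ofReal (M * (1 + ‖x‖ ^ p))) {η : ℝ → StrongDual ℝ X}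
    (hη : Integrable η μ) {c : ℝ}
    (h : ∀ a, MemLp a ∞ μ → c ≤ (∫⁻ t, Ψ (a t) ∂μ).toReal + ∫ t, η t (a t) ∂μ) :
    MemLp η (ENNReal.ofReal (p / (p - 1))) μ := by
  set q := p / (p - 1) with hqdef
  have hq : 1 < q := one_lt_conj hp
  have hqp : (q - 1) * p = q := by
    rw [hqdef]; have : p - 1 ≠ 0 := by linarith
    field_simp; ring
  -- The Riesz map serves as a duality map: `J ξ` is bounded by `‖ξ‖`, and `ξ (J ξ)` is comparable
  -- with `‖ξ‖²`.
  set J := hB.equiv.symm with hJ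
  set j := ‖(J : StrongDual ℝ X →L[ℝ] X)‖ with hj
  have hj0 : 0 ≤ j := ContinuousLinearMap.opNorm_nonneg _
  have hJle : ∀ ξ, ‖J ξ‖ ≤ j * ‖ξ‖ := fun ξ => (J : StrongDual ℝ X →L[ℝ] X).le_opNorm ξ
  obtain ⟨κ, hκ, hκJ⟩ : ∃ κ : ℝ, 0 < κ ∧ ∀ ξ : StrongDual ℝ X, κ * ‖ξ‖ ^ 2 ≤ ξ (J ξ) := by
    obtain ⟨b, hb, hbB⟩ := hB.coercive
    refine ⟨b / (‖B‖ + 1) ^ 2, by positivity, fun ξ => ?_⟩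
    have h1 : ‖ξ‖ ≤ (‖B‖ + 1) * ‖J ξ‖ := by
      conv_lhs => rw [← hB.equiv_symm_apply ξ]
      refine (B.le_opNorm _).trans ?_
      gcongr
      linarith
    have h2 := hbB (J ξ)
    rw [hB.equiv_symm_apply] at h2
    refine le_trans ?_ h2
    rw [div_mul_eq_mul_div, div_le_iff₀ (by positivity), mul_assoc, ← mul_pow]
    gcongr
    linarith
  -- Since `p > 1`, for small `l` the `p`-growth of the potential is absorbed by half of the pairing
  -- term, which is linear in `l`.
  obtain ⟨l, hl, hlM⟩ : ∃ l : ℝ, 0 < l ∧ M * (l * j) ^ p ≤ l * κ / 2 := by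
    have h1 : 0 < κ / (2 * (M * j ^ p + 1)) := by positivity
    refine ⟨(κ / (2 * (M * j ^ p + 1))) ^ (1 / (p - 1)), by positivity, ?_⟩
    set l := (κ / (2 * (M * j ^ p + 1))) ^ (1 / (p - 1)) with hl
    have hl0 : 0 < l := by positivity
    have h2 : l ^ (p - 1) = κ / (2 * (M * j ^ p + 1)) := by
      rw [hl, ← Real.rpow_mul h1.le, one_div_mul_cancel (by linarith), Real.rpow_one]
    have h3 : l ^ p = l * l ^ (p - 1) := by
      rw [← Real.rpow_one_add' hl0.le (by linarith)]; congr 1; ring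
    rw [Real.mul_rpow hl0.le hj0, h3, h2]
    have h4 : 0 ≤ M * j ^ p := by positivity
    rw [show M * (l * (κ / (2 * (M * j ^ p + 1))) * j ^ p)
      = (l * κ / 2) * (M * j ^ p / (M * j ^ p + 1)) by field_simp]
    refine mul_le_of_le_one_right (by positivity) ?_
    rw [div_le_one (by positivity)]
    linarith
  classical
  set E : ℕ → ℝ → ℝ := fun m t => if ‖η t‖ ≤ m then ‖η t‖ ^ q else 0 with hE
  set φ : ℕ → ℝ → ℝ := fun m s => if s ≤ m then s ^ (q - 2) else 0 with hφ
  have hφm : ∀ m, Measurable (φ m) := fun m =>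
    Measurable.ite measurableSet_Iic (by fun_prop) measurable_const
  have hEm : ∀ m, AEStronglyMeasurable (E m) μ := fun m => by
    have h1 : Measurable fun s : ℝ => if s ≤ m then s ^ q else 0 :=
      Measurable.ite measurableSet_Iic (by fun_prop) measurable_const
    exact (h1.comp_aemeasurable hη.1.norm.aemeasurable).aestronglyMeasurable
  have hE0 : ∀ m t, 0 ≤ E m t := fun m t => by
    simp only [hE]; split_ifs <;> positivity
  have hEi : ∀ m, Integrable (E m) μ := fun m => by
    refine Integrable.of_bound (hEm m) ((m : ℝ) ^ q) (Eventually.of_forall fun t => ?_)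
    rw [Real.norm_of_nonneg (hE0 m t)]
    simp only [hE]
    split_ifs with h1
    · gcongr
    · positivity
  -- The test `-l ‖η‖^(q-2) J η`, cut off where `‖η‖ > m`. Since `(q - 1) p = q`, both its `p`-th
  -- power and its pairing with `η` are measured by `‖η‖^q`.
  set a : ℕ → ℝ → X := fun m t => (-(l * φ m ‖η t‖)) • J (η t) with ha
  have hcase : ∀ (m : ℕ) t, (‖η t‖ ≤ m ∧ E m t = ‖η t‖ ^ q ∧ φ m ‖η t‖ * ‖η t‖ = ‖η t‖ ^ (q - 1)
      ∧ 0 ≤ φ m ‖η t‖) ∨ (E m t = 0 ∧ φ m ‖η t‖ = 0) := fun m t => by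
    simp only [hE, hφ]
    split_ifs with h1
    · refine Or.inl ⟨h1, rfl, ?_, by positivity⟩
      rcases (norm_nonneg (η t)).eq_or_lt with h2 | h2
      · rw [← h2, mul_zero, Real.zero_rpow (by linarith)]
      · rw [← Real.rpow_add_one h2.ne']; congr 1; ring
    · exact Or.inr ⟨rfl, rfl⟩
  have hnorm : ∀ m t, ‖a m t‖ ^ p ≤ (l * j) ^ p * E m t ∧ ‖a m t‖ ≤ l * j * (m : ℝ) ^ (q - 1) := by
    intro m t
    rcases hcase m t with ⟨h1, h2, h3, h4⟩ | ⟨h1, h2⟩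
    · have h5 : ‖a m t‖ ≤ l * j * ‖η t‖ ^ (q - 1) := by
        simp only [ha]
        rw [norm_smul, norm_neg, Real.norm_of_nonneg (by positivity)]
        refine (mul_le_mul_of_nonneg_left (hJle _) (by positivity)).trans_eq ?_
        rw [← h3]; ring
      refine ⟨?_, h5.trans ?_⟩
      · refine (Real.rpow_le_rpow (norm_nonneg _) h5 (by linarith)).trans_eq ?_
        rw [Real.mul_rpow (by positivity) (by positivity), ← Real.rpow_mul (norm_nonneg _), hqp, h2]
      · gcongr
    · have h5 : a m t = 0 := by simp [ha, h2]
      rw [h5, norm_zero, h1, mul_zero, Real.zero_rpow (by linarith)]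
      exact ⟨le_rfl, by positivity⟩
  have ham : ∀ m, MemLp (a m) ∞ μ := fun m => by
    refine memLp_top_of_bound ?_ _ (Eventually.of_forall fun t => (hnorm m t).2)
    exact (((hφm m).comp_aemeasurable hη.1.norm.aemeasurable).aestronglyMeasurable.const_mul
      l).neg.smul ((J : StrongDual ℝ X →L[ℝ] X).continuous.comp_aestronglyMeasurable hη.1)
  have hpair : ∀ m t, η t (a m t) ≤ -(l * κ) * E m t := by
    intro m t
    simp only [ha, map_smul, smul_eq_mul]
    rcases hcase m t with ⟨h1, h2, h3, h4⟩ | ⟨h1, h2⟩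
    · have h5 := mul_le_mul_of_nonneg_left (hκJ (η t)) (mul_nonneg hl.le h4)
      have h6 : φ m ‖η t‖ * ‖η t‖ ^ 2 = ‖η t‖ ^ q := by
        rw [sq, ← mul_assoc, h3]
        rcases (norm_nonneg (η t)).eq_or_lt with h7 | h7
        · rw [← h7, mul_zero, Real.zero_rpow (by linarith)]
        · rw [← Real.rpow_add_one h7.ne']; congr 1; ring
      rw [h2, ← h6]
      nlinarith
    · rw [h1, h2]; simp
  -- With the test above, `c ≤ M μ(Ω) - (l κ / 2) ∫ E m`, a bound independent of the truncation
  -- level.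
  set C := (M * μ.real univ - c) / (l * κ / 2) with hC
  have hS : ∀ m, ∫ t, E m t ∂μ ≤ C := fun m => by
    have h1 := h (a m) (ham m)
    have h2 : (∫⁻ t, Ψ (a m t) ∂μ).toReal ≤ M * μ.real univ + M * (l * j) ^ p * ∫ t, E m t ∂μ := by
      have hi : Integrable (fun t => M + M * (l * j) ^ p * E m t) μ :=
        (integrable_const M).add ((hEi m).const_mul _)
      have h3 : ∫⁻ t, Ψ (a m t) ∂μ ≤ ENNReal.ofReal (∫ t, (M + M * (l * j) ^ p * E m t) ∂μ) := by
        rw [ofReal_integral_eq_lintegral_ofReal hi (Eventually.of_forall fun t => by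
          have := hE0 m t; positivity)]
        refine lintegral_mono fun t => (hΨ _).trans (ENNReal.ofReal_le_ofReal ?_)
        have := mul_le_mul_of_nonneg_left (hnorm m t).1 hM
        linarith
      have h4 : ∫ t, (M + M * (l * j) ^ p * E m t) ∂μ
          = M * μ.real univ + M * (l * j) ^ p * ∫ t, E m t ∂μ := by
        rw [integral_add (integrable_const M) ((hEi m).const_mul _), integral_const,
          integral_const_mul, smul_eq_mul, mul_comm (μ.real univ)]
      rw [← h4]
      refine (ENNReal.toReal_mono ENNReal.ofReal_ne_top h3).trans_eq
        (ENNReal.toReal_ofReal (integral_nonneg fun t => ?_))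
      have := hE0 m t; positivity
    have h3 : ∫ t, η t (a m t) ∂μ ≤ -(l * κ) * ∫ t, E m t ∂μ := by
      rw [← integral_const_mul]
      refine integral_mono ?_ ((hEi m).const_mul _) (hpair m)
      exact integrable_pairing (p := ∞) (q := 1) (by simp) (memLp_one_iff_integrable.mpr hη) (ham m)
    have h5 : 0 ≤ ∫ t, E m t ∂μ := integral_nonneg (hE0 m)
    rw [hC, le_div_iff₀ (by positivity)]
    nlinarith
  refine ⟨hη.1, ?_⟩
  rw [eLpNorm_lt_top_iff_lintegral_rpow_enorm_lt_top
    (by simpa using (by linarith : (0 : ℝ) < q)) ENNReal.ofReal_ne_top,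
    ENNReal.toReal_ofReal (by linarith)]
  -- Fatou's lemma removes the truncation.
  have hF : ∫⁻ t, ‖η t‖ₑ ^ q ∂μ ≤ ENNReal.ofReal C := by
    have h1 : ∀ t, ‖η t‖ₑ ^ q = liminf (fun m => ENNReal.ofReal (E m t)) atTop := fun t => by
      refine (Tendsto.liminf_eq (tendsto_const_nhds.congr' ?_)).symm
      filter_upwards [eventually_ge_atTop ⌈‖η t‖⌉₊] with m hm
      have h1 : ‖η t‖ ≤ m := (Nat.le_ceil _).trans (by exact_mod_cast hm)
      simp only [hE, if_pos h1]
      rw [← ENNReal.ofReal_rpow_of_nonneg (norm_nonneg _) (by linarith), ofReal_norm]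
    simp_rw [h1]
    refine (lintegral_liminf_le' fun m => (hEm m).aemeasurable.ennreal_ofReal).trans ?_
    refine liminf_le_of_frequently_le' (Frequently.of_forall fun m => ?_)
    rw [← ofReal_integral_eq_lintegral_ofReal (hEi m) (Eventually.of_forall (hE0 m))]
    exact ENNReal.ofReal_le_ofReal (hS m)
  exact hF.trans_lt ENNReal.ofReal_lt_top

/-- A weakly continuous function on a compact interval is bounded. -/
theorem exists_norm_le_of_weak_cont {H : Type*} [NormedAddCommGroup H] [NormedSpace ℝ H]
    [CompleteSpace H] {K : H →L[ℝ] H →L[ℝ] ℝ} (hK : IsCoerciveForm K) {T : ℝ} {v : ℝ → H}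
    (hv : ∀ h : StrongDual ℝ H, ContinuousOn (fun t => h (v t)) (Icc 0 T)) :
    ∃ M : ℝ, ∀ t ∈ Icc 0 T, ‖v t‖ ≤ M := by
  obtain ⟨c, hc, hcK⟩ := hK.coercive
  obtain ⟨C, hC⟩ := banach_steinhaus (g := fun t : Icc 0 T => K (v t)) (fun x => by
    obtain ⟨C, hC⟩ := isCompact_Icc.exists_bound_of_continuousOn (hv (K x))
    exact ⟨C, fun t => by rw [hK.symm]; exact hC t t.2⟩)
  refine ⟨C / c, fun t ht => ?_⟩
  rcases (norm_nonneg (v t)).eq_or_lt with h | h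
  · rw [← h]
    have : 0 ≤ C := (norm_nonneg _).trans (hC ⟨t, ht⟩)
    positivity
  · rw [le_div_iff₀ hc]
    have h1 := (hcK (v t)).trans ((le_abs_self _).trans (dual_apply_le (K (v t)) (v t)))
    have h2 := mul_le_mul_of_nonneg_right (hC ⟨t, ht⟩) h.le
    simp only at h2
    refine le_of_mul_le_mul_right ?_ h
    nlinarith

end

/-! ### Regularity of the dual velocity and unbounded test functions. -/

section

namespace Frame

variable {U H Z : Type*} [NormedAddCommGroup U] [NormedSpace ℝ U] [CompleteSpace U]
  [NormedAddCommGroup H] [InnerProductSpace ℝ H] [CompleteSpace H]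
  [NormedAddCommGroup Z] [NormedSpace ℝ Z] [CompleteSpace Z] {F : Frame U H Z} {A : Traj U H Z}

/-- The variational inequality for bounded tests makes the dual velocity `p'`-integrable. -/
theorem memLp_ζ_of_vi (hst : ContinuousOn (F.state A) (Icc 0 F.P.T)) (hζ : Integrable A.ζ F.μ)
    {E : ℝ} (hvi : ∀ a b, MemLp a ∞ F.μ → MemLp b ∞ F.μ → F.pot a b ≠ ∞ →
      E ≤ (F.pot a b).toReal + F.lin A a b) : MemLp A.ζ F.P.conj₁ F.μ := by
  obtain ⟨C, hC⟩ := F.growth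
  obtain ⟨M, hM, hΨ⟩ := potential_le_of_subdiff_le F.hQ.fst F.hΨ₁.proper F.hΨ₁.convex F.hΨ₁.lsc
    F.hp₁ hC
  obtain ⟨y₀, hy₀⟩ := F.hΨ₂.proper
  have hq : (∞ : ℝ≥0∞)⁻¹ + (1 : ℝ≥0∞)⁻¹ = 1 := by simp
  set L : (U × Z →L[ℝ] ℝ) →L[ℝ] (U →L[ℝ] ℝ) :=
    (ContinuousLinearMap.compL ℝ U (U × Z) ℝ).flip (ContinuousLinearMap.inl ℝ U Z) with hL
  -- The part of the stored energy that acts on the test in `U`. It is continuous in time, so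
  -- integrability of `ζ + θ` passes to `ζ`. The second test is the constant `y₀`, and all terms
  -- free of `a` are collected in `D`.
  set θ : ℝ → StrongDual ℝ U := fun t => L ((2 : ℝ) • F.Q (F.state A t)) with hθ
  have hθm : ∀ p, MemLp θ p F.μ := fun p =>
    memLp_of_continuousOn (L.continuous.comp_continuousOn
      ((F.Q.continuous.comp_continuousOn hst).const_smul (2 : ℝ))) _
  have hθa : ∀ t x, θ t x = 2 * F.Q (F.state A t) (x, 0) := fun t x => by simp [hθ, hL]
  have hθi : Integrable θ F.μ := memLp_one_iff_integrable.mp (hθm 1)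
  have hsum : MemLp (fun t => A.ζ t + θ t) F.P.conj₁ F.μ := by
    set b : ℝ → Z := fun _ => y₀
    set D : ℝ := (∫ t, 2 * F.Q (F.state A t) (0, y₀) ∂F.μ) + (∫ t, F.f₁ t (A.w t) ∂F.μ)
      + (∫ t, F.f₂ t (F.P.ι (A.w t)) ∂F.μ) + (∫ t, F.P.g t (A.y t) ∂F.μ)
      - (∫ t, F.P.g t (b t) ∂F.μ) + F.K F.P.v₀ F.P.v₀ + F.Q (F.P.u₀, F.P.z₀) (F.P.u₀, F.P.z₀)
    have hsi : Integrable (fun t => A.ζ t + θ t) F.μ := hζ.add (f := A.ζ) (g := θ) hθi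
    rw [Problem.conj₁]
    refine memLp_conj_of_le F.hQ.fst F.hp₁ hM hΨ hsi
      (c := E - (∫⁻ _, F.P.Ψ₂ y₀ ∂F.μ).toReal - D) fun a ha => ?_
    have hm : AEMeasurable (fun t => F.P.Ψ₁ (a t)) F.μ := aemeasurable_comp_lsc F.hΨ₁.lsc ha.1
    have h1 : F.pot a b = (∫⁻ t, F.P.Ψ₁ (a t) ∂F.μ) + ∫⁻ _, F.P.Ψ₂ y₀ ∂F.μ :=
      lintegral_add_left' hm _
    have h2 : ∫⁻ t, F.P.Ψ₁ (a t) ∂F.μ ≠ ∞ := by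
      have h3 : Integrable (fun t => M * (1 + ‖a t‖ ^ F.P.p₁)) F.μ := by
        have h4 : MemLp a (ENNReal.ofReal F.P.p₁) F.μ := ha.mono_exponent le_top
        exact ((integrable_const 1).add
          (MemLp.integrable_rpow (by linarith [F.hp₁]) h4)).const_mul M
      refine ne_top_of_le_ne_top h3.lintegral_lt_top.ne (lintegral_mono fun t => hΨ _)
    have h3 : ∫⁻ _, F.P.Ψ₂ y₀ ∂F.μ ≠ ∞ := by
      rw [lintegral_const]
      exact ENNReal.mul_ne_top hy₀ (measure_ne_top _ _)
    have h4 := hvi a b ha (memLp_const _) (by rw [h1]; exact ENNReal.add_ne_top.mpr ⟨h2, h3⟩)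
    rw [h1, ENNReal.toReal_add h2 h3] at h4
    have i1 : Integrable (fun t => A.ζ t (a t)) F.μ :=
      integrable_pairing hq (memLp_one_iff_integrable.mpr hζ) ha
    have i2 : Integrable (fun t => θ t (a t)) F.μ := integrable_pairing hq (hθm 1) ha
    have i3 : Integrable (fun t => 2 * F.Q (F.state A t) (0, y₀)) F.μ :=
      integrable_of_continuousOn (by
        exact ((F.Q.continuous.comp_continuousOn hst).clm_apply continuousOn_const).const_smul
          (2 : ℝ))
    have h5 : F.lin A a b = (∫ t, (A.ζ t + θ t) (a t) ∂F.μ) + D := by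
      have e1 : ∫ t, (A.ζ t + θ t) (a t) ∂F.μ
          = (∫ t, A.ζ t (a t) ∂F.μ) + ∫ t, θ t (a t) ∂F.μ := integral_add i1 i2
      have e2 : ∫ t, 2 * F.Q (F.state A t) (a t, b t) ∂F.μ
          = (∫ t, θ t (a t) ∂F.μ) + ∫ t, 2 * F.Q (F.state A t) (0, y₀) ∂F.μ := by
        rw [← integral_add i2 i3]
        refine integral_congr_ae (Eventually.of_forall fun t => ?_)
        simp only [hθa]
        rw [← mul_add, ← map_add]
        simp [b]
      rw [lin, e1, e2]
      ring
    linarith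
  have h1 := hsum.sub (hθm F.P.conj₁)
  refine h1.ae_eq (Eventually.of_forall fun t => ?_)
  simp

/-- The variational inequality extends from bounded tests to `p`-integrable tests. -/
theorem vi_of_bounded (hst : ContinuousOn (F.state A) (Icc 0 F.P.T))
    (hζ : MemLp A.ζ F.P.conj₁ F.μ)
    {E : ℝ} (hvi : ∀ a b, MemLp a ∞ F.μ → MemLp b ∞ F.μ → F.pot a b ≠ ∞ →
      E ≤ (F.pot a b).toReal + F.lin A a b) {a : ℝ → U} {b : ℝ → Z} (ha : MemLp a F.P.q₁ F.μ)
    (hb : MemLp b F.P.q₂ F.μ) (hab : F.pot a b ≠ ∞) : E ≤ (F.pot a b).toReal + F.lin A a b := by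
  obtain ⟨x₀, y₀, hx₀, hy₀, h0⟩ := F.exists_pot_ne_top
  -- Each truncated pair has a potential at most that of `(a, b)` plus that of `(x₀, y₀)`, an
  -- integrable majorant.
  obtain ⟨a', b', ha', hb', hor, hev⟩ := exists_truncation ha.1 hb.1 x₀ y₀
  have hbound : ∀ n t, F.P.Ψ₁ (a' n t) + F.P.Ψ₂ (b' n t)
      ≤ (F.P.Ψ₁ (a t) + F.P.Ψ₂ (b t)) + (F.P.Ψ₁ x₀ + F.P.Ψ₂ y₀) := fun n t => by
    rcases hor n t with ⟨h1, h2⟩ | ⟨h1, h2⟩ <;> rw [h1, h2]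
    · exact le_self_add
    · exact le_add_self
  have hsum : ∫⁻ t, ((F.P.Ψ₁ (a t) + F.P.Ψ₂ (b t)) + (F.P.Ψ₁ x₀ + F.P.Ψ₂ y₀)) ∂F.μ ≠ ∞ := by
    rw [lintegral_add_left' (aemeasurable_pot ha.1 hb.1)]
    exact ENNReal.add_ne_top.mpr ⟨hab, h0⟩
  have hfin : ∀ n, F.pot (a' n) (b' n) ≠ ∞ := fun n =>
    ne_top_of_le_ne_top hsum (lintegral_mono (hbound n))
  have hpot : Tendsto (fun n => F.pot (a' n) (b' n)) atTop (𝓝 (F.pot a b)) := by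
    refine tendsto_lintegral_of_dominated_convergence' _
      (fun n => aemeasurable_pot (ha' n).1 (hb' n).1)
      (fun n => Eventually.of_forall (hbound n)) hsum (Eventually.of_forall fun t => ?_)
    refine tendsto_const_nhds.congr' ?_
    filter_upwards [hev t] with n hn
    rw [hn.1, hn.2]
  have hna : ∀ n t, ‖a' n t‖ ≤ ‖a t‖ + ‖x₀‖ := fun n t => by
    rcases hor n t with ⟨h1, -⟩ | ⟨h1, -⟩ <;> rw [h1]
    · linarith [norm_nonneg x₀]
    · linarith [norm_nonneg (a t)]
  have hnb : ∀ n t, ‖b' n t‖ ≤ ‖b t‖ + ‖y₀‖ := fun n t => by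
    rcases hor n t with ⟨-, h1⟩ | ⟨-, h1⟩ <;> rw [h1]
    · linarith [norm_nonneg y₀]
    · linarith [norm_nonneg (b t)]
  have hla : ∀ t, Tendsto (fun n => a' n t) atTop (𝓝 (a t)) := fun t =>
    tendsto_const_nhds.congr' ((hev t).mono fun n hn => hn.1.symm)
  have hlb : ∀ t, Tendsto (fun n => b' n t) atTop (𝓝 (b t)) := fun t =>
    tendsto_const_nhds.congr' ((hev t).mono fun n hn => hn.2.symm)
  have t1 := tendsto_pairing_of_dominated F.holder₁ hζ ha (fun n => (ha' n).1) hna hla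
  have t2 : Tendsto (fun n => ∫ t, 2 * F.Q (F.state A t) (a' n t, b' n t) ∂F.μ) atTop
      (𝓝 (∫ t, 2 * F.Q (F.state A t) (a t, b t) ∂F.μ)) := by
    have hq : (1 : ℝ≥0∞)⁻¹ + (∞ : ℝ≥0∞)⁻¹ = 1 := by simp
    have hQ : MemLp (fun t => (2 : ℝ) • F.Q (F.state A t)) ∞ F.μ :=
      memLp_of_continuousOn ((F.Q.continuous.comp_continuousOn hst).const_smul (2 : ℝ)) _
    have h1 : MemLp (fun t => (a t, b t)) 1 F.μ := memLp_one_iff_integrable.mpr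
      ((ha.integrable F.one_le_q₁).prodMk (hb.integrable F.one_le_q₂))
    have := tendsto_pairing_of_dominated hq hQ h1 (c := ‖x₀‖ + ‖y₀‖)
      (a' := fun n t => (a' n t, b' n t))
      (fun n => (ha' n).1.prodMk (hb' n).1) (fun n t => by
        rw [Prod.norm_def, Prod.norm_def]
        refine max_le ?_ ?_
        · linarith [hna n t, le_max_left ‖a t‖ ‖b t‖, norm_nonneg y₀]
        · linarith [hnb n t, le_max_right ‖a t‖ ‖b t‖, norm_nonneg x₀])
      (fun t => (hla t).prodMk_nhds (hlb t))
    simpa using this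
  have t3 := tendsto_pairing_of_dominated F.holder₂ F.memLp_g hb (fun n => (hb' n).1) hnb hlb
  have hlin : Tendsto (fun n => F.lin A (a' n) (b' n)) atTop (𝓝 (F.lin A a b)) :=
    (((((((t1.add t2).add_const _).add_const _).add_const _).sub t3).add_const _).add_const _)
  exact ge_of_tendsto' (((ENNReal.tendsto_toReal hab).comp hpot).add hlin)
    fun n => hvi _ _ (ha' n) (hb' n) (hfin n)

end Frame

end

/-! ### Weak solutions satisfy the variational inequality and are unique. -/

section

namespace Frame

variable {U H Z : Type*} [NormedAddCommGroup U] [NormedSpace ℝ U] [CompleteSpace U]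
  [NormedAddCommGroup H] [InnerProductSpace ℝ H] [CompleteSpace H]
  [NormedAddCommGroup Z] [NormedSpace ℝ Z] [CompleteSpace Z]

/-- Weak solutions satisfy the variational inequality. -/
theorem exists_isApprox_of_isWeakSolution (F : Frame U H Z) {u : ℝ → U} {v : ℝ → H} {z : ℝ → Z}
    (h : F.P.IsWeakSolution u v z) :
    ∃ (R : ℝ) (A : Traj U H Z), F.IsApprox R 0 A ∧
      EqOn (fun t => (u t, z t)) (F.state A) (Icc 0 F.P.T) ∧
      ∀ t ∈ Icc 0 F.P.T, F.dK (v t) = F.mom A t := by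
  obtain ⟨w, dv, y, huc, hu, hwv, hvc, hv, hzc, hz, hu0, hv0, hz0, hvi⟩ := h
  have hdv : Integrable dv F.μ := memLp_one_iff_integrable.mp hv.memLp_deriv
  set A : Traj U H Z := (w, y, fun t => dv t - F.load t, v F.P.T) with hA
  have hdvA : ∀ t, dv t = A.ζ t + F.load t := fun t => by
    change dv t = dv t - F.load t + F.load t
    rw [sub_add_cancel]
  have hwi : Integrable w F.μ := hu.memLp_deriv.integrable F.one_le_q₁
  have hyi : Integrable y F.μ := hz.memLp_deriv.integrable F.one_le_q₂
  have hst : ContinuousOn (F.state A) (Icc 0 F.P.T) :=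
    (continuousOn_primitive' _ hwi).prodMk (continuousOn_primitive' _ hyi)
  have hζ : Integrable A.ζ F.μ := hdv.sub (f := dv) (g := F.load) F.integrable_load
  have huz : EqOn (fun t => (u t, z t)) (F.state A) (Icc 0 F.P.T) := fun t ht => by
    have h1 := eqOn_primitive F.T_pos huc hwi hu.hasWeakDeriv ht
    have h2 := eqOn_primitive F.T_pos hzc hyi hz.hasWeakDeriv ht
    rw [hu0] at h1
    rw [hz0] at h2
    exact Prod.ext h1 h2
  have hmom : ∀ t ∈ Icc 0 F.P.T, F.dK (v t) = F.mom A t := by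
    obtain ⟨c, hc⟩ := exists_eq_primitive F.T_pos
      (memLp_one_iff_integrable.mp hv.memLp) hdv hv.hasWeakDeriv
    -- The primitive represents the momentum almost everywhere. Both sides are continuous in time
    -- when tested with `x`, the left one by weak continuity of `v`, so they agree at every time.
    have h1 : ∀ t ∈ Icc 0 F.P.T, F.dK (v t) = primitive c dv t := fun t ht => by
      ext x
      have h2 : EqOn (fun t => F.dK (v t) x) (fun t => primitive c dv t x) (Icc 0 F.P.T) := by
        refine Measure.eqOn_Icc_of_ae_eq volume F.T_pos.ne ?_ ?_ ?_
        · have : ∀ᵐ t ∂F.μ, F.dK (v t) x = primitive c dv t x := by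
            filter_upwards [hc] with t ht
            rw [← F.dKin_eq, ht, primitive]
          exact this
        · exact hvc (F.dK.flip x)
        · exact (continuousOn_primitive' c hdv).clm_apply continuousOn_const
      exact h2 ht
    have h3 := h1 0 F.zero_mem
    rw [primitive_zero, hv0] at h3
    intro t ht
    rw [h1 t ht, ← h3, mom]
    congr 1
    exact funext hdvA
  obtain ⟨M, hM⟩ := exists_norm_le_of_weak_cont F.hK hvc
  have hιb : ∀ᵐ t ∂F.μ, ‖F.P.ι (w t)‖ ≤ M := by
    filter_upwards [hwv, ae_timeMeasure_mem] with t h1 h2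
    rw [h1]
    exact hM t h2
  have hι : MemLp (fun t => F.P.ι (A.w t)) ∞ F.μ :=
    memLp_top_of_bound (F.P.ι.continuous.comp_aestronglyMeasurable hwi.1) M hιb
  have hvi' : ∀ a b, MemLp a ∞ F.μ → MemLp b ∞ F.μ →
      ((F.K A.vT A.vT + F.Q (F.state A F.P.T) (F.state A F.P.T) : ℝ) : EReal)
        + ((F.pot A.w A.y : ℝ≥0∞) : EReal) ≤ ((F.pot a b : ℝ≥0∞) : EReal)
        + ((F.lin A a b : ℝ) : EReal) := fun a b ha hb => by
    have h1 := hvi a b ha hb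
    have h2 := huz F.T_mem
    simp only at h2
    have e := lin_add_integral (F := F) (A := A) hu.memLp_deriv hz.memLp_deriv hι hζ huz hdvA ha hb
    rw [e, F.kin_eq, F.phi_eq, h2] at h1
    exact h1
  -- A constant test with finite potentials makes the right side finite.
  have hpot : F.pot A.w A.y ≠ ∞ := by
    obtain ⟨x₀, y₀, -, -, h0⟩ := F.exists_pot_ne_top
    have h1 := hvi' _ _ (memLp_const x₀) (memLp_const y₀)
    intro h2
    rw [h2, ← ENNReal.ofReal_toReal h0, EReal.coe_ennreal_ofReal, EReal.coe_ennreal_top,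
      EReal.coe_add_top, ← EReal.coe_add] at h1
    exact absurd h1 (not_le.mpr (EReal.coe_lt_top _))
  have hvi2 : ∀ a b, MemLp a ∞ F.μ → MemLp b ∞ F.μ → F.pot a b ≠ ∞ →
      F.K A.vT A.vT + F.Q (F.state A F.P.T) (F.state A F.P.T) + (F.pot A.w A.y).toReal
        ≤ (F.pot a b).toReal + F.lin A a b := fun a b ha hb hab => by
    have h1 := hvi' a b ha hb
    rw [← ENNReal.ofReal_toReal hab, ← ENNReal.ofReal_toReal hpot,
      EReal.coe_ennreal_ofReal, EReal.coe_ennreal_ofReal, max_eq_left ENNReal.toReal_nonneg,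
      max_eq_left ENNReal.toReal_nonneg] at h1
    exact_mod_cast h1
  have hζp := memLp_ζ_of_vi hst hζ hvi2
  -- Any finite bound will do: for uniqueness the two solutions may have different constants.
  set R := max (max (eLpNorm w F.P.q₁ F.μ).toReal (eLpNorm y F.P.q₂ F.μ).toReal)
    (max (eLpNorm A.ζ F.P.conj₁ F.μ).toReal (max M ‖A.vT‖)) with hR
  have hle : ∀ {s : ℝ≥0∞}, s ≠ ∞ → s.toReal ≤ R → s ≤ ENNReal.ofReal R := fun hs h1 => by
    rw [← ENNReal.ofReal_toReal hs]
    exact ENNReal.ofReal_le_ofReal h1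
  refine ⟨R, A, ⟨⟨hu.memLp_deriv, hle hu.memLp_deriv.2.ne ?_, hz.memLp_deriv,
    hle hz.memLp_deriv.2.ne ?_, hζp, hle hζp.2.ne ?_, ?_, ?_⟩, hpot, hmom _ F.T_mem, ?_,
    fun a b ha hb hab => ?_⟩, huz, hmom⟩
  · exact (le_max_left _ _).trans (le_max_left _ _)
  · exact (le_max_right _ _).trans (le_max_left _ _)
  · exact (le_max_left _ _).trans (le_max_right _ _)
  · filter_upwards [hιb] with t ht
    exact ht.trans ((le_max_left _ _).trans ((le_max_right _ _).trans (le_max_right _ _)))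
  · exact (le_max_right _ _).trans ((le_max_right _ _).trans (le_max_right _ _))
  · refine (integral_eq_zero_of_ae ?_).le
    filter_upwards [hwv, ae_timeMeasure_mem] with t h1 h2
    change ‖F.dK (F.P.ι (w t)) - F.mom A t‖ = 0
    rw [h1, hmom t h2, sub_self, norm_zero]
  · rw [zero_mul, add_zero]
    exact vi_of_bounded hst hζp hvi2 ha hb hab

/-- Weak solutions are unique. -/
theorem eqOn_of_isWeakSolution (F : Frame U H Z) {R : ℝ} {A : Traj U H Z} (hA : F.IsApprox R 0 A)
    {v₁ : ℝ → H} (hv₁ : ∀ t ∈ Icc 0 F.P.T, F.dK (v₁ t) = F.mom A t)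
    {u : ℝ → U} {v : ℝ → H} {z : ℝ → Z} (h : F.P.IsWeakSolution u v z) :
    EqOn u (fun t => (F.state A t).1) (Icc 0 F.P.T) ∧ EqOn v v₁ (Icc 0 F.P.T) ∧
      EqOn z (fun t => (F.state A t).2) (Icc 0 F.P.T) := by
  obtain ⟨R', B, hB, hst, hmom⟩ := F.exists_isApprox_of_isWeakSolution h
  refine ⟨fun t ht => ?_, fun t ht => F.dK_injective ?_, fun t ht => ?_⟩
  · change u t = (F.state A t).1
    rw [← (hB.eqOn hA ht).1, ← hst ht]
  · rw [hmom t ht, hv₁ t ht, (hB.eqOn hA ht).2]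
  · change z t = (F.state A t).2
    rw [← (hB.eqOn hA ht).1, ← hst ht]

end Frame

end

/-! ### Solvability of the scheme. -/

section

/-- Only one component is varied; the potential of the other one is finite and cancels. -/
theorem mem_subdiff_prod {X Y : Type*} [NormedAddCommGroup X] [NormedSpace ℝ X]
    [NormedAddCommGroup Y] [NormedSpace ℝ Y] {Ψ₁ : X → ℝ≥0∞} {Ψ₂ : Y → ℝ≥0∞} {v : X × Y}
    {ξ : StrongDual ℝ (X × Y)} (h : ξ ∈ subdiff (fun x : X × Y => Ψ₁ x.1 + Ψ₂ x.2) v) :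
    ξ.comp (ContinuousLinearMap.inl ℝ X Y) ∈ subdiff Ψ₁ v.1 ∧
      ξ.comp (ContinuousLinearMap.inr ℝ X Y) ∈ subdiff Ψ₂ v.2 := by
  obtain ⟨h1, h2⟩ := mem_subdiff_iff.mp h
  obtain ⟨h3, h4⟩ := ENNReal.add_ne_top.mp h1
  refine ⟨mem_subdiff_iff.mpr ⟨h3, fun x hx => ?_⟩, mem_subdiff_iff.mpr ⟨h4, fun y hy => ?_⟩⟩
  · have h5 := h2 (x, v.2) (ENNReal.add_ne_top.mpr ⟨hx, h4⟩)
    rw [ENNReal.toReal_add h3 h4, ENNReal.toReal_add hx h4] at h5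
    have h6 : (x, v.2) - v = (x - v.1, 0) := Prod.ext rfl (sub_self _)
    rw [h6] at h5
    simp only [ContinuousLinearMap.comp_apply, ContinuousLinearMap.inl_apply]
    linarith
  · have h5 := h2 (v.1, y) (ENNReal.add_ne_top.mpr ⟨h3, hy⟩)
    rw [ENNReal.toReal_add h3 h4, ENNReal.toReal_add h3 hy] at h5
    have h6 : (v.1, y) - v = (0, y - v.2) := Prod.ext (sub_self _) rfl
    rw [h6] at h5
    simp only [ContinuousLinearMap.comp_apply, ContinuousLinearMap.inr_apply]
    linarith

theorem half_add_smul {X : Type*} [AddCommGroup X] [Module ℝ X] (τ : ℝ) (x y : X) :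
    (2⁻¹ : ℝ) • (x + τ • y + x) = x + (τ / 2) • y := by module

theorem inv_smul_add_smul_sub {X : Type*} [AddCommGroup X] [Module ℝ X] {τ : ℝ} (hτ : τ ≠ 0)
    (x y : X) : τ⁻¹ • (x + τ • y - x) = y := by
  rw [add_sub_cancel_left, smul_smul, inv_mul_cancel₀ hτ, one_smul]

/-- The difference quotient of a sequence. -/
noncomputable def slope {X : Type*} [NormedAddCommGroup X] [NormedSpace ℝ X] (τ : ℝ) (x : ℕ → X)
    (k : ℕ) : X := τ⁻¹ • (x k - x (k - 1))

/-- The half-step value of a sequence. -/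
noncomputable def midpt {X : Type*} [NormedAddCommGroup X] [NormedSpace ℝ X] (x : ℕ → X)
    (k : ℕ) : X := (2⁻¹ : ℝ) • (x k + x (k - 1))

namespace Frame

variable {U H Z : Type*} [NormedAddCommGroup U] [NormedSpace ℝ U]
  [NormedAddCommGroup H] [InnerProductSpace ℝ H]
  [NormedAddCommGroup Z] [NormedSpace ℝ Z]

theorem step_pos (F : Frame U H Z) {N : ℕ} (hN : 1 ≤ N) : 0 < F.P.step N :=
  div_pos F.T_pos (by exact_mod_cast hN)

theorem mul_step (F : Frame U H Z) {N : ℕ} (hN : 1 ≤ N) : N * F.P.step N = F.P.T := by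
  have : (N : ℝ) ≠ 0 := by positivity
  rw [Problem.step]
  field_simp

/-- One step of the scheme is solvable. -/
theorem exists_step [CompleteSpace U] [CompleteSpace Z] (F : Frame U H Z) {τ : ℝ} (hτ : 0 < τ)
    (f : StrongDual ℝ U) (g : StrongDual ℝ Z) (u : U) (v : H) (z : Z) : ∃ (w : U) (y : Z),
      f - F.P.dKin ((2 / τ) • (F.P.ι w - v)) - F.P.dPhiU (u + (τ / 2) • w) (z + (τ / 2) • y)
        ∈ subdiff F.P.Ψ₁ w ∧
      g - F.P.dPhiZ (u + (τ / 2) • w) (z + (τ / 2) • y) ∈ subdiff F.P.Ψ₂ y := by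
  set L : U × Z →L[ℝ] H := F.P.ι.comp (ContinuousLinearMap.fst ℝ U Z) with hL
  -- From `ι w = (v' + v) / 2` the difference quotient of the velocity is `(2/τ)(ι w - v)`, and the
  -- half-step state is the old one plus `τ/2` times the velocities. These are the weights `2/τ` and
  -- `τ/2`, and the terms with the old values go into the linear functional.
  set B : (U × Z) →L[ℝ] (U × Z) →L[ℝ] ℝ := (2 / τ) • F.K.bilinearComp L L + (τ / 2) • F.Q with hBdef
  have hBa : ∀ x y, B x y = (2 / τ) * F.K (F.P.ι x.1) (F.P.ι y.1) + (τ / 2) * F.Q x y :=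
    fun x y => by simp [hBdef, hL]
  have hB : IsCoerciveForm B := by
    refine ⟨fun x y => by rw [hBa, hBa, F.hK.symm, F.hQ.symm], ?_⟩
    obtain ⟨c, hc, hcQ⟩ := F.hQ.coercive
    refine ⟨τ / 2 * c, by positivity, fun x => ?_⟩
    rw [hBa]
    have h1 := mul_le_mul_of_nonneg_left (hcQ x) (by positivity : 0 ≤ τ / 2)
    have h2 : 0 ≤ 2 / τ * F.K (F.P.ι x.1) (F.P.ι x.1) :=
      mul_nonneg (by positivity) (F.hK.nonneg _)
    linarith
  set Ψ : U × Z → ℝ≥0∞ := fun x => F.P.Ψ₁ x.1 + F.P.Ψ₂ x.2 with hΨ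
  have hp : ∃ x, Ψ x ≠ ∞ := by
    obtain ⟨x, hx⟩ := F.hΨ₁.proper
    obtain ⟨y, hy⟩ := F.hΨ₂.proper
    exact ⟨(x, y), ENNReal.add_ne_top.mpr ⟨hx, hy⟩⟩
  have hc : ConvexOn ℝ≥0 univ Ψ := by
    refine ⟨convex_univ, fun x _ y _ a b ha hb hab => ?_⟩
    have h1 := F.hΨ₁.convex.2 (mem_univ x.1) (mem_univ y.1) ha hb hab
    have h2 := F.hΨ₂.convex.2 (mem_univ x.2) (mem_univ y.2) ha hb hab
    refine (add_le_add h1 h2).trans_eq ?_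
    simp only [hΨ, smul_add]
    abel
  have hl : LowerSemicontinuous Ψ :=
    (F.hΨ₁.lsc.comp continuous_fst).add (F.hΨ₂.lsc.comp continuous_snd)
  obtain ⟨⟨w, y⟩, hwy⟩ := exists_mem_subdiff hB hp hc hl
    (f.comp (ContinuousLinearMap.fst ℝ U Z) + g.comp (ContinuousLinearMap.snd ℝ U Z)
      + (4 / τ) • (F.K v).comp L - (2 : ℝ) • F.Q (u, z))
  obtain ⟨h1, h2⟩ := mem_subdiff_prod hwy
  have hmid : (u + (τ / 2) • w, z + (τ / 2) • y) = (u, z) + (τ / 2) • (w, y) := rfl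
  refine ⟨w, y, ?_, ?_⟩
  · convert h1 using 1
    ext x
    simp only [sub_apply, F.dKin_eq, F.dPhiU_apply, hmid, dK_apply, ContinuousLinearMap.comp_apply,
      ContinuousLinearMap.inl_apply, add_apply, smul_apply, hBa, hL, map_add, map_smul, map_sub,
      ContinuousLinearMap.coe_fst', ContinuousLinearMap.coe_snd', smul_eq_mul, map_zero]
    ring
  · convert h2 using 1
    ext x
    simp only [sub_apply, F.dPhiZ_apply, hmid, ContinuousLinearMap.comp_apply,
      ContinuousLinearMap.inr_apply, add_apply, smul_apply, hBa, hL, map_add, map_smul, map_sub,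
      ContinuousLinearMap.coe_fst', ContinuousLinearMap.coe_snd', smul_eq_mul, map_zero]
    ring

/-- The Crank-Nicolson scheme is solvable. -/
theorem exists_isCNSolution [CompleteSpace U] [CompleteSpace Z] (F : Frame U H Z) {N : ℕ}
    (hN : 1 ≤ N) : ∃ u v z w, F.P.IsCNSolution N u v z w := by
  have hτ := F.step_pos hN
  set τ := F.P.step N with hτdef
  choose W Y hW hY using fun (k : ℕ) (s : U × H × Z) =>
    F.exists_step hτ (F.P.fMean N k) (F.P.gMean N k) s.1 s.2.1 s.2.2
  -- The new velocity is `2 ι w - v`, so that the half-step value is `ι w`; it lies in `H` only,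
  -- while `w` lies in `U`.
  let S : ℕ → U × H × Z := fun n => Nat.rec (F.P.u₀, F.P.v₀, F.P.z₀) (fun k s =>
    (s.1 + τ • W (k + 1) s, (2 : ℝ) • F.P.ι (W (k + 1) s) - s.2.1, s.2.2 + τ • Y (k + 1) s)) n
  have hS : ∀ k, S (k + 1) = ((S k).1 + τ • W (k + 1) (S k),
    (2 : ℝ) • F.P.ι (W (k + 1) (S k)) - (S k).2.1, (S k).2.2 + τ • Y (k + 1) (S k)) := fun k => rfl
  refine ⟨fun k => (S k).1, fun k => (S k).2.1, fun k => (S k).2.2, fun k => W k (S (k - 1)),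
    rfl, rfl, rfl, ?_, ?_, ?_, ?_⟩
  all_goals
    intro k hk _
    obtain ⟨m, rfl⟩ : ∃ m, k = m + 1 := ⟨k - 1, by omega⟩
    simp only [Nat.add_sub_cancel, hS, ← hτdef]
  · module
  · exact inv_smul_add_smul_sub hτ.ne' _ _
  · have h1 := hW (m + 1) (S m)
    rw [half_add_smul, half_add_smul]
    convert h1 using 4
    module
  · have h1 := hY (m + 1) (S m)
    rw [half_add_smul, half_add_smul, inv_smul_add_smul_sub hτ.ne']
    exact h1

end Frame

end

/-! ### Discrete energy identities. -/

section

theorem sum_rpow_gridMean_le {X : Type*} [NormedAddCommGroup X] [NormedSpace ℝ X] [CompleteSpace X]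
    {τ T : ℝ} {N : ℕ} (hτ : 0 < τ) (hN : N * τ = T) {q : ℝ} (hq : 1 ≤ q) {G : ℝ → X}
    (hG : MemLp G (ENNReal.ofReal q) (timeMeasure T)) {n : ℕ} (hn : n ≤ N) :
    ∑ k ∈ Finset.range n, τ * ‖gridMean τ G (k + 1)‖ ^ q ≤ ∫ t, ‖G t‖ ^ q ∂(timeMeasure T) := by
  refine le_trans ?_ (integral_rpow_gridMean_le hτ hN hq hG)
  have h1 := integral_timeMeasure_pwConst hτ hN fun k => ‖gridMean τ G k‖ ^ q
  change ∫ t, ‖pwConst τ (gridMean τ G) t‖ ^ q ∂(timeMeasure T) = _ at h1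
  rw [h1]
  refine Finset.sum_le_sum_of_subset_of_nonneg (Finset.range_mono hn) fun k _ _ => ?_
  positivity

theorem sum_norm_gridMean_le {X : Type*} [NormedAddCommGroup X] [NormedSpace ℝ X] [CompleteSpace X]
    {τ T : ℝ} {N : ℕ} (hτ : 0 < τ) (hN : N * τ = T) {G : ℝ → X}
    (hG : Integrable G (timeMeasure T)) {n : ℕ} (hn : n ≤ N) :
    ∑ k ∈ Finset.range n, τ * ‖gridMean τ G (k + 1)‖ ≤ ∫ t, ‖G t‖ ∂(timeMeasure T) := by
  simpa using sum_rpow_gridMean_le hτ hN le_rfl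
    (by rw [ENNReal.ofReal_one]; exact memLp_one_iff_integrable.mpr hG) hn

/-- Young's inequality for `l a` and `l⁻¹ b`, with `l ^ p = ε p`. -/
theorem exists_young {p ε : ℝ} (hp : 1 < p) (hε : 0 < ε) : ∃ D : ℝ, 0 ≤ D ∧ ∀ a b : ℝ, 0 ≤ a →
    0 ≤ b → a * b ≤ ε * a ^ p + D * b ^ (p / (p - 1)) := by
  have hpq : p.HolderConjugate (p / (p - 1)) := Real.HolderConjugate.conjExponent hp
  set q := p / (p - 1)
  have hp0 : 0 < p := by linarith
  have hq0 : 0 < q := hpq.symm.pos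
  set l := (ε * p) ^ p⁻¹ with hl
  have hl0 : 0 < l := by positivity
  have hlp : l ^ p = ε * p := by
    rw [hl, ← Real.rpow_mul (by positivity), inv_mul_cancel₀ hp0.ne', Real.rpow_one]
  refine ⟨(l⁻¹) ^ q / q, by positivity, fun a b ha hb => ?_⟩
  have h1 := Real.young_inequality_of_nonneg (mul_nonneg hl0.le ha)
    (mul_nonneg (inv_nonneg.mpr hl0.le) hb) hpq
  rw [Real.mul_rpow hl0.le ha, Real.mul_rpow (by positivity) hb, hlp] at h1
  have e1 : l * a * (l⁻¹ * b) = a * b := by field_simp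
  have e2 : ε * p * a ^ p / p = ε * a ^ p := by field_simp
  rw [e1, e2] at h1
  refine h1.trans_eq ?_
  ring

namespace Frame

variable {U H Z : Type*} [NormedAddCommGroup U] [NormedSpace ℝ U]
  [NormedAddCommGroup H] [InnerProductSpace ℝ H]
  [NormedAddCommGroup Z] [NormedSpace ℝ Z] {F : Frame U H Z} {N : ℕ}
  {u : ℕ → U} {v : ℕ → H} {z : ℕ → Z} {w : ℕ → U}

/-- The discrete dual velocity, without the load. -/
noncomputable def cnDual (F : Frame U H Z) (N : ℕ) (v : ℕ → H) (k : ℕ) : StrongDual ℝ U :=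
  F.dK (slope (F.P.step N) v k) - F.P.fMean N k

theorem fMean_eq [CompleteSpace H] (hN : 1 ≤ N) {k : ℕ} (hk : k < N) : F.P.fMean N (k + 1)
    = gridMean (F.P.step N) F.f₁ (k + 1)
      + (gridMean (F.P.step N) F.f₂ (k + 1)).comp F.P.ι := by
  have hτ := F.step_pos hN
  have hNτ := F.mul_step hN
  have h1 : F.P.fMean N (k + 1) = gridMean (F.P.step N) F.P.f (k + 1) := rfl
  rw [h1, gridMean_congr hτ hNτ F.f_eq hk, gridMean_add hτ hNτ F.integrable_f₁
    F.integrable_f₂_comp hk]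
  congr 1
  rw [gridMean_succ, gridMean_succ]
  have h2 : IntervalIntegrable F.f₂ volume ((k : ℝ) * F.P.step N) (((k : ℝ) + 1) * F.P.step N) := by
    refine intervalIntegrable_of_timeMeasure F.integrable_f₂ (grid_mem_Icc hτ hNτ hk.le) ?_
    exact_mod_cast grid_mem_Icc hτ hNτ hk
  have h3 := ((ContinuousLinearMap.compL ℝ U H ℝ).flip F.P.ι).intervalIntegral_comp_comm h2
  simp only [ContinuousLinearMap.flip_apply, ContinuousLinearMap.compL_apply] at h3
  rw [h3, ContinuousLinearMap.smul_comp]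

namespace CN

theorem momentum (h : F.P.IsCNSolution N u v z w) {k : ℕ} (hk : k < N) :
    - F.cnDual N v (k + 1) - F.P.dPhiU (midpt u (k + 1)) (midpt z (k + 1))
      ∈ subdiff F.P.Ψ₁ (w (k + 1)) := by
  have h1 := h.momentum (k + 1) (by omega) (by omega)
  rw [F.dKin_eq] at h1
  convert h1 using 2
  · rw [cnDual, neg_sub]
    rfl
  · rfl

theorem flow (h : F.P.IsCNSolution N u v z w) {k : ℕ} (hk : k < N) :
    F.P.gMean N (k + 1) - F.P.dPhiZ (midpt u (k + 1)) (midpt z (k + 1))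
      ∈ subdiff F.P.Ψ₂ (slope (F.P.step N) z (k + 1)) := h.flow (k + 1) (by omega) (by omega)

theorem slope_u (h : F.P.IsCNSolution N u v z w) {k : ℕ} (hk : k < N) : slope (F.P.step N) u (k + 1) = w (k + 1) :=
  h.velocity (k + 1) (by omega) (by omega)

theorem ι_w (h : F.P.IsCNSolution N u v z w) {k : ℕ} (hk : k < N) : F.P.ι (w (k + 1)) = midpt v (k + 1) :=
  h.half (k + 1) (by omega) (by omega)

/-- The midpoint rule satisfies the chain rule exactly for quadratic functionals: by symmetry `K v'
v' - K v v = K (v' - v) (v' + v)`. -/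
theorem kin_sub (h : F.P.IsCNSolution N u v z w) {k : ℕ} (hk : k < N) : F.K (v (k + 1)) (v (k + 1)) - F.K (v k) (v k)
    = F.P.step N * F.dK (slope (F.P.step N) v (k + 1)) (w (k + 1)) := by
  have hτ := F.step_pos (N := N) (by omega)
  rw [dK_apply, ι_w h hk]
  simp only [slope, midpt, Nat.add_sub_cancel, map_smul, map_add, map_sub, smul_apply, add_apply,
    sub_apply, smul_eq_mul]
  rw [F.hK.symm (v k) (v (k + 1))]
  field_simp
  ring

/-- The same identity for the joint stored energy. It uses that both inclusions are evaluated at the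
same half-step state of `u` and `z`. -/
theorem phi_sub (h : F.P.IsCNSolution N u v z w) {k : ℕ} (hk : k < N) :
    F.Q (u (k + 1), z (k + 1)) (u (k + 1), z (k + 1)) - F.Q (u k, z k) (u k, z k)
    = F.P.step N * (2 * F.Q (midpt u (k + 1), midpt z (k + 1))
        (w (k + 1), slope (F.P.step N) z (k + 1))) := by
  have hτ := F.step_pos (N := N) (by omega)
  have e1 : (midpt u (k + 1), midpt z (k + 1))
      = (2⁻¹ : ℝ) • ((u (k + 1), z (k + 1)) + (u k, z k)) := rfl
  have e2 : (w (k + 1), slope (F.P.step N) z (k + 1))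
      = (F.P.step N)⁻¹ • ((u (k + 1), z (k + 1)) - (u k, z k)) := by
    rw [← slope_u h hk]; rfl
  rw [e1, e2]
  simp only [map_smul, map_add, map_sub, smul_apply, add_apply, sub_apply, smul_eq_mul]
  rw [F.hQ.symm (u k, z k) (u (k + 1), z (k + 1))]
  field_simp
  ring

/-- The energy inequality of one step. -/
theorem energy_step (h : F.P.IsCNSolution N u v z w) {k : ℕ} (hk : k < N) {x : U} {y : Z} (hx : F.P.Ψ₁ x ≠ ∞) (hy : F.P.Ψ₂ y ≠ ∞) :
    F.P.step N * ((F.P.Ψ₁ (w (k + 1))).toReal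
        + (F.P.Ψ₂ (slope (F.P.step N) z (k + 1))).toReal)
      + ((F.K (v (k + 1)) (v (k + 1)) + F.Q (u (k + 1), z (k + 1)) (u (k + 1), z (k + 1)))
        - (F.K (v k) (v k) + F.Q (u k, z k) (u k, z k)))
      ≤ F.P.step N * ((F.P.Ψ₁ x).toReal + (F.P.Ψ₂ y).toReal
          + F.P.fMean N (k + 1) (w (k + 1) - x)
          + F.P.gMean N (k + 1) (slope (F.P.step N) z (k + 1) - y)
          + 2 * F.Q (midpt u (k + 1), midpt z (k + 1)) (x, y))
        + (2 * F.K (v (k + 1)) (F.P.ι x) - 2 * F.K (v k) (F.P.ι x)) := by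
  have hτ := F.step_pos (N := N) (by omega)
  have h1 := (mem_subdiff_iff.mp (momentum h hk)).2 x hx
  have h2 := (mem_subdiff_iff.mp (flow h hk)).2 y hy
  have h3 := kin_sub h hk
  have h4 := phi_sub h hk
  have e1 : F.P.step N * F.dK (slope (F.P.step N) v (k + 1)) x
      = 2 * F.K (v (k + 1)) (F.P.ι x) - 2 * F.K (v k) (F.P.ι x) := by
    simp only [dK_apply, slope, Nat.add_sub_cancel, map_smul, map_sub, smul_apply, sub_apply,
      smul_eq_mul]
    field_simp
  simp only [cnDual, sub_apply, neg_apply, map_sub, F.dPhiU_apply, F.dPhiZ_apply] at h1 h2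
  have e2 : ∀ a b, F.Q (midpt u (k + 1), midpt z (k + 1)) (a, b)
      = F.Q (midpt u (k + 1), midpt z (k + 1)) (a, 0)
        + F.Q (midpt u (k + 1), midpt z (k + 1)) (0, b) := fun a b => by
    rw [← map_add]; simp
  rw [e2] at h4 ⊢
  have h5 := mul_le_mul_of_nonneg_left (add_le_add h1 h2) hτ.le
  simp only [map_sub]
  linarith

end CN

end Frame

end

/-! ### A-priori bounds for discrete solutions. -/

section

namespace Frame

variable {U H Z : Type*} [NormedAddCommGroup U] [NormedSpace ℝ U]
  [NormedAddCommGroup H] [InnerProductSpace ℝ H] [CompleteSpace H]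
  [NormedAddCommGroup Z] [NormedSpace ℝ Z] {F : Frame U H Z} {N : ℕ}
  {u : ℕ → U} {v : ℕ → H} {z : ℕ → Z} {w : ℕ → U}

/-- Bounds for a discrete solution. -/
structure IsCNBdd (F : Frame U H Z) (S W : ℝ) (N : ℕ) (u : ℕ → U) (v : ℕ → H) (z : ℕ → Z)
    (w : ℕ → U) : Prop where
  v_le : ∀ k ≤ N, ‖v k‖ ≤ S
  u_le : ∀ k ≤ N, ‖u k‖ ≤ S
  z_le : ∀ k ≤ N, ‖z k‖ ≤ S
  w_sum : ∑ k ∈ Finset.range N, F.P.step N * ‖w (k + 1)‖ ^ F.P.p₁ ≤ W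
  y_sum : ∑ k ∈ Finset.range N,
    F.P.step N * ‖slope (F.P.step N) z (k + 1)‖ ^ F.P.p₂ ≤ W

theorem norm_midpt_le {X : Type*} [NormedAddCommGroup X] [NormedSpace ℝ X] {x : ℕ → X} {S : ℝ}
    {k N : ℕ} (hx : ∀ k ≤ N, ‖x k‖ ≤ S) (hk : k < N) : ‖midpt x (k + 1)‖ ≤ S := by
  have h1 := hx (k + 1) (by omega)
  have h2 := hx k (by omega)
  rw [midpt, Nat.add_sub_cancel, norm_smul, Real.norm_of_nonneg (by norm_num)]
  linarith [norm_add_le (x (k + 1)) (x k)]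

/-- The discrete energy estimate, with the data estimated termwise. -/
theorem CN.energy_le [CompleteSpace U] [CompleteSpace Z] (F : Frame U H Z) :
    ∃ A B c : ℝ, 0 ≤ A ∧ 0 ≤ B ∧ 0 < c ∧ ∀ (N : ℕ) (u : ℕ → U) (v : ℕ → H) (z : ℕ → Z) (w : ℕ → U),
      1 ≤ N → F.P.IsCNSolution N u v z w → ∀ S : ℝ, 0 ≤ S → (∀ k ≤ N, ‖v k‖ ≤ S) →
      (∀ k ≤ N, ‖(u k, z k)‖ ≤ S) → ∀ n ≤ N,
      c * (∑ k ∈ Finset.range n, F.P.step N * ‖w (k + 1)‖ ^ F.P.p₁)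
        + c * (∑ k ∈ Finset.range n, F.P.step N * ‖slope (F.P.step N) z (k + 1)‖ ^ F.P.p₂)
        + c * ‖v n‖ ^ 2 + c * ‖(u n, z n)‖ ^ 2 ≤ A + B * S := by
  obtain ⟨x, y, hx, hy, -⟩ := F.exists_pot_ne_top
  obtain ⟨ε₁, hε₁, hc₁⟩ := F.hΨ₁.coercive
  obtain ⟨ε₂, hε₂, hc₂⟩ := F.hΨ₂.coercive
  obtain ⟨cK, hcK, hK⟩ := F.hK.coercive
  obtain ⟨cQ, hcQ, hQ⟩ := F.hQ.coercive
  -- Half of the coercivity of each potential is reserved for absorbing the load.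
  obtain ⟨D₁, hD₁, hy₁⟩ := exists_young F.hp₁ (half_pos hε₁)
  obtain ⟨D₂, hD₂, hy₂⟩ := exists_young F.hp₂ (half_pos hε₂)
  set c := min (min (ε₁ / 2) (ε₂ / 2)) (min cK cQ) with hc
  have hc0 : 0 < c := by positivity
  have l1 : c ≤ ε₁ / 2 := (min_le_left _ _).trans (min_le_left _ _)
  have l2 : c ≤ ε₂ / 2 := (min_le_left _ _).trans (min_le_right _ _)
  have l3 : c ≤ cK := (min_le_right _ _).trans (min_le_left _ _)
  have l4 : c ≤ cQ := (min_le_right _ _).trans (min_le_right _ _)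
  set q₁ := F.P.p₁ / (F.P.p₁ - 1) with hq₁
  set q₂ := F.P.p₂ / (F.P.p₂ - 1) with hq₂
  have h1q₁ : 1 ≤ q₁ := (one_lt_conj F.hp₁).le
  have h1q₂ : 1 ≤ q₂ := (one_lt_conj F.hp₂).le
  have hf₁ : MemLp F.f₁ (ENNReal.ofReal q₁) F.μ := F.memLp_f₁
  have hg : MemLp F.P.g (ENNReal.ofReal q₂) F.μ := F.memLp_g
  have hgi : Integrable F.P.g F.μ := hg.integrable F.one_le_conj₂
  set c₀ := (F.P.Ψ₁ x).toReal + (F.P.Ψ₂ y).toReal with hc₀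
  have hc₀0 : 0 ≤ c₀ := by positivity
  have hE0 : 0 ≤ F.K F.P.v₀ F.P.v₀ + F.Q (F.P.u₀, F.P.z₀) (F.P.u₀, F.P.z₀) :=
    add_nonneg (F.hK.nonneg _) (F.hQ.nonneg _)
  have hTp := F.T_pos
  set I₁ := ∫ t, ‖F.f₁ t‖ ^ q₁ ∂F.μ
  set I₂ := ∫ t, ‖F.f₁ t‖ ∂F.μ
  set I₃ := ∫ t, ‖F.f₂ t‖ ∂F.μ
  set I₄ := ∫ t, ‖F.P.g t‖ ^ q₂ ∂F.μ
  set I₅ := ∫ t, ‖F.P.g t‖ ∂F.μ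
  have hI₁ : 0 ≤ I₁ := integral_nonneg fun t => by positivity
  have hI₂ : 0 ≤ I₂ := integral_nonneg fun t => by positivity
  have hI₃ : 0 ≤ I₃ := integral_nonneg fun t => by positivity
  have hI₄ : 0 ≤ I₄ := integral_nonneg fun t => by positivity
  have hI₅ : 0 ≤ I₅ := integral_nonneg fun t => by positivity
  refine ⟨F.K F.P.v₀ F.P.v₀ + F.Q (F.P.u₀, F.P.z₀) (F.P.u₀, F.P.z₀) + F.P.T * c₀ + D₁ * I₁
      + ‖x‖ * I₂ + ‖F.P.ι x‖ * I₃ + D₂ * I₄ + ‖y‖ * I₅,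
    I₃ + 2 * ‖F.Q‖ * ‖(x, y)‖ * F.P.T + 4 * ‖F.K‖ * ‖F.P.ι x‖, c, by positivity, by positivity, hc0,
    fun N u v z w hN h S hS hv hst n hn => ?_⟩
  have hτ := F.step_pos hN
  have hNτ := F.mul_step hN
  set τ := F.P.step N with hτdef
  have hst' : ∀ k < N, ‖(midpt u (k + 1), midpt z (k + 1))‖ ≤ S := fun k hk =>
    norm_midpt_le (x := fun k => (u k, z k)) hst hk
  have hterm : ∀ k < N,
      c * (τ * ‖w (k + 1)‖ ^ F.P.p₁) + c * (τ * ‖slope τ z (k + 1)‖ ^ F.P.p₂)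
      + ((F.K (v (k + 1)) (v (k + 1)) + F.Q (u (k + 1), z (k + 1)) (u (k + 1), z (k + 1)))
        - (F.K (v k) (v k) + F.Q (u k, z k) (u k, z k)))
      ≤ τ * c₀ + D₁ * (τ * ‖gridMean τ F.f₁ (k + 1)‖ ^ q₁)
        + ‖x‖ * (τ * ‖gridMean τ F.f₁ (k + 1)‖)
        + (S + ‖F.P.ι x‖) * (τ * ‖gridMean τ F.f₂ (k + 1)‖)
        + D₂ * (τ * ‖gridMean τ F.P.g (k + 1)‖ ^ q₂)
        + ‖y‖ * (τ * ‖gridMean τ F.P.g (k + 1)‖) + 2 * ‖F.Q‖ * S * ‖(x, y)‖ * τ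
        + (2 * F.K (v (k + 1)) (F.P.ι x) - 2 * F.K (v k) (F.P.ι x)) := by
    intro k hk
    have e := CN.energy_step h hk hx hy
    have hfin₁ : ε₁ * ‖w (k + 1)‖ ^ F.P.p₁ ≤ (F.P.Ψ₁ (w (k + 1))).toReal :=
      (ENNReal.ofReal_le_iff_le_toReal (mem_subdiff_iff.mp (CN.momentum h hk)).1).mp (hc₁ _)
    have hfin₂ : ε₂ * ‖slope τ z (k + 1)‖ ^ F.P.p₂ ≤ (F.P.Ψ₂ (slope τ z (k + 1))).toReal :=
      (ENNReal.ofReal_le_iff_le_toReal (mem_subdiff_iff.mp (CN.flow h hk)).1).mp (hc₂ _)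
    have hgm : F.P.gMean N (k + 1) = gridMean τ F.P.g (k + 1) := rfl
    rw [fMean_eq hN hk, hgm, ← hτdef] at e
    simp only [add_apply, ContinuousLinearMap.comp_apply, map_sub, CN.ι_w h hk] at e
    set G₁ := gridMean τ F.f₁ (k + 1)
    set G₂ := gridMean τ F.f₂ (k + 1)
    set G₃ := gridMean τ F.P.g (k + 1)
    have a1 : G₁ (w (k + 1)) ≤ ε₁ / 2 * ‖w (k + 1)‖ ^ F.P.p₁ + D₁ * ‖G₁‖ ^ q₁ :=
      (le_abs_self _).trans ((dual_apply_le _ _).trans ((mul_comm _ _).trans_le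
        (hy₁ _ _ (norm_nonneg _) (norm_nonneg _))))
    have a2 : -G₁ x ≤ ‖x‖ * ‖G₁‖ :=
      (neg_le_abs _).trans ((dual_apply_le _ _).trans (mul_comm _ _).le)
    -- The integrable part of the load is paired with the half-step velocity in `H`, for which only
    -- the bound `S` is available. This is one source of the term linear in `S` on the right.
    have a3 : G₂ (midpt v (k + 1)) ≤ S * ‖G₂‖ :=
      (le_abs_self _).trans ((dual_apply_le _ _).trans ((mul_comm _ _).trans_le
        (mul_le_mul_of_nonneg_right (norm_midpt_le hv hk) (norm_nonneg _))))
    have a4 : -G₂ (F.P.ι x) ≤ ‖F.P.ι x‖ * ‖G₂‖ :=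
      (neg_le_abs _).trans ((dual_apply_le _ _).trans (mul_comm _ _).le)
    have a5 : G₃ (slope τ z (k + 1)) ≤ ε₂ / 2 * ‖slope τ z (k + 1)‖ ^ F.P.p₂ + D₂ * ‖G₃‖ ^ q₂ :=
      (le_abs_self _).trans ((dual_apply_le _ _).trans ((mul_comm _ _).trans_le
        (hy₂ _ _ (norm_nonneg _) (norm_nonneg _))))
    have a6 : -G₃ y ≤ ‖y‖ * ‖G₃‖ :=
      (neg_le_abs _).trans ((dual_apply_le _ _).trans (mul_comm _ _).le)
    have a7 : F.Q (midpt u (k + 1), midpt z (k + 1)) (x, y) ≤ ‖F.Q‖ * S * ‖(x, y)‖ :=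
      (le_abs_self _).trans ((IsCoerciveForm.abs_le _ _ _).trans (by
        gcongr
        exact hst' k hk))
    have b1 : c * ‖w (k + 1)‖ ^ F.P.p₁ ≤ ε₁ / 2 * ‖w (k + 1)‖ ^ F.P.p₁ := by gcongr
    have b2 : c * ‖slope τ z (k + 1)‖ ^ F.P.p₂ ≤ ε₂ / 2 * ‖slope τ z (k + 1)‖ ^ F.P.p₂ := by
      gcongr
    have key : c * ‖w (k + 1)‖ ^ F.P.p₁ + c * ‖slope τ z (k + 1)‖ ^ F.P.p₂
        - ((F.P.Ψ₁ (w (k + 1))).toReal + (F.P.Ψ₂ (slope τ z (k + 1))).toReal)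
        + (c₀ + (G₁ (w (k + 1)) - G₁ x + (G₂ (midpt v (k + 1)) - G₂ (F.P.ι x)))
          + (G₃ (slope τ z (k + 1)) - G₃ y)
          + 2 * F.Q (midpt u (k + 1), midpt z (k + 1)) (x, y))
        ≤ c₀ + D₁ * ‖G₁‖ ^ q₁ + ‖x‖ * ‖G₁‖ + (S + ‖F.P.ι x‖) * ‖G₂‖ + D₂ * ‖G₃‖ ^ q₂ + ‖y‖ * ‖G₃‖
          + 2 * ‖F.Q‖ * S * ‖(x, y)‖ := by linarith
    have key2 := mul_le_mul_of_nonneg_left key hτ.le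
    linarith
  have hsum := Finset.sum_le_sum fun k (hk : k ∈ Finset.range n) =>
    hterm k ((Finset.mem_range.mp hk).trans_le hn)
  simp only [Finset.sum_add_distrib, ← Finset.mul_sum, Finset.sum_const, Finset.card_range] at hsum
  rw [Finset.sum_range_sub (fun k => F.K (v k) (v k) + F.Q (u k, z k) (u k, z k)),
    Finset.sum_range_sub (fun k => 2 * F.K (v k) (F.P.ι x))] at hsum
  have s1 := sum_rpow_gridMean_le hτ hNτ h1q₁ hf₁ hn
  have s2 := sum_norm_gridMean_le hτ hNτ F.integrable_f₁ hn
  have s3 := sum_norm_gridMean_le hτ hNτ F.integrable_f₂ hn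
  have s4 := sum_rpow_gridMean_le hτ hNτ h1q₂ hg hn
  have s5 := sum_norm_gridMean_le hτ hNτ hgi hn
  simp only [← Finset.mul_sum] at s1 s2 s3 s4 s5 ⊢
  rw [nsmul_eq_mul, nsmul_eq_mul] at hsum
  have hnT : n * τ ≤ F.P.T := by
    rw [← hNτ]
    gcongr
  have m1 := mul_le_mul_of_nonneg_left s1 hD₁
  have m2 := mul_le_mul_of_nonneg_left s2 (norm_nonneg x)
  have m3 := mul_le_mul_of_nonneg_left s3 (add_nonneg hS (norm_nonneg (F.P.ι x)))
  have m4 := mul_le_mul_of_nonneg_left s4 hD₂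
  have m5 := mul_le_mul_of_nonneg_left s5 (norm_nonneg y)
  have m6 := mul_le_mul_of_nonneg_right hnT hc₀0
  have m7 := mul_le_mul_of_nonneg_right hnT (by positivity : 0 ≤ 2 * ‖F.Q‖ * S * ‖(x, y)‖)
  -- The inertial term tested with the fixed point `x` has telescoped; only its end values remain.
  have m8 : 2 * F.K (v n) (F.P.ι x) - 2 * F.K (v 0) (F.P.ι x) ≤ 4 * ‖F.K‖ * ‖F.P.ι x‖ * S := by
    have e1 := (le_abs_self _).trans (IsCoerciveForm.abs_le F.K (v n) (F.P.ι x))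
    have e2 := (neg_le_abs _).trans (IsCoerciveForm.abs_le F.K (v 0) (F.P.ι x))
    have e3 : ‖F.K‖ * ‖v n‖ * ‖F.P.ι x‖ ≤ ‖F.K‖ * S * ‖F.P.ι x‖ := by gcongr; exact hv n hn
    have e4 : ‖F.K‖ * ‖v 0‖ * ‖F.P.ι x‖ ≤ ‖F.K‖ * S * ‖F.P.ι x‖ := by
      gcongr; exact hv 0 (Nat.zero_le _)
    linarith
  have m9 : c * ‖v n‖ ^ 2 ≤ F.K (v n) (v n) :=
    (mul_le_mul_of_nonneg_right l3 (by positivity)).trans (hK _)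
  have m10 : c * ‖(u n, z n)‖ ^ 2 ≤ F.Q (u n, z n) (u n, z n) :=
    (mul_le_mul_of_nonneg_right l4 (by positivity)).trans (hQ _)
  rw [h.init_u, h.init_v, h.init_z] at hsum
  rw [h.init_v] at m8
  linarith

/-- A-priori bounds for discrete solutions. -/
theorem exists_isCNBdd [CompleteSpace U] [CompleteSpace Z] (F : Frame U H Z) :
    ∃ S W : ℝ, 0 ≤ S ∧ 0 ≤ W ∧ ∀ (N : ℕ) (u : ℕ → U) (v : ℕ → H) (z : ℕ → Z) (w : ℕ → U),
      1 ≤ N → F.P.IsCNSolution N u v z w → F.IsCNBdd S W N u v z w := by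
  obtain ⟨A, B, c, hA, hB, hc, h⟩ := CN.energy_le F
  -- The inequality `c r² ≤ A + B r` fails for `r > 1` with `r > (A + B) / c`.
  set S := 1 + (A + B) / c with hS
  have hS0 : 0 ≤ S := by positivity
  refine ⟨S, (A + B * S) / c, hS0, by positivity, fun N u v z w hN hCN => ?_⟩
  have hτ := F.step_pos hN
  set r : ℕ → ℝ := fun k => max ‖v k‖ ‖(u k, z k)‖ with hr
  -- The energy estimate is applied with the largest norm itself in the role of `S`, at the index
  -- where it is attained.
  obtain ⟨n, hn, hmax⟩ := Finset.exists_max_image (Finset.range (N + 1)) r ⟨0, by simp⟩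
  have hmax' : ∀ k ≤ N, r k ≤ r n := fun k hk => hmax k (Finset.mem_range.mpr (by omega))
  have hr0 : 0 ≤ r n := (norm_nonneg _).trans (le_max_left _ _)
  have hw0 : ∀ n, 0 ≤ c * (∑ k ∈ Finset.range n, F.P.step N * ‖w (k + 1)‖ ^ F.P.p₁) := fun n =>
    mul_nonneg hc.le (Finset.sum_nonneg fun k _ => by positivity)
  have hy0 : ∀ n, 0 ≤ c * (∑ k ∈ Finset.range n,
      F.P.step N * ‖slope (F.P.step N) z (k + 1)‖ ^ F.P.p₂) := fun n =>
    mul_nonneg hc.le (Finset.sum_nonneg fun k _ => by positivity)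
  have hrS : r n ≤ S := by
    have h1 := h N u v z w hN hCN (r n) hr0 (fun k hk => (le_max_left _ _).trans (hmax' k hk))
      (fun k hk => (le_max_right _ _).trans (hmax' k hk)) n (Nat.lt_succ_iff.mp (Finset.mem_range.mp hn))
    have h2 : c * r n ^ 2 ≤ c * ‖v n‖ ^ 2 + c * ‖(u n, z n)‖ ^ 2 := by
      rcases max_choice ‖v n‖ ‖(u n, z n)‖ with h3 | h3
      · simp only [hr, h3]
        nlinarith [sq_nonneg ‖(u n, z n)‖]
      · simp only [hr, h3]
        nlinarith [sq_nonneg ‖v n‖]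
    have h3 : c * r n ^ 2 ≤ A + B * r n := by linarith [hw0 n, hy0 n]
    by_contra! h4
    have h5 : 1 < r n := lt_of_le_of_lt (by rw [hS]; linarith [div_nonneg (add_nonneg hA hB) hc.le]) h4
    have h6 : (A + B) / c < r n := by linarith
    rw [div_lt_iff₀ hc] at h6
    nlinarith
  have hv : ∀ k ≤ N, ‖v k‖ ≤ S := fun k hk =>
    (le_max_left _ _).trans ((hmax' k hk).trans hrS)
  have huz : ∀ k ≤ N, ‖(u k, z k)‖ ≤ S := fun k hk =>
    (le_max_right _ _).trans ((hmax' k hk).trans hrS)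
  have h1 := h N u v z w hN hCN S hS0 hv huz N le_rfl
  have h2 : 0 ≤ c * ‖v N‖ ^ 2 := by positivity
  have h3 : 0 ≤ c * ‖(u N, z N)‖ ^ 2 := by positivity
  refine ⟨hv, fun k hk => (norm_fst_le (u k, z k)).trans (huz k hk),
    fun k hk => (norm_snd_le (u k, z k)).trans (huz k hk), ?_, ?_⟩
  · rw [le_div_iff₀ hc]
    linarith [hy0 N]
  · rw [le_div_iff₀ hc]
    linarith [hw0 N]

end Frame

end

/-! ### Bounds for the interpolants and the dual velocity. -/

section

section Grid

variable {X : Type*} [NormedAddCommGroup X] [NormedSpace ℝ X] {τ T : ℝ} {N : ℕ}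

theorem pwConst_succ (hτ : 0 < τ) (x : ℕ → X) {k : ℕ} {t : ℝ}
    (ht : t ∈ Ioc (k * τ) ((k + 1) * τ)) : pwConst τ x t = x (k + 1) := by
  rw [pwConst, stepIndex_eq hτ ht]

theorem pwConst_congr (hτ : 0 < τ) (hN : N * τ = T) {x y : ℕ → X}
    (h : ∀ k < N, x (k + 1) = y (k + 1)) {t : ℝ} (ht : t ∈ Ioc 0 T) :
    pwConst τ x t = pwConst τ y t := by
  obtain ⟨k, hk, hkt⟩ := exists_mem_Ioc hτ hN ht
  rw [pwConst_succ hτ x hkt, pwConst_succ hτ y hkt, h k hk]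

theorem eLpNorm_pwConst_le (hτ : 0 < τ) (hN : N * τ = T) {p W : ℝ} (hp : 0 < p) {x : ℕ → X}
    (h : ∑ k ∈ Finset.range N, τ * ‖x (k + 1)‖ ^ p ≤ W) :
    eLpNorm (pwConst τ x) (ENNReal.ofReal p) (timeMeasure T) ≤ ENNReal.ofReal (W ^ p⁻¹) := by
  refine eLpNorm_le_of_integral_rpow_le hp (memLp_pwConst hτ hN x _) ?_
  have h1 := integral_timeMeasure_pwConst hτ hN fun k => ‖x k‖ ^ p
  exact h1.trans_le h

theorem norm_pwAffine_le [CompleteSpace X] (hτ : 0 < τ) (hN : N * τ = T) {x : ℕ → X} {S : ℝ}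
    (h : ∀ k ≤ N, ‖x k‖ ≤ S) {t : ℝ} (ht : t ∈ Icc 0 T) : ‖pwAffine τ x t‖ ≤ S := by
  rcases ht.1.eq_or_lt with h0 | h0
  · rw [← h0, pwAffine_zero τ hτ]
    exact h 0 (Nat.zero_le _)
  · obtain ⟨k, hk, hkt⟩ := exists_mem_Ioc hτ hN ⟨h0, ht.2⟩
    rw [pwAffine, stepIndex_eq hτ hkt]
    have ha : 0 ≤ (t - (((k + 1 : ℕ) : ℝ) - 1) * τ) / τ :=
      div_nonneg (by push_cast; linarith [hkt.1]) hτ.le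
    have hb : 0 ≤ (((k + 1 : ℕ) : ℝ) * τ - t) / τ :=
      div_nonneg (by push_cast; linarith [hkt.2]) hτ.le
    have hmem := convex_closedBall (0 : X) S (mem_closedBall_zero_iff.mpr (h (k + 1) hk))
      (mem_closedBall_zero_iff.mpr (h k hk.le)) ha hb (by push_cast; field_simp; ring)
    exact mem_closedBall_zero_iff.mp hmem

theorem norm_midpt_sub_pwAffine_le [CompleteSpace X] (hτ : 0 < τ) (x : ℕ → X) {k : ℕ} {t : ℝ}
    (ht : t ∈ Ioc ((k : ℝ) * τ) ((k + 1) * τ)) :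
    ‖midpt x (k + 1) - pwAffine τ x t‖ ≤ τ * ‖slope τ x (k + 1)‖ := by
  rw [pwAffine_apply hτ x ht]
  have h1 : midpt x (k + 1) - (x k + (t - k * τ) • (τ⁻¹ • (x (k + 1) - x k)))
      = (τ / 2 - (t - k * τ)) • slope τ x (k + 1) := by
    have h2 : x (k + 1) - x k = τ • slope τ x (k + 1) := by
      rw [slope, Nat.add_sub_cancel, smul_smul, mul_inv_cancel₀ hτ.ne', one_smul]
    have h3 : x (k + 1) = x k + τ • slope τ x (k + 1) := by rw [← h2]; abel
    rw [h2, inv_smul_smul₀ hτ.ne', midpt, Nat.add_sub_cancel]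
    nth_rewrite 1 [h3]
    module
  rw [h1, norm_smul]
  gcongr
  rw [Real.norm_eq_abs, abs_le]
  constructor <;> linarith [ht.1, ht.2]

end Grid

namespace Frame

variable {U H Z : Type*} [NormedAddCommGroup U] [NormedSpace ℝ U]
  [NormedAddCommGroup H] [InnerProductSpace ℝ H]
  [NormedAddCommGroup Z] [NormedSpace ℝ Z] {F : Frame U H Z} {N : ℕ}
  {u : ℕ → U} {v : ℕ → H} {z : ℕ → Z} {w : ℕ → U} {S W : ℝ}

/-- The piecewise constant velocities of a discrete solution. -/
noncomputable def cnTraj (F : Frame U H Z) (N : ℕ) (v : ℕ → H) (z : ℕ → Z) (w : ℕ → U) :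
    Traj U H Z :=
  (pwConst (F.P.step N) w, pwConst (F.P.step N) (slope (F.P.step N) z),
    pwConst (F.P.step N) (F.cnDual N v), v N)

/-- The affine interpolants are the primitives of the piecewise constant difference quotients, so
the discrete solution fits the description by velocities. -/
theorem CN.state_eq [CompleteSpace U] [CompleteSpace Z] (hN : 1 ≤ N)
    (h : F.P.IsCNSolution N u v z w) {t : ℝ} (ht : t ∈ Icc 0 F.P.T) :
    F.state (F.cnTraj N v z w) t
      = (pwAffine (F.P.step N) u t, pwAffine (F.P.step N) z t) := by
  have hτ := F.step_pos hN
  have hNτ := F.mul_step hN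
  refine Prod.ext ?_ ?_
  · change primitive F.P.u₀ (pwConst (F.P.step N) w) t = _
    rw [pwAffine_eq_primitive hτ hNτ u ht, h.init_u, primitive]
    congr 1
    refine intervalIntegral.integral_congr_ae (Eventually.of_forall fun s hs => ?_)
    rw [uIoc_of_le ht.1] at hs
    exact (pwConst_congr hτ hNτ (fun k hk => CN.slope_u h hk) ⟨hs.1, hs.2.trans ht.2⟩).symm
  · change primitive F.P.z₀ (pwConst (F.P.step N) (slope (F.P.step N) z)) t = _
    rw [pwAffine_eq_primitive hτ hNτ z ht, h.init_z]
    rfl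

/-- The momentum inclusion exhibits `-ζ - ∂_uΦ` as a subgradient of `Ψ₁` at `w`; the growth
condition bounds it, and `∂_uΦ` is bounded by the norm of the state. -/
theorem CN.norm_cnDual_le {C : ℝ}
    (hC : ∀ v : U, ∀ ξ ∈ subdiff F.P.Ψ₁ v, ‖ξ‖ ≤ C * (1 + ‖v‖ ^ (F.P.p₁ - 1)))
    (h : F.P.IsCNSolution N u v z w) (hb : F.IsCNBdd S W N u v z w) {k : ℕ} (hk : k < N) :
    ‖F.cnDual N v (k + 1)‖ ≤ (|C| + 2 * ‖F.Q‖ * S) + |C| * ‖w (k + 1)‖ ^ (F.P.p₁ - 1) := by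
  have h1 := hC _ _ (CN.momentum h hk)
  have hS : 0 ≤ S := (norm_nonneg _).trans (hb.v_le 0 (Nat.zero_le _))
  have h2 : ‖F.P.dPhiU (midpt u (k + 1)) (midpt z (k + 1))‖ ≤ 2 * ‖F.Q‖ * S := by
    refine ContinuousLinearMap.opNorm_le_bound _ (by positivity) fun x => ?_
    rw [F.dPhiU_apply, norm_mul, Real.norm_of_nonneg (by norm_num : (0 : ℝ) ≤ 2), Real.norm_eq_abs,
      mul_assoc, mul_assoc]
    refine mul_le_mul_of_nonneg_left ?_ (by norm_num)
    rw [← mul_assoc]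
    refine (IsCoerciveForm.abs_le _ _ _).trans ?_
    have h3 : ‖(midpt u (k + 1), midpt z (k + 1))‖ ≤ S :=
      max_le (norm_midpt_le hb.u_le hk) (norm_midpt_le hb.z_le hk)
    have h4 : ‖((x, 0) : U × Z)‖ ≤ ‖x‖ := max_le le_rfl (by simp)
    gcongr
  have h3 : F.cnDual N v (k + 1)
      = -((- F.cnDual N v (k + 1) - F.P.dPhiU (midpt u (k + 1)) (midpt z (k + 1)))
        + F.P.dPhiU (midpt u (k + 1)) (midpt z (k + 1))) := by abel
  rw [h3, norm_neg]
  refine (norm_add_le _ _).trans ?_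
  have h4 : C * (1 + ‖w (k + 1)‖ ^ (F.P.p₁ - 1)) ≤ |C| * (1 + ‖w (k + 1)‖ ^ (F.P.p₁ - 1)) :=
    mul_le_mul_of_nonneg_right (le_abs_self C) (by positivity)
  linarith

/-- Uniform bounds for the piecewise constant velocities. -/
theorem CN.exists_isBdd (F : Frame U H Z) {S W : ℝ} (hW : 0 ≤ W) : ∃ R : ℝ, 0 ≤ R ∧
    ∀ (N : ℕ) (u : ℕ → U) (v : ℕ → H) (z : ℕ → Z) (w : ℕ → U), 1 ≤ N →
      F.P.IsCNSolution N u v z w → F.IsCNBdd S W N u v z w → F.IsBdd R (F.cnTraj N v z w) := by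
  obtain ⟨C, hC⟩ := F.growth
  have hp₁ := F.hp₁
  have hp₂ := F.hp₂
  set q := F.P.p₁ / (F.P.p₁ - 1) with hq
  have hq1 : 1 < q := one_lt_conj F.hp₁
  have hpq : (F.P.p₁ - 1) * q = F.P.p₁ := by
    rw [hq]; have : F.P.p₁ - 1 ≠ 0 := by linarith
    field_simp
  set D := |C| + 2 * ‖F.Q‖ * |S| with hD
  have hD0 : 0 ≤ D := by positivity
  -- The `q`-th power of the bound on the dual velocity; by `(p₁ - 1) q = p₁` it is controlled by
  -- the `p₁`-th powers of `w`.
  set W' := (2 : ℝ) ^ (q - 1) * (D ^ q * F.P.T + |C| ^ q * W) with hW'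
  refine ⟨max (max (W ^ F.P.p₁⁻¹) (W ^ F.P.p₂⁻¹)) (max (W' ^ q⁻¹) |S|),
    le_max_of_le_right (le_max_of_le_right (abs_nonneg _)), fun N u v z w hN h hb => ?_⟩
  have hτ := F.step_pos hN
  have hNτ := F.mul_step hN
  have hS : 0 ≤ S := (norm_nonneg _).trans (hb.v_le 0 (Nat.zero_le _))
  have hSa : |S| = S := abs_of_nonneg hS
  have hζ : ∑ k ∈ Finset.range N, F.P.step N * ‖F.cnDual N v (k + 1)‖ ^ q ≤ W' := by
    have h1 : ∀ k ∈ Finset.range N, F.P.step N * ‖F.cnDual N v (k + 1)‖ ^ q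
        ≤ (2 : ℝ) ^ (q - 1) * (D ^ q * F.P.step N
          + |C| ^ q * (F.P.step N * ‖w (k + 1)‖ ^ F.P.p₁)) := fun k hk => by
      have h2 := CN.norm_cnDual_le hC h hb (Finset.mem_range.mp hk)
      have h3 := Real.rpow_le_rpow (norm_nonneg _) h2 (by linarith : 0 ≤ q)
      have h4 := real_add_rpow_le (a := D) (b := |C| * ‖w (k + 1)‖ ^ (F.P.p₁ - 1)) hD0
        (by positivity) hq1.le
      rw [Real.mul_rpow (abs_nonneg C) (by positivity), ← Real.rpow_mul (norm_nonneg _), hpq] at h4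
      rw [hD, hSa] at h4
      have h5 := mul_le_mul_of_nonneg_left (h3.trans h4) hτ.le
      rw [hD, hSa]
      refine h5.trans_eq ?_
      ring
    refine (Finset.sum_le_sum h1).trans ?_
    rw [← Finset.mul_sum, Finset.sum_add_distrib, Finset.sum_const,
      Finset.card_range, nsmul_eq_mul, mul_left_comm]
    rw [hW', ← hNτ]
    have := hb.w_sum
    rw [← Finset.mul_sum]
    gcongr
  refine ⟨memLp_pwConst hτ hNτ w _, ?_, memLp_pwConst hτ hNτ (slope (F.P.step N) z) _, ?_,
    memLp_pwConst hτ hNτ (F.cnDual N v) _, ?_,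
    ?_, ?_⟩
  · exact (eLpNorm_pwConst_le hτ hNτ (by linarith) hb.w_sum).trans
      (ENNReal.ofReal_le_ofReal ((le_max_left _ _).trans (le_max_left _ _)))
  · exact (eLpNorm_pwConst_le hτ hNτ (by linarith) hb.y_sum).trans
      (ENNReal.ofReal_le_ofReal ((le_max_right _ _).trans (le_max_left _ _)))
  · exact (eLpNorm_pwConst_le hτ hNτ (by linarith) hζ).trans
      (ENNReal.ofReal_le_ofReal ((le_max_left _ _).trans (le_max_right _ _)))
  · filter_upwards [ae_timeMeasure_mem_Ioc] with t ht
    obtain ⟨k, hk, hkt⟩ := exists_mem_Ioc hτ hNτ ht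
    change ‖F.P.ι (pwConst (F.P.step N) w t)‖ ≤ _
    rw [pwConst_succ hτ w hkt, CN.ι_w h hk]
    exact (norm_midpt_le hb.v_le hk).trans
      ((le_abs_self S).trans ((le_max_right _ _).trans (le_max_right _ _)))
  · exact (hb.v_le N le_rfl).trans
      ((le_abs_self S).trans ((le_max_right _ _).trans (le_max_right _ _)))

end Frame

end

/-! ### The discrete momentum. -/

section

theorem integral_norm_le_eLpNorm {X : Type*} [NormedAddCommGroup X] {μ : Measure ℝ}
    [IsFiniteMeasure μ] {p : ℝ≥0∞} (hp : 1 ≤ p) {f : ℝ → X} (hf : MemLp f p μ) :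
    ∫ t, ‖f t‖ ∂μ ≤ (eLpNorm f p μ).toReal
      * (μ univ ^ (1 / (1 : ℝ≥0∞).toReal - 1 / p.toReal)).toReal := by
  have h1 := eLpNorm_le_eLpNorm_mul_rpow_measure_univ (μ := μ) hp hf.1
  rw [integral_norm_eq_lintegral_enorm hf.1, ← eLpNorm_one_eq_lintegral_enorm, ← ENNReal.toReal_mul]
  refine ENNReal.toReal_mono (ENNReal.mul_ne_top hf.2.ne ?_) h1
  refine ENNReal.rpow_ne_top_of_nonneg ?_ (measure_ne_top _ _)
  rw [ENNReal.toReal_one, div_one, sub_nonneg]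
  by_cases h : p = ∞
  · simp [h]
  · have h2 : 1 ≤ p.toReal := by
      rw [← ENNReal.toReal_one]
      exact ENNReal.toReal_mono h hp
    rw [div_le_one (by linarith)]
    exact h2

namespace Frame

variable {U H Z : Type*} [NormedAddCommGroup U] [NormedSpace ℝ U]
  [NormedAddCommGroup H] [InnerProductSpace ℝ H]
  [NormedAddCommGroup Z] [NormedSpace ℝ Z] {F : Frame U H Z} {N : ℕ}
  {u : ℕ → U} {v : ℕ → H} {z : ℕ → Z} {w : ℕ → U} {S W R : ℝ}

theorem fMean_eq_gridMean_load (hN : 1 ≤ N) {k : ℕ} (hk : k < N) :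
    F.P.fMean N (k + 1) = gridMean (F.P.step N) F.load (k + 1) :=
  gridMean_congr (F.step_pos hN) (F.mul_step hN) F.f_eq hk

/-- The momentum of a discrete solution is exact at the grid points. -/
theorem CN.mom_grid (hN : 1 ≤ N) (h : F.P.IsCNSolution N u v z w)
    (hA : F.IsBdd R (F.cnTraj N v z w)) {n : ℕ} (hn : n ≤ N) :
    F.mom (F.cnTraj N v z w) (n * F.P.step N) = F.dK (v n) := by
  have hτ := F.step_pos hN
  have hNτ := F.mul_step hN
  set τ := F.P.step N with hτdef
  rw [mom, primitive, integral_grid hτ hNτ hA.integrable_ζ_load hn]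
  have h1 : ∀ k ∈ Finset.range n, ∫ t in (k : ℝ) * τ..((k : ℝ) + 1) * τ,
      ((F.cnTraj N v z w).ζ t + F.load t) = F.dK (v (k + 1)) - F.dK (v k) := fun k hk => by
    have hkN : k < N := (Finset.mem_range.mp hk).trans_le hn
    have m1 := grid_mem_Icc hτ hNτ hkN.le
    have m2 := grid_mem_Icc hτ hNτ (show k + 1 ≤ N from hkN)
    push_cast at m2
    have e1 : ∫ t in (k : ℝ) * τ..((k : ℝ) + 1) * τ, (F.cnTraj N v z w).ζ t
        = τ • F.cnDual N v (k + 1) := by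
      have := integral_pwConst_part hτ (F.cnDual N v) k (left_mem_grid hτ k)
      rw [show ((k : ℝ) + 1) * τ - k * τ = τ by ring] at this
      exact this
    have e2 : ∫ t in (k : ℝ) * τ..((k : ℝ) + 1) * τ, F.load t = τ • F.P.fMean N (k + 1) := by
      rw [fMean_eq_gridMean_load hN hkN, gridMean_succ, smul_inv_smul₀ hτ.ne']
    rw [intervalIntegral.integral_add (intervalIntegrable_of_timeMeasure hA.integrable_ζ m1 m2)
      (intervalIntegrable_of_timeMeasure F.integrable_load m1 m2), e1, e2, cnDual, ← smul_add,
      sub_add_cancel, slope, map_smul, ← hτdef, smul_inv_smul₀ hτ.ne', map_sub, Nat.add_sub_cancel]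
  rw [Finset.sum_congr rfl h1, Finset.sum_range_sub (fun k => F.dK (v k)), h.init_v,
    add_sub_cancel]

/-- The momentum of a discrete solution is close to its velocity. -/
theorem CN.integral_mom_sub_le (hN : 1 ≤ N) (h : F.P.IsCNSolution N u v z w)
    (hA : F.IsBdd R (F.cnTraj N v z w)) :
    ∫ t, ‖F.dK (F.P.ι ((F.cnTraj N v z w).w t)) - F.mom (F.cnTraj N v z w) t‖ ∂F.μ
      ≤ F.P.step N * ((∫ t, ‖(F.cnTraj N v z w).ζ t‖ ∂F.μ) + ∫ t, ‖F.load t‖ ∂F.μ) := by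
  have hτ := F.step_pos hN
  have hNτ := F.mul_step hN
  set τ := F.P.step N with hτdef
  set A := F.cnTraj N v z w with hAdef
  set G : ℝ → StrongDual ℝ U := fun t => A.ζ t + F.load t with hG
  have hGi : Integrable G F.μ := hA.integrable_ζ_load
  have hpt : ∀ᵐ t ∂F.μ, ‖F.dK (F.P.ι (A.w t)) - F.mom A t‖
      ≤ τ * pwConst τ (gridMean τ fun t => ‖G t‖) t := by
    filter_upwards [ae_timeMeasure_mem_Ioc] with t ht
    obtain ⟨k, hk, hkt⟩ := exists_mem_Ioc hτ hNτ ht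
    have m1 := grid_mem_Icc hτ hNτ hk.le
    have m2 := grid_mem_Icc hτ hNτ (show k + 1 ≤ N from hk)
    have g1 := CN.mom_grid hN h hA hk.le
    have g2 := CN.mom_grid hN h hA (show k + 1 ≤ N from hk)
    rw [← hτdef, ← hAdef] at g1 g2
    push_cast at m2 g2
    have hw : A.w t = w (k + 1) := pwConst_succ hτ w hkt
    -- Within one cell the momentum changes by at most the integral of `‖G‖` over that cell.
    have hle : ∀ s ∈ Icc ((k : ℝ) * τ) (((k : ℝ) + 1) * τ),
        ‖F.mom A s - F.mom A t‖ ≤ τ * gridMean τ (fun t => ‖G t‖) (k + 1) := fun s hs => by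
      have ms : s ∈ Icc 0 F.P.T := ⟨m1.1.trans hs.1, hs.2.trans m2.2⟩
      have h1 : F.mom A s - F.mom A t = ∫ r in t..s, G r := by
        simp only [mom, primitive, add_sub_add_left_eq_sub]
        exact primitive_sub hGi (Ioc_subset_Icc_self ht) ms
      have hGI := intervalIntegrable_of_timeMeasure hGi.norm m1 m2
      rw [h1, gridMean_succ, smul_eq_mul, mul_inv_cancel_left₀ hτ.ne']
      refine (intervalIntegral.norm_integral_le_abs_integral_norm).trans ?_
      rcases le_total t s with hts | hts
      · rw [abs_of_nonneg (intervalIntegral.integral_nonneg hts fun _ _ => norm_nonneg _)]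
        exact intervalIntegral.integral_mono_interval hkt.1.le hts hs.2
          (Eventually.of_forall fun _ => norm_nonneg _) hGI
      · rw [intervalIntegral.integral_symm, abs_neg,
          abs_of_nonneg (intervalIntegral.integral_nonneg hts fun _ _ => norm_nonneg _)]
        exact intervalIntegral.integral_mono_interval hs.1 hts hkt.2
          (Eventually.of_forall fun _ => norm_nonneg _) hGI
    -- The momentum is exact at both ends of the cell, and the half-step velocity is the mean of the
    -- two end velocities.
    have e : F.dK (F.P.ι (A.w t)) - F.mom A t
        = (2⁻¹ : ℝ) • ((F.mom A (((k : ℝ) + 1) * τ) - F.mom A t)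
          + (F.mom A ((k : ℝ) * τ) - F.mom A t)) := by
      rw [hw, CN.ι_w h hk, midpt, Nat.add_sub_cancel, map_smul, map_add, g1, g2]
      module
    rw [e, norm_smul, Real.norm_of_nonneg (by norm_num), pwConst_succ hτ _ hkt]
    have n1 := hle _ ⟨by nlinarith, le_rfl⟩
    have n2 := hle _ ⟨le_rfl, by nlinarith⟩
    linarith [norm_add_le (F.mom A (((k : ℝ) + 1) * τ) - F.mom A t)
      (F.mom A ((k : ℝ) * τ) - F.mom A t)]
  have hpi := integrable_pwConst hτ hNτ (gridMean τ fun t => ‖G t‖)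
  refine (integral_mono_ae hA.integrable_mom_sub.norm (hpi.const_mul τ) hpt).trans ?_
  rw [integral_const_mul]
  refine mul_le_mul_of_nonneg_left ?_ hτ.le
  have e : ∫ t, pwConst τ (gridMean τ fun t => ‖G t‖) t ∂F.μ = ∫ t, ‖G t‖ ∂F.μ := by
    rw [integral_timeMeasure_pwConst hτ hNτ, integral_timeMeasure_grid hτ hNτ hGi.norm]
    refine Finset.sum_congr rfl fun k _ => ?_
    rw [gridMean_succ, smul_inv_smul₀ hτ.ne']
  rw [e, ← integral_add hA.integrable_ζ.norm F.integrable_load.norm]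
  exact integral_mono hGi.norm (hA.integrable_ζ.norm.add F.integrable_load.norm)
    fun t => norm_add_le _ _

end Frame

end

/-! ### The variational inequality of a discrete solution. -/

section

namespace Frame

variable {U H Z : Type*} [NormedAddCommGroup U] [NormedSpace ℝ U]
  [NormedAddCommGroup H] [InnerProductSpace ℝ H]
  [NormedAddCommGroup Z] [NormedSpace ℝ Z] {F : Frame U H Z} {N : ℕ}
  {u : ℕ → U} {v : ℕ → H} {z : ℕ → Z} {w : ℕ → U} {S W R : ℝ}

theorem CN.pot_ne_top (hN : 1 ≤ N) (h : F.P.IsCNSolution N u v z w) :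
    F.pot (F.cnTraj N v z w).w (F.cnTraj N v z w).y ≠ ∞ := by
  have hτ := F.step_pos hN
  have hNτ := F.mul_step hN
  set c : ℕ → ℝ≥0∞ := fun k => F.P.Ψ₁ (w (k + 1)) + F.P.Ψ₂ (slope (F.P.step N) z (k + 1))
  have hc : ∑ k ∈ Finset.range N, c k ≠ ∞ := ENNReal.sum_ne_top.mpr fun k hk =>
    ENNReal.add_ne_top.mpr ⟨(mem_subdiff_iff.mp (CN.momentum h (Finset.mem_range.mp hk))).1,
      (mem_subdiff_iff.mp (CN.flow h (Finset.mem_range.mp hk))).1⟩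
  have h1 : F.pot (F.cnTraj N v z w).w (F.cnTraj N v z w).y
      ≤ ∫⁻ _, ∑ k ∈ Finset.range N, c k ∂F.μ := by
    refine lintegral_mono_ae ?_
    filter_upwards [ae_timeMeasure_mem_Ioc] with t ht
    obtain ⟨k, hk, hkt⟩ := exists_mem_Ioc hτ hNτ ht
    change F.P.Ψ₁ (pwConst (F.P.step N) w t)
      + F.P.Ψ₂ (pwConst (F.P.step N) (slope (F.P.step N) z) t) ≤ _
    rw [pwConst_succ hτ w hkt, pwConst_succ hτ _ hkt]
    exact Finset.single_le_sum (f := c) (fun _ _ => zero_le) (Finset.mem_range.mpr hk)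
  refine ne_top_of_le_ne_top ?_ h1
  rw [lintegral_const]
  exact ENNReal.mul_ne_top hc (measure_ne_top _ _)

/-- The variational inequality of a discrete solution, integrated in time. -/
theorem CN.vi_integral (hN : 1 ≤ N) (h : F.P.IsCNSolution N u v z w)
    (hA : F.IsBdd R (F.cnTraj N v z w)) {a : ℝ → U} {b : ℝ → Z}
    (ha : MemLp a F.P.q₁ F.μ) (hb : MemLp b F.P.q₂ F.μ) (hab : F.pot a b ≠ ∞) :
    F.K (v N) (v N) + F.Q (u N, z N) (u N, z N)
        + (F.pot (F.cnTraj N v z w).w (F.cnTraj N v z w).y).toReal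
      ≤ (F.pot a b).toReal + (∫ t, (F.cnTraj N v z w).ζ t (a t) ∂F.μ)
        + (∫ t, pwConst (F.P.step N) (fun k => (2 : ℝ) • F.Q (midpt u k, midpt z k)) t
            (a t, b t) ∂F.μ)
        - (∫ t, pwConst (F.P.step N) (gridMean (F.P.step N) F.P.g) t (b t) ∂F.μ)
        + (∫ t, F.load t ((F.cnTraj N v z w).w t) ∂F.μ)
        + (∫ t, F.P.g t ((F.cnTraj N v z w).y t) ∂F.μ)
        + F.K F.P.v₀ F.P.v₀ + F.Q (F.P.u₀, F.P.z₀) (F.P.u₀, F.P.z₀) := by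
  have hτ := F.step_pos hN
  have hNτ := F.mul_step hN
  have hpotA := CN.pot_ne_top hN h
  set A := F.cnTraj N v z w with hAdef
  set τ := F.P.step N with hτdef
  set q : ℕ → StrongDual ℝ (U × Z) := fun k => (2 : ℝ) • F.Q (midpt u k, midpt z k) with hq
  set gb := gridMean τ F.P.g with hgb
  -- The part of the summed inclusions that does not contain the tests; `s3` evaluates its sum.
  set Θ : ℕ → ℝ := fun k => F.cnDual N v k (w k) + q k (w k, slope τ z k) - gb k (slope τ z k)
    with hΘ
  have hq1 : (1 : ℝ≥0∞)⁻¹ + (∞ : ℝ≥0∞)⁻¹ = 1 := by simp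
  have hgi : Integrable F.P.g F.μ := F.memLp_g.integrable F.one_le_conj₂
  have habi : MemLp (fun t => (a t, b t)) 1 F.μ := memLp_one_iff_integrable.mpr
    ((ha.integrable F.one_le_q₁).prodMk (hb.integrable F.one_le_q₂))
  have i1 : Integrable (fun t => A.ζ t (a t)) F.μ := integrable_pairing F.holder₁ hA.memLp_ζ ha
  have i2 : Integrable (fun t => pwConst τ q t (a t, b t)) F.μ :=
    integrable_pairing hq1 (memLp_pwConst hτ hNτ q ∞) habi
  have i3 : Integrable (fun t => pwConst τ gb t (b t)) F.μ :=
    integrable_pairing hq1 (memLp_pwConst hτ hNτ gb ∞) (hb.mono_exponent F.one_le_q₂)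
  have i4 := integrable_pwConst hτ hNτ Θ
  have m1 := aemeasurable_pot hA.memLp_w.1 hA.memLp_y.1
  have m2 := aemeasurable_pot ha.1 hb.1
  have f1 := ae_lt_top' m1 hpotA
  have f2 := ae_lt_top' m2 hab
  have i5 := integrable_toReal_of_lintegral_ne_top m1 hpotA
  have i6 := integrable_toReal_of_lintegral_ne_top m2 hab
  have e5 : ∫ t, (F.P.Ψ₁ (A.w t) + F.P.Ψ₂ (A.y t)).toReal ∂F.μ = (F.pot A.w A.y).toReal :=
    integral_toReal m1 f1
  have e6 : ∫ t, (F.P.Ψ₁ (a t) + F.P.Ψ₂ (b t)).toReal ∂F.μ = (F.pot a b).toReal :=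
    integral_toReal m2 f2
  have hpt : ∀ᵐ t ∂F.μ, (F.P.Ψ₁ (A.w t) + F.P.Ψ₂ (A.y t)).toReal + pwConst τ Θ t
      ≤ (F.P.Ψ₁ (a t) + F.P.Ψ₂ (b t)).toReal + (A.ζ t (a t) + pwConst τ q t (a t, b t)
        - pwConst τ gb t (b t)) := by
    filter_upwards [ae_timeMeasure_mem_Ioc, f2] with t ht hfin
    obtain ⟨k, hk, hkt⟩ := exists_mem_Ioc hτ hNτ ht
    have w1 : A.w t = w (k + 1) := pwConst_succ hτ w hkt
    have w2 : A.y t = slope τ z (k + 1) := pwConst_succ hτ (slope τ z) hkt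
    have w3 : A.ζ t = F.cnDual N v (k + 1) := pwConst_succ hτ (F.cnDual N v) hkt
    obtain ⟨hfa, hfb⟩ := ENNReal.add_ne_top.mp hfin.ne
    obtain ⟨n1, d1⟩ := mem_subdiff_iff.mp (CN.momentum h hk)
    obtain ⟨n2, d2⟩ := mem_subdiff_iff.mp (CN.flow h hk)
    have d1' := d1 (a t) hfa
    have d2' := d2 (b t) hfb
    rw [w1, w2, w3, pwConst_succ hτ Θ hkt, pwConst_succ hτ q hkt, pwConst_succ hτ gb hkt,
      ENNReal.toReal_add n1 n2, ENNReal.toReal_add hfa hfb]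
    have hgm : F.P.gMean N (k + 1) = gb (k + 1) := rfl
    have e2 : ∀ x y, F.Q (midpt u (k + 1), midpt z (k + 1)) (x, y)
        = F.Q (midpt u (k + 1), midpt z (k + 1)) (x, 0)
          + F.Q (midpt u (k + 1), midpt z (k + 1)) (0, y) := fun x y => by
      rw [← map_add]; simp
    simp only [hgm, sub_apply, neg_apply, map_sub, F.dPhiU_apply, F.dPhiZ_apply] at d1' d2'
    simp only [hΘ, hq, smul_apply, smul_eq_mul]
    rw [e2 (w (k + 1)), e2 (a t)]
    linarith
  have hint := integral_mono_ae (i5.add i4) (i6.add ((i1.add i2).sub i3)) hpt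
  have s1 : ∫ t, ((F.P.Ψ₁ (A.w t) + F.P.Ψ₂ (A.y t)).toReal + pwConst τ Θ t) ∂F.μ
      = (F.pot A.w A.y).toReal + ∑ k ∈ Finset.range N, τ * Θ (k + 1) := by
    rw [integral_add i5 i4, e5, integral_timeMeasure_pwConst hτ hNτ]
    rfl
  have s2 : ∫ t, ((F.P.Ψ₁ (a t) + F.P.Ψ₂ (b t)).toReal + (A.ζ t (a t) + pwConst τ q t (a t, b t)
        - pwConst τ gb t (b t))) ∂F.μ
      = (F.pot a b).toReal + ((∫ t, A.ζ t (a t) ∂F.μ) + (∫ t, pwConst τ q t (a t, b t) ∂F.μ)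
        - ∫ t, pwConst τ gb t (b t) ∂F.μ) := by
    have t1 := integral_add i6 ((i1.add i2).sub i3)
    have t2 := integral_sub (i1.add i2) i3
    have t3 := integral_add i1 i2
    simp only [Pi.add_apply, Pi.sub_apply] at t1 t2 t3
    rw [t1, t2, t3, e6]
  -- The energy increments telescope. The loads act on piecewise constant velocities, so replacing
  -- cell means by the original functions is exact here.
  have s3 : ∑ k ∈ Finset.range N, τ * Θ (k + 1)
      = (F.K (v N) (v N) + F.Q (u N, z N) (u N, z N))
        - (F.K F.P.v₀ F.P.v₀ + F.Q (F.P.u₀, F.P.z₀) (F.P.u₀, F.P.z₀))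
        - (∫ t, F.load t (A.w t) ∂F.μ) - ∫ t, F.P.g t (A.y t) ∂F.μ := by
    have l1 : ∫ t, F.load t (A.w t) ∂F.μ
        = ∑ k ∈ Finset.range N, τ * F.P.fMean N (k + 1) (w (k + 1)) := by
      refine (integral_pairing_pwConst hτ hNτ F.integrable_load w).trans
        (Finset.sum_congr rfl fun k hk => ?_)
      rw [fMean_eq_gridMean_load hN (Finset.mem_range.mp hk)]
    have l2 : ∫ t, F.P.g t (A.y t) ∂F.μ
        = ∑ k ∈ Finset.range N, τ * gb (k + 1) (slope τ z (k + 1)) :=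
      integral_pairing_pwConst hτ hNτ hgi (slope τ z)
    have l3 := Finset.sum_range_sub (fun k => F.K (v k) (v k) + F.Q (u k, z k) (u k, z k)) N
    rw [h.init_u, h.init_v, h.init_z] at l3
    rw [l1, l2, ← l3, ← Finset.sum_sub_distrib, ← Finset.sum_sub_distrib]
    refine Finset.sum_congr rfl fun k hk => ?_
    have k1 := CN.kin_sub h (Finset.mem_range.mp hk)
    have k2 := CN.phi_sub h (Finset.mem_range.mp hk)
    rw [← hτdef] at k1 k2
    have k3 : F.cnDual N v (k + 1) (w (k + 1))
        = F.dK (slope τ v (k + 1)) (w (k + 1)) - F.P.fMean N (k + 1) (w (k + 1)) := by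
      rw [cnDual, sub_apply]
    simp only [hΘ, hq, smul_apply, smul_eq_mul, k3]
    linarith
  simp only [Pi.add_apply, Pi.sub_apply] at hint
  rw [s1, s2, s3] at hint
  linarith

/-- Replacing the half-step states by the affine interpolants. -/
theorem CN.midpt_error [CompleteSpace U] [CompleteSpace Z] (hN : 1 ≤ N)
    (h : F.P.IsCNSolution N u v z w) (hA : F.IsBdd R (F.cnTraj N v z w)) {e : ℝ}
    (he : ∀ k < N, F.P.step N * ‖(w (k + 1), slope (F.P.step N) z (k + 1))‖ ≤ e)
    {a : ℝ → U} {b : ℝ → Z} (ha : MemLp a F.P.q₁ F.μ) (hb : MemLp b F.P.q₂ F.μ) :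
    (∫ t, pwConst (F.P.step N) (fun k => (2 : ℝ) • F.Q (midpt u k, midpt z k)) t (a t, b t) ∂F.μ)
      ≤ (∫ t, 2 * F.Q (F.state (F.cnTraj N v z w) t) (a t, b t) ∂F.μ)
        + 2 * ‖F.Q‖ * e * ((∫ t, ‖a t‖ ∂F.μ) + ∫ t, ‖b t‖ ∂F.μ) := by
  have hτ := F.step_pos hN
  have hNτ := F.mul_step hN
  set A := F.cnTraj N v z w with hAdef
  set τ := F.P.step N with hτdef
  set q : ℕ → StrongDual ℝ (U × Z) := fun k => (2 : ℝ) • F.Q (midpt u k, midpt z k) with hq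
  have hai := ha.integrable F.one_le_q₁
  have hbi := hb.integrable F.one_le_q₂
  have i1 : Integrable (fun t => pwConst τ q t (a t, b t)) F.μ :=
    integrable_pairing (by simp : (1 : ℝ≥0∞)⁻¹ + (∞ : ℝ≥0∞)⁻¹ = 1) (memLp_pwConst hτ hNτ q ∞)
      (memLp_one_iff_integrable.mpr (hai.prodMk hbi))
  have i2 := hA.integrable_state hai hbi
  have i3 : Integrable (fun t => ‖a t‖ + ‖b t‖) F.μ := hai.norm.add hbi.norm
  rw [← integral_add hai.norm hbi.norm, ← integral_const_mul, ← integral_add i2 (i3.const_mul _)]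
  refine integral_mono_ae i1 (i2.add (i3.const_mul _)) ?_
  filter_upwards [ae_timeMeasure_mem_Ioc] with t ht
  obtain ⟨k, hk, hkt⟩ := exists_mem_Ioc hτ hNτ ht
  rw [pwConst_succ hτ q hkt, CN.state_eq hN h (Ioc_subset_Icc_self ht)]
  simp only [hq, smul_apply, smul_eq_mul]
  have h1 : F.Q (midpt u (k + 1), midpt z (k + 1)) (a t, b t)
      = F.Q (pwAffine τ u t, pwAffine τ z t) (a t, b t)
        + F.Q (midpt u (k + 1) - pwAffine τ u t, midpt z (k + 1) - pwAffine τ z t) (a t, b t) := by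
    rw [← add_apply, ← map_add]
    simp
  have h2 : ‖(midpt u (k + 1) - pwAffine τ u t, midpt z (k + 1) - pwAffine τ z t)‖ ≤ e := by
    have h3 := he k hk
    rw [Prod.norm_def, mul_max_of_nonneg _ _ hτ.le] at h3
    refine max_le ?_ ?_
    · refine (norm_midpt_sub_pwAffine_le hτ u hkt).trans ?_
      rw [CN.slope_u h hk]
      exact (le_max_left _ _).trans h3
    · exact (norm_midpt_sub_pwAffine_le hτ z hkt).trans ((le_max_right _ _).trans h3)
  have he0 : 0 ≤ e := (norm_nonneg _).trans h2
  have h4 : ‖(a t, b t)‖ ≤ ‖a t‖ + ‖b t‖ :=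
    max_le (by linarith [norm_nonneg (b t)]) (by linarith [norm_nonneg (a t)])
  have h5 : F.Q (midpt u (k + 1) - pwAffine τ u t, midpt z (k + 1) - pwAffine τ z t) (a t, b t)
      ≤ ‖F.Q‖ * e * (‖a t‖ + ‖b t‖) :=
    (le_abs_self _).trans ((IsCoerciveForm.abs_le _ _ _).trans (by gcongr))
  rw [h1]
  linarith

end Frame

end

/-! ### Discrete solutions are approximate solutions. -/

section

/-- A single summand is bounded by the whole sum. The power `1 - p⁻¹` of `τ` is positive for `p >
1`, so the increments over one step tend to zero uniformly. -/
theorem mul_le_of_sum_rpow_le {X : Type*} [NormedAddCommGroup X] {τ p W : ℝ} {N : ℕ} (hτ : 0 < τ)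
    (hp : 1 < p) (hW : 0 ≤ W) {x : ℕ → X}
    (h : ∑ k ∈ Finset.range N, τ * ‖x (k + 1)‖ ^ p ≤ W) {k : ℕ} (hk : k < N) :
    τ * ‖x (k + 1)‖ ≤ W ^ p⁻¹ * τ ^ (1 - p⁻¹) := by
  have h1 : τ * ‖x (k + 1)‖ ^ p ≤ W :=
    (Finset.single_le_sum (f := fun k => τ * ‖x (k + 1)‖ ^ p) (fun _ _ => by positivity)
      (Finset.mem_range.mpr hk)).trans h
  have h2 : ‖x (k + 1)‖ ≤ (W / τ) ^ p⁻¹ := by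
    rw [Real.le_rpow_inv_iff_of_pos (norm_nonneg _) (by positivity) (by linarith), le_div_iff₀ hτ,
      mul_comm]
    exact h1
  calc τ * ‖x (k + 1)‖ ≤ τ * (W / τ) ^ p⁻¹ := by gcongr
    _ = W ^ p⁻¹ * τ ^ (1 - p⁻¹) := by
      rw [Real.div_rpow hW hτ.le, Real.rpow_sub hτ, Real.rpow_one]
      ring

namespace Frame

variable {U H Z : Type*} [NormedAddCommGroup U] [NormedSpace ℝ U]
  [NormedAddCommGroup H] [InnerProductSpace ℝ H]
  [NormedAddCommGroup Z] [NormedSpace ℝ Z] {S W R : ℝ}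

theorem tendsto_step (F : Frame U H Z) : Tendsto F.P.step atTop (𝓝 0) :=
  tendsto_const_div_atTop_nhds_zero_nat F.P.T

theorem tendsto_step_rpow (F : Frame U H Z) {p : ℝ} (hp : 1 < p) (W : ℝ) :
    Tendsto (fun N => W ^ p⁻¹ * F.P.step N ^ (1 - p⁻¹)) atTop (𝓝 0) := by
  have h1 : 0 < 1 - p⁻¹ := by
    rw [sub_pos]; exact inv_lt_one_of_one_lt₀ hp
  have h2 := (F.tendsto_step.rpow_const (p := 1 - p⁻¹) (Or.inr h1.le)).const_mul (W ^ p⁻¹)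
  rwa [Real.zero_rpow h1.ne', mul_zero] at h2

/-- Discrete solutions are approximate solutions of the variational inequality. -/
theorem CN.exists_isApprox [CompleteSpace U] [CompleteSpace Z] (F : Frame U H Z) (hW : 0 ≤ W)
    (hR : ∀ (N : ℕ) (u : ℕ → U) (v : ℕ → H) (z : ℕ → Z) (w : ℕ → U), 1 ≤ N →
      F.P.IsCNSolution N u v z w → F.IsCNBdd S W N u v z w ∧ F.IsBdd R (F.cnTraj N v z w)) :
    ∃ δ : ℕ → ℝ, Tendsto δ atTop (𝓝 0) ∧
      ∀ (N : ℕ) (u : ℕ → U) (v : ℕ → H) (z : ℕ → Z) (w : ℕ → U), 1 ≤ N →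
        F.P.IsCNSolution N u v z w → F.IsApprox R (δ N) (F.cnTraj N v z w) := by
  set c : ℝ≥0∞ → ℝ := fun p => (F.μ univ ^ (1 / (1 : ℝ≥0∞).toReal - 1 / p.toReal)).toReal with hc
  have hc0 : ∀ p, 0 ≤ c p := fun p => ENNReal.toReal_nonneg
  set e : ℕ → ℝ := fun N => W ^ F.P.p₁⁻¹ * F.P.step N ^ (1 - F.P.p₁⁻¹)
    + W ^ F.P.p₂⁻¹ * F.P.step N ^ (1 - F.P.p₂⁻¹) with he
  have het : Tendsto e atTop (𝓝 0) := by
    simpa using (F.tendsto_step_rpow F.hp₁ W).add (F.tendsto_step_rpow F.hp₂ W)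
  set η : ℕ → ℝ := fun N => (eLpNorm (pwConst (F.P.step N) (gridMean (F.P.step N) F.P.g) - F.P.g)
    F.P.conj₂ F.μ).toReal with hη
  -- The convergence of the cell means is stated for `n + 1` steps, hence the index shift.
  have hηt : Tendsto η atTop (𝓝 0) := by
    rw [← tendsto_add_atTop_iff_nat 1]
    have h1 := (ENNReal.tendsto_toReal ENNReal.zero_ne_top).comp
      (tendsto_gridMean F.T_pos (one_lt_conj F.hp₂).le F.memLp_g)
    exact h1
  -- Three errors: the momentum against the half-step velocity, the affine interpolants against the
  -- half-step states, and the cell means of `g` against `g` in the pairing with the test. The last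
  -- two are proportional to the norms of the tests.
  refine ⟨fun N => F.P.step N * (R * c F.P.conj₁ + ∫ t, ‖F.load t‖ ∂F.μ)
    + 2 * ‖F.Q‖ * e N * (c F.P.q₁ + c F.P.q₂) + η N, ?_, fun N u v z w hN h => ?_⟩
  · have h1 := ((F.tendsto_step.mul_const (R * c F.P.conj₁ + ∫ t, ‖F.load t‖ ∂F.μ)).add
      ((het.const_mul (2 * ‖F.Q‖)).mul_const (c F.P.q₁ + c F.P.q₂))).add hηt
    simpa using h1
  obtain ⟨hb, hA⟩ := hR N u v z w hN h
  have hτ := F.step_pos hN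
  have hNτ := F.mul_step hN
  have hR0 : 0 ≤ R := (norm_nonneg _).trans hA.bdd_vT
  have hL0 : 0 ≤ ∫ t, ‖F.load t‖ ∂F.μ := integral_nonneg fun _ => norm_nonneg _
  have he0 : 0 ≤ e N := by positivity
  have hη0 : 0 ≤ η N := ENNReal.toReal_nonneg
  have hek : ∀ k < N, F.P.step N * ‖(w (k + 1), slope (F.P.step N) z (k + 1))‖ ≤ e N := by
    intro k hk
    have h1 := mul_le_of_sum_rpow_le hτ F.hp₁ hW hb.w_sum hk
    have h2 := mul_le_of_sum_rpow_le hτ F.hp₂ hW hb.y_sum hk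
    have h3 : 0 ≤ F.P.step N * ‖w (k + 1)‖ := by positivity
    have h4 : 0 ≤ F.P.step N * ‖slope (F.P.step N) z (k + 1)‖ := by positivity
    rw [Prod.norm_def, mul_max_of_nonneg _ _ hτ.le]
    exact max_le (by simp only [he]; linarith) (by simp only [he]; linarith)
  have hstT : F.state (F.cnTraj N v z w) F.P.T = (u N, z N) := by
    rw [CN.state_eq hN h F.T_mem]
    have h1 : ∀ k : ℕ, k < N → k + 1 = N → F.P.T ∈ Ioc ((k : ℝ) * F.P.step N)
        ((k + 1) * F.P.step N) := fun k hk hkN => by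
      have : ((k : ℝ) + 1) = N := by exact_mod_cast hkN
      rw [this, hNτ, ← hNτ]
      refine ⟨?_, le_rfl⟩
      gcongr
    obtain ⟨m, rfl⟩ : ∃ m, N = m + 1 := ⟨N - 1, by omega⟩
    have h2 := h1 m (by omega) rfl
    have h3 : F.P.T - m * F.P.step (m + 1) = F.P.step (m + 1) := by
      rw [← hNτ]; push_cast; ring
    rw [pwAffine_apply hτ u h2, pwAffine_apply hτ z h2, h3, smul_inv_smul₀ hτ.ne',
      smul_inv_smul₀ hτ.ne', add_sub_cancel, add_sub_cancel]
  refine ⟨hA, CN.pot_ne_top hN h, ?_, ?_, fun a b ha hb' hab => ?_⟩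
  · have := CN.mom_grid hN h hA le_rfl
    rw [hNτ] at this
    exact this.symm
  · refine (CN.integral_mom_sub_le hN h hA).trans ?_
    have h1 := integral_norm_le_eLpNorm F.one_le_conj₁ hA.memLp_ζ
    have h2 := ENNReal.toReal_mono ENNReal.ofReal_ne_top hA.le_ζ
    rw [ENNReal.toReal_ofReal hR0] at h2
    have h3 := mul_le_mul_of_nonneg_right h2 (hc0 F.P.conj₁)
    have h4 : 0 ≤ 2 * ‖F.Q‖ * e N * (c F.P.q₁ + c F.P.q₂) :=
      mul_nonneg (by positivity) (add_nonneg (hc0 _) (hc0 _))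
    have h5 := mul_le_mul_of_nonneg_left (add_le_add_left (h1.trans h3) (∫ t, ‖F.load t‖ ∂F.μ)) hτ.le
    linarith
  · have h1 := CN.vi_integral hN h hA ha hb' hab
    have h2 := CN.midpt_error hN h hA hek ha hb'
    have h3 := integral_norm_le_eLpNorm F.one_le_q₁ ha
    have h4 := integral_norm_le_eLpNorm F.one_le_q₂ hb'
    have hgm := memLp_pwConst hτ hNτ (gridMean (F.P.step N) F.P.g) F.P.conj₂
    have h5 : (∫ t, F.P.g t (b t) ∂F.μ)
        - (∫ t, pwConst (F.P.step N) (gridMean (F.P.step N) F.P.g) t (b t) ∂F.μ)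
        ≤ η N * (eLpNorm b F.P.q₂ F.μ).toReal := by
      have k1 := abs_integral_pairing_le F.holder₂ (hgm.sub F.memLp_g) hb'
      have k2 := integral_sub (integrable_pairing F.holder₂ hgm hb')
        (integrable_pairing F.holder₂ F.memLp_g hb')
      simp only [Pi.sub_apply, sub_apply] at k1
      rw [k2] at k1
      linarith [(abs_le.mp k1).1]
    have i1 := integrable_pairing F.holder₁ F.memLp_f₁ hA.memLp_w
    have i2 := integrable_pairing (by simp : (∞ : ℝ≥0∞)⁻¹ + (1 : ℝ≥0∞)⁻¹ = 1) F.memLp_f₂ hA.memLp_ιw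
    have h6 : ∫ t, F.load t ((F.cnTraj N v z w).w t) ∂F.μ
        = (∫ t, F.f₁ t ((F.cnTraj N v z w).w t) ∂F.μ)
          + ∫ t, F.f₂ t (F.P.ι ((F.cnTraj N v z w).w t)) ∂F.μ := integral_add i1 i2
    rw [hstT, lin]
    change F.K (v N) (v N) + _ + _ ≤ _
    set α := (eLpNorm a F.P.q₁ F.μ).toReal with hα
    set β := (eLpNorm b F.P.q₂ F.μ).toReal with hβ
    have hα0 : 0 ≤ α := ENNReal.toReal_nonneg
    have hβ0 : 0 ≤ β := ENNReal.toReal_nonneg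
    have h7 : (∫ t, ‖a t‖ ∂F.μ) + ∫ t, ‖b t‖ ∂F.μ ≤ (c F.P.q₁ + c F.P.q₂) * (α + β) := by
      have k1 : 0 ≤ c F.P.q₁ * β := mul_nonneg (hc0 _) hβ0
      have k2 : 0 ≤ c F.P.q₂ * α := mul_nonneg (hc0 _) hα0
      linarith
    have h8 := mul_le_mul_of_nonneg_left h7 (by positivity : 0 ≤ 2 * ‖F.Q‖ * e N)
    have h9 : 0 ≤ F.P.step N * (R * c F.P.conj₁ + ∫ t, ‖F.load t‖ ∂F.μ) * (α + β) :=
      mul_nonneg (mul_nonneg hτ.le (add_nonneg (mul_nonneg hR0 (hc0 _)) hL0))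
        (add_nonneg hα0 hβ0)
    have h10 : 0 ≤ η N * α := mul_nonneg hη0 hα0
    linarith

end Frame

end

/-! ### The a-priori estimates in Sobolev norms. -/

section

theorem SobolevNormLE.mono {X : Type*} [NormedAddCommGroup X] [NormedSpace ℝ X] {T : ℝ} {p : ℝ≥0∞}
    {u : ℝ → X} {C C' : ℝ} (h : SobolevNormLE T p u C) (hC : C ≤ C') : SobolevNormLE T p u C' := by
  obtain ⟨du, h1, h2⟩ := h
  exact ⟨du, h1, h2.trans (ENNReal.ofReal_le_ofReal hC)⟩

theorem LpNormLE.mono {X : Type*} [NormedAddCommGroup X] {T : ℝ} {p : ℝ≥0∞}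
    {u : ℝ → X} {C C' : ℝ} (h : LpNormLE T p u C) (hC : C ≤ C') : LpNormLE T p u C' :=
  ⟨h.1, h.2.trans (ENNReal.ofReal_le_ofReal hC)⟩

/-- A bound for the norm of a primitive in a Sobolev space. -/
noncomputable def sobolevBound (T : ℝ) (p : ℝ≥0∞) (c M : ℝ) : ℝ :=
  (timeMeasure T univ ^ p.toReal⁻¹).toReal
    * (c + M * (timeMeasure T univ ^ (1 / (1 : ℝ≥0∞).toReal - 1 / p.toReal)).toReal) + M

theorem sobolevBound_nonneg {T : ℝ} {p : ℝ≥0∞} {c M : ℝ} (hc : 0 ≤ c) (hM : 0 ≤ M) :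
    0 ≤ sobolevBound T p c M := by
  rw [sobolevBound]
  positivity

theorem isSobolev_of_primitive {X : Type*} [NormedAddCommGroup X] [NormedSpace ℝ X]
    [CompleteSpace X] {T : ℝ} (hT : 0 ≤ T) {p : ℝ≥0∞} (hp : 1 ≤ p) {α u : ℝ → X} {c : X}
    (hα : MemLp α p (timeMeasure T)) (hu : ∀ t ∈ Icc 0 T, u t = primitive c α t) :
    IsSobolev T p u α := by
  have hαi : Integrable α (timeMeasure T) := hα.integrable hp
  have hae : u =ᵐ[timeMeasure T] primitive c α := by
    filter_upwards [ae_timeMeasure_mem] with t ht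
    exact hu t ht
  exact ⟨(memLp_of_continuousOn (continuousOn_primitive' c hαi) p).ae_eq hae.symm, hα,
    hasWeakDeriv_of_primitive hT hαi hae⟩

theorem sobolevNormLE_of_primitive {X : Type*} [NormedAddCommGroup X] [NormedSpace ℝ X]
    [CompleteSpace X] {T : ℝ} (hT : 0 ≤ T) {p : ℝ≥0∞} (hp : 1 ≤ p) {α u : ℝ → X} {c : X} {M : ℝ}
    (hM : 0 ≤ M) (hα : MemLp α p (timeMeasure T))
    (hαM : eLpNorm α p (timeMeasure T) ≤ ENNReal.ofReal M)
    (hu : ∀ t ∈ Icc 0 T, u t = primitive c α t) :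
    SobolevNormLE T p u (sobolevBound T p ‖c‖ M) := by
  have hαi : Integrable α (timeMeasure T) := hα.integrable hp
  refine ⟨α, isSobolev_of_primitive hT hp hα hu, ?_⟩
  set d := (timeMeasure T univ ^ (1 / (1 : ℝ≥0∞).toReal - 1 / p.toReal)).toReal with hd
  set m := (timeMeasure T univ ^ p.toReal⁻¹).toReal with hm
  have hd0 : 0 ≤ d := ENNReal.toReal_nonneg
  have h1 : ∫ t, ‖α t‖ ∂(timeMeasure T) ≤ M * d := by
    refine (integral_norm_le_eLpNorm hp hα).trans (mul_le_mul_of_nonneg_right ?_ hd0)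
    have := ENNReal.toReal_mono ENNReal.ofReal_ne_top hαM
    rwa [ENNReal.toReal_ofReal hM] at this
  have h2 : ∀ᵐ t ∂(timeMeasure T), ‖u t‖ ≤ ‖c‖ + M * d := by
    filter_upwards [ae_timeMeasure_mem] with t ht
    rw [hu t ht, primitive]
    refine (norm_add_le _ _).trans (add_le_add_right ?_ _)
    exact (norm_intervalIntegral_le hαi ⟨le_rfl, hT⟩ ht).trans h1
  have h3 := eLpNorm_le_of_ae_bound (p := p) h2
  have h4 : timeMeasure T univ ^ p.toReal⁻¹ = ENNReal.ofReal m :=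
    (ENNReal.ofReal_toReal (ENNReal.rpow_ne_top_of_nonneg (by positivity)
      (measure_ne_top _ _))).symm
  rw [h4, ← ENNReal.ofReal_mul ENNReal.toReal_nonneg] at h3
  rw [sobolevBound, ENNReal.ofReal_add (by positivity) hM]
  exact add_le_add h3 hαM

namespace Frame

variable {U H Z : Type*} [NormedAddCommGroup U] [NormedSpace ℝ U]
  [NormedAddCommGroup H] [InnerProductSpace ℝ H]
  [NormedAddCommGroup Z] [NormedSpace ℝ Z] {F : Frame U H Z} {S W R : ℝ} {N : ℕ}
  {u : ℕ → U} {v : ℕ → H} {z : ℕ → Z} {w : ℕ → U}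

variable [CompleteSpace U] [CompleteSpace H] [CompleteSpace Z]

theorem CN.pwAffine_u (hN : 1 ≤ N) (h : F.P.IsCNSolution N u v z w) {t : ℝ}
    (ht : t ∈ Icc 0 F.P.T) :
    pwAffine (F.P.step N) u t = primitive F.P.u₀ (pwConst (F.P.step N) w) t :=
  (congrArg Prod.fst (CN.state_eq hN h ht)).symm

theorem CN.pwAffine_z (hN : 1 ≤ N) (h : F.P.IsCNSolution N u v z w) {t : ℝ}
    (ht : t ∈ Icc 0 F.P.T) : pwAffine (F.P.step N) z t
      = primitive F.P.z₀ (pwConst (F.P.step N) (slope (F.P.step N) z)) t :=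
  (congrArg Prod.snd (CN.state_eq hN h ht)).symm

theorem CN.pwAffine_ιu (hN : 1 ≤ N) (h : F.P.IsCNSolution N u v z w)
    (hA : F.IsBdd R (F.cnTraj N v z w)) {t : ℝ} (ht : t ∈ Icc 0 F.P.T) :
    F.P.ι (pwAffine (F.P.step N) u t)
      = primitive (F.P.ι F.P.u₀) (fun t => F.P.ι (pwConst (F.P.step N) w t)) t := by
  rw [CN.pwAffine_u hN h ht, primitive, map_add, primitive]
  congr 1
  exact (F.P.ι.intervalIntegral_comp_comm
    (intervalIntegrable_of_timeMeasure hA.integrable_w F.zero_mem ht)).symm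

/-- The momentum of a discrete solution, split as the load. -/
theorem CN.dK_pwAffine (hN : 1 ≤ N) (h : F.P.IsCNSolution N u v z w) {t : ℝ}
    (ht : t ∈ Icc 0 F.P.T) :
    F.dK (pwAffine (F.P.step N) v t)
      = primitive 0 (fun t => pwConst (F.P.step N) (F.cnDual N v) t
          + pwConst (F.P.step N) (gridMean (F.P.step N) F.f₁) t) t
        + (primitive ((2 : ℝ) • F.K F.P.v₀)
            (pwConst (F.P.step N) (gridMean (F.P.step N) F.f₂)) t).comp F.P.ι := by
  have hτ := F.step_pos hN
  have hNτ := F.mul_step hN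
  set τ := F.P.step N with hτdef
  have i1 := intervalIntegrable_of_timeMeasure (integrable_pwConst hτ hNτ (slope τ v)) F.zero_mem ht
  have i2 := intervalIntegrable_of_timeMeasure
    (integrable_pwConst hτ hNτ (gridMean τ F.f₂)) F.zero_mem ht
  have i3 : IntervalIntegrable (fun s => pwConst τ (F.cnDual N v) s
      + pwConst τ (gridMean τ F.f₁) s) volume 0 t := intervalIntegrable_of_timeMeasure
    ((integrable_pwConst hτ hNτ (F.cnDual N v)).add
      (integrable_pwConst hτ hNτ (gridMean τ F.f₁))) F.zero_mem ht
  set L := (ContinuousLinearMap.compL ℝ U H ℝ).flip F.P.ι with hL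
  have hLa : ∀ ξ : StrongDual ℝ H, ξ.comp F.P.ι = L ξ := fun ξ => rfl
  -- The initial velocity lies in `H` only, so its momentum is assigned to the summand with values
  -- in the dual of `H`, together with the means of `f₂`.
  have e0 : F.dK F.P.v₀ = L ((2 : ℝ) • F.K F.P.v₀) := by
    ext x; simp [hL]
  rw [pwAffine_eq_primitive hτ hNτ v ht, h.init_v, map_add]
  change F.dK F.P.v₀ + F.dK (∫ s in (0 : ℝ)..t, pwConst τ (slope τ v) s) = _
  rw [← F.dK.intervalIntegral_comp_comm i1, hLa, primitive, primitive, map_add, zero_add, e0,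
    ← L.intervalIntegral_comp_comm i2]
  have i4 : IntervalIntegrable (fun s => L (pwConst τ (gridMean τ F.f₂) s)) volume 0 t :=
    ⟨L.integrable_comp i2.1, L.integrable_comp i2.2⟩
  rw [add_left_comm, ← intervalIntegral.integral_add i3 i4]
  congr 1
  refine intervalIntegral.integral_congr_ae (Eventually.of_forall fun s hs => ?_)
  rw [uIoc_of_le ht.1] at hs
  obtain ⟨k, hk, hks⟩ := exists_mem_Ioc hτ hNτ ⟨hs.1, hs.2.trans ht.2⟩
  simp only [pwConst_succ hτ _ hks]
  rw [cnDual, fMean_eq hN hk, ← hLa]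
  abel

/-- The a-priori estimates. -/
theorem exists_aprioriEstimates (F : Frame U H Z)
    (hR : ∀ (N : ℕ) (u : ℕ → U) (v : ℕ → H) (z : ℕ → Z) (w : ℕ → U), 1 ≤ N →
      F.P.IsCNSolution N u v z w → F.IsCNBdd S W N u v z w ∧ F.IsBdd R (F.cnTraj N v z w))
    (hR0 : 0 ≤ R) (hS0 : 0 ≤ S) :
    ∃ C : ℝ, ∀ N : ℕ, 1 ≤ N → ∀ u v z w, F.P.IsCNSolution N u v z w →
      F.P.APrioriEstimates C N u v z w := by
  set M₁ := R + (eLpNorm F.f₁ F.P.conj₁ F.μ).toReal with hM₁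
  set M₂ := (eLpNorm F.f₂ 1 F.μ).toReal with hM₂
  have hM₁0 : 0 ≤ M₁ := by positivity
  have hM₂0 : 0 ≤ M₂ := by positivity
  set C₁ := sobolevBound F.P.T ∞ ‖F.P.ι F.P.u₀‖ R with hC₁
  set C₂ := sobolevBound F.P.T F.P.q₁ ‖F.P.u₀‖ R with hC₂
  set C₃ := sobolevBound F.P.T F.P.q₂ ‖F.P.z₀‖ R with hC₃
  set C₄ := sobolevBound F.P.T F.P.conj₁ ‖(0 : StrongDual ℝ U)‖ M₁ with hC₄
  set C₅ := sobolevBound F.P.T 1 ‖(2 : ℝ) • F.K F.P.v₀‖ M₂ with hC₅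
  have h1 : 0 ≤ C₁ := sobolevBound_nonneg (norm_nonneg _) hR0
  have h2 : 0 ≤ C₂ := sobolevBound_nonneg (norm_nonneg _) hR0
  have h3 : 0 ≤ C₃ := sobolevBound_nonneg (norm_nonneg _) hR0
  have h4 : 0 ≤ C₄ := sobolevBound_nonneg (norm_nonneg _) hM₁0
  have h5 : 0 ≤ C₅ := sobolevBound_nonneg (norm_nonneg _) hM₂0
  refine ⟨S + R + C₁ + C₂ + C₃ + C₄ + C₅, fun N hN u v z w h => ?_⟩
  obtain ⟨hb, hA⟩ := hR N u v z w hN h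
  have hT := F.T_pos.le
  have hτ := F.step_pos hN
  have hNτ := F.mul_step hN
  have hιw : LpNormLE F.P.T ∞ (fun t => F.P.ι (pwConst (F.P.step N) w t)) R := by
    refine ⟨hA.memLp_ιw, ?_⟩
    refine (eLpNorm_le_of_ae_bound (p := ∞) hA.bdd).trans ?_
    simp
  have hwS : LpNormLE F.P.T F.P.q₁ (pwConst (F.P.step N) w) R := ⟨hA.memLp_w, hA.le_w⟩
  refine ⟨?_, ?_, ?_, ?_, hιw.mono (by linarith), hwS.mono (by linarith), ?_⟩
  · refine LpNormLE.mono (C := S) ⟨?_, ?_⟩ (by linarith)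
    · exact (isSobolev_of_primitive hT le_rfl (p := 1) (memLp_one_iff_integrable.mpr
        hA.integrable_w) fun t ht => CN.pwAffine_u hN h ht).memLp.1 |> fun hm =>
        memLp_top_of_bound hm S (by
          filter_upwards [ae_timeMeasure_mem] with t ht
          exact norm_pwAffine_le hτ hNτ hb.u_le ht)
    · have := eLpNorm_le_of_ae_bound (p := ∞) (μ := F.μ) (f := pwAffine (F.P.step N) u) (C := S) (by
          filter_upwards [ae_timeMeasure_mem] with t ht
          exact norm_pwAffine_le hτ hNτ hb.u_le ht)
      simpa using this
  · exact (sobolevNormLE_of_primitive hT le_top hR0 hιw.1 hιw.2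
      fun t ht => CN.pwAffine_ιu hN h hA ht).mono (by linarith)
  · exact (sobolevNormLE_of_primitive hT F.one_le_q₁ hR0 hwS.1 hwS.2
      fun t ht => CN.pwAffine_u hN h ht).mono (by linarith)
  · exact (sobolevNormLE_of_primitive hT F.one_le_q₂ hR0 hA.memLp_y hA.le_y
      fun t ht => CN.pwAffine_z hN h ht).mono (by linarith)
  · have m1 : MemLp (pwConst (F.P.step N) (gridMean (F.P.step N) F.f₁)) F.P.conj₁ F.μ :=
      memLp_pwConst hτ hNτ _ _
    have m2 : MemLp (pwConst (F.P.step N) (gridMean (F.P.step N) F.f₂)) 1 F.μ :=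
      memLp_pwConst hτ hNτ _ _
    have m3 : MemLp (fun t => pwConst (F.P.step N) (F.cnDual N v) t
        + pwConst (F.P.step N) (gridMean (F.P.step N) F.f₁) t) F.P.conj₁ F.μ :=
      MemLp.add (f := pwConst (F.P.step N) (F.cnDual N v)) hA.memLp_ζ m1
    have n1 : eLpNorm (fun t => pwConst (F.P.step N) (F.cnDual N v) t
        + pwConst (F.P.step N) (gridMean (F.P.step N) F.f₁) t) F.P.conj₁ F.μ
        ≤ ENNReal.ofReal M₁ := by
      refine (eLpNorm_add_le (f := pwConst (F.P.step N) (F.cnDual N v)) hA.memLp_ζ.1 m1.1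
        F.one_le_conj₁).trans ?_
      rw [hM₁, ENNReal.ofReal_add hR0 ENNReal.toReal_nonneg,
        ENNReal.ofReal_toReal F.memLp_f₁.2.ne]
      exact add_le_add hA.le_ζ (eLpNorm_gridMean_le hτ hNτ F.hq F.memLp_f₁)
    have n2 : eLpNorm (pwConst (F.P.step N) (gridMean (F.P.step N) F.f₂)) 1 F.μ
        ≤ ENNReal.ofReal M₂ := by
      rw [hM₂, ENNReal.ofReal_toReal F.memLp_f₂.2.ne]
      have := eLpNorm_gridMean_le hτ hNτ le_rfl (F := F.f₂)
        (by rw [ENNReal.ofReal_one]; exact F.memLp_f₂)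
      rwa [ENNReal.ofReal_one] at this
    refine ⟨_, _, C₄, C₅, h4, h5, by linarith, fun t ht => ?_,
      sobolevNormLE_of_primitive hT F.one_le_conj₁ hM₁0 m3 n1 (fun t _ => rfl),
      sobolevNormLE_of_primitive hT le_rfl hM₂0 m2 n2 (fun t _ => rfl)⟩
    rw [F.dKin_eq]
    exact CN.dK_pwAffine hN h ht

end Frame

end

/-! ### Norm convergence from uniform convexity. -/

section

variable {X : Type*} [NormedAddCommGroup X] [NormedSpace ℝ X] {Ψ : X → ℝ≥0∞} {p : ℝ}

/-- For a convex functional, the uniform convexity gap at a fixed point holds globally. -/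
theorem exists_gap (hc : ConvexOn ℝ≥0 univ Ψ) (hu : IsUniformlyConvexFunctional Ψ) (x₀ : X)
    {ε : ℝ} (hε : 0 < ε) : ∃ δ : ℝ, 0 < δ ∧ ∀ x, Ψ x ≠ ∞ → Ψ x₀ ≠ ∞ → ε ≤ ‖x - x₀‖ →
      (Ψ ((2⁻¹ : ℝ) • (x + x₀))).toReal + δ ≤ ((Ψ x).toReal + (Ψ x₀).toReal) / 2 := by
  -- The assumption is used only for `x₀` and points at distance exactly `ε` from it, which lie in
  -- this ball; distant `x` are reached by convexity along the segment.
  obtain ⟨δ, hδ, h⟩ := hu (‖x₀‖ + ε) ε (by positivity) hε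
  refine ⟨δ, hδ, fun x hx hx₀ hd => ?_⟩
  set d := x - x₀ with hd_def
  have hd0 : 0 < ‖d‖ := hε.trans_le hd
  set s := ε / ‖d‖ with hs
  have hs0 : 0 < s := by positivity
  have hs1 : s ≤ 1 := by rw [hs, div_le_one hd0]; exact hd
  set φ : ℝ → X := fun r => x₀ + r • d with hφ
  have hseg : ∀ r ∈ Icc (0 : ℝ) 1, Ψ (φ r) ≠ ∞ := fun r hr => by
    have h1 := convexOn_real_combo hc x x₀ hr.1 (sub_nonneg.mpr hr.2) (by ring)
    have h2 : r • x + (1 - r) • x₀ = φ r := by simp only [hφ, hd_def]; module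
    rw [h2] at h1
    exact ne_top_of_le_ne_top (ENNReal.add_ne_top.mpr
      ⟨ENNReal.mul_ne_top ENNReal.ofReal_ne_top hx, ENNReal.mul_ne_top ENNReal.ofReal_ne_top hx₀⟩) h1
  have hconv : ∀ r ∈ Icc (0 : ℝ) 1, ∀ a : ℝ, 0 ≤ a → a ≤ 1 → ∀ r', r' = a * r + (1 - a) * 1 →
      (Ψ (φ r')).toReal ≤ a * (Ψ (φ r)).toReal + (1 - a) * (Ψ (φ 1)).toReal := by
    intro r hr a ha ha1 r' hr'
    have h1 := convexOn_real_combo hc (φ r) (φ 1) ha (sub_nonneg.mpr ha1) (by ring)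
    have h2 : a • φ r + (1 - a) • φ 1 = φ r' := by simp only [hφ, hr']; module
    rw [h2] at h1
    have f1 := ENNReal.mul_ne_top (ENNReal.ofReal_ne_top (r := a)) (hseg r hr)
    have f2 := ENNReal.mul_ne_top (ENNReal.ofReal_ne_top (r := 1 - a)) (hseg 1 ⟨zero_le_one, le_rfl⟩)
    have h3 := ENNReal.toReal_mono (ENNReal.add_ne_top.mpr ⟨f1, f2⟩) h1
    rwa [ENNReal.toReal_add f1 f2, ENNReal.toReal_mul, ENNReal.toReal_mul,
      ENNReal.toReal_ofReal ha, ENNReal.toReal_ofReal (sub_nonneg.mpr ha1)] at h3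
  have hsm : s / 2 ∈ Icc (0 : ℝ) 1 := ⟨by positivity, by linarith⟩
  have hden : 0 < 1 - s / 2 := by linarith
  -- On the segment from `x₀` to `x`, both the parameters `s` and `1/2` are convex combinations of
  -- `s/2` and `1`. The weights satisfy `α + 2β = 2`, so the midpoint gap at parameter `s` carries
  -- over to the whole segment.
  have c1 := hconv (s / 2) hsm ((1 - s) / (1 - s / 2)) (div_nonneg (by linarith) hden.le)
    (by rw [div_le_one hden]; linarith) s (by linear_combination div_mul_cancel₀ (1 - s) hden.ne')
  have c2 := hconv (s / 2) hsm (2⁻¹ / (1 - s / 2)) (by positivity)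
    (by rw [div_le_one hden]; linarith) 2⁻¹
      (by linear_combination div_mul_cancel₀ (2⁻¹ : ℝ) hden.ne')
  have e1 : (1 - s) / (1 - s / 2) + 2 * (2⁻¹ / (1 - s / 2)) = 2 := by
    rw [← mul_div_assoc, ← add_div, div_eq_iff hden.ne']; ring
  have hφ1 : φ 1 = x := by simp [hφ, hd_def]
  have hφh : φ 2⁻¹ = (2⁻¹ : ℝ) • (x + x₀) := by
    simp only [hφ, hd_def]
    rw [smul_add, smul_sub]
    nth_rewrite 1 [show x₀ = (2⁻¹ : ℝ) • x₀ + (2⁻¹ : ℝ) • x₀ by module]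
    module
  have hφs : φ (s / 2) = (2⁻¹ : ℝ) • (φ s + x₀) := by
    simp only [hφ]
    nth_rewrite 1 [show x₀ = (2⁻¹ : ℝ) • x₀ + (2⁻¹ : ℝ) • x₀ by module]
    module
  have hnorm : ‖s • d‖ = ε := by
    rw [norm_smul, Real.norm_of_nonneg hs0.le, hs, div_mul_cancel₀ _ hd0.ne']
  have c3 := h (φ s) x₀ ((norm_add_le _ _).trans (by rw [hnorm])) (by linarith)
    (by simp only [hφ, add_sub_cancel_left, hnorm, le_refl])
  rw [← hφs] at c3
  have fs := hseg s ⟨hs0.le, hs1⟩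
  have c4 := ENNReal.toReal_mono (ENNReal.div_ne_top (ENNReal.add_ne_top.mpr ⟨fs, hx₀⟩)
    two_ne_zero) c3
  rw [ENNReal.toReal_add (hseg _ hsm) ENNReal.ofReal_ne_top, ENNReal.toReal_ofReal hδ.le,
    ENNReal.toReal_div, ENNReal.toReal_add fs hx₀, ENNReal.toReal_ofNat] at c4
  rw [hφ1] at c1 c2
  rw [hφh] at c2
  set α := (1 - s) / (1 - s / 2)
  set β := 2⁻¹ / (1 - s / 2)
  have hβ : β = (2 - α) / 2 := by linarith
  rw [hβ] at c2
  linarith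

variable {μ : Measure ℝ} [IsFiniteMeasure μ]

/-- Convexity of `r ↦ r ^ p` and coercivity make the `p`-th power of the distance dominated by the
mean of the two potentials. -/
theorem enorm_sub_rpow_le {ε : ℝ} (hp : 1 ≤ p) (hε : 0 < ε)
    (hΨ : ∀ v, ENNReal.ofReal (ε * ‖v‖ ^ p) ≤ Ψ v) (x y : X) :
    ENNReal.ofReal (ε * (1 / 2) ^ p) * ‖x - y‖ₑ ^ p ≤ (Ψ x + Ψ y) / 2 := by
  have hp0 : 0 ≤ p := zero_le_one.trans hp
  have h1 : (1 / 2 * ‖x - y‖) ^ p ≤ 1 / 2 * ‖x‖ ^ p + 1 / 2 * ‖y‖ ^ p := by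
    have h2 := (convexOn_rpow hp).2 (norm_nonneg x) (norm_nonneg y) (by norm_num : (0 : ℝ) ≤ 1 / 2)
      (by norm_num : (0 : ℝ) ≤ 1 / 2) (by norm_num)
    simp only [smul_eq_mul] at h2
    exact (Real.rpow_le_rpow (by positivity) (by linarith [norm_sub_le x y]) hp0).trans h2
  rw [Real.mul_rpow (by norm_num) (norm_nonneg _)] at h1
  rw [← ofReal_norm, ENNReal.ofReal_rpow_of_nonneg (norm_nonneg _) hp0,
    ← ENNReal.ofReal_mul (by positivity)]
  calc _ ≤ ENNReal.ofReal ((ε * ‖x‖ ^ p + ε * ‖y‖ ^ p) / 2) :=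
        ENNReal.ofReal_le_ofReal (by nlinarith)
    _ = (ENNReal.ofReal (ε * ‖x‖ ^ p) + ENNReal.ofReal (ε * ‖y‖ ^ p)) / 2 := by
        rw [ENNReal.ofReal_div_of_pos two_pos, ENNReal.ofReal_add (by positivity) (by positivity),
          ENNReal.ofReal_ofNat]
    _ ≤ _ := by gcongr <;> exact hΨ _

theorem tendsto_sub_zero_of_le_liminf {ι : Type*} {l : Filter ι} {a b : ι → ℝ≥0∞} {J : ℝ≥0∞}
    (hJ : J ≠ ∞) (ha : Tendsto a l (𝓝 J)) (hab : ∀ i, b i ≤ a i) (hb : J ≤ liminf b l) :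
    Tendsto (fun i => a i - b i) l (𝓝 0) := by
  rcases l.eq_or_neBot with rfl | _
  · exact tendsto_bot
  have hb' : Tendsto b l (𝓝 J) := tendsto_of_le_liminf_of_limsup_le hb
    ((limsup_le_limsup (Eventually.of_forall hab)).trans ha.limsup_eq.le)
  have := ENNReal.Tendsto.sub ha hb' (Or.inl hJ)
  rwa [tsub_self] at this

/-- If the integrals of a uniformly convex potential converge along a sequence, and those at the
midpoints with the limit are asymptotically no smaller, then the sequence converges in norm. -/
theorem tendsto_eLpNorm_of_uniformlyConvex (hp : 1 < p) (hΨ : IsDissipationPotential p Ψ)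
    (hu : IsUniformlyConvexFunctional Ψ) {x : ℕ → ℝ → X} {x₀ : ℝ → X}
    (hx : ∀ n, AEStronglyMeasurable (x n) μ) (hx₀ : AEStronglyMeasurable x₀ μ)
    (hJ : ∫⁻ t, Ψ (x₀ t) ∂μ ≠ ∞)
    (hlim : Tendsto (fun n => ∫⁻ t, Ψ (x n t) ∂μ) atTop (𝓝 (∫⁻ t, Ψ (x₀ t) ∂μ)))
    (hmid : ∫⁻ t, Ψ (x₀ t) ∂μ
      ≤ liminf (fun n => ∫⁻ t, Ψ ((2⁻¹ : ℝ) • (x n t + x₀ t)) ∂μ) atTop) :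
    Tendsto (fun n => eLpNorm (fun t => x n t - x₀ t) (ENNReal.ofReal p) μ) atTop (𝓝 0) := by
  obtain ⟨ε, hε, hco⟩ := hΨ.coercive
  have hp0 : 0 < p := one_pos.trans hp
  set J := ∫⁻ t, Ψ (x₀ t) ∂μ with hJ_def
  have mx := fun n => Frame.aemeasurable_comp_lsc hΨ.lsc (hx n)
  have mx₀ := Frame.aemeasurable_comp_lsc hΨ.lsc hx₀
  have mmid := fun n => Frame.aemeasurable_comp_lsc hΨ.lsc
    (((hx n).add hx₀).const_smul (2⁻¹ : ℝ))
  set A : ℕ → ℝ → ℝ≥0∞ := fun n t => (Ψ (x n t) + Ψ (x₀ t)) / 2 with hA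
  have mA : ∀ n, AEMeasurable (A n) μ := fun n => ((mx n).add mx₀).div_const 2
  have hAint : ∀ n, ∫⁻ t, A n t ∂μ = ((∫⁻ t, Ψ (x n t) ∂μ) + J) / 2 := fun n => by
    simp_rw [hA, div_eq_mul_inv]
    rw [lintegral_mul_const' _ _ (by simp), lintegral_add_left' (mx n)]
  have hAlim : Tendsto (fun n => ∫⁻ t, A n t ∂μ) atTop (𝓝 J) := by
    simp_rw [hAint]
    have := ENNReal.Tendsto.div_const (hlim.add (tendsto_const_nhds (x := J)))
      (Or.inr (two_ne_zero (α := ℝ≥0∞)))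
    rwa [ENNReal.add_div, ENNReal.add_halves] at this
  have hmidle : ∀ n t, Ψ ((2⁻¹ : ℝ) • (x n t + x₀ t)) ≤ A n t := fun n t => by
    have h1 := convexOn_real_combo hΨ.convex (x n t) (x₀ t) (by norm_num : (0 : ℝ) ≤ 2⁻¹)
      (by norm_num : (0 : ℝ) ≤ 2⁻¹) (by norm_num)
    rw [← smul_add, ← mul_add, mul_comm, ENNReal.ofReal_inv_of_pos two_pos, ENNReal.ofReal_ofNat,
      ← div_eq_mul_inv] at h1
    exact h1
  have hfin : ∀ᶠ n in atTop, ∫⁻ t, Ψ (x n t) ∂μ ≠ ∞ :=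
    (hlim.eventually_lt_const hJ.lt_top).mono fun n h => h.ne
  -- The nonnegative defect of midpoint convexity. Its integrals tend to zero: `hlim` gives the
  -- limit of the means, and `hmid` prevents the midpoint integrals from falling below it.
  set d : ℕ → ℝ → ℝ≥0∞ := fun n t => A n t - Ψ ((2⁻¹ : ℝ) • (x n t + x₀ t)) with hd
  have hAtop : ∀ n, ∫⁻ t, Ψ (x n t) ∂μ ≠ ∞ → ∫⁻ t, A n t ∂μ ≠ ∞ := fun n hn => by
    rw [hAint]; exact ENNReal.div_ne_top (ENNReal.add_ne_top.mpr ⟨hn, hJ⟩) two_ne_zero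
  have hdlim : Tendsto (fun n => ∫⁻ t, d n t ∂μ) atTop (𝓝 0) := by
    refine (tendsto_sub_zero_of_le_liminf hJ hAlim (fun n => lintegral_mono (hmidle n))
      hmid).congr' (hfin.mono fun n hn => ?_)
    exact (lintegral_sub' (mmid n)
      (ne_top_of_le_ne_top (hAtop n hn) (lintegral_mono (hmidle n)))
      (Eventually.of_forall (hmidle n))).symm
  refine tendsto_of_subseq_tendsto fun ns hns => ?_
  -- Along a subsequence the integrals of the defects are summable, so the defects tend to zero
  -- almost everywhere.
  obtain ⟨ms, -, hms⟩ := extraction_forall_of_eventually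
    (P := fun k n => ∫⁻ t, d (ns n) t ∂μ ≤ 2⁻¹ ^ k ∧ ∫⁻ t, Ψ (x (ns n) t) ∂μ ≠ ∞ ∧ k ≤ ns n)
    (fun k => ((hdlim.comp hns).eventually_le_const (ENNReal.pow_pos (by simp) k)).and
      ((hns.eventually hfin).and (hns.eventually_ge_atTop k)))
  refine ⟨ms, ?_⟩
  set m := fun k => ns (ms k) with hm
  have hmt : Tendsto m atTop atTop := tendsto_atTop_mono (fun k => (hms k).2.2) tendsto_id
  have md : ∀ n, AEMeasurable (d n) μ := fun n => (mA n).sub (mmid n)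
  have hd0 : ∀ᵐ t ∂μ, Tendsto (fun k => d (m k) t) atTop (𝓝 0) := by
    have h1 : ∫⁻ t, ∑' k, d (m k) t ∂μ ≠ ∞ := by
      rw [lintegral_tsum fun k => md _]
      refine ne_top_of_le_ne_top ?_ (ENNReal.tsum_le_tsum fun k => (hms k).1)
      rw [ENNReal.tsum_geometric]
      simp
    filter_upwards [ae_lt_top' (AEMeasurable.ennreal_tsum fun k => md (m k)) h1] with t ht
    exact ENNReal.tendsto_atTop_zero_of_tsum_ne_top ht.ne
  have hfinx : ∀ᵐ t ∂μ, ∀ k, Ψ (x (m k) t) ≠ ∞ := ae_all_iff.mpr fun k =>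
    (ae_lt_top' (mx _) (hms k).2.1).mono fun t h => h.ne
  have hfinx₀ : ∀ᵐ t ∂μ, Ψ (x₀ t) ≠ ∞ := (ae_lt_top' mx₀ hJ).mono fun t h => h.ne
  have hxlim : ∀ᵐ t ∂μ, Tendsto (fun k => x (m k) t) atTop (𝓝 (x₀ t)) := by
    filter_upwards [hd0, hfinx, hfinx₀] with t h1 h2 h3
    refine Metric.tendsto_atTop'.mpr fun r hr => ?_
    obtain ⟨δ, hδ, h⟩ := exists_gap hΨ.convex hu (x₀ t) hr
    obtain ⟨k₀, hk₀⟩ := eventually_atTop.mp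
      (h1.eventually_lt_const (ENNReal.ofReal_pos.mpr hδ))
    refine ⟨k₀, fun k hk => ?_⟩
    rw [dist_eq_norm]
    by_contra! hcon
    have h4 := h _ (h2 k) h3 hcon
    have hAt : A (m k) t ≠ ∞ := ENNReal.div_ne_top (ENNReal.add_ne_top.mpr ⟨h2 k, h3⟩) two_ne_zero
    have hMt := ne_top_of_le_ne_top hAt (hmidle (m k) t)
    refine (hk₀ k hk.le).not_ge ?_
    rw [hd]
    refine ENNReal.le_sub_of_add_le_left hMt ?_
    rw [← ENNReal.toReal_le_toReal (ENNReal.add_ne_top.mpr ⟨hMt, ENNReal.ofReal_ne_top⟩) hAt,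
      ENNReal.toReal_add hMt ENNReal.ofReal_ne_top, ENNReal.toReal_ofReal hδ.le, hA,
      ENNReal.toReal_div, ENNReal.toReal_add (h2 k) h3, ENNReal.toReal_ofNat]
    exact h4
  set c := ENNReal.ofReal (ε * (1 / 2) ^ p) with hc
  have hc0 : c ≠ 0 := (ENNReal.ofReal_pos.mpr (by positivity)).ne'
  have hct : c ≠ ∞ := ENNReal.ofReal_ne_top
  set e : ℕ → ℝ → ℝ≥0∞ := fun n t => c * ‖x n t - x₀ t‖ₑ ^ p with he
  have hele : ∀ n t, e n t ≤ A n t := fun n t => enorm_sub_rpow_le hp.le hε hco _ _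
  have me : ∀ n, AEMeasurable (e n) μ := fun n =>
    ((((hx n).sub hx₀).enorm).pow_const p).const_mul c
  have hel : ∀ᵐ t ∂μ, Tendsto (fun k => e (m k) t) atTop (𝓝 0) := by
    filter_upwards [hxlim] with t ht
    have h1 : Tendsto (fun k => ‖x (m k) t - x₀ t‖ₑ) atTop (𝓝 0) := by
      have := (ht.sub_const (x₀ t)).enorm
      rwa [sub_self, enorm_zero] at this
    have h2 := ENNReal.Tendsto.const_mul ((ENNReal.continuous_rpow_const (y := p)).tendsto 0 |>.comp h1)
      (Or.inr hct)
    rw [ENNReal.zero_rpow_of_pos hp0, mul_zero] at h2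
    exact h2
  -- There is no fixed majorant, but `e ≤ A` and the integrals of `A` converge. Fatou's lemma for `A
  -- - e` therefore forces the integrals of `e` to zero.
  have hfatou : J ≤ liminf (fun k => ∫⁻ t, (A (m k) t - e (m k) t) ∂μ) atTop := by
    refine le_trans (lintegral_mono_ae ?_)
      (lintegral_liminf_le' fun k => (mA (m k)).sub (me (m k)))
    filter_upwards [hel, hxlim] with t h1 h2
    refine le_of_forall_lt_imp_le_of_dense fun b hb => ?_
    obtain ⟨b', hbb', hb'⟩ := exists_between hb
    refine le_liminf_of_le (by isBoundedDefault) ?_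
    filter_upwards [h2.eventually (hΨ.lsc (x₀ t) b' hb'),
      h1.eventually_lt_const (tsub_pos_of_lt hbb')] with k h3 h4
    refine ENNReal.le_sub_of_add_le_right (h4.trans_le le_top).ne ?_
    calc b + e (m k) t ≤ b + (b' - b) := by gcongr
      _ = (b' + b') / 2 := by
        rw [add_tsub_cancel_of_le hbb'.le, ENNReal.add_div, ENNReal.add_halves]
      _ ≤ A (m k) t := by simp only [hA]; gcongr
  have helim : Tendsto (fun k => ∫⁻ t, e (m k) t ∂μ) atTop (𝓝 0) := by
    have h1 := tendsto_sub_zero_of_le_liminf hJ (hAlim.comp hmt)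
      (fun k => lintegral_mono fun t => tsub_le_self) hfatou
    refine h1.congr fun k => ?_
    have hAk := hAtop (m k) (hms k).2.1
    have hek := ne_top_of_le_ne_top hAk (lintegral_mono (hele (m k)))
    simp only [Function.comp_apply]
    rw [lintegral_sub' (me _) hek (Eventually.of_forall (hele (m k))),
      ENNReal.sub_sub_cancel hAk (lintegral_mono (hele (m k)))]
  have h2 := ENNReal.Tendsto.const_mul helim (Or.inr (ENNReal.inv_ne_top.mpr hc0))
  rw [mul_zero] at h2
  have h3 := ((ENNReal.continuous_rpow_const (y := 1 / p)).tendsto 0).comp h2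
  rw [ENNReal.zero_rpow_of_pos (by positivity)] at h3
  refine h3.congr fun k => ?_
  rw [eLpNorm_eq_lintegral_rpow_enorm_toReal (ENNReal.ofReal_pos.mpr hp0).ne' ENNReal.ofReal_ne_top,
    ENNReal.toReal_ofReal hp0.le]
  simp only [Function.comp_apply, he]
  rw [lintegral_const_mul' _ _ hct, ← mul_assoc, ENNReal.inv_mul_cancel hc0 hct, one_mul]

end

/-! ### Convergence of approximate solutions to the solution. -/

section

/-- Indices start at one: for `N = 0` the step is `T / 0 = 0`, and nothing is claimed. -/
theorem TendstoWeakStarLp.congr {X : Type*} [NormedAddCommGroup X] [NormedSpace ℝ X] {T : ℝ}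
    {p : ℝ≥0∞} {f g : ℕ → ℝ → X} {f₀ g₀ : ℝ → X} (h : TendstoWeakStarLp T p (fun n => f (n + 1)) f₀)
    (hfg : ∀ n, f (n + 1) =ᵐ[timeMeasure T] g (n + 1)) (h₀ : f₀ =ᵐ[timeMeasure T] g₀) :
    TendstoWeakStarLp T p g g₀ := fun q hq φ hφ => by
  have h1 := h q hq φ hφ
  rw [integral_congr_ae (h₀.mono fun t ht => by simp only [ht] : (fun t => φ t (f₀ t)) =ᵐ[_]
    fun t => φ t (g₀ t))] at h1
  refine (tendsto_add_atTop_iff_nat 1).mp (h1.congr fun n => integral_congr_ae ?_)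
  filter_upwards [hfg n] with t ht
  rw [ht]

/-- An upper bound for the sum and lower bounds for both summands leave no room for either to exceed
its limit. Truncating `b` at `y` avoids subtracting infinity. -/
theorem tendsto_left_of_add_le {a b e : ℕ → ℝ≥0∞} {x y : ℝ≥0∞} (hy : y ≠ ∞)
    (he : Tendsto e atTop (𝓝 (x + y))) (hab : ∀ n, a n + b n ≤ e n) (ha : x ≤ liminf a atTop)
    (hb : y ≤ liminf b atTop) : Tendsto a atTop (𝓝 x) := by
  have h1 : Tendsto (fun n => min (b n) y) atTop (𝓝 y) := by
    refine tendsto_order.mpr ⟨fun c hc => ?_, fun c hc => Eventually.of_forall fun n =>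
      (min_le_right _ _).trans_lt hc⟩
    filter_upwards [eventually_lt_of_lt_liminf (hc.trans_le hb)] with n hn using lt_min hn hc
  have h2 := ENNReal.Tendsto.sub he h1 (Or.inr hy)
  rw [ENNReal.add_sub_cancel_right hy] at h2
  refine tendsto_of_le_liminf_of_limsup_le ha
    ((limsup_le_limsup (Eventually.of_forall fun n => ?_)).trans h2.limsup_eq.le)
  refine ENNReal.le_sub_of_add_le_right (ne_top_of_le_ne_top hy (min_le_right _ _)) ?_
  exact (add_le_add_right (min_le_left _ _) _).trans (hab n)

theorem lintegral_combo_le {X : Type*} [NormedAddCommGroup X] [NormedSpace ℝ X] {Ψ : X → ℝ≥0∞}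
    (hc : ConvexOn ℝ≥0 univ Ψ) (hl : LowerSemicontinuous Ψ) {μ : Measure ℝ} {x y : ℝ → X}
    (hx : AEStronglyMeasurable x μ) (hy : AEStronglyMeasurable y μ) {a b : ℝ} (ha : 0 ≤ a)
    (hb : 0 ≤ b) (hab : a + b = 1) : ∫⁻ t, Ψ (a • x t + b • y t) ∂μ
      ≤ ENNReal.ofReal a * ∫⁻ t, Ψ (x t) ∂μ + ENNReal.ofReal b * ∫⁻ t, Ψ (y t) ∂μ := by
  rw [← lintegral_const_mul'' _ (Frame.aemeasurable_comp_lsc hl hx),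
    ← lintegral_const_mul'' _ (Frame.aemeasurable_comp_lsc hl hy),
    ← lintegral_add_left' ((Frame.aemeasurable_comp_lsc hl hx).const_mul _)]
  exact lintegral_mono fun t => convexOn_real_combo hc (x t) (y t) ha hb hab

theorem tendsto_eLpNorm_primitive {X : Type*} [NormedAddCommGroup X] [NormedSpace ℝ X]
    {T : ℝ} {p : ℝ≥0∞} (hp : 1 ≤ p) {α : ℕ → ℝ → X} {α₀ : ℝ → X} {c : X}
    (hα : ∀ n, MemLp (α n) p (timeMeasure T)) (hα₀ : MemLp α₀ p (timeMeasure T))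
    (h : Tendsto (fun n => eLpNorm (fun t => α n t - α₀ t) p (timeMeasure T)) atTop (𝓝 0)) :
    Tendsto (fun n => eLpNorm (fun t => primitive c (α n) t - primitive c α₀ t) p (timeMeasure T))
      atTop (𝓝 0) := by
  set m := timeMeasure T univ ^ (1 / (1 : ℝ≥0∞).toReal - 1 / p.toReal) with hm
  have hmt : m ≠ ∞ := by
    refine ENNReal.rpow_ne_top_of_nonneg ?_ (measure_ne_top _ _)
    rcases eq_or_ne p ∞ with rfl | hpt
    · simp
    · have := ENNReal.toReal_mono hpt hp
      rw [ENNReal.toReal_one] at this ⊢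
      rw [sub_nonneg, one_div, one_div, inv_one]
      exact inv_le_one_of_one_le₀ this
  have hm' : timeMeasure T univ ^ p.toReal⁻¹ ≠ ∞ :=
    ENNReal.rpow_ne_top_of_nonneg (by positivity) (measure_ne_top _ _)
  have h1 := ENNReal.Tendsto.const_mul (ENNReal.Tendsto.mul_const h (Or.inr hmt)) (Or.inr hm')
  rw [zero_mul, mul_zero] at h1
  refine tendsto_of_tendsto_of_tendsto_of_le_of_le tendsto_const_nhds h1
    (fun _ => zero_le) fun n => ?_
  have i1 := (hα n).integrable hp
  have i2 := hα₀.integrable hp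
  have h2 : ∀ᵐ t ∂(timeMeasure T), ‖primitive c (α n) t - primitive c α₀ t‖
      ≤ (eLpNorm (α n - α₀) 1 (timeMeasure T)).toReal := by
    filter_upwards [ae_timeMeasure_mem] with t ht using norm_primitive_sub_le c i1 i2 ht
  refine (eLpNorm_le_of_ae_bound h2).trans ?_
  rw [ENNReal.ofReal_toReal (memLp_one_iff_integrable.mpr (i1.sub i2)).2.ne]
  gcongr
  exact eLpNorm_le_eLpNorm_mul_rpow_measure_univ hp ((hα n).sub hα₀).1

theorem eq_of_inv_add_inv {p q q' : ℝ≥0∞} (h : p⁻¹ + q⁻¹ = 1) (h' : p⁻¹ + q'⁻¹ = 1) : q = q' := by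
  have hp : p⁻¹ ≠ ∞ := ne_top_of_le_ne_top ENNReal.one_ne_top (h ▸ le_self_add)
  exact inv_injective ((ENNReal.add_right_inj hp).mp (h.trans h'.symm))

theorem one_le_of_inv_add_inv {p q : ℝ≥0∞} (h : p⁻¹ + q⁻¹ = 1) : 1 ≤ q :=
  ENNReal.inv_le_one.mp (h ▸ le_add_self)

namespace Frame

variable {U H Z : Type*} [NormedAddCommGroup U] [NormedSpace ℝ U]
  [NormedAddCommGroup H] [InnerProductSpace ℝ H]
  [NormedAddCommGroup Z] [NormedSpace ℝ Z] {F : Frame U H Z} {R : ℝ} {δ : ℕ → ℝ}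
  {A : Traj U H Z} {B : ℕ → Traj U H Z}

variable [CompleteSpace U] [CompleteSpace H] [CompleteSpace Z]

namespace IsApprox

/-- Approximate solutions leave a convex set that is separated from the solution. -/
theorem eventually_notMem (hA : F.IsApprox R 0 A) (hδ : Tendsto δ atTop (𝓝 0))
    (hB : ∀ n, F.IsApprox R (δ n) (B n)) {S : Set (Traj U H Z)}
    (hS : Convex ℝ ({A | F.IsBdd R A} ∩ S))
    (hT : ∀ A' : ℕ → Traj U H Z, (∀ n, A' n ∈ S) → ¬ F.Tends R A' A) :
    ∀ᶠ n in atTop, B n ∉ S := by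
  by_contra hcon
  have hfr : ∃ᶠ n in atTop, B n ∈ S := fun h => hcon h
  obtain ⟨A', h1, h2⟩ := hA.exists_tends hS fun ε hε => by
    obtain ⟨n, hn, hn'⟩ := (hfr.and_eventually (hδ.eventually_le_const hε)).exists
    exact ⟨B n, hn, (hB n).mono hn'⟩
  exact hT A' h1 h2

/-- For an affine `L`, the sets `L ≤ c` with `c < L A` and `c ≤ L` with `L A < c` are convex and
separated from the solution, so the sequence eventually leaves both. -/
theorem tendsto_affine (hA : F.IsApprox R 0 A) (hδ : Tendsto δ atTop (𝓝 0))
    (hB : ∀ n, F.IsApprox R (δ n) (B n)) {L : Traj U H Z → ℝ}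
    (hL : ∀ C D, F.IsBdd R C → F.IsBdd R D → ∀ a b : ℝ, a + b = 1 →
      L (a • C + b • D) = a * L C + b * L D)
    (hc : ∀ A', F.Tends R A' A → Tendsto (fun n => L (A' n)) atTop (𝓝 (L A))) :
    Tendsto (fun n => L (B n)) atTop (𝓝 (L A)) := by
  refine tendsto_order.mpr ⟨fun c hlt => ?_, fun c hlt => ?_⟩
  · refine (hA.eventually_notMem hδ hB (S := {C | L C ≤ c}) ?_ fun A' h1 h2 => ?_).mono
      fun n hn => not_le.mp hn
    · rintro C ⟨hC, hC'⟩ D ⟨hD, hD'⟩ a b ha hb hab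
      refine ⟨hC.combo hD ha hb hab, ?_⟩
      rw [mem_setOf_eq] at hC' hD' ⊢
      rw [hL C D hC hD a b hab]
      calc a * L C + b * L D ≤ a * c + b * c := by gcongr
        _ = c := by rw [← add_mul, hab, one_mul]
    · exact hlt.not_ge (le_of_tendsto (hc A' h2) (Eventually.of_forall h1))
  · refine (hA.eventually_notMem hδ hB (S := {C | c ≤ L C}) ?_ fun A' h1 h2 => ?_).mono
      fun n hn => not_le.mp hn
    · rintro C ⟨hC, hC'⟩ D ⟨hD, hD'⟩ a b ha hb hab
      refine ⟨hC.combo hD ha hb hab, ?_⟩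
      rw [mem_setOf_eq] at hC' hD' ⊢
      rw [hL C D hC hD a b hab]
      calc c = a * c + b * c := by rw [← add_mul, hab, one_mul]
        _ ≤ _ := by gcongr
    · exact hlt.not_ge (ge_of_tendsto (hc A' h2) (Eventually.of_forall h1))

/-- Sublevel sets of a convex functional replace half-spaces. Lower semicontinuity along strongly
convergent trajectories thus passes to the given sequence, as in Mazur's lemma. -/
theorem le_liminf_convex (hA : F.IsApprox R 0 A) (hδ : Tendsto δ atTop (𝓝 0))
    (hB : ∀ n, F.IsApprox R (δ n) (B n)) {J : Traj U H Z → ℝ≥0∞}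
    (hJ : ∀ C D, F.IsBdd R C → F.IsBdd R D → ∀ a b : ℝ, 0 ≤ a → 0 ≤ b → a + b = 1 →
      J (a • C + b • D) ≤ ENNReal.ofReal a * J C + ENNReal.ofReal b * J D)
    (hc : ∀ A', F.Tends R A' A → J A ≤ liminf (fun n => J (A' n)) atTop) :
    J A ≤ liminf (fun n => J (B n)) atTop := by
  refine le_of_forall_lt_imp_le_of_dense fun c hlt => le_liminf_of_le (by isBoundedDefault) ?_
  refine (hA.eventually_notMem hδ hB (S := {C | J C ≤ c}) ?_ fun A' h1 h2 => ?_).mono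
    fun n hn => (not_le.mp hn).le
  · rintro C ⟨hC, hC'⟩ D ⟨hD, hD'⟩ a b ha hb hab
    refine ⟨hC.combo hD ha hb hab, ?_⟩
    rw [mem_setOf_eq] at hC' hD' ⊢
    calc _ ≤ ENNReal.ofReal a * J C + ENNReal.ofReal b * J D := hJ C D hC hD a b ha hb hab
      _ ≤ ENNReal.ofReal a * c + ENNReal.ofReal b * c := by gcongr
      _ = c := by rw [← add_mul, ← ENNReal.ofReal_add ha hb, hab, ENNReal.ofReal_one, one_mul]
  · exact hlt.not_ge ((hc A' h2).trans
      (liminf_le_of_frequently_le' (Eventually.of_forall h1).frequently))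

theorem tendsto_w (hA : F.IsApprox R 0 A) (hδ : Tendsto δ atTop (𝓝 0))
    (hB : ∀ n, F.IsApprox R (δ n) (B n)) :
    TendstoWeakStarLp F.P.T F.P.q₁ (fun n => (B n).w) A.w := fun q hq φ hφ => by
  obtain rfl := eq_of_inv_add_inv hq F.holder₁
  refine hA.tendsto_affine hδ hB (L := fun C => ∫ t, φ t (C.w t) ∂F.μ)
    (fun C D hC hD a b hab => ?_) fun A' h => h.pairing_w hφ
  have i1 := integral_combo (integrable_pairing F.holder₁ hφ hC.memLp_w)
    (integrable_pairing F.holder₁ hφ hD.memLp_w) a b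
  rw [← i1]
  exact integral_congr_ae (Eventually.of_forall fun t => by
    change φ t (a • C.w t + b • D.w t) = _; simp)

theorem tendsto_y (hA : F.IsApprox R 0 A) (hδ : Tendsto δ atTop (𝓝 0))
    (hB : ∀ n, F.IsApprox R (δ n) (B n)) :
    TendstoWeakStarLp F.P.T F.P.q₂ (fun n => (B n).y) A.y := fun q hq φ hφ => by
  obtain rfl := eq_of_inv_add_inv hq F.holder₂
  refine hA.tendsto_affine hδ hB (L := fun C => ∫ t, φ t (C.y t) ∂F.μ)
    (fun C D hC hD a b hab => ?_) fun A' h => h.pairing_y hφ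
  have i1 := integral_combo (integrable_pairing F.holder₂ hφ hC.memLp_y)
    (integrable_pairing F.holder₂ hφ hD.memLp_y) a b
  rw [← i1]
  exact integral_congr_ae (Eventually.of_forall fun t => by
    change φ t (a • C.y t + b • D.y t) = _; simp)

theorem tendsto_ιw (hA : F.IsApprox R 0 A) (hδ : Tendsto δ atTop (𝓝 0))
    (hB : ∀ n, F.IsApprox R (δ n) (B n)) :
    TendstoWeakStarLp F.P.T ∞ (fun n t => F.P.ι ((B n).w t)) (fun t => F.P.ι (A.w t)) :=
      fun q hq φ hφ => by
  have h1 : (∞ : ℝ≥0∞)⁻¹ + (1 : ℝ≥0∞)⁻¹ = 1 := by simp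
  obtain rfl := eq_of_inv_add_inv hq h1
  refine hA.tendsto_affine hδ hB (L := fun C => ∫ t, φ t (F.P.ι (C.w t)) ∂F.μ)
    (fun C D hC hD a b hab => ?_) fun A' h => h.pairing_ιw hφ
  have i1 := integral_combo (integrable_pairing h1 hφ hC.memLp_ιw)
    (integrable_pairing h1 hφ hD.memLp_ιw) a b
  rw [← i1]
  exact integral_congr_ae (Eventually.of_forall fun t => by
    change φ t (F.P.ι (a • C.w t + b • D.w t)) = _; simp)

/-- The images of the states under continuous linear maps converge weakly*. -/
theorem tendsto_state (hA : F.IsApprox R 0 A) (hδ : Tendsto δ atTop (𝓝 0))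
    (hB : ∀ n, F.IsApprox R (δ n) (B n)) {X : Type*} [NormedAddCommGroup X] [NormedSpace ℝ X]
    (L : U × Z →L[ℝ] X) (p : ℝ≥0∞) :
    TendstoWeakStarLp F.P.T p (fun n t => L (F.state (B n) t)) (fun t => L (F.state A t)) :=
      fun q hq φ hφ => by
  have hφi : Integrable φ F.μ := hφ.integrable (one_le_of_inv_add_inv hq)
  have hψ : Integrable (fun t => (φ t).comp L) F.μ :=
    ((ContinuousLinearMap.compL ℝ (U × Z) X ℝ).flip L).integrable_comp hφi
  have hi : ∀ {C}, F.IsBdd R C → Integrable (fun t => (φ t).comp L (F.state C t)) F.μ := fun hC =>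
    integrable_pairing (p := ∞) (q := 1) (by simp) (memLp_one_iff_integrable.mpr hψ)
      (memLp_of_continuousOn hC.continuousOn_state _)
  refine hA.tendsto_affine hδ hB (L := fun C => ∫ t, (φ t).comp L (F.state C t) ∂F.μ)
    (fun C D hC hD a b hab => ?_) fun A' h => h.pairing_state hψ
  rw [← integral_combo (hi hC) (hi hD) a b]
  refine integral_congr_ae ?_
  filter_upwards [ae_timeMeasure_mem] with t ht
  rw [state_combo hC hD hab ht, map_add, map_smul, map_smul, smul_eq_mul, smul_eq_mul]

/-- The dissipation of approximate solutions is asymptotically bounded by that of the solution. -/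
theorem exists_pot_le (hA : F.IsApprox R 0 A) (hδ : Tendsto δ atTop (𝓝 0))
    (hB : ∀ n, F.IsApprox R (δ n) (B n)) : ∃ e : ℕ → ℝ≥0∞,
      Tendsto e atTop (𝓝 (F.pot A.w A.y)) ∧ ∀ n, F.pot (B n).w (B n).y ≤ e n := by
  set c := (eLpNorm A.w F.P.q₁ F.μ).toReal + (eLpNorm A.y F.P.q₂ F.μ).toReal with hc
  -- The inequality for `B n` is tested with the velocities of the solution. Replacing the terminal
  -- energies by their tangent planes at the solution leaves an affine functional of `B n`, which
  -- converges.
  set Λ : Traj U H Z → ℝ := fun C => F.lin C A.w A.y - 2 * F.K A.vT C.vT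
    - 2 * F.Q (F.state A F.P.T) (F.state C F.P.T) with hΛ
  have h1 : Tendsto (fun n => Λ (B n)) atTop (𝓝 (Λ A)) := by
    refine hA.tendsto_affine hδ hB (fun C D hC hD a b hab => ?_) fun A' h => ?_
    · have e1 : F.K A.vT (a • C + b • D).vT = a * F.K A.vT C.vT + b * F.K A.vT D.vT := by
        change F.K A.vT (a • C.vT + b • D.vT) = _
        simp
      simp only [hΛ]
      rw [lin_combo hC hD hab hA.memLp_w hA.memLp_y, state_combo hC hD hab F.T_mem, e1, map_add,
        map_smul, map_smul, smul_eq_mul, smul_eq_mul]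
      ring
    · exact ((h.lin hA.memLp_w hA.memLp_y).sub ((h.vT (F.K A.vT)).const_mul 2)).sub
        ((((F.Q (F.state A F.P.T)).continuous.tendsto _).comp (h.tendsto_state F.T_mem)).const_mul 2)
  have h2 := ((h1.const_add ((F.pot A.w A.y).toReal + F.K A.vT A.vT
    + F.Q (F.state A F.P.T) (F.state A F.P.T))).add (hδ.mul_const c))
  -- The energy balance of the solution cancels everything except its dissipation.
  have h3 : (F.pot A.w A.y).toReal + F.K A.vT A.vT + F.Q (F.state A F.P.T) (F.state A F.P.T)
      + Λ A + 0 * c = (F.pot A.w A.y).toReal := by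
    have := hA.energy_eq
    simp only [hΛ]
    linarith
  rw [h3] at h2
  have h4 := ENNReal.tendsto_ofReal h2
  rw [ENNReal.ofReal_toReal hA.pot_ne] at h4
  refine ⟨_, h4, fun n => ?_⟩
  rw [← ENNReal.ofReal_toReal (hB n).pot_ne]
  refine ENNReal.ofReal_le_ofReal ?_
  have h5 := (hB n).vi A.w A.y hA.memLp_w hA.memLp_y hA.pot_ne
  have h6 := F.hK.le_self A.vT (B n).vT
  have h7 := F.hQ.le_self (F.state A F.P.T) (F.state (B n) F.P.T)
  rw [map_sub] at h6 h7
  simp only [hΛ]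
  linarith

/-- With `r = 1` this is lower semicontinuity of the dissipation, and with `r = 2⁻¹` it is the
midpoint condition for norm convergence. In both cases `r + s = 1` makes the limit of the arguments
`A.w` itself. -/
theorem le_liminf_w (hA : F.IsApprox R 0 A) (hδ : Tendsto δ atTop (𝓝 0))
    (hB : ∀ n, F.IsApprox R (δ n) (B n)) {r s : ℝ} (hrs : r + s = 1) :
    ∫⁻ t, F.P.Ψ₁ (A.w t) ∂F.μ
      ≤ liminf (fun n => ∫⁻ t, F.P.Ψ₁ (r • (B n).w t + s • A.w t) ∂F.μ) atTop := by
  have hm : ∀ {C}, F.IsBdd R C → AEStronglyMeasurable (fun t => r • C.w t + s • A.w t) F.μ :=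
    fun hC => (hC.memLp_w.1.const_smul r).add (hA.memLp_w.1.const_smul s)
  refine Eq.trans_le ?_ (hA.le_liminf_convex hδ hB
    (J := fun C => ∫⁻ t, F.P.Ψ₁ (r • C.w t + s • A.w t) ∂F.μ)
    (fun C D hC hD a b ha hb hab => ?_) fun A' h => ?_)
  · simp_rw [← add_smul, hrs, one_smul]
  · refine Eq.trans_le ?_ (lintegral_combo_le F.hΨ₁.convex F.hΨ₁.lsc (hm hC) (hm hD) ha hb hab)
    refine lintegral_congr fun t => congrArg F.P.Ψ₁ ?_
    change r • (a • C.w t + b • D.w t) + s • A.w t = _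
    obtain rfl : b = 1 - a := by linarith
    module
  · refine lintegral_lsc_le_liminf F.hΨ₁.lsc (fun n => hm (h.bdd_n n)) ?_
    filter_upwards [h.w_ae] with t ht using (ht.const_smul r).add_const _

theorem le_liminf_y (hA : F.IsApprox R 0 A) (hδ : Tendsto δ atTop (𝓝 0))
    (hB : ∀ n, F.IsApprox R (δ n) (B n)) {r s : ℝ} (hrs : r + s = 1) :
    ∫⁻ t, F.P.Ψ₂ (A.y t) ∂F.μ
      ≤ liminf (fun n => ∫⁻ t, F.P.Ψ₂ (r • (B n).y t + s • A.y t) ∂F.μ) atTop := by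
  have hm : ∀ {C}, F.IsBdd R C → AEStronglyMeasurable (fun t => r • C.y t + s • A.y t) F.μ :=
    fun hC => (hC.memLp_y.1.const_smul r).add (hA.memLp_y.1.const_smul s)
  refine Eq.trans_le ?_ (hA.le_liminf_convex hδ hB
    (J := fun C => ∫⁻ t, F.P.Ψ₂ (r • C.y t + s • A.y t) ∂F.μ)
    (fun C D hC hD a b ha hb hab => ?_) fun A' h => ?_)
  · simp_rw [← add_smul, hrs, one_smul]
  · refine Eq.trans_le ?_ (lintegral_combo_le F.hΨ₂.convex F.hΨ₂.lsc (hm hC) (hm hD) ha hb hab)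
    refine lintegral_congr fun t => congrArg F.P.Ψ₂ ?_
    change r • (a • C.y t + b • D.y t) + s • A.y t = _
    obtain rfl : b = 1 - a := by linarith
    module
  · refine lintegral_lsc_le_liminf F.hΨ₂.lsc (fun n => hm (h.bdd_n n)) ?_
    filter_upwards [h.y_ae] with t ht using (ht.const_smul r).add_const _

/-- The total dissipation is asymptotically bounded by that of the solution and each of its two
parts is lower semicontinuous, so the part of `Ψ₁` converges separately. Uniform convexity of `Ψ₁`
alone is then enough. -/
theorem tendsto_w_of_uniformlyConvex (hA : F.IsApprox R 0 A) (hδ : Tendsto δ atTop (𝓝 0))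
    (hB : ∀ n, F.IsApprox R (δ n) (B n)) (hu : IsUniformlyConvexFunctional F.P.Ψ₁) :
    Tendsto (fun n => eLpNorm (fun t => (B n).w t - A.w t) F.P.q₁ F.μ) atTop (𝓝 0) := by
  obtain ⟨e, he, hle⟩ := hA.exists_pot_le hδ hB
  have hp : ∀ {R δ C}, F.IsApprox R δ C → F.pot C.w C.y
      = (∫⁻ t, F.P.Ψ₁ (C.w t) ∂F.μ) + ∫⁻ t, F.P.Ψ₂ (C.y t) ∂F.μ := fun hC =>
    lintegral_add_left' (aemeasurable_comp_lsc F.hΨ₁.lsc hC.memLp_w.1) _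
  have hne := hA.pot_ne
  rw [hp hA] at he hne
  have h1 := hA.le_liminf_w hδ hB (r := 1) (s := 0) (by norm_num)
  have h2 := hA.le_liminf_y hδ hB (r := 1) (s := 0) (by norm_num)
  have h3 := hA.le_liminf_w hδ hB (r := 2⁻¹) (s := 2⁻¹) (by norm_num)
  simp only [one_smul, zero_smul, add_zero] at h1 h2
  simp only [← smul_add] at h3
  exact tendsto_eLpNorm_of_uniformlyConvex F.hp₁ F.hΨ₁ hu (fun n => (hB n).memLp_w.1)
    hA.memLp_w.1 (ENNReal.add_ne_top.mp hne).1 (tendsto_left_of_add_le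
      (ENNReal.add_ne_top.mp hne).2 he (fun n => (hp (hB n)).ge.trans (hle n)) h1 h2) h3

theorem tendsto_y_of_uniformlyConvex (hA : F.IsApprox R 0 A) (hδ : Tendsto δ atTop (𝓝 0))
    (hB : ∀ n, F.IsApprox R (δ n) (B n)) (hu : IsUniformlyConvexFunctional F.P.Ψ₂) :
    Tendsto (fun n => eLpNorm (fun t => (B n).y t - A.y t) F.P.q₂ F.μ) atTop (𝓝 0) := by
  obtain ⟨e, he, hle⟩ := hA.exists_pot_le hδ hB
  have hp : ∀ {R δ C}, F.IsApprox R δ C → F.pot C.w C.y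
      = (∫⁻ t, F.P.Ψ₂ (C.y t) ∂F.μ) + ∫⁻ t, F.P.Ψ₁ (C.w t) ∂F.μ := fun hC =>
    (lintegral_add_left' (aemeasurable_comp_lsc F.hΨ₁.lsc hC.memLp_w.1) _).trans (add_comm _ _)
  have hne := hA.pot_ne
  rw [hp hA] at he hne
  have h1 := hA.le_liminf_w hδ hB (r := 1) (s := 0) (by norm_num)
  have h2 := hA.le_liminf_y hδ hB (r := 1) (s := 0) (by norm_num)
  have h3 := hA.le_liminf_y hδ hB (r := 2⁻¹) (s := 2⁻¹) (by norm_num)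
  simp only [one_smul, zero_smul, add_zero] at h1 h2
  simp only [← smul_add] at h3
  exact tendsto_eLpNorm_of_uniformlyConvex F.hp₂ F.hΨ₂ hu (fun n => (hB n).memLp_y.1)
    hA.memLp_y.1 (ENNReal.add_ne_top.mp hne).1 (tendsto_left_of_add_le
      (ENNReal.add_ne_top.mp hne).2 he (fun n => (hp (hB n)).ge.trans (hle n)) h2 h1) h3

end IsApprox

end Frame

end

/-! ### Convergence of the interpolants. -/

section

namespace Frame

variable {U H Z : Type*} [NormedAddCommGroup U] [NormedSpace ℝ U]
  [NormedAddCommGroup H] [InnerProductSpace ℝ H]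
  [NormedAddCommGroup Z] [NormedSpace ℝ Z] {F : Frame U H Z} {S W R : ℝ} {δ : ℕ → ℝ}
  {A : Traj U H Z} {un : ℕ → ℕ → U} {vn : ℕ → ℕ → H} {zn : ℕ → ℕ → Z} {wn : ℕ → ℕ → U}

variable [CompleteSpace U] [CompleteSpace H] [CompleteSpace Z]

theorem IsBdd.ι_state (hA : F.IsBdd R A) {t : ℝ} (ht : t ∈ Icc 0 F.P.T) :
    F.P.ι (F.state A t).1 = primitive (F.P.ι F.P.u₀) (fun t => F.P.ι (A.w t)) t := by
  change F.P.ι (primitive F.P.u₀ A.w t) = _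
  rw [primitive, map_add, primitive]
  congr 1
  exact (F.P.ι.intervalIntegral_comp_comm
    (intervalIntegrable_of_timeMeasure hA.integrable_w F.zero_mem ht)).symm

/-- Weak* convergence of the discrete solutions. -/
theorem CN.convergesWeakStar (hA : F.IsApprox R 0 A) (hδ : Tendsto δ atTop (𝓝 0))
    (hsol : ∀ N, 1 ≤ N → F.P.IsCNSolution N (un N) (vn N) (zn N) (wn N))
    (hB : ∀ N, 1 ≤ N → F.IsApprox R (δ N) (F.cnTraj N (vn N) (zn N) (wn N)))
    {v : ℝ → H} (hv : (fun t => F.P.ι (A.w t)) =ᵐ[F.μ] v) :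
    F.P.ConvergesWeakStar un zn wn (fun t => (F.state A t).1) v (fun t => (F.state A t).2) := by
  have hδ' : Tendsto (fun n => δ (n + 1)) atTop (𝓝 0) := (tendsto_add_atTop_iff_nat 1).mpr hδ
  have hB' := fun n => hB (n + 1) (by omega)
  have hs' := fun n => hsol (n + 1) (by omega)
  have hT := F.T_pos.le
  have hae : ∀ n, F.state (F.cnTraj (n + 1) (vn (n + 1)) (zn (n + 1)) (wn (n + 1)))
      =ᵐ[timeMeasure F.P.T] fun t => (pwAffine (F.P.step (n + 1)) (un (n + 1)) t,
        pwAffine (F.P.step (n + 1)) (zn (n + 1)) t) := fun n => by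
    filter_upwards [ae_timeMeasure_mem] with t ht using CN.state_eq (by omega) (hs' n) ht
  refine ⟨?_, ⟨fun N t => F.P.ι (pwConst (F.P.step N) (wn N) t), fun t => F.P.ι (A.w t),
      fun N hN => ?_, ?_, ?_, ?_⟩, ⟨fun N => pwConst (F.P.step N) (wn N), A.w, fun N hN => ?_, ?_,
      ?_, ?_⟩, ?_, ⟨A.w, hA.memLp_w, hv, ?_⟩,
    ⟨fun N => pwConst (F.P.step N) (slope (F.P.step N) (zn N)), A.y, fun N hN => ?_, ?_, ?_, ?_⟩⟩
  · exact (hA.tendsto_state hδ' hB' (ContinuousLinearMap.fst ℝ U Z) ∞).congr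
      (f := fun N t => (F.state (F.cnTraj N (vn N) (zn N) (wn N)) t).1)
      (fun n => (hae n).fun_comp Prod.fst) (ae_eq_refl _)
  · exact isSobolev_of_primitive hT le_top (hB N hN).memLp_ιw
      fun t ht => CN.pwAffine_ιu hN (hsol N hN) (hB N hN).toIsBdd ht
  · exact isSobolev_of_primitive hT le_top hA.memLp_ιw fun t ht => hA.ι_state ht
  · exact (hA.tendsto_state hδ' hB' (F.P.ι.comp (ContinuousLinearMap.fst ℝ U Z)) ∞).congr
      (f := fun N t => F.P.ι (F.state (F.cnTraj N (vn N) (zn N) (wn N)) t).1)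
      (fun n => (hae n).fun_comp fun x => F.P.ι x.1) (ae_eq_refl _)
  · exact (hA.tendsto_ιw hδ' hB').congr
      (f := fun N t => F.P.ι ((F.cnTraj N (vn N) (zn N) (wn N)).w t))
      (fun n => ae_eq_refl _) (ae_eq_refl _)
  · exact isSobolev_of_primitive hT F.one_le_q₁ (hB N hN).memLp_w
      fun t ht => CN.pwAffine_u hN (hsol N hN) ht
  · exact isSobolev_of_primitive hT F.one_le_q₁ hA.memLp_w fun t _ => rfl
  · exact (hA.tendsto_state hδ' hB' (ContinuousLinearMap.fst ℝ U Z) _).congr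
      (f := fun N t => (F.state (F.cnTraj N (vn N) (zn N) (wn N)) t).1)
      (fun n => (hae n).fun_comp Prod.fst) (ae_eq_refl _)
  · exact (hA.tendsto_w hδ' hB').congr (f := fun N => (F.cnTraj N (vn N) (zn N) (wn N)).w)
      (fun n => ae_eq_refl _) (ae_eq_refl _)
  · exact (hA.tendsto_ιw hδ' hB').congr
      (f := fun N t => F.P.ι ((F.cnTraj N (vn N) (zn N) (wn N)).w t))
      (fun n => ae_eq_refl _) hv
  · exact (hA.tendsto_w hδ' hB').congr (f := fun N => (F.cnTraj N (vn N) (zn N) (wn N)).w)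
      (fun n => ae_eq_refl _) (ae_eq_refl _)
  · exact isSobolev_of_primitive hT F.one_le_q₂ (hB N hN).memLp_y
      fun t ht => CN.pwAffine_z hN (hsol N hN) ht
  · exact isSobolev_of_primitive hT F.one_le_q₂ hA.memLp_y fun t _ => rfl
  · exact (hA.tendsto_state hδ' hB' (ContinuousLinearMap.snd ℝ U Z) _).congr
      (f := fun N t => (F.state (F.cnTraj N (vn N) (zn N) (wn N)) t).2)
      (fun n => (hae n).fun_comp Prod.snd) (ae_eq_refl _)
  · exact (hA.tendsto_y hδ' hB').congr (f := fun N => (F.cnTraj N (vn N) (zn N) (wn N)).y)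
      (fun n => ae_eq_refl _) (ae_eq_refl _)

/-- Primitives of strongly convergent velocities converge in a Sobolev space. -/
theorem tendstoSobolev_of_primitive {X : Type*} [NormedAddCommGroup X] [NormedSpace ℝ X]
    [CompleteSpace X] {T : ℝ} (hT : 0 ≤ T) {p : ℝ≥0∞} (hp : 1 ≤ p) {α f : ℕ → ℝ → X}
    {α₀ : ℝ → X} {c : X} (hα : ∀ n, 1 ≤ n → MemLp (α n) p (timeMeasure T))
    (hα₀ : MemLp α₀ p (timeMeasure T))
    (hf : ∀ n, 1 ≤ n → ∀ t ∈ Icc 0 T, f n t = primitive c (α n) t)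
    (h : Tendsto (fun n => eLpNorm (fun t => α (n + 1) t - α₀ t) p (timeMeasure T)) atTop (𝓝 0)) :
    TendstoSobolev T p f (primitive c α₀) := by
  refine ⟨α, α₀, fun n hn => isSobolev_of_primitive hT hp (hα n hn) (hf n hn),
    isSobolev_of_primitive hT hp hα₀ fun t _ => rfl, ?_, (tendsto_add_atTop_iff_nat 1).mp h⟩
  refine (tendsto_add_atTop_iff_nat 1).mp ((tendsto_eLpNorm_primitive (c := c) hp
    (fun n => hα (n + 1) (by omega)) hα₀ h).congr fun n => eLpNorm_congr_ae ?_)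
  filter_upwards [ae_timeMeasure_mem] with t ht
  rw [hf (n + 1) (by omega) t ht]

theorem CN.tendstoSobolev_u (hA : F.IsApprox R 0 A) (hδ : Tendsto δ atTop (𝓝 0))
    (hsol : ∀ N, 1 ≤ N → F.P.IsCNSolution N (un N) (vn N) (zn N) (wn N))
    (hB : ∀ N, 1 ≤ N → F.IsApprox R (δ N) (F.cnTraj N (vn N) (zn N) (wn N)))
    (hu : IsUniformlyConvexFunctional F.P.Ψ₁) :
    TendstoSobolev F.P.T F.P.q₁ (fun N => pwAffine (F.P.step N) (un N))
      (fun t => (F.state A t).1) :=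
  tendstoSobolev_of_primitive F.T_pos.le F.one_le_q₁ (fun N hN => (hB N hN).memLp_w) hA.memLp_w
    (fun N hN t ht => CN.pwAffine_u hN (hsol N hN) ht)
    (hA.tendsto_w_of_uniformlyConvex ((tendsto_add_atTop_iff_nat 1).mpr hδ)
      (fun n => hB (n + 1) (by omega)) hu)

theorem CN.tendstoSobolev_z (hA : F.IsApprox R 0 A) (hδ : Tendsto δ atTop (𝓝 0))
    (hsol : ∀ N, 1 ≤ N → F.P.IsCNSolution N (un N) (vn N) (zn N) (wn N))
    (hB : ∀ N, 1 ≤ N → F.IsApprox R (δ N) (F.cnTraj N (vn N) (zn N) (wn N)))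
    (hu : IsUniformlyConvexFunctional F.P.Ψ₂) :
    TendstoSobolev F.P.T F.P.q₂ (fun N => pwAffine (F.P.step N) (zn N))
      (fun t => (F.state A t).2) :=
  tendstoSobolev_of_primitive F.T_pos.le F.one_le_q₂ (fun N hN => (hB N hN).memLp_y) hA.memLp_y
    (fun N hN t ht => CN.pwAffine_z hN (hsol N hN) ht)
    (hA.tendsto_y_of_uniformlyConvex ((tendsto_add_atTop_iff_nat 1).mpr hδ)
      (fun n => hB (n + 1) (by omega)) hu)

end Frame

end

end CrankNicolson

/-! ### The main theorem. -/

open CrankNicolson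
theorem proposition1
    {U H Z : Type*}
    [NormedAddCommGroup U] [NormedSpace ℝ U] [CompleteSpace U]
    [NormedAddCommGroup H] [InnerProductSpace ℝ H] [CompleteSpace H]
    [NormedAddCommGroup Z] [NormedSpace ℝ Z] [CompleteSpace Z]
    (hU : IsReflexiveSpace U) (hZ : IsReflexiveSpace Z)
    (P : Problem U H Z)
    (hT : 0 < P.T)
    (hι : Function.Injective P.ι) (hιd : DenseRange P.ι)
    (hΦq : IsQuadratic P.Φ) (hΦc : IsCoerciveFunctional P.Φ)
    (hKq : IsQuadratic P.kin) (hKc : IsCoerciveFunctional P.kin)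
    (hp₁ : 1 < P.p₁) (hp₂ : 1 < P.p₂)
    (hΨ₁ : IsDissipationPotential P.p₁ P.Ψ₁)
    (hΨ₂ : IsDissipationPotential P.p₂ P.Ψ₂)
    (hgrowth : ∃ C : ℝ, ∀ v : U, ∀ ξ ∈ subdiff P.Ψ₁ v, ‖ξ‖ ≤ C * (1 + ‖v‖ ^ (P.p₁ - 1)))
    (hf : P.LoadInSum)
    (hg : MemLp P.g P.conj₂ (timeMeasure P.T)) :
    -- the scheme is solvable for every step `T / N`
    (∀ N : ℕ, 1 ≤ N → ∃ u v z w, P.IsCNSolution N u v z w) ∧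
    -- a-priori estimates, uniform in the step
    (∃ C : ℝ, ∀ N : ℕ, 1 ≤ N → ∀ u v z w, P.IsCNSolution N u v z w →
      P.APrioriEstimates C N u v z w) ∧
    -- the unique weak solution, and convergence to it
    (∃ (u : ℝ → U) (v : ℝ → H) (z : ℝ → Z),
      P.IsWeakSolution u v z ∧
      (∀ u' v' z', P.IsWeakSolution u' v' z' →
        Set.EqOn u' u (Set.Icc 0 P.T) ∧ Set.EqOn v' v (Set.Icc 0 P.T) ∧
          Set.EqOn z' z (Set.Icc 0 P.T)) ∧
      ∀ (un : ℕ → ℕ → U) (vn : ℕ → ℕ → H) (zn : ℕ → ℕ → Z) (wn : ℕ → ℕ → U),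
        (∀ N, 1 ≤ N → P.IsCNSolution N (un N) (vn N) (zn N) (wn N)) →
        P.ConvergesWeakStar un zn wn u v z ∧
        (P.p₁ ≤ 2 →
          (UniformConvexSpace U → IsUniformlyConvexFunctional P.Ψ₁ →
            TendstoSobolev P.T P.q₁ (fun N => pwAffine (P.step N) (un N)) u) ∧
          (UniformConvexSpace Z → IsUniformlyConvexFunctional P.Ψ₂ →
            TendstoSobolev P.T P.q₂ (fun N => pwAffine (P.step N) (zn N)) z))) := by
  obtain ⟨Q, hQ, hQe⟩ := exists_coerciveForm hΦq hΦc
  obtain ⟨K, hK, hKe⟩ := exists_coerciveForm hKq hKc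
  obtain ⟨f₁, f₂, hf₁, hf₂, hfe⟩ := hf
  obtain ⟨F, rfl⟩ : ∃ F : Frame U H Z, F.P = P :=
    ⟨{ P := P, K := K, Q := Q, f₁ := f₁, f₂ := f₂, T_pos := hT, inj := hι, dense := hιd, hK := hK,
       kin_eq := hKe, hQ := hQ, phi_eq := hQe, hp₁ := hp₁, hp₂ := hp₂, hΨ₁ := hΨ₁, hΨ₂ := hΨ₂,
       growth := hgrowth, memLp_f₁ := hf₁, memLp_f₂ := hf₂, f_eq := hfe, memLp_g := hg }, rfl⟩
  obtain ⟨S, W, hS, hW, hSW⟩ := F.exists_isCNBdd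
  obtain ⟨R, hR, hRb⟩ := Frame.CN.exists_isBdd F hW (S := S)
  have hb : ∀ (N : ℕ) (u : ℕ → U) (v : ℕ → H) (z : ℕ → Z) (w : ℕ → U), 1 ≤ N →
      F.P.IsCNSolution N u v z w → F.IsCNBdd S W N u v z w ∧ F.IsBdd R (F.cnTraj N v z w) :=
    fun N u v z w hN h => ⟨hSW N u v z w hN h, hRb N u v z w hN h (hSW N u v z w hN h)⟩
  obtain ⟨δ, hδ, hB⟩ := Frame.CN.exists_isApprox F hW hb
  refine ⟨fun N hN => F.exists_isCNSolution hN, F.exists_aprioriEstimates hb hR hS, ?_⟩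
  -- The exact solution is a limit of selections from the approximate solutions, which exist for
  -- every tolerance because the scheme is solvable. No further convex constraint is imposed.
  obtain ⟨-, A, -, -, hA⟩ := F.exists_tends (R := R) (S := Set.univ)
    (by
      rintro C ⟨hC, -⟩ D ⟨hD, -⟩ a b ha hb hab
      exact ⟨hC.combo hD ha hb hab, trivial⟩)
    (fun ε hε => by
      obtain ⟨N, hN, hN'⟩ := ((eventually_ge_atTop 1).and (hδ.eventually_le_const hε)).exists
      obtain ⟨u, v, z, w, h⟩ := F.exists_isCNSolution hN
      exact ⟨_, trivial, (hB N u v z w hN h).mono hN'⟩)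
  obtain ⟨v, hv, hv0, hvT, hvK, hvc⟩ := hA.exists_velocity
  have hwv : (fun t => F.P.ι (A.w t)) =ᵐ[F.μ] v := hv.ae_eq
  refine ⟨_, v, _, hA.isWeakSolution hwv hv0 hvT hvK hvc,
    fun u' v' z' h => F.eqOn_of_isWeakSolution hA hvK h, fun un vn zn wn hsol => ?_⟩
  have hBn : ∀ N, 1 ≤ N → F.IsApprox R (δ N) (F.cnTraj N (vn N) (zn N) (wn N)) :=
    fun N hN => hB N _ _ _ _ hN (hsol N hN)
  exact ⟨Frame.CN.convergesWeakStar hA hδ hsol hBn hwv, fun _ =>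
    ⟨fun _ hu => Frame.CN.tendstoSobolev_u hA hδ hsol hBn hu,
      fun _ hu => Frame.CN.tendstoSobolev_z hA hδ hsol hBn hu⟩⟩
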